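/- **Setting.** Let $(V,Y,\mathbf 1,\omega)$ be a vertex operator algebra over $\mathbb C$ with central charge $c$: $V=\coprod_{n\in\mathbb Z}V_{(n)}$ is graded by the eigenvalues of $L(0)$, with $\dim V_{(n)}<\infty$ and $V_{(n)}=0$ for $n$ sufficiently negative. Let $g$ be an automorphism of $V$. Write $\mathbb I=\mathbb R\sqrt{-1}$ and $Y(u,x)=\sum_{n\in\mathbb Z} u_nx^{-n-1}$. For $a\in[0,1)+\mathbb I$ let $V^{[a+\mathbb Z]}$ be the generalized eigenspace of $g$ with eigenvalue $e^{2\pi\sqrt{-1}a}$; then $V=\coprod_a V^{[a+\mathbb Z]}$. Write $g=\sigma g_u$ with commuting $\sigma$ semisimple and $g_u$ locally unipotent, and put $\mathcal N=\frac{1}{2\pi\sqrt{-1}}\log g_u$. Let $\mathbf A_V$ and $\mathcal L$ be the linear operators on $V$ with $\mathbf A_Vu=au$ and $\mathcal Lu=l(u)u$ for $u\in V_{(m)}\cap V^{[a+\mathbb Z]}$, where $l(u)=m+a$ if $\Re a=0$ and $l(u)=m+a-1$ if $\Re a>0$. **Algebras.** Define $$u*_gv=\mathrm{Res}_x\,x^{-1}Y\big((1+x)^{\mathcal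 L+\mathcal N}u,x\big)v,$$ $$u\bullet_gv=\mathrm{Res}_y\,y^{-1}Y\Big((1+y)^{\mathcal L-L(0)+\mathcal N}u,\tfrac{1}{2\pi\sqrt{-1}}\log(1+y)\Big)v.$$ Let $O_g(V)$ be the span of all $\mathrm{Res}_x\,x^{-n}Y\big(x^{L(0)-\mathcal L+\mathbf A_V}(1+x)^{\mathcal L+\mathcal N}u,x\big)v$, and $\tilde O_g(V)$ the span of all $\mathrm{Res}_y\,y^{-n}Y\big(y^{L(0)-\mathcal L+\mathbf A_V}(1+y)^{\mathcal L-L(0)+\mathcal N}u,\frac{1}{2\pi\sqrt{-1}}\log(1+y)\big)v$, for integers $n>1$ and $u,v\in V$. Put $A_g(V)=V/O_g(V)$ and $\tilde A_g(V)=V/\tilde O_g(V)$, with the products induced by $*_g$ and $\bullet_g$ and the identity given by the class of $\mathbf 1$. Let $\mathcal U(1)=(2\pi\sqrt{-1})^{L(0)}e^{-\sum_{j\ge1}A_jL(j)}$, where the numbers $A_j$ are determined by $\frac{1}{2\pi\sqrt{-1}}(e^{2\pi\sqrt{-1}y}-1)=\exp\big(-\sum_{j\ge1}A_jy^{j+1}\frac{\partial}{\partial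 y}\big)y$. **Twisted modules.** Let $\overline{\mathbb C}_+=\{n\in\mathbb C:\Re n\ge0\}$, let $\log z=\log|z|+\sqrt{-1}\arg z$ with $0\le\arg z<2\pi$, and $l_p(z)=\log z+2\pi p\sqrt{-1}$ for $p\in\mathbb Z$. A $\overline{\mathbb C}_+$-graded weak $g$-twisted $V$-module is a vector space $W=\coprod_{n\in\overline{\mathbb C}_+,\,\alpha\in\mathbb C/\mathbb Z}W_n^{[\alpha]}$ with a linear action of $g$ and a linear map $Y^g:V\otimes W\to W\{x\}[\log x]$, $Y^g(v,x)w=\sum_{k\ge0}\sum_{n\in\mathbb C}Y^g_{n,k}(v)w\,x^{-n-1}(\log x)^k$ (finitely many $k$ for given $v,w$), such that the following hold. Write $W_n=\coprod_\alpha W_n^{[\alpha]}$, let $\pi_n$ be the projections of $W$ onto $W_n$ and of $V$ onto $V_{(n)}$, and let $Y^{g;p}(v,z)w$ be obtained from $Y^g(v,x)w$ by $x^n=e^{nl_p(z)}$, $\log x=l_p(z)$. 1. $Y^{g;p+1}(gv,z)w=Y^{g;p}(v,z)w$ for $p\in\mathbb Z$, $z\in\mathbb C^\times$. 2. $Y^g(\mathbf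 1,x)w=w$. 3. For $u,v\in V$, $w\in W$ and $w'\in\coprod_{n,\alpha}(W_n^{[\alpha]})^*$ there are $N\in\mathbb N$, $m_i,n_j,a_{ijkl}\in\mathbb C$ and $t\in\mathbb Z_+$ such that, for all $p\in\mathbb Z$, the series $\sum_n\langle w',Y^{g;p}(u,z_1)\pi_nY^{g;p}(v,z_2)w\rangle$, $\sum_n\langle w',Y^{g;p}(v,z_2)\pi_nY^{g;p}(u,z_1)w\rangle$ and $\sum_n\langle w',Y^{g;p}(\pi_nY(u,z_1-z_2)v,z_2)w\rangle$ converge absolutely for $|z_1|>|z_2|>0$, $|z_2|>|z_1|>0$ and $|z_2|>|z_1-z_2|>0$, respectively, and there, when $|\arg z_1-\arg z_2|<\frac\pi2$, have the sum $\sum_{i,j,k,l=0}^Na_{ijkl}e^{m_il_p(z_1)}e^{n_jl_p(z_2)}l_p(z_1)^kl_p(z_2)^l(z_1-z_2)^{-t}$. 4. For $v\in V_{(m)}$ and $w\in W_p$, $Y^g_{n,k}(v)w$ lies in $W_{m-n-1+p}$ (and is $0$ if $\Re(m-n-1+p)<0$). The space $\coprod_{n\in\mathbb I}W_n$ is the set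 of all $w$ with $Y^g_{n,k}(v)w=0$ for all $v\in V_{(m)}$, $m\in\mathbb Z$, $n\in\mathbb C$, $k\ge0$ with $\Re(m-n-1)<0$. Every $w\in W^{[\alpha]}=\coprod_nW_n^{[\alpha]}$ is killed by a power of $g-e^{2\pi\sqrt{-1}\alpha}$. Moreover $gY^g(u,x)w=Y^g(gu,x)gw$. 5. $\frac{d}{dx}Y^g(v,x)=Y^g(L(-1)v,x)$. $W$ is a lower bounded $g$-twisted module if moreover $W=\coprod_{n\in\mathbb C}W_{[n]}$, with $W_{[n]}$ the generalized eigenspaces of $L^g(0)=\mathrm{Res}_x\,xY^g(\omega,x)$, and for all $n\in\mathbb C$, $\alpha\in\mathbb C/\mathbb Z$ one has $W_{[n+l]}\cap W^{[\alpha]}=0$ for all sufficiently negative real $l$. Write $u(k)=Y^g_{k,0}(u)$ and $$\Omega_g(W)=\{w\in W\mid u(k)w=0\text{ for all } u\in V_{(m)},\ m\in\mathbb Z,\ k\in\mathbb C\text{ with }\Re(m-k-1)<0\}.$$ Let $o_W$ be the linear map defined on $V$ by $o_W(v)w=v(m+a-1)w$ for $v\in V_{(m)}\cap V^{[a+\mathbb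 Z]}$ if $\Re a=0$, and $o_W(v)w=0$ for $v\in V^{[a+\mathbb Z]}$ if $\Re a>0$ ($w\in\Omega_g(W)$). Put $\rho_W=o_W\circ\mathcal U(1)$. **Modules for the algebras.** A module $M$ for $A_g(V)$ or $\tilde A_g(V)$ is $g$-graded if it carries an action of $g$ compatible with the action of $g$ on the algebra and is the direct sum of the generalized eigenspaces $M^{[\alpha]}$ of $g$ with eigenvalues $e^{2\pi\sqrt{-1}\alpha}$, $\alpha\in\mathbb C/\mathbb Z$. For $n\in\mathbb C$ let $M_{[n]}$ be the generalized eigenspace with eigenvalue $n$ of $\omega+O_g(V)$ in the case of $A_g(V)$, and of $\big((2\pi\sqrt{-1})^{-2}\omega+\frac c{24}\mathbf 1\big)+\tilde O_g(V)$ in the case of $\tilde A_g(V)$. A $g$-graded module $M$ is lower bounded if $M=\coprod_{n,\alpha}M_{[n]}\cap M^{[\alpha]}$ and for all $n,\alpha$ one has $M_{[n+l]}\cap M^{[\alpha]}=0$ for all sufficiently negative real $l$. **Theorem 5.5.** Let $W$ be a $\overline{\mathbb C}_+$-graded weak $g$-twisted $V$-module. Then $O_g(V)\subseteq\ker o_W$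 and $\tilde O_g(V)\subseteq\ker\rho_W$. The products $*_g$ and $\bullet_g$ make $A_g(V)$ and $\tilde A_g(V)$ associative algebras with identity on which $g$ acts. The maps $u+O_g(V)\mapsto o_W(u)$ and $u+\tilde O_g(V)\mapsto\rho_W(u)$ take values in $\mathrm{End}\,\Omega_g(W)$ and, together with the action of $g$ on $W$, make $\Omega_g(W)$ a $g$-graded $A_g(V)$-module and a $g$-graded $\tilde A_g(V)$-module, respectively. If $W$ is a lower bounded $g$-twisted $V$-module, then $\Omega_g(W)$ is a lower bounded $A_g(V)$-module and a lower bounded $\tilde A_g(V)$-module, in both cases with $(\Omega_g(W))_{[n]}=\Omega_g(W)\cap W_{[n]}$, and for every $r\in\mathbb R$ the space $\coprod_{n\in r+\mathbb I}(\Omega_g(W))_{[n]}$ is an $A_g(V)$-submodule and an $\tilde A_g(V)$-submodule of $\Omega_g(W)$. -/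

import Mathlib

namespace TwistedZhu

noncomputable section

/-! ### Linear algebra of gradings and locally finite sums -/

/-- For an internal direct sum decomposition `V = ⨁ ℳ i`, the linear map on `V` that agrees with
`F i` on `ℳ i` for every `i` ("define on homogeneous elements and extend by linearity"). -/
def byGrading {ι V X : Type*} [DecidableEq ι] [AddCommGroup V] [Module ℂ V]
    [AddCommGroup X] [Module ℂ X] (ℳ : ι → Submodule ℂ V) (h : DirectSum.IsInternal ℳ)
    (F : ι → V →ₗ[ℂ] X) : V →ₗ[ℂ] X :=
  (DirectSum.toModule ℂ ι X fun i => F i ∘ₗ (ℳ i).subtype) ∘ₗ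
    (LinearEquiv.ofBijective (DirectSum.coeLinearMap ℳ) h).symm.toLinearMap

theorem byGrading_apply {ι V X : Type*} [DecidableEq ι] [AddCommGroup V] [Module ℂ V]
    [AddCommGroup X] [Module ℂ X] (ℳ : ι → Submodule ℂ V) (h : DirectSum.IsInternal ℳ)
    (F : ι → V →ₗ[ℂ] X) {i : ι} {v : V} (hv : v ∈ ℳ i) : byGrading ℳ h F v = F i v := by
  have h1 : (LinearEquiv.ofBijective (DirectSum.coeLinearMap ℳ) h).symm v
      = DirectSum.lof ℂ ι (fun i => ℳ i) i ⟨v, hv⟩ := by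
    refine (LinearEquiv.symm_apply_eq _).mpr ?_
    exact (DirectSum.coeLinearMap_lof ℳ i ⟨v, hv⟩).symm
  simp only [byGrading, LinearMap.comp_apply, LinearEquiv.coe_coe]
  erw [h1]
  rw [DirectSum.toModule_lof]
  rfl

/-- The pointwise sum `∑ j, T j` of a locally finite family of operators. -/
def locSum {V : Type*} [AddCommGroup V] [Module ℂ V] (T : ℕ → Module.End ℂ V)
    (h : ∀ v, ∃ K : ℕ, ∀ k, K ≤ k → T k v = 0) : Module.End ℂ V where
  toFun v := ∑ᶠ j : ℕ, T j v
  map_add' u v := by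
    have fin : ∀ v, (Function.support fun j => T j v).Finite := fun v => by
      obtain ⟨K, hK⟩ := h v
      refine (Set.finite_lt_nat K).subset fun j hj => ?_
      by_contra hlt
      exact hj (hK j (not_lt.mp hlt))
    simp only [map_add]
    exact finsum_add_distrib (fin u) (fin v)
  map_smul' r v := by
    simp only [map_smul, RingHom.id_apply]
    rw [smul_finsum]

/-- A family of operators that is locally nilpotent on each summand of a spanning family is
locally nilpotent. -/
theorem locally_zero_of_iSup {ι V : Type*} [AddCommGroup V] [Module ℂ V]
    (ℳ : ι → Submodule ℂ V) (hℳ : ⨆ i, ℳ i = ⊤) (T : ℕ → Module.End ℂ V)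
    (h : ∀ i, ∀ v ∈ ℳ i, ∃ K : ℕ, ∀ k, K ≤ k → T k v = 0) (v : V) :
    ∃ K : ℕ, ∀ k, K ≤ k → T k v = 0 := by
  have hv : v ∈ ⨆ i, ℳ i := hℳ ▸ Submodule.mem_top
  induction hv using Submodule.iSup_induction' with
  | mem i x hx => exact h i x hx
  | zero => exact ⟨0, fun k _ => map_zero _⟩
  | add x y _ _ hx hy =>
    obtain ⟨K, hK⟩ := hx
    obtain ⟨M, hM⟩ := hy
    refine ⟨max K M, fun k hk => ?_⟩
    rw [map_add, hK k (le_trans (le_max_left _ _) hk), hM k (le_trans (le_max_right _ _) hk),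
      add_zero]

/-- The binomial coefficient `T (T - 1) ⋯ (T - j + 1) / j!` of an operator `T`; it is the
coefficient of `x ^ j` in `(1 + x) ^ T`. -/
def binomOp {V : Type*} [AddCommGroup V] [Module ℂ V] (T : Module.End ℂ V) (j : ℕ) :
    Module.End ℂ V :=
  ((j.factorial : ℂ)⁻¹) • Polynomial.aeval T (descPochhammer ℂ j)

/-! ### Complex powers, logarithms, representatives of `ℂ / ℤ` -/

/-- The argument with values in `[0, 2π)`. -/
def arg0 (z : ℂ) : ℝ := if 0 ≤ z.arg then z.arg else z.arg + 2 * Real.pi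

/-- `l_p(z) = log |z| + i arg z + 2 π i p` with `0 ≤ arg z < 2π`. -/
def logBranch (p : ℤ) (z : ℂ) : ℂ :=
  (Real.log ‖z‖ : ℂ) + (arg0 z : ℂ) * Complex.I + 2 * Real.pi * p * Complex.I

/-- The number `2 π i`. -/
def twoPiI : ℂ := 2 * Real.pi * Complex.I

/-- The set `[0, 1) + iℝ`. Every class in `ℂ / ℤ` has exactly one representative in it, and
we index objects labelled by `ℂ / ℤ` by these representatives. -/
abbrev Strip : Type := {a : ℂ // 0 ≤ a.re ∧ a.re < 1}

/-- The eigenvalue `e ^ (2 π i a)` that belongs to the class `a + ℤ`. -/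
def Strip.eig (a : Strip) : ℂ := Complex.exp (twoPiI * a)

theorem twoPiI_ne_zero : twoPiI ≠ 0 := Complex.two_pi_I_ne_zero

theorem Strip.eig_ne_zero (a : Strip) : a.eig ≠ 0 := Complex.exp_ne_zero _

theorem Strip.eig_injective : Function.Injective Strip.eig := by
  intro a b hab
  obtain ⟨n, hn⟩ := Complex.exp_eq_exp_iff_exists_int.mp hab
  have h1 : (a : ℂ) = b + n := by
    apply mul_left_cancel₀ twoPiI_ne_zero
    rw [hn, twoPiI]
    ring
  have h2 : (a : ℂ).re = (b : ℂ).re + n := by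
    rw [h1]
    simp
  have hn0 : n = 0 := by
    have ha := a.2
    have hb := b.2
    have u : (n : ℝ) < 1 := by linarith
    have l : (-1 : ℝ) < n := by linarith
    have u' : n < 1 := by exact_mod_cast u
    have l' : -1 < n := by exact_mod_cast l
    omega
  apply Subtype.ext
  rw [h1, hn0]
  simp

theorem Strip.exists_eig {μ : ℂ} (hμ : μ ≠ 0) : ∃ a : Strip, a.eig = μ := by
  set b : ℂ := Complex.log μ / twoPiI with hb
  refine ⟨⟨b - (⌊b.re⌋ : ℤ), ?_, ?_⟩, ?_⟩
  · simp
  · have := Int.lt_floor_add_one b.re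
    simp only [Complex.sub_re, Complex.intCast_re]
    linarith
  · have h1 : twoPiI * (b - (⌊b.re⌋ : ℤ))
        = Complex.log μ - (⌊b.re⌋ : ℤ) * (2 * Real.pi * Complex.I) := by
      rw [mul_sub, hb, mul_div_cancel₀ _ twoPiI_ne_zero, twoPiI]
      ring
    simp only [Strip.eig, h1]
    rw [Complex.exp_sub, Complex.exp_int_mul_two_pi_mul_I, Complex.exp_log hμ, div_one]

/-! ### Vertex operator algebras and their automorphisms -/

/-- A vertex operator algebra `(V, Y, 𝟏, ω)` over `ℂ` (with central charge `c`). The coefficient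
`uₙ` of `x ^ (-n-1)` in `Y(u, x)` is `VertexOperator.ncoeff (Y u) n`, and `L(n) = ω₍ₙ₊₁₎`; lower
truncation is part of `VertexOperator`. The Jacobi identity is stated in components. The
homogeneous subspace `V₍ₙ₎` is the eigenspace of `L(0)` with eigenvalue `n`. -/
structure VertexOperatorAlgebra (V : Type*) [AddCommGroup V] [Module ℂ V] where
  Y : V →ₗ[ℂ] VertexOperator ℂ V
  vac : V
  conf : V
  c : ℂ
  vac_mode : ∀ (n : ℤ) (v : V),
    VertexOperator.ncoeff (Y vac) n v = if n = -1 then v else 0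
  creation : ∀ v : V, VertexOperator.ncoeff (Y v) (-1) vac = v
  creation_nonneg : ∀ (v : V) (n : ℤ), 0 ≤ n → VertexOperator.ncoeff (Y v) n vac = 0
  jacobi : ∀ (u v w : V) (l m n : ℤ),
    ∑ᶠ i : ℕ, ((Ring.choose m i : ℤ) : ℂ) •
        VertexOperator.ncoeff (Y (VertexOperator.ncoeff (Y u) (l + i) v)) (m + n - i) w
      = ∑ᶠ i : ℕ, ((-1 : ℂ) ^ i * ((Ring.choose l i : ℤ) : ℂ)) •
        (VertexOperator.ncoeff (Y u) (m + l - i) (VertexOperator.ncoeff (Y v) (n + i) w)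
          - (-1 : ℂ) ^ l •
            VertexOperator.ncoeff (Y v) (n + l - i) (VertexOperator.ncoeff (Y u) (m + i) w))
  virasoro : ∀ (m n : ℤ) (v : V),
    VertexOperator.ncoeff (Y conf) (m + 1) (VertexOperator.ncoeff (Y conf) (n + 1) v)
        - VertexOperator.ncoeff (Y conf) (n + 1) (VertexOperator.ncoeff (Y conf) (m + 1) v)
      = ((m : ℂ) - n) • VertexOperator.ncoeff (Y conf) (m + n + 1) v
        + if m + n = 0 then (((m : ℂ) ^ 3 - m) / 12 * c) • v else 0
  derivative : ∀ (u v : V) (n : ℤ),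
    VertexOperator.ncoeff (Y (VertexOperator.ncoeff (Y conf) 0 u)) n v
      = -(n : ℂ) • VertexOperator.ncoeff (Y u) (n - 1) v
  grading : DirectSum.IsInternal
    fun n : ℤ => Module.End.eigenspace (VertexOperator.ncoeff (Y conf) 1) (n : ℂ)
  finite_dimensional : ∀ n : ℤ, FiniteDimensional ℂ
    (Module.End.eigenspace (VertexOperator.ncoeff (Y conf) 1) (n : ℂ))
  lower_bounded : ∃ N : ℤ, ∀ n : ℤ, n < N →
    Module.End.eigenspace (VertexOperator.ncoeff (Y conf) 1) (n : ℂ) = ⊥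

namespace VertexOperatorAlgebra

variable {V : Type*} [AddCommGroup V] [Module ℂ V] (𝒱 : VertexOperatorAlgebra V)

/-- The operator `uₙ`. -/
def mode (u : V) (n : ℤ) : Module.End ℂ V := VertexOperator.ncoeff (𝒱.Y u) n

/-- The Virasoro operator `L(n)`. -/
def L (n : ℤ) : Module.End ℂ V := 𝒱.mode 𝒱.conf (n + 1)

/-- The homogeneous subspace `V₍ₙ₎`. -/
def wt (n : ℤ) : Submodule ℂ V := Module.End.eigenspace (𝒱.L 0) (n : ℂ)

theorem wt_isInternal : DirectSum.IsInternal 𝒱.wt := 𝒱.grading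

theorem mode_eq_zero (u v : V) : ∃ K : ℕ, ∀ n : ℤ, (K : ℤ) ≤ n → 𝒱.mode u n v = 0 := by
  set o := HahnSeries.order ((HahnModule.of ℂ).symm (𝒱.Y u v)) with ho
  refine ⟨(-o).toNat, fun n hn => ?_⟩
  apply VertexOperator.ncoeff_eq_zero_of_lt_order
  have := Int.self_le_toNat (-o)
  omega

/-- `L(j)` with `j > 0` lowers the weight by `j`. -/
theorem L_mem_wt {n j : ℤ} {v : V} (hv : v ∈ 𝒱.wt n) : 𝒱.L j v ∈ 𝒱.wt (n - j) := by
  have h := 𝒱.virasoro 0 j v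
  have hv' : 𝒱.L 0 v = (n : ℂ) • v := Module.End.mem_eigenspace_iff.mp hv
  have h0 : ∀ w, VertexOperator.ncoeff (𝒱.Y 𝒱.conf) (0 + 1) w = 𝒱.L 0 w := fun _ => rfl
  have hj : ∀ w, VertexOperator.ncoeff (𝒱.Y 𝒱.conf) (j + 1) w = 𝒱.L j w := fun _ => rfl
  rw [h0, h0, hj, hj, hv', zero_add, hj, map_smul] at h
  apply Module.End.mem_eigenspace_iff.mpr
  rw [sub_eq_iff_eq_add.mp h]
  push_cast
  split_ifs with hj0
  · simp [hj0]
  · rw [add_zero, ← add_smul]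
    congr 1
    ring

end VertexOperatorAlgebra

/-- An automorphism of a vertex operator algebra. -/
structure Automorphism {V : Type*} [AddCommGroup V] [Module ℂ V]
    (𝒱 : VertexOperatorAlgebra V) where
  equiv : V ≃ₗ[ℂ] V
  map_mode : ∀ (u v : V) (n : ℤ), equiv (𝒱.mode u n v) = 𝒱.mode (equiv u) n (equiv v)
  map_vac : equiv 𝒱.vac = 𝒱.vac
  map_conf : equiv 𝒱.conf = 𝒱.conf

/-! ### Operators attached to an automorphism -/

namespace Automorphism

variable {V : Type*} [AddCommGroup V] [Module ℂ V] {𝒱 : VertexOperatorAlgebra V}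
  (g : Automorphism 𝒱)

/-- `g` as a linear operator. -/
def op : Module.End ℂ V := g.equiv.toLinearMap

/-- The generalized eigenspace `V^[a + ℤ]` of `g` with eigenvalue `e ^ (2 π i a)`. -/
def gen (a : Strip) : Submodule ℂ V := g.op.maxGenEigenspace a.eig

theorem op_mem_wt {n : ℤ} {v : V} (hv : v ∈ 𝒱.wt n) : g.op v ∈ 𝒱.wt n := by
  have hv' : 𝒱.L 0 v = (n : ℂ) • v := Module.End.mem_eigenspace_iff.mp hv
  apply Module.End.mem_eigenspace_iff.mpr
  have h := g.map_mode 𝒱.conf v (0 + 1)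
  rw [g.map_conf] at h
  change g.equiv (𝒱.L 0 v) = 𝒱.L 0 (g.equiv v) at h
  rw [hv', map_smul] at h
  exact h.symm

theorem maxGenEigenspace_zero : g.op.maxGenEigenspace 0 = ⊥ := by
  rw [eq_bot_iff]
  intro v hv
  obtain ⟨k, hk⟩ := (Module.End.mem_maxGenEigenspace _ _ _).mp hv
  rw [zero_smul, sub_zero] at hk
  have hinj : Function.Injective (g.op ^ k) := by
    rw [Module.End.coe_pow]
    exact g.equiv.injective.iterate k
  exact hinj (hk.trans (map_zero _).symm)

/-- `V` is the direct sum of the subspaces `V^[a + ℤ]`. -/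
theorem gen_isInternal : DirectSum.IsInternal g.gen := by
  apply DirectSum.isInternal_submodule_of_iSupIndep_of_iSup_eq_top
  · exact (Module.End.independent_maxGenEigenspace g.op).comp Strip.eig_injective
  · rw [eq_top_iff, ← 𝒱.wt_isInternal.submodule_iSup_eq_top]
    refine iSup_le fun n => ?_
    have hmap : ∀ x ∈ 𝒱.wt n, g.op x ∈ 𝒱.wt n := fun x hx => g.op_mem_wt hx
    have : FiniteDimensional ℂ (𝒱.wt n) := 𝒱.finite_dimensional n
    have htop := Module.End.iSup_maxGenEigenspace_eq_top (g.op.restrict hmap)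
    have h1 : 𝒱.wt n = Submodule.map (𝒱.wt n).subtype ⊤ := by simp
    rw [h1, ← htop, Submodule.map_iSup]
    refine iSup_le fun μ => ?_
    have h2 : Submodule.map (𝒱.wt n).subtype (Module.End.maxGenEigenspace (g.op.restrict hmap) μ)
        ≤ g.op.maxGenEigenspace μ := by
      rw [Submodule.map_le_iff_le_comap]
      exact (Module.End.genEigenspace_restrict g.op (𝒱.wt n) ⊤ μ hmap).le
    refine h2.trans ?_
    by_cases hμ : μ = 0
    · rw [hμ, maxGenEigenspace_zero]
      exact bot_le
    · obtain ⟨a, ha⟩ := Strip.exists_eig hμ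
      rw [← ha]
      exact le_iSup g.gen a

/-- `A_V`: multiplication by `a` on `V^[a + ℤ]`, `a ∈ [0, 1) + iℝ`. -/
def A : Module.End ℂ V := byGrading g.gen g.gen_isInternal fun a => (a : ℂ) • LinearMap.id

/-- The unipotent factor `g_u = σ⁻¹ g` in `g = σ g_u`, where the semisimple factor `σ` is
multiplication by `e ^ (2 π i a)` on `V^[a + ℤ]`. -/
def unipotent : Module.End ℂ V :=
  byGrading g.gen g.gen_isInternal fun a => a.eig⁻¹ • g.op

theorem unipotent_sub_one_pow (a : Strip) (k : ℕ) : ∀ v ∈ g.gen a,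
    ((g.unipotent - 1) ^ k) v = (a.eig⁻¹) ^ k • ((g.op - a.eig • (1 : Module.End ℂ V)) ^ k) v := by
  induction k with
  | zero =>
    intro v _
    simp
  | succ k ih =>
    intro v hv
    have h1 : (g.unipotent - 1) v
        = a.eig⁻¹ • (g.op - a.eig • (1 : Module.End ℂ V)) v := by
      have h2 : g.unipotent v = (a.eig⁻¹ • g.op) v := byGrading_apply _ _ _ hv
      simp [h2, smul_sub, smul_smul, a.eig_ne_zero]
    have h3 : (g.op - a.eig • (1 : Module.End ℂ V)) v ∈ g.gen a := by
      apply Module.End.mapsTo_maxGenEigenspace_of_comm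
        (f := g.op) (g := g.op - a.eig • (1 : Module.End ℂ V)) _ _ hv
      exact (Commute.refl _).sub_right ((Commute.one_right _).smul_right _)
    rw [pow_succ, Module.End.mul_apply, h1, map_smul, ih _ h3, smul_smul, pow_succ, pow_succ,
      Module.End.mul_apply, mul_comm]

/-- `g_u - 1` is locally nilpotent. -/
theorem unipotent_locally_nilpotent (v : V) :
    ∃ K : ℕ, ∀ k, K ≤ k → ((g.unipotent - 1) ^ k) v = 0 := by
  refine locally_zero_of_iSup g.gen g.gen_isInternal.submodule_iSup_eq_top _ ?_ v
  intro a v hv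
  obtain ⟨K, hK⟩ := (Module.End.mem_maxGenEigenspace _ _ _).mp hv
  refine ⟨K, fun k hk => ?_⟩
  rw [g.unipotent_sub_one_pow a k v hv]
  obtain ⟨d, rfl⟩ := Nat.exists_eq_add_of_le hk
  rw [add_comm K d, pow_add _ d K, pow_add _ d K, Module.End.mul_apply, hK, map_zero, smul_zero]

/-- `𝒩 = log g_u / (2 π i) = ∑_{j ≥ 1} (-1) ^ (j+1) (g_u - 1) ^ j / (2 π i j)`. -/
def N : Module.End ℂ V :=
  locSum (fun j => ((-1 : ℂ) ^ j / (twoPiI * (j + 1))) • (g.unipotent - 1) ^ (j + 1)) fun v => by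
    obtain ⟨K, hK⟩ := g.unipotent_locally_nilpotent v
    refine ⟨K, fun k hk => ?_⟩
    rw [LinearMap.smul_apply, hK (k + 1) (by omega), smul_zero]

/-- For `u ∈ V^[a + ℤ]` of weight `m`: the first `n ∈ a + ℤ` from which on all operators
`u(n)` have weight `m - n - 1` with negative real part. -/
def l (m : ℤ) (a : Strip) : ℂ := if (a : ℂ).re = 0 then m + a else m + a - 1

/-- The operator `ℒ`, with `ℒ u = l(u) u` for homogeneous `u ∈ V^[a + ℤ]`. -/
def LL : Module.End ℂ V :=
  byGrading 𝒱.wt 𝒱.wt_isInternal fun m =>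
    byGrading g.gen g.gen_isInternal fun a => l m a • LinearMap.id

/-- The operator `L(0) - ℒ + A_V`; its eigenvalues are `0` and `1`. -/
def E : Module.End ℂ V := 𝒱.L 0 - g.LL + g.A

/-! ### The products and the subspaces that define `A_g(V)` and `Ã_g(V)` -/

/-- `Res_x x ^ k Y((1 + x) ^ (ℒ + 𝒩) u, x) v`. -/
def res (k : ℤ) (u v : V) : V :=
  ∑ᶠ j : ℕ, 𝒱.mode (binomOp (g.LL + g.N) j u) (j + k) v

/-- The product `u *_g v = Res_x x⁻¹ Y((1 + x) ^ (ℒ + 𝒩) u, x) v`. -/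
def star (u v : V) : V := g.res (-1) u v

/-- `O_g(V)`, spanned by `Res_x x ^ (-n) Y(x ^ (L(0) - ℒ + A_V) (1 + x) ^ (ℒ + 𝒩) u, x) v` with
`n > 1`. As `L(0) - ℒ + A_V` is diagonalizable with integral eigenvalues, it is enough to take for
`u` its eigenvectors; when the eigenvalue of `u` is `d`, the power of the operator
is `x ^ d`. -/
def O : Submodule ℂ V :=
  Submodule.span ℂ {y | ∃ (n d : ℤ) (u v : V), 1 < n ∧ g.E u = (d : ℂ) • u ∧
    y = g.res (d - n) u v}

end Automorphism

/-- The series `(1 / 2 π i) log (1 + y)`, as a Laurent series in `y`. -/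
def logSeries : LaurentSeries ℂ :=
  HahnSeries.ofPowerSeries ℤ ℂ
    (PowerSeries.mk fun k => if k = 0 then 0 else (-1 : ℂ) ^ (k + 1) / (twoPiI * k))

namespace Automorphism

variable {V : Type*} [AddCommGroup V] [Module ℂ V] {𝒱 : VertexOperatorAlgebra V}
  (g : Automorphism 𝒱)

/-- `Res_y y ^ k Y((1 + y) ^ (ℒ - L(0) + 𝒩) u, (1 / 2 π i) log (1 + y)) v`: the coefficient of
`y⁻¹` in `∑_{j, m} y ^ (k + j) ((1 / 2 π i) log (1 + y)) ^ (-m-1) (binom(ℒ - L(0) + 𝒩, j) u)ₘ v`. -/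
def resT (k : ℤ) (u v : V) : V :=
  ∑ᶠ q : ℕ × ℤ, (logSeries ^ (-q.2 - 1)).coeff (-1 - k - q.1) •
    𝒱.mode (binomOp (g.LL - 𝒱.L 0 + g.N) q.1 u) q.2 v

/-- The product `u •_g v = Res_y y⁻¹ Y((1 + y) ^ (ℒ - L(0) + 𝒩) u, (1 / 2 π i) log (1 + y)) v`. -/
def bullet (u v : V) : V := g.resT (-1) u v

/-- `Õ_g(V)`, spanned by
`Res_y y ^ (-n) Y(y ^ (L(0) - ℒ + A_V) (1 + y) ^ (ℒ - L(0) + 𝒩) u, (1 / 2 π i) log (1 + y)) v`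
with `n > 1`; again the eigenvectors `u` of `L(0) - ℒ + A_V` suffice. -/
def OT : Submodule ℂ V :=
  Submodule.span ℂ {y | ∃ (n d : ℤ) (u v : V), 1 < n ∧ g.E u = (d : ℂ) • u ∧
    y = g.resT (d - n) u v}

end Automorphism

/-! ### The operator `𝒰(1)` -/

/-- The derivation `(∑_{j ≥ 1} A_j y ^ (j+1)) d/dy` of `ℂ⟦y⟧`. -/
def coordDer (A : ℕ → ℂ) (f : PowerSeries ℂ) : PowerSeries ℂ :=
  (PowerSeries.mk fun i => if i < 2 then 0 else A (i - 1)) * PowerSeries.derivative ℂ f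

/-- The identity `(1 / 2 π i) (e ^ (2 π i y) - 1) = exp(- ∑_{j ≥ 1} A_j y ^ (j+1) d/dy) y`, read
off coefficient by coefficient (the `k`-th power of the derivation raises the order by at
least `k`, so only `k ≤ n` contributes to the coefficient of `y ^ n`). -/
def IsCoordCoeff (A : ℕ → ℂ) : Prop :=
  ∀ n : ℕ, ∑ k ∈ Finset.range (n + 1), ((-1 : ℂ) ^ k / k.factorial) *
      PowerSeries.coeff n ((coordDer A)^[k] PowerSeries.X)
    = if n = 0 then 0 else twoPiI ^ n / (twoPiI * n.factorial)

theorem coeff_coordDer (A : ℕ → ℂ) (f : PowerSeries ℂ) (n : ℕ) :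
    PowerSeries.coeff n (coordDer A f) = ∑ p ∈ Finset.HasAntidiagonal.antidiagonal n,
      (if p.1 < 2 then 0 else A (p.1 - 1)) * (PowerSeries.coeff (p.2 + 1) f * (p.2 + 1)) := by
  rw [coordDer, PowerSeries.coeff_mul]
  simp [PowerSeries.coeff_derivative]

theorem coeff_coordDer_iterate_eq_zero (A : ℕ → ℂ) (k : ℕ) : ∀ n ≤ k,
    PowerSeries.coeff n ((coordDer A)^[k] PowerSeries.X) = 0 := by
  induction k with
  | zero =>
    intro n hn
    obtain rfl : n = 0 := by omega
    simp
  | succ k ih =>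
    intro n hn
    rw [Function.iterate_succ_apply', coeff_coordDer]
    refine Finset.sum_eq_zero fun p hp => ?_
    rw [Finset.HasAntidiagonal.mem_antidiagonal] at hp
    split_ifs with h
    · simp
    · rw [ih (p.2 + 1) (by omega)]
      simp

theorem coeff_coordDer_iterate_congr {A B : ℕ → ℂ} {M : ℕ} (h : ∀ i < M, A i = B i) (k : ℕ) :
    ∀ n ≤ M, PowerSeries.coeff n ((coordDer A)^[k] PowerSeries.X)
      = PowerSeries.coeff n ((coordDer B)^[k] PowerSeries.X) := by
  induction k with
  | zero =>
    intro n _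
    rfl
  | succ k ih =>
    intro n hn
    rw [Function.iterate_succ_apply', Function.iterate_succ_apply', coeff_coordDer,
      coeff_coordDer]
    refine Finset.sum_congr rfl fun p hp => ?_
    rw [Finset.HasAntidiagonal.mem_antidiagonal] at hp
    split_ifs with h2
    · simp
    · rw [ih (p.2 + 1) (by omega), h (p.1 - 1) (by omega)]

theorem coeff_coordDer_iterate_congr_succ {A B : ℕ → ℂ} {M : ℕ} (h : ∀ i < M, A i = B i)
    (k : ℕ) (hk : k ≠ 1) :
    PowerSeries.coeff (M + 1) ((coordDer A)^[k] PowerSeries.X)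
      = PowerSeries.coeff (M + 1) ((coordDer B)^[k] PowerSeries.X) := by
  match k, hk with
  | 0, _ => rfl
  | k + 2, _ =>
    rw [Function.iterate_succ_apply' (coordDer A) (k + 1),
      Function.iterate_succ_apply' (coordDer B) (k + 1), coeff_coordDer,
      coeff_coordDer]
    refine Finset.sum_congr rfl fun p hp => ?_
    rw [Finset.HasAntidiagonal.mem_antidiagonal] at hp
    split_ifs with h2
    · simp
    · rw [coeff_coordDer_iterate_congr h (k + 1) (p.2 + 1) (by omega)]
      rcases Nat.lt_or_ge (p.1 - 1) M with h3 | h3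
      · rw [h _ h3]
      · rw [coeff_coordDer_iterate_eq_zero B (k + 1) (p.2 + 1) (by omega)]
        simp

theorem coeff_coordDer_X (A : ℕ → ℂ) (n : ℕ) :
    PowerSeries.coeff n (coordDer A PowerSeries.X) = if n < 2 then 0 else A (n - 1) := by
  rw [coordDer]
  simp

/-- The coefficient of `y ^ n` in `exp(- ∑_{j ≥ 1} A_j y ^ (j+1) d/dy) y`. -/
def expCoeff (A : ℕ → ℂ) (n : ℕ) : ℂ :=
  ∑ k ∈ Finset.range (n + 1), ((-1 : ℂ) ^ k / k.factorial) *
    PowerSeries.coeff n ((coordDer A)^[k] PowerSeries.X)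

theorem expCoeff_succ {A B : ℕ → ℂ} {M : ℕ} (hM : 0 < M) (h : ∀ i < M, A i = B i)
    (hB : B M = 0) : expCoeff A (M + 1) = expCoeff B (M + 1) - A M := by
  have key : ∀ C : ℕ → ℂ, expCoeff C (M + 1)
      = ∑ k ∈ (Finset.range (M + 1 + 1)).erase 1, ((-1 : ℂ) ^ k / k.factorial) *
          PowerSeries.coeff (M + 1) ((coordDer C)^[k] PowerSeries.X) - C M := by
    intro C
    have h1 : 1 ∈ Finset.range (M + 1 + 1) := Finset.mem_range.mpr (by omega)
    rw [expCoeff, ← Finset.sum_erase_add _ _ h1, Function.iterate_one, coeff_coordDer_X,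
      if_neg (by omega)]
    simp [sub_eq_add_neg]
  rw [key A, key B, hB, sub_zero]
  congr 1
  refine Finset.sum_congr rfl fun k hk => ?_
  rw [coeff_coordDer_iterate_congr_succ h k (Finset.ne_of_mem_erase hk)]

/-- The numbers `A_j` (`j ≥ 1`) that satisfy `IsCoordCoeff`, found one after the other: the
coefficient of `y ^ (j+1)` in `exp(- ∑ A_i y ^ (i+1) d/dy) y` is `- A_j` plus a term that depends
on `A_1, …, A_{j-1}` only. -/
def coordCoeff (M : ℕ) : ℂ :=
  expCoeff (fun i => if _h : i < M then coordCoeff i else 0) (M + 1)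
    - twoPiI ^ (M + 1) / (twoPiI * (M + 1).factorial)
termination_by M

theorem coordCoeff_spec : IsCoordCoeff coordCoeff := by
  intro n
  change expCoeff coordCoeff n = _
  match n with
  | 0 => simp [expCoeff]
  | 1 =>
    simp [expCoeff, Finset.sum_range_succ, coeff_coordDer_X, twoPiI_ne_zero]
  | M + 2 =>
    rw [expCoeff_succ (A := coordCoeff)
      (B := fun i => if _h : i < M + 1 then coordCoeff i else 0) (by omega)
      (fun i hi => by simp [hi]) (by simp), if_neg (by omega)]
    conv_lhs => rw [coordCoeff]
    ring

namespace VertexOperatorAlgebra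

variable {V : Type*} [AddCommGroup V] [Module ℂ V] (𝒱 : VertexOperatorAlgebra V)

/-- `L_+(A) = ∑_{j ≥ 1} A_j L(j)`. -/
def LPlus : Module.End ℂ V :=
  locSum (fun j => coordCoeff (j + 1) • 𝒱.L (j + 1)) fun v => by
    obtain ⟨K, hK⟩ := 𝒱.mode_eq_zero 𝒱.conf v
    refine ⟨K, fun k hk => ?_⟩
    rw [LinearMap.smul_apply, L, hK _ (by omega), smul_zero]

theorem LPlus_mem {n : ℤ} {v : V} (hv : v ∈ ⨆ m : Set.Iic n, 𝒱.wt m) :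
    𝒱.LPlus v ∈ ⨆ m : Set.Iic (n - 1), 𝒱.wt m := by
  induction hv using Submodule.iSup_induction' with
  | mem i x hx =>
    change (∑ᶠ j : ℕ, (coordCoeff (j + 1) • 𝒱.L (j + 1)) x) ∈ _
    refine finsum_induction (· ∈ ⨆ m : Set.Iic (n - 1), 𝒱.wt m) (Submodule.zero_mem _)
      (fun _ _ => Submodule.add_mem _) fun j => ?_
    refine Submodule.smul_mem _ _ ?_
    have hi : (i : ℤ) ≤ n := i.2
    exact Submodule.mem_iSup_of_mem
      (⟨i - (j + 1), by simp only [Set.mem_Iic]; omega⟩ : Set.Iic (n - 1)) (𝒱.L_mem_wt hx)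
  | zero => simp
  | add x y _ _ hx hy =>
    rw [map_add]
    exact Submodule.add_mem _ hx hy

theorem LPlus_pow_mem (k : ℕ) : ∀ {n : ℤ} {v : V}, v ∈ ⨆ m : Set.Iic n, 𝒱.wt m →
    (𝒱.LPlus ^ k) v ∈ ⨆ m : Set.Iic (n - k), 𝒱.wt m := by
  induction k with
  | zero =>
    intro n v hv
    rw [Nat.cast_zero, sub_zero, pow_zero]
    exact hv
  | succ k ih =>
    intro n v hv
    have h := ih (𝒱.LPlus_mem hv)
    rw [pow_succ, Module.End.mul_apply]
    have e : n - ((k + 1 : ℕ) : ℤ) = n - 1 - k := by push_cast; ring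
    rw [e]
    exact h

/-- `L_+(A)` is locally nilpotent. -/
theorem LPlus_locally_nilpotent (v : V) :
    ∃ K : ℕ, ∀ k, K ≤ k → (𝒱.LPlus ^ k) v = 0 := by
  refine locally_zero_of_iSup 𝒱.wt 𝒱.wt_isInternal.submodule_iSup_eq_top _ ?_ v
  intro n v hv
  obtain ⟨N, hN⟩ := 𝒱.lower_bounded
  refine ⟨(n - N + 1).toNat, fun k hk => ?_⟩
  have h := 𝒱.LPlus_pow_mem k
    (Submodule.mem_iSup_of_mem (⟨n, Set.mem_Iic.mpr le_rfl⟩ : Set.Iic n) hv)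
  have hbot : ⨆ m : Set.Iic (n - k), 𝒱.wt m = ⊥ := by
    rw [iSup_eq_bot]
    intro m
    have hm : (m : ℤ) ≤ n - k := m.2
    have := Int.self_le_toNat (n - N + 1)
    exact hN m (by omega)
  rw [hbot] at h
  exact (Submodule.mem_bot ℂ).mp h

/-- `e ^ (- L_+(A))`. -/
def expNegLPlus : Module.End ℂ V :=
  locSum (fun k => ((-1 : ℂ) ^ k / k.factorial) • 𝒱.LPlus ^ k) fun v => by
    obtain ⟨K, hK⟩ := 𝒱.LPlus_locally_nilpotent v
    refine ⟨K, fun k hk => ?_⟩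
    rw [LinearMap.smul_apply, hK k hk, smul_zero]

/-- `𝒰(1) = (2 π i) ^ L(0) e ^ (- L_+(A))`. -/
def U1 : Module.End ℂ V :=
  (byGrading 𝒱.wt 𝒱.wt_isInternal fun n => twoPiI ^ n • LinearMap.id) * 𝒱.expNegLPlus

end VertexOperatorAlgebra

/-! ### Twisted modules -/

/-- The data of a twisted module `W`: the operators `Y_{n,k}(v)`, which are the coefficients in
`Y^g(v, x) w = ∑_{n,k} Y_{n,k}(v) w x ^ (-n-1) (log x) ^ k`, the action of the automorphism on
`W`, and a direct sum decomposition of `W` into subspaces `W_n^[a + ℤ]` with `W_n^[a + ℤ] = 0`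
unless `Re n ≥ 0`. -/
structure TwistedData (V W : Type*) [AddCommGroup V] [Module ℂ V] [AddCommGroup W]
    [Module ℂ W] where
  Yg : ℂ → ℕ → V →ₗ[ℂ] W →ₗ[ℂ] W
  log_finite : ∀ (v : V) (w : W), ∃ N : ℕ, ∀ (n : ℂ) (k : ℕ), N < k → Yg n k v w = 0
  act : W ≃ₗ[ℂ] W
  gr : ℂ × Strip → Submodule ℂ W
  gr_isInternal : DirectSum.IsInternal gr
  gr_eq_bot : ∀ (n : ℂ) (a : Strip), n.re < 0 → gr (n, a) = ⊥

namespace TwistedData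

variable {V W : Type*} [AddCommGroup V] [Module ℂ V] [AddCommGroup W] [Module ℂ W]
  (D : TwistedData V W)

/-- `W_n = ⨁_a W_n^[a + ℤ]`. -/
def deg (n : ℂ) : Submodule ℂ W := ⨆ a : Strip, D.gr (n, a)

/-- `W^[a + ℤ] = ⨁_n W_n^[a + ℤ]`. -/
def gen (a : Strip) : Submodule ℂ W := ⨆ n : ℂ, D.gr (n, a)

/-- The projection `π_n : W → W_n`. -/
def proj (n : ℂ) : W →ₗ[ℂ] W :=
  byGrading D.gr D.gr_isInternal fun i => if i.1 = n then LinearMap.id else 0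

/-- The value of `x ^ (-n-1) (log x) ^ k` at `x ^ m = e ^ (m l_p(z))`, `log x = l_p(z)`. -/
def monomial (p : ℤ) (z n : ℂ) (k : ℕ) : ℂ :=
  Complex.exp ((-n - 1) * logBranch p z) * logBranch p z ^ k

/-- The component in `W_n` of the `p`-th branch `Y^{g;p}(v, z) w`. -/
def branch (p : ℤ) (v : V) (z : ℂ) (w : W) (n : ℂ) : W :=
  ∑ᶠ q : ℂ × ℕ, monomial p z q.1 q.2 • D.proj n (D.Yg q.1 q.2 v w)

/-- The number `⟨φ, Y^{g;p}(v, z) w⟩` for a functional `φ` in the graded dual. -/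
def pairing (φ : W →ₗ[ℂ] ℂ) (p : ℤ) (v : V) (z : ℂ) (w : W) : ℂ :=
  ∑ᶠ q : ℂ × ℕ, monomial p z q.1 q.2 * φ (D.Yg q.1 q.2 v w)

/-- `φ` is in the graded dual `⨁ (W_n^[a + ℤ])^*`. -/
def IsGradedDual (φ : W →ₗ[ℂ] ℂ) : Prop := {i | ∃ w ∈ D.gr i, φ w ≠ 0}.Finite

end TwistedData

/-- The component in `V₍ₙ₎` of `Y(u, z) v` for a nonzero complex number `z`. -/
def VertexOperatorAlgebra.eval {V : Type*} [AddCommGroup V] [Module ℂ V]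
    (𝒱 : VertexOperatorAlgebra V) (u : V) (z : ℂ) (v : V) (n : ℤ) : V :=
  ∑ᶠ m : ℤ, z ^ (-m - 1) •
    byGrading 𝒱.wt 𝒱.wt_isInternal (fun i => if i = n then LinearMap.id else 0) (𝒱.mode u m v)

/-- The coefficients of a function
`∑_{i,j,k,l = 0}^N a_{ijkl} z₁ ^ m_i z₂ ^ n_j (log z₁) ^ k (log z₂) ^ l (z₁ - z₂) ^ (-t)`
with `t > 0`. -/
structure TwoPointFunction where
  N : ℕ
  m : Fin (N + 1) → ℂ
  n : Fin (N + 1) → ℂ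
  a : Fin (N + 1) → Fin (N + 1) → Fin (N + 1) → Fin (N + 1) → ℂ
  t : ℕ
  t_pos : 0 < t

/-- The branch of a two point function that is given by `l_p(z₁)` and `l_p(z₂)`. -/
def TwoPointFunction.branch (f : TwoPointFunction) (p : ℤ) (z₁ z₂ : ℂ) : ℂ :=
  ∑ i, ∑ j, ∑ k, ∑ l, f.a i j k l * Complex.exp (f.m i * logBranch p z₁) *
    Complex.exp (f.n j * logBranch p z₂) * logBranch p z₁ ^ (k : ℕ) *
    logBranch p z₂ ^ (l : ℕ) * ((z₁ - z₂) ^ f.t)⁻¹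

/-- The series `s` converges absolutely, and to `b` if `|arg z₁ - arg z₂| < π / 2`. -/
def ConvergesToBranch {ι : Type*} (s : ι → ℂ) (z₁ z₂ b : ℂ) : Prop :=
  Summable (fun i => ‖s i‖) ∧ (|arg0 z₁ - arg0 z₂| < Real.pi / 2 → HasSum s b)

/-- A weak `g`-twisted `V`-module graded by the closed right half plane and by `ℂ / ℤ`. -/
structure WeakTwistedModule {V : Type*} [AddCommGroup V] [Module ℂ V]
    (𝒱 : VertexOperatorAlgebra V) (g : Automorphism 𝒱) (W : Type*) [AddCommGroup W]
    [Module ℂ W] extends TwistedData V W where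
  equivariance : ∀ (p : ℤ) (z : ℂ), z ≠ 0 → ∀ (v : V) (w : W),
    toTwistedData.branch (p + 1) (g.op v) z w = toTwistedData.branch p v z w
  identity : ∀ (n : ℂ) (k : ℕ) (w : W),
    Yg n k 𝒱.vac w = if n = -1 ∧ k = 0 then w else 0
  duality : ∀ (u v : V) (w : W) (φ : W →ₗ[ℂ] ℂ), toTwistedData.IsGradedDual φ →
    ∃ f : TwoPointFunction, ∀ (p : ℤ) (z₁ z₂ : ℂ),
      (‖z₂‖ < ‖z₁‖ → 0 < ‖z₂‖ →
        ConvergesToBranch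
          (fun n : ℂ => toTwistedData.pairing φ p u z₁ (toTwistedData.branch p v z₂ w n))
          z₁ z₂ (f.branch p z₁ z₂)) ∧
      (‖z₁‖ < ‖z₂‖ → 0 < ‖z₁‖ →
        ConvergesToBranch
          (fun n : ℂ => toTwistedData.pairing φ p v z₂ (toTwistedData.branch p u z₁ w n))
          z₁ z₂ (f.branch p z₁ z₂)) ∧
      (‖z₁ - z₂‖ < ‖z₂‖ → 0 < ‖z₁ - z₂‖ →
        ConvergesToBranch
          (fun n : ℤ => toTwistedData.pairing φ p (𝒱.eval u (z₁ - z₂) v n) z₂ w)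
          z₁ z₂ (f.branch p z₁ z₂))
  degree : ∀ (m : ℤ) (v : V), v ∈ 𝒱.wt m → ∀ (p : ℂ) (w : W), w ∈ toTwistedData.deg p →
    ∀ (n : ℂ) (k : ℕ), Yg n k v w ∈ toTwistedData.deg (m - n - 1 + p)
  lowest : ∀ w : W, w ∈ (⨆ n : {n : ℂ // n.re = 0}, toTwistedData.deg n) ↔
    ∀ (m : ℤ) (v : V), v ∈ 𝒱.wt m → ∀ (n : ℂ) (k : ℕ), (m - n - 1 : ℂ).re < 0 →
      Yg n k v w = 0
  generalized : ∀ (a : Strip) (w : W), w ∈ toTwistedData.gen a →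
    ∃ Λ : ℕ, 0 < Λ ∧ ((act.toLinearMap - a.eig • (1 : Module.End ℂ W)) ^ Λ) w = 0
  act_Yg : ∀ (n : ℂ) (k : ℕ) (v : V) (w : W), act (Yg n k v w) = Yg n k (g.op v) (act w)
  derivative : ∀ (n : ℂ) (k : ℕ) (v : V) (w : W),
    Yg n k (𝒱.L (-1) v) w = -n • Yg (n - 1) k v w + ((k : ℂ) + 1) • Yg (n - 1) (k + 1) v w

namespace WeakTwistedModule

variable {V W : Type*} [AddCommGroup V] [Module ℂ V] [AddCommGroup W] [Module ℂ W]
  {𝒱 : VertexOperatorAlgebra V} {g : Automorphism 𝒱} (M : WeakTwistedModule 𝒱 g W)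

/-- `L^g(0) = Res_x x Y^g(ω, x)`. -/
def L0 : Module.End ℂ W := M.Yg 1 0 𝒱.conf

/-- `M` is a lower bounded `g`-twisted module: `W` is the direct sum of the generalized
eigenspaces `W_[n]` of `L^g(0)`, and for all `n` and `a` the space `W_[n + l] ∩ W^[a + ℤ]` is zero
for all sufficiently negative real numbers `l`. -/
structure IsLowerBounded : Prop where
  isInternal : DirectSum.IsInternal fun n : ℂ => M.L0.maxGenEigenspace n
  bounded : ∀ (n : ℂ) (a : Strip), ∃ B : ℝ, ∀ l : ℝ, l ≤ B →
    M.L0.maxGenEigenspace (n + l) ⊓ M.toTwistedData.gen a = ⊥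

/-- The lowest space `Ω_g(W)`. -/
def Omega : Submodule ℂ W where
  carrier := {w | ∀ (m : ℤ) (u : V), u ∈ 𝒱.wt m → ∀ k : ℂ, (m - k - 1 : ℂ).re < 0 →
    M.Yg k 0 u w = 0}
  zero_mem' := fun _ _ _ _ _ => map_zero _
  add_mem' := fun hv hw m u hu k hk => by rw [map_add, hv m u hu k hk, hw m u hu k hk, add_zero]
  smul_mem' := fun r w hw m u hu k hk => by rw [map_smul, hw m u hu k hk, smul_zero]

/-- The operator on `W` that is `v(m + a - 1)` for `v ∈ V^[a + ℤ]` of weight `m` if `Re a = 0`,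
and `0` for `v ∈ V^[a + ℤ]` if `Re a ≠ 0`. -/
def zeroMode : V →ₗ[ℂ] Module.End ℂ W :=
  byGrading 𝒱.wt 𝒱.wt_isInternal fun m =>
    byGrading g.gen g.gen_isInternal fun a =>
      if (a : ℂ).re = 0 then M.Yg (m + a - 1) 0 else 0

/-- The map `o_W`, with values in the linear maps on `Ω_g(W)`. -/
def o : V →ₗ[ℂ] (M.Omega →ₗ[ℂ] W) :=
  LinearMap.lcomp ℂ W M.Omega.subtype ∘ₗ M.zeroMode

/-- The map `ρ_W = o_W ∘ 𝒰(1)`. -/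
def rho : V →ₗ[ℂ] (M.Omega →ₗ[ℂ] W) := M.o ∘ₗ 𝒱.U1

/-- `(Ω_g(W))_[n]`, the intersection of `Ω_g(W)` with the generalized eigenspace `W_[n]` of
`L^g(0)`. -/
def OmegaWt (n : ℂ) : Submodule ℂ M.Omega :=
  (M.L0.maxGenEigenspace n).comap M.Omega.subtype

end WeakTwistedModule

/-! ### The algebras on `V / O` and their modules -/

variable {V : Type*} [AddCommGroup V] [Module ℂ V]

/-- The structure of an associative algebra with identity, and with an action of `g`, on the
quotient `V / O` which is induced by a product on `V`, by the vacuum and by `g`. There is at most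
one. -/
structure InducedAlgebra {𝒱 : VertexOperatorAlgebra V} (g : Automorphism 𝒱)
    (prod : V → V → V) (O : Submodule ℂ V) where
  mul : (V ⧸ O) →ₗ[ℂ] (V ⧸ O) →ₗ[ℂ] (V ⧸ O)
  mul_mk : ∀ u v : V, mul (O.mkQ u) (O.mkQ v) = O.mkQ (prod u v)
  mul_assoc : ∀ x y z : V ⧸ O, mul (mul x y) z = mul x (mul y z)
  one_mul : ∀ x : V ⧸ O, mul (O.mkQ 𝒱.vac) x = x
  mul_one : ∀ x : V ⧸ O, mul x (O.mkQ 𝒱.vac) = x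
  gact : (V ⧸ O) →ₗ[ℂ] (V ⧸ O)
  gact_mk : ∀ u : V, gact (O.mkQ u) = O.mkQ (g.op u)

/-- `A_g(V) = V / O_g(V)` with the product induced by `*_g`. -/
abbrev ZhuAlgebra {𝒱 : VertexOperatorAlgebra V} (g : Automorphism 𝒱) :=
  InducedAlgebra g g.star g.O

/-- `Ã_g(V) = V / Õ_g(V)` with the product induced by `•_g`. -/
abbrev ZhuAlgebraT {𝒱 : VertexOperatorAlgebra V} (g : Automorphism 𝒱) :=
  InducedAlgebra g g.bullet g.OT

namespace InducedAlgebra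

variable {𝒱 : VertexOperatorAlgebra V} {g : Automorphism 𝒱} {prod : V → V → V}
  {O : Submodule ℂ V} (𝔸 : InducedAlgebra g prod O)

/-- A `g`-graded module for the algebra `V / O`: a module with a compatible action of `g` that
is the direct sum of the generalized eigenspaces of `g` with eigenvalues `e ^ (2 π i a)`. -/
structure GradedModule (M : Type*) [AddCommGroup M] [Module ℂ M] where
  smul : (V ⧸ O) →ₗ[ℂ] Module.End ℂ M
  mul_smul : ∀ (x y : V ⧸ O) (m : M), smul (𝔸.mul x y) m = smul x (smul y m)
  one_smul : ∀ m : M, smul (O.mkQ 𝒱.vac) m = m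
  act : M ≃ₗ[ℂ] M
  act_smul : ∀ (x : V ⧸ O) (m : M), act (smul x m) = smul (𝔸.gact x) (act m)
  isInternal : DirectSum.IsInternal
    fun a : Strip => Module.End.maxGenEigenspace act.toLinearMap a.eig

namespace GradedModule

variable {𝔸} {M : Type*} [AddCommGroup M] [Module ℂ M] (R : 𝔸.GradedModule M)

/-- `M_[n]`: the generalized eigenspace with eigenvalue `n` of the class of `y`. -/
def weightSpace (y : V) (n : ℂ) : Submodule ℂ M :=
  Module.End.maxGenEigenspace (R.smul (O.mkQ y)) n

/-- `M_[n]^[a + ℤ]`. -/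
def doubleSpace (y : V) (n : ℂ) (a : Strip) : Submodule ℂ M :=
  R.weightSpace y n ⊓ Module.End.maxGenEigenspace R.act.toLinearMap a.eig

/-- A lower bounded module: `M = ⨁ M_[n]^[a + ℤ]`, and for all `n` and `a` the
space `M_[n + l]^[a + ℤ]` is zero for all sufficiently negative real numbers `l`. Weights are the
eigenvalues of the class of the element `y`. -/
structure IsLowerBounded (y : V) : Prop where
  isInternal : DirectSum.IsInternal fun i : ℂ × Strip => R.doubleSpace y i.1 i.2
  bounded : ∀ (n : ℂ) (a : Strip), ∃ B : ℝ, ∀ l : ℝ, l ≤ B → R.doubleSpace y (n + l) a = ⊥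

/-- `S` is a submodule for the algebra `V / O`. -/
def IsSubmodule (S : Submodule ℂ M) : Prop := ∀ (x : V ⧸ O), ∀ m ∈ S, R.smul x m ∈ S

end GradedModule

end InducedAlgebra

/-- The element of `V` whose class in `Ã_g(V)` measures weights: `(2 π i)⁻² ω + (c / 24) 𝟏`. It is
`𝒰(1)⁻¹ ω`, so that it corresponds to `ω` under the isomorphism `Ã_g(V) ≅ A_g(V)` induced
by `𝒰(1)`; its generalized eigenspace with eigenvalue `n` is the generalized eigenspace of `ω` with
eigenvalue `(2 π i)² (n - c / 24)`. -/
def VertexOperatorAlgebra.confT (𝒱 : VertexOperatorAlgebra V) : V :=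
  (twoPiI ^ 2)⁻¹ • 𝒱.conf + (𝒱.c / 24) • 𝒱.vac

end

end TwistedZhu

/-!
# The lowest space of a twisted module over the twisted Zhu algebra

Put `T = ℒ + 𝒩`, and let `res k u v` be the residue `Res_x x ^ k Y((1 + x) ^ T u, x) v`, so that
`u *_g v = res (-1) u v` and `O_g(V)` is spanned by the `res (ε(a) - n) u v` with `u ∈ V^[a + ℤ]`
and `n > 1`. Here `ε(a)` is `0` if `Re a = 0`, and `1` otherwise.

**The algebra `A_g(V)`.** As `g_u = e ^ (2 π i 𝒩)` is an automorphism, `𝒩` is a derivation of all modes,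
and `T` is one up to a scalar (`mode_T`). By Vandermonde's identity the Jacobi identity of `V` then
gives a Jacobi identity for the products `res` (`resOp_resOp`, `res_res`). Its special cases say that
`O_g(V)` is a two-sided ideal (`star_O`, `O_star`) and that `*_g` is associative modulo `O_g(V)`
(`star_assoc`).

**The algebra `Ã_g(V)`.** The operator `𝒰(1)` implements the coordinate change
`f(x) = (e ^ (2 π i x) - 1) / (2 π i)`, up to the scale `2 π i`. The vector fields `p(x) d/dx` act on `V`
by `∑ p_n L(n-1)`, without central term, and conjugation with `exp(-L_+)` maps `L(-1)` to
`L(-1) + 2 π i L(0)`. This determines `exp(-L_+) Y(u, x) exp(L_+)` as a vertex operator of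
`e ^ ((f(x) - x) L(-1)) e ^ (2 π i x L(0)) exp(-L_+) u`. After the substitution
`x = (1 / 2 π i) log (1 + y)` the outcome is `𝒰(1) (resT k u v) = res k (𝒰(1) u) (𝒰(1) v)` (`U1_resT`).
Hence `𝒰(1)` identifies `Ã_g(V)` with `A_g(V)`, and `𝒰(1) ((2 π i)⁻² ω + c / 24 𝟏) = ω`; everything that
concerns `Ã_g(V)` follows from the corresponding fact for `A_g(V)`.

**Zero modes.** Equivariance shows that only powers `x ^ (-n-1)` with `n ∈ a + ℤ` occur in `Y^g(u, x)` for
`u ∈ V^[a + ℤ]`, and that the logarithms come from a factor `x ^ (-𝒩)` (`Yg_eq_zero`, `Yg_log`). Now take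
`φ` in the graded dual, supported in one degree with real part `0`, and `w` in the lowest space. By
duality for `z₂ = 1` and real `z₁ = e ^ ζ = 1 + y`, the function
`e ^ (l ζ) ∑_j ζ ^ j / j! ⟨φ, Y^g(𝒩 ^ j u, z₁) Y^g(v, 1) w⟩` is free of logarithms in the regions
`|z₁| > 1` and `|z₁| < 1`: there it is a power series in `z₁⁻¹`, respectively in `z₁`. Times `y ^ t` it is
an entire function of `ζ`, hence `2 π i`-periodic, hence an entire function of `z₁` of polynomial
growth, hence a polynomial (`exists_polynomial_in_exp`). So the function is a Laurent polynomial in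
`y`, whose coefficients are the numbers `φ(o(res q u v) w)` by the third part of duality. Its leading
coefficient is `φ(o(u) o(v) w)`, its value at `y = -1` is `φ(o(v) o(u) w)` if `Re a = 0`, and the
coefficients above the leading one vanish (`exists_coeffs_zeroMode_res`). As such functionals separate
the lowest space, `o` kills `O_g(V)` and is multiplicative (`zeroMode_O`, `zeroMode_star`). The case
`u = ω` gives `[L^g(0), o(v)] = o(L(-1) v + L(0) v)` (`L0_zeroMode_sub`).

**Weights.** In `A_g(V)` the class of `L(-1) v + L(0) v` is that of `-(a + 𝒩) v` if `Re a = 0`, and `o(v) = 0`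
if `Re a > 0`. Since `𝒩` is locally nilpotent, `o(v)` shifts generalized `L^g(0)`-weights by `-a`, hence
preserves their real parts. As `ω` acts on the lowest space by `L^g(0)`, which commutes with `g`, the
statements about lower bounded modules follow by restricting generalized eigenspaces.
-/

namespace TwistedZhu

open Finset.HasAntidiagonal (antidiagonal mem_antidiagonal)

/-! ### Finite and locally finite sums -/

theorem finsum_nat_eq_sum_range {X : Type*} [AddCommMonoid X] {f : ℕ → X} {K : ℕ}
    (h : ∀ j, K ≤ j → f j = 0) : ∑ᶠ j, f j = ∑ j ∈ Finset.range K, f j := by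
  refine finsum_eq_sum_of_support_subset _ fun j hj => ?_
  rw [Finset.coe_range, Set.mem_Iio]
  by_contra hlt
  exact hj (h j (not_lt.mp hlt))

theorem sum_range_shift {X : Type*} [AddCommMonoid X] {f : ℕ → X} {K : ℕ} (i : ℕ)
    (h : ∀ j, K ≤ j → f j = 0) (h' : ∀ j, j < i → f j = 0) :
    ∑ j ∈ Finset.range K, f j = ∑ j ∈ Finset.range K, f (j + i) := by
  have h1 : ∑ j ∈ Finset.range K, f j = ∑ j ∈ Finset.range (i + K), f j := by
    refine Finset.sum_subset (fun x hx => ?_) fun x _ hx => h x ?_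
    · rw [Finset.mem_range] at *
      omega
    · rw [Finset.mem_range] at hx
      omega
  rw [h1, Finset.sum_range_add, Finset.sum_eq_zero fun j hj => h' j (Finset.mem_range.mp hj),
    zero_add]
  simp only [add_comm]

theorem sum_range_sum_range_eq_antidiagonal {X : Type*} [AddCommMonoid X] {f : ℕ → ℕ → X} {K : ℕ}
    (h : ∀ i j, K ≤ i + j → f i j = 0) :
    ∑ i ∈ Finset.range K, ∑ j ∈ Finset.range K, f i j
      = ∑ t ∈ Finset.range K, ∑ p ∈ antidiagonal t, f p.1 p.2 := by
  rw [← Finset.sum_product', Finset.sum_sigma']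
  refine Finset.sum_bij_ne_zero (fun p _ _ => ⟨p.1 + p.2, p⟩) ?_ ?_ ?_ ?_
  · rintro ⟨i, j⟩ _ hne
    simp only [Finset.mem_sigma, Finset.mem_range, mem_antidiagonal, and_true]
    by_contra hlt
    exact hne (h i j (not_lt.mp hlt))
  · rintro ⟨i, j⟩ _ _ ⟨i', j'⟩ _ _ heq
    simp only [Sigma.mk.injEq] at heq
    obtain ⟨h1, h2⟩ := heq
    simpa [h1] using h2
  · rintro ⟨t, i, j⟩ hm hne
    simp only [Finset.mem_sigma, Finset.mem_range, mem_antidiagonal] at hm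
    refine ⟨(i, j), ?_, hne, ?_⟩
    · simp only [Finset.mem_product, Finset.mem_range]
      omega
    · obtain ⟨h1, h2⟩ := hm
      subst h2
      rfl
  · intros
    rfl

/-- The combinatorial step in all Leibniz and Vandermonde identities below. -/
theorem sum_antidiagonal_succ_smul {X : Type*} [AddCommGroup X] [Module ℂ X] (F : ℕ → ℕ → X)
    (k : ℕ) :
    ∑ p ∈ antidiagonal k, (((p.1 : ℂ) + 1) • F (p.1 + 1) p.2
        + ((p.2 : ℂ) + 1) • F p.1 (p.2 + 1))
      = ((k : ℂ) + 1) • ∑ p ∈ antidiagonal (k + 1), F p.1 p.2 := by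
  have h1 : ((k : ℂ) + 1) • ∑ p ∈ antidiagonal (k + 1), F p.1 p.2
      = ∑ p ∈ antidiagonal (k + 1), (p.1 : ℂ) • F p.1 p.2
        + ∑ p ∈ antidiagonal (k + 1), (p.2 : ℂ) • F p.1 p.2 := by
    rw [Finset.smul_sum, ← Finset.sum_add_distrib]
    refine Finset.sum_congr rfl fun p hp => ?_
    rw [← add_smul]
    congr 1
    have := mem_antidiagonal.mp hp
    exact_mod_cast this.symm
  rw [h1, Finset.Nat.sum_antidiagonal_succ, Finset.Nat.sum_antidiagonal_succ',
    Finset.sum_add_distrib]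
  simp

/-! ### Generalized binomial coefficients of operators -/

section binomOp

variable {V W X : Type*} [AddCommGroup V] [Module ℂ V] [AddCommGroup W] [Module ℂ W]
  [AddCommGroup X] [Module ℂ X]

@[simp]
theorem binomOp_zero (T : Module.End ℂ V) : binomOp T 0 = 1 := by
  simp [binomOp]

/-- The recursion `(j + 1) binom(T, j + 1) = (T - j) binom(T, j)`. -/
theorem binomOp_succ (T : Module.End ℂ V) (j : ℕ) :
    ((j : ℂ) + 1) • binomOp T (j + 1) = (T - (j : ℂ) • 1) * binomOp T j := by
  have h : (j.factorial : ℂ) ≠ 0 := by exact_mod_cast j.factorial_ne_zero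
  have h' : (j : ℂ) + 1 ≠ 0 := by exact_mod_cast j.succ_ne_zero
  rw [binomOp, binomOp, descPochhammer_succ_right, mul_comm (descPochhammer ℂ j), map_mul,
    smul_smul, Nat.factorial_succ, mul_smul_comm]
  simp only [map_sub, Polynomial.aeval_X, map_natCast]
  congr 1
  · push_cast
    field_simp
  · congr 2
    rw [← nsmul_one, ← Nat.cast_smul_eq_nsmul ℂ]

theorem binomOp_succ_apply (T : Module.End ℂ V) (j : ℕ) (v : V) :
    ((j : ℂ) + 1) • binomOp T (j + 1) v = T (binomOp T j v) - (j : ℂ) • binomOp T j v := by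
  rw [← LinearMap.smul_apply, binomOp_succ]
  simp

theorem binomOp_apply_mem (T : Module.End ℂ V) {S : Submodule ℂ V} (h : ∀ v ∈ S, T v ∈ S) (j : ℕ) :
    ∀ v ∈ S, binomOp T j v ∈ S := by
  induction j with
  | zero => simp
  | succ j ih =>
    intro v hv
    have h' : (j : ℂ) + 1 ≠ 0 := by exact_mod_cast j.succ_ne_zero
    have h2 := binomOp_succ_apply T j v
    rw [← eq_inv_smul_iff₀ h'] at h2
    rw [h2]
    exact S.smul_mem _ (S.sub_mem (h _ (ih v hv)) (S.smul_mem _ (ih v hv)))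

/-- If `F` intertwines `T` with `T'`, then it intertwines the binomial coefficients. -/
theorem binomOp_map (F : V →ₗ[ℂ] W) {T : Module.End ℂ V} {T' : Module.End ℂ W}
    (h : ∀ v, F (T v) = T' (F v)) (j : ℕ) (v : V) : F (binomOp T j v) = binomOp T' j (F v) := by
  induction j with
  | zero => simp
  | succ j ih =>
    have h' : (j : ℂ) + 1 ≠ 0 := by exact_mod_cast j.succ_ne_zero
    apply smul_right_injective _ h'
    change ((j : ℂ) + 1) • _ = ((j : ℂ) + 1) • _
    rw [← map_smul, binomOp_succ_apply, binomOp_succ_apply, map_sub, map_smul, h, ih]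

/-- Vandermonde's identity: if `S ∘ m = m ∘ (A ⊗ 1 + 1 ⊗ B)` on `P ⊗ Q`, where `P` and `Q` are
stable under `A` and `B`, then `binom(S, t) ∘ m = m ∘ ∑ binom(A, p) ⊗ binom(B, q)`. -/
theorem binomOp_bilin (m : V →ₗ[ℂ] W →ₗ[ℂ] X) {A : Module.End ℂ V} {B : Module.End ℂ W}
    {S : Module.End ℂ X} {P : Submodule ℂ V} {Q : Submodule ℂ W} (hA : ∀ v ∈ P, A v ∈ P)
    (hB : ∀ w ∈ Q, B w ∈ Q)
    (h : ∀ v ∈ P, ∀ w ∈ Q, S (m v w) = m (A v) w + m v (B w)) (t : ℕ) {v : V} (hv : v ∈ P)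
    {w : W} (hw : w ∈ Q) :
    binomOp S t (m v w) = ∑ p ∈ antidiagonal t, m (binomOp A p.1 v) (binomOp B p.2 w) := by
  induction t with
  | zero => simp
  | succ t ih =>
    have h' : (t : ℂ) + 1 ≠ 0 := by exact_mod_cast t.succ_ne_zero
    apply smul_right_injective _ h'
    change ((t : ℂ) + 1) • _ = ((t : ℂ) + 1) • _
    rw [← sum_antidiagonal_succ_smul (fun i j => m (binomOp A i v) (binomOp B j w)),
      binomOp_succ_apply, ih, map_sum, Finset.smul_sum, ← Finset.sum_sub_distrib]
    refine Finset.sum_congr rfl fun p hp => ?_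
    rw [h _ (binomOp_apply_mem A hA _ _ hv) _ (binomOp_apply_mem B hB _ _ hw)]
    have e1 := binomOp_succ_apply A p.1 v
    have e2 := binomOp_succ_apply B p.2 w
    have e3 : (t : ℂ) = p.1 + p.2 := by exact_mod_cast (mem_antidiagonal.mp hp).symm
    have f1 := congrArg (fun x => m x (binomOp B p.2 w)) e1
    have f2 := congrArg (fun x => m (binomOp A p.1 v) x) e2
    simp only [map_smul, map_sub, LinearMap.smul_apply, LinearMap.sub_apply] at f1 f2
    rw [f1, f2, e3, add_smul]
    abel

/-- `binom(p + i, i) binom(T, p + i) = binom(T - i, p) binom(T, i)`. -/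
theorem choose_smul_binomOp (T : Module.End ℂ V) (i p : ℕ) (v : V) :
    ((p + i).choose i : ℂ) • binomOp T (p + i) v
      = binomOp (T - (i : ℂ) • 1) p (binomOp T i v) := by
  induction p with
  | zero => simp
  | succ p ih =>
    have h' : (p : ℂ) + 1 ≠ 0 := by exact_mod_cast p.succ_ne_zero
    apply smul_right_injective _ h'
    change ((p : ℂ) + 1) • _ = ((p : ℂ) + 1) • _
    rw [binomOp_succ_apply, ← ih]
    have e1 := binomOp_succ_apply T (p + i) v
    have e2 : ((p : ℂ) + 1) * ((p + 1 + i).choose i : ℂ)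
        = ((p + i).choose i : ℂ) * (((p + i : ℕ) : ℂ) + 1) := by
      have := Nat.add_one_mul_choose_eq (p + i) p
      rw [Nat.choose_symm_add (a := p) (b := i)] at this
      rw [show (p + 1 + i).choose i = (p + i + 1).choose (p + 1) by
        rw [show p + i + 1 = (p + 1) + i by ring, Nat.choose_symm_add]]
      have e : (((p + i + 1) * (p + i).choose i : ℕ) : ℂ)
        = (((p + i + 1).choose (p + 1) * (p + 1) : ℕ) : ℂ) := by rw [this]
      push_cast at e ⊢
      linear_combination -e
    rw [smul_smul, e2, mul_smul, show p + 1 + i = p + i + 1 by ring, e1]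
    simp only [map_smul, LinearMap.sub_apply, LinearMap.smul_apply, Module.End.one_apply, smul_sub]
    push_cast
    module

end binomOp

/-! ### Modes of a vertex operator algebra -/

namespace VertexOperatorAlgebra

variable {V : Type*} [AddCommGroup V] [Module ℂ V] (𝒱 : VertexOperatorAlgebra V)

/-- The bilinear map `(u, v) ↦ uₙ v`. -/
def modeₗ (n : ℤ) : V →ₗ[ℂ] V →ₗ[ℂ] V where
  toFun u := 𝒱.mode u n
  map_add' u v := by simp [mode]
  map_smul' r u := by simp [mode]

@[simp]
theorem modeₗ_apply (n : ℤ) (u v : V) : 𝒱.modeₗ n u v = 𝒱.mode u n v := rfl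

theorem mode_add (u u' : V) (n : ℤ) : 𝒱.mode (u + u') n = 𝒱.mode u n + 𝒱.mode u' n :=
  map_add (𝒱.modeₗ n) u u'

theorem mode_smul (r : ℂ) (u : V) (n : ℤ) : 𝒱.mode (r • u) n = r • 𝒱.mode u n :=
  map_smul (𝒱.modeₗ n) r u

@[simp]
theorem mode_zero (n : ℤ) : 𝒱.mode 0 n = 0 := map_zero (𝒱.modeₗ n)

theorem mode_sum {ι : Type*} (s : Finset ι) (f : ι → V) (n : ℤ) :
    𝒱.mode (∑ i ∈ s, f i) n = ∑ i ∈ s, 𝒱.mode (f i) n :=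
  map_sum (𝒱.modeₗ n) f s

theorem mode_jacobi (u v w : V) (l m n : ℤ) :
    ∑ᶠ i : ℕ, ((Ring.choose m i : ℤ) : ℂ) • 𝒱.mode (𝒱.mode u (l + i) v) (m + n - i) w
      = ∑ᶠ i : ℕ, ((-1 : ℂ) ^ i * ((Ring.choose l i : ℤ) : ℂ)) •
        (𝒱.mode u (m + l - i) (𝒱.mode v (n + i) w)
          - (-1 : ℂ) ^ l • 𝒱.mode v (n + l - i) (𝒱.mode u (m + i) w)) :=
  𝒱.jacobi u v w l m n

/-- The commutator formula. -/
theorem mode_commutator (u v w : V) (m n : ℤ) :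
    𝒱.mode u m (𝒱.mode v n w) - 𝒱.mode v n (𝒱.mode u m w)
      = ∑ᶠ i : ℕ, ((Ring.choose m i : ℤ) : ℂ) • 𝒱.mode (𝒱.mode u i v) (m + n - i) w := by
  have h := 𝒱.mode_jacobi u v w 0 m n
  simp only [zero_add] at h
  rw [h, finsum_eq_single _ 0]
  · simp
  · intro i hi
    obtain ⟨j, rfl⟩ := Nat.exists_eq_succ_of_ne_zero hi
    simp [Ring.choose_zero_succ]

theorem mode_L_neg_one (u : V) (n : ℤ) (v : V) :
    𝒱.mode (𝒱.L (-1) u) n v = -(n : ℂ) • 𝒱.mode u (n - 1) v :=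
  𝒱.derivative u v n

/-- The commutator of `L(0)` with `uₙ`. -/
theorem L_zero_mode (u v : V) (n : ℤ) :
    𝒱.L 0 (𝒱.mode u n v) = 𝒱.mode (𝒱.L 0 u) n v + 𝒱.mode u n (𝒱.L 0 v)
      - ((n : ℂ) + 1) • 𝒱.mode u n v := by
  have h := 𝒱.mode_commutator 𝒱.conf u v (0 + 1) n
  rw [sub_eq_iff_eq_add] at h
  change 𝒱.mode 𝒱.conf (0 + 1) (𝒱.mode u n v) = _
  rw [h, finsum_nat_eq_sum_range (K := 2)]
  · simp only [Finset.sum_range_succ, Finset.sum_range_zero]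
    have e0 : 𝒱.mode (𝒱.mode 𝒱.conf ((0 : ℕ) : ℤ) u) (0 + 1 + n - ((0 : ℕ) : ℤ)) v
        = -((n : ℂ) + 1) • 𝒱.mode u n v := by
      have := 𝒱.mode_L_neg_one u (n + 1) v
      simp only [L] at this
      rw [neg_add_cancel] at this
      rw [Nat.cast_zero, show (0 + 1 + n - 0 : ℤ) = n + 1 by ring, this, add_sub_cancel_right]
      push_cast
      rfl
    have e1 : 𝒱.mode (𝒱.mode 𝒱.conf ((1 : ℕ) : ℤ) u) (0 + 1 + n - ((1 : ℕ) : ℤ)) v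
        = 𝒱.mode (𝒱.L 0 u) n v := by
      simp [L]
    rw [e0, e1]
    simp only [Ring.choose_zero_right, zero_add, Int.cast_one, one_smul,
      Ring.choose_one_right', pow_one]
    rw [L, zero_add]
    module
  · intro i hi
    obtain ⟨j, rfl⟩ := Nat.exists_eq_add_of_le' hi
    have : Ring.choose ((0 : ℤ) + 1) (j + 2) = 0 := by
      have := Ring.choose_natCast (R := ℤ) 1 (j + 2)
      rw [Nat.choose_eq_zero_of_lt (by omega)] at this
      simpa using this
    rw [this]
    simp

theorem mem_wt {n : ℤ} {v : V} : v ∈ 𝒱.wt n ↔ 𝒱.L 0 v = (n : ℂ) • v :=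
  Module.End.mem_eigenspace_iff

theorem mode_mem_wt {m n : ℤ} {u v : V} (hu : u ∈ 𝒱.wt m) (hv : v ∈ 𝒱.wt n) (k : ℤ) :
    𝒱.mode u k v ∈ 𝒱.wt (m + n - k - 1) := by
  rw [mem_wt] at *
  rw [L_zero_mode, hu, hv, mode_smul, map_smul, LinearMap.smul_apply]
  push_cast
  module

/-- The sum of the homogeneous subspaces of weight at most `n`. -/
def fil (n : ℤ) : Submodule ℂ V := ⨆ m : Set.Iic n, 𝒱.wt m

theorem wt_le_fil {m n : ℤ} (h : m ≤ n) : 𝒱.wt m ≤ 𝒱.fil n :=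
  le_iSup (fun m : Set.Iic n => 𝒱.wt m) ⟨m, h⟩

theorem fil_mono {m n : ℤ} (h : m ≤ n) : 𝒱.fil m ≤ 𝒱.fil n :=
  iSup_le fun k => 𝒱.wt_le_fil (le_trans k.2 h)

theorem exists_fil_eq_bot : ∃ N : ℤ, ∀ n < N, 𝒱.fil n = ⊥ := by
  obtain ⟨N, hN⟩ := 𝒱.lower_bounded
  refine ⟨N, fun n hn => ?_⟩
  rw [fil, iSup_eq_bot]
  rintro ⟨m, hm⟩
  exact hN m (lt_of_le_of_lt hm hn)

theorem exists_mem_fil (v : V) : ∃ n, v ∈ 𝒱.fil n := by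
  have hv : v ∈ ⨆ i, 𝒱.wt i := 𝒱.wt_isInternal.submodule_iSup_eq_top ▸ Submodule.mem_top
  induction hv using Submodule.iSup_induction' with
  | mem i x hx => exact ⟨i, 𝒱.wt_le_fil le_rfl hx⟩
  | zero => exact ⟨0, Submodule.zero_mem _⟩
  | add x y _ _ hx hy =>
    obtain ⟨m, hm⟩ := hx
    obtain ⟨n, hn⟩ := hy
    exact ⟨max m n, Submodule.add_mem _ (𝒱.fil_mono (le_max_left _ _) hm)
      (𝒱.fil_mono (le_max_right _ _) hn)⟩

theorem fil_induction {n : ℤ} {P : V → Prop} (h0 : P 0) (hadd : ∀ x y, P x → P y → P (x + y))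
    (hwt : ∀ m ≤ n, ∀ x ∈ 𝒱.wt m, P x) {v : V} (hv : v ∈ 𝒱.fil n) : P v := by
  induction hv using Submodule.iSup_induction' with
  | mem i x hx => exact hwt i i.2 x hx
  | zero => exact h0
  | add x y _ _ hx hy => exact hadd x y hx hy

theorem mode_mem_fil {m n : ℤ} {u v : V} (hu : u ∈ 𝒱.fil m) (hv : v ∈ 𝒱.fil n) (k : ℤ) :
    𝒱.mode u k v ∈ 𝒱.fil (m + n - k - 1) := by
  revert hu
  refine 𝒱.fil_induction (P := fun u => 𝒱.mode u k v ∈ 𝒱.fil (m + n - k - 1)) (by simp)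
    (fun x y hx hy => by rw [mode_add]; exact Submodule.add_mem _ hx hy) fun i hi x hx => ?_
  revert hv
  refine 𝒱.fil_induction (P := fun v => 𝒱.mode x k v ∈ 𝒱.fil (m + n - k - 1)) (by simp)
    (fun x y hx hy => by rw [map_add]; exact Submodule.add_mem _ hx hy) fun j hj y hy => ?_
  exact 𝒱.wt_le_fil (by omega) (𝒱.mode_mem_wt hx hy k)

/-- Two vectors generate only finitely many modes, uniformly on filtration pieces. -/
theorem exists_mode_fil_eq_zero (m n : ℤ) :
    ∃ K : ℤ, ∀ u ∈ 𝒱.fil m, ∀ v ∈ 𝒱.fil n, ∀ k, K ≤ k → 𝒱.mode u k v = 0 := by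
  obtain ⟨N, hN⟩ := 𝒱.exists_fil_eq_bot
  refine ⟨m + n - N, fun u hu v hv k hk => ?_⟩
  have h := 𝒱.mode_mem_fil hu hv k
  rwa [hN _ (by omega), Submodule.mem_bot] at h

/-- A linear identity may be checked on homogeneous vectors. -/
theorem wt_induction {P : V → Prop} (h0 : P 0) (hadd : ∀ x y, P x → P y → P (x + y))
    (hwt : ∀ m, ∀ x ∈ 𝒱.wt m, P x) (v : V) : P v := by
  obtain ⟨n, hn⟩ := 𝒱.exists_mem_fil v
  exact 𝒱.fil_induction h0 hadd (fun m _ => hwt m) hn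

end VertexOperatorAlgebra

end TwistedZhu

namespace TwistedZhu

noncomputable section

open Finset.HasAntidiagonal (antidiagonal mem_antidiagonal)

/-! ### Invariant subspaces and generalized eigenspaces -/

/-- An invariant subspace of an operator contains the components in the generalized eigenspaces of
each of its elements. -/
theorem inf_iSup_genEigenspace_le {V : Type*} [AddCommGroup V] [Module ℂ V] (f : Module.End ℂ V)
    {p : Submodule ℂ V} (h : ∀ x ∈ p, f x ∈ p) (k : ℕ∞) :
    p ⊓ ⨆ μ, f.genEigenspace μ k ≤ ⨆ μ, p ⊓ f.genEigenspace μ k := by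
  classical
  rintro x ⟨hx, hx'⟩
  obtain ⟨m, hm, rfl⟩ := (Submodule.mem_iSup_iff_exists_finsupp _ _).mp hx'
  let f' : Module.End ℂ (V ⧸ p) := p.mapQ p f h
  have hcomm : ∀ (μ : ℂ) (l : ℕ) (v : V),
      ((f' - μ • (1 : Module.End ℂ (V ⧸ p))) ^ l) (p.mkQ v)
        = p.mkQ (((f - μ • (1 : Module.End ℂ V)) ^ l) v) := by
    intro μ l
    induction l with
    | zero => simp
    | succ l ih =>
      intro v
      have h1 : (f' - μ • (1 : Module.End ℂ (V ⧸ p))) (p.mkQ v)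
          = p.mkQ ((f - μ • (1 : Module.End ℂ V)) v) := by
        simp [f']
      rw [pow_succ, pow_succ, Module.End.mul_apply, Module.End.mul_apply, h1, ih]
  have hmem : ∀ μ, p.mkQ (m μ) ∈ f'.genEigenspace μ k := by
    intro μ
    obtain ⟨l, hl, hl'⟩ := Module.End.mem_genEigenspace.mp (hm μ)
    refine Module.End.mem_genEigenspace.mpr ⟨l, hl, ?_⟩
    rw [LinearMap.mem_ker] at hl' ⊢
    rw [hcomm, hl', map_zero]
  have hz := (iSupIndep_iff_finsetSum_eq_zero_imp_eq_zero _).mp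
    (Module.End.independent_genEigenspace f' k) m.support (fun μ => p.mkQ (m μ))
    (fun μ _ => hmem μ) (by
      rw [← map_sum]
      exact (Submodule.Quotient.mk_eq_zero p).mpr hx)
  refine Submodule.sum_mem _ fun μ hμ => Submodule.mem_iSup_of_mem μ ⟨?_, hm μ⟩
  exact (Submodule.Quotient.mk_eq_zero p).mp (hz μ hμ)

/-- A polynomial with coefficients in a vector space that vanishes at infinitely many points is
zero. -/
theorem eq_zero_of_sum_pow_smul_eq_zero {V : Type*} [AddCommGroup V] [Module ℂ V] {S : Set ℂ}
    (hS : S.Infinite) {K : ℕ} {a : ℕ → V}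
    (h : ∀ s ∈ S, ∑ i ∈ Finset.range K, s ^ i • a i = 0) : ∀ i < K, a i = 0 := by
  intro i hi
  rw [← Module.forall_dual_apply_eq_zero_iff ℂ]
  intro φ
  let P : Polynomial ℂ := ∑ j ∈ Finset.range K, Polynomial.monomial j (φ (a j))
  have hP : P = 0 := by
    refine Polynomial.eq_zero_of_infinite_isRoot P (hS.mono fun s hs => ?_)
    have := congrArg φ (h s hs)
    rw [map_sum, map_zero] at this
    change P.eval s = 0
    rw [← this, Polynomial.eval_finsetSum]
    refine Finset.sum_congr rfl fun j _ => ?_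
    rw [Polynomial.eval_monomial, map_smul, smul_eq_mul, mul_comm]
  have hc := congrArg (fun q => Polynomial.coeff q i) hP
  simpa [P, Polynomial.finsetSum_coeff, Polynomial.coeff_monomial, hi] using hc

/-! ### Exponential and logarithm -/

theorem exp_subst_log : (PowerSeries.exp ℂ).subst (PowerSeries.log ℂ) = 1 + PowerSeries.X := by
  set G := (PowerSeries.exp ℂ).subst (PowerSeries.log ℂ) with hG
  have h0 : PowerSeries.coeff 0 G = 1 := by
    rw [PowerSeries.coeff_subst' PowerSeries.HasSubst.log, finsum_eq_single _ 0]
    · simp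
    · intro n hn
      simp [hn]
  have hd : (1 + PowerSeries.X) * PowerSeries.derivative ℂ G = G := by
    have h1 : (1 + PowerSeries.X) * PowerSeries.derivative ℂ (PowerSeries.log ℂ) = 1 := by
      rw [PowerSeries.deriv_log]
      ext n
      rcases n with _ | n
      · simp [add_mul]
      · rw [add_mul, one_mul, map_add, PowerSeries.coeff_succ_X_mul, PowerSeries.coeff_mk,
          PowerSeries.coeff_mk, PowerSeries.coeff_one]
        simp [pow_succ]
    rw [hG, PowerSeries.derivative_subst PowerSeries.HasSubst.log, PowerSeries.derivative_exp,
      mul_left_comm, h1, mul_one]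
  have hrec : ∀ n : ℕ, PowerSeries.coeff (n + 1) G * ((n : ℂ) + 1)
      = (1 - n) * PowerSeries.coeff n G := by
    intro n
    have h1 := congrArg (PowerSeries.coeff n) hd
    rw [add_mul, one_mul, map_add, PowerSeries.coeff_derivative] at h1
    rcases n with _ | n
    · simp at h1 ⊢
      exact h1
    · rw [PowerSeries.coeff_succ_X_mul, PowerSeries.coeff_derivative] at h1
      push_cast at h1 ⊢
      linear_combination h1
  have h1 : PowerSeries.coeff 1 G = 1 := by
    have := hrec 0
    rw [h0] at this
    simpa using this
  have h2 : ∀ n, PowerSeries.coeff (n + 2) G = 0 := by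
    intro n
    induction n with
    | zero =>
      have := hrec 1
      simp only [Nat.cast_one, sub_self, zero_mul, mul_eq_zero] at this
      exact this.resolve_right (by norm_num)
    | succ n ih =>
      have := hrec (n + 2)
      rw [ih, mul_zero, mul_eq_zero] at this
      exact this.resolve_right (by exact_mod_cast (n + 2).succ_ne_zero)
  ext n
  rcases n with _ | _ | n
  · simp [h0]
  · simp [h1, PowerSeries.coeff_one]
  · rw [h2]
    simp [PowerSeries.coeff_one, PowerSeries.coeff_X]

theorem coeff_pow_eq_zero_of_lt {p : PowerSeries ℂ} (hp : PowerSeries.constantCoeff p = 0) {i j : ℕ}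
    (h : j < i) : PowerSeries.coeff j (p ^ i) = 0 :=
  PowerSeries.coeff_of_lt_order _ <| lt_of_lt_of_le (by exact_mod_cast h)
    (PowerSeries.le_order_pow_of_constantCoeff_eq_zero i hp)

/-- `∑_i k ^ i / i! (log (1 + X)) ^ i = (1 + X) ^ k`, coefficient by coefficient. -/
theorem sum_coeff_log_pow (k j K : ℕ) (hK : j < K) :
    ∑ i ∈ Finset.range K, ((k : ℂ) ^ i / i.factorial) *
      PowerSeries.coeff j (PowerSeries.log ℂ ^ i) = PowerSeries.coeff j ((1 + PowerSeries.X) ^ k) := by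
  rw [← exp_subst_log, ← PowerSeries.subst_pow PowerSeries.HasSubst.log,
    PowerSeries.exp_pow_eq_rescale_exp, PowerSeries.coeff_subst' PowerSeries.HasSubst.log,
    finsum_nat_eq_sum_range (K := K)]
  · refine Finset.sum_congr rfl fun i _ => ?_
    simp [PowerSeries.coeff_rescale, PowerSeries.coeff_exp, div_eq_mul_inv]
  · intro i hi
    rw [coeff_pow_eq_zero_of_lt PowerSeries.constantCoeff_log (by omega), smul_zero]

section powerSeriesOp

variable {V : Type*} [AddCommGroup V] [Module ℂ V] {n : Module.End ℂ V}

/-- The value `p(n) = ∑ p_j n ^ j` of a power series at a locally nilpotent operator. -/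
def seriesOp (hn : ∀ v, ∃ K : ℕ, ∀ k, K ≤ k → (n ^ k) v = 0) (p : PowerSeries ℂ) :
    Module.End ℂ V :=
  locSum (fun j => PowerSeries.coeff j p • n ^ j) fun v => by
    obtain ⟨K, hK⟩ := hn v
    exact ⟨K, fun k hk => by rw [LinearMap.smul_apply, hK k hk, smul_zero]⟩

variable (hn : ∀ v, ∃ K : ℕ, ∀ k, K ≤ k → (n ^ k) v = 0)

theorem seriesOp_apply (p : PowerSeries ℂ) {v : V} {K : ℕ} (hK : ∀ k, K ≤ k → (n ^ k) v = 0) :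
    seriesOp hn p v = ∑ j ∈ Finset.range K, PowerSeries.coeff j p • (n ^ j) v := by
  change ∑ᶠ j : ℕ, (PowerSeries.coeff j p • n ^ j) v = _
  rw [finsum_nat_eq_sum_range (K := K)]
  · rfl
  · intro j hj
    rw [LinearMap.smul_apply, hK j hj, smul_zero]

theorem pow_seriesOp_eq_zero (p : PowerSeries ℂ) {v : V} {K : ℕ}
    (hK : ∀ k, K ≤ k → (n ^ k) v = 0) : ∀ k, K ≤ k → (n ^ k) (seriesOp hn p v) = 0 := by
  intro k hk
  rw [seriesOp_apply hn p hK, map_sum]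
  refine Finset.sum_eq_zero fun j _ => ?_
  rw [map_smul, ← Module.End.mul_apply, ← pow_add, hK _ (by omega), smul_zero]

theorem seriesOp_mul (p q : PowerSeries ℂ) :
    seriesOp hn (p * q) = seriesOp hn p * seriesOp hn q := by
  ext v
  obtain ⟨K, hK⟩ := hn v
  rw [Module.End.mul_apply, seriesOp_apply hn p (pow_seriesOp_eq_zero hn q hK),
    seriesOp_apply hn q hK, seriesOp_apply hn _ hK]
  have h1 : ∀ i, (PowerSeries.coeff i p) • (n ^ i) (∑ j ∈ Finset.range K,
      PowerSeries.coeff j q • (n ^ j) v) = ∑ j ∈ Finset.range K,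
        (PowerSeries.coeff i p * PowerSeries.coeff j q) • (n ^ (i + j)) v := by
    intro i
    rw [map_sum, Finset.smul_sum]
    refine Finset.sum_congr rfl fun j _ => ?_
    rw [map_smul, smul_smul, pow_add, Module.End.mul_apply]
  rw [Finset.sum_congr rfl fun i _ => h1 i, sum_range_sum_range_eq_antidiagonal
    (f := fun i j => (PowerSeries.coeff i p * PowerSeries.coeff j q) • (n ^ (i + j)) v)]
  · refine Finset.sum_congr rfl fun t _ => ?_
    rw [PowerSeries.coeff_mul, Finset.sum_smul]
    refine Finset.sum_congr rfl fun x hx => ?_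
    rw [mem_antidiagonal.mp hx]
  · intro i j hij
    rw [hK _ hij, smul_zero]

theorem seriesOp_one : seriesOp hn 1 = 1 := by
  ext v
  change ∑ᶠ j : ℕ, (PowerSeries.coeff j (1 : PowerSeries ℂ) • n ^ j) v = _
  rw [finsum_eq_single _ 0]
  · simp
  · intro j hj
    simp [PowerSeries.coeff_one, hj]

theorem seriesOp_pow (p : PowerSeries ℂ) (k : ℕ) : seriesOp hn (p ^ k) = seriesOp hn p ^ k := by
  induction k with
  | zero => rw [pow_zero, pow_zero, seriesOp_one]
  | succ k ih => rw [pow_succ, pow_succ, seriesOp_mul, ih]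

theorem seriesOp_one_add_X : seriesOp hn (1 + PowerSeries.X) = 1 + n := by
  ext v
  obtain ⟨K, hK⟩ := hn v
  rw [seriesOp_apply hn _ (K := K + 2) fun k hk => hK k (by omega), Finset.sum_range_succ',
    Finset.sum_range_succ', Finset.sum_eq_zero]
  · simp [PowerSeries.coeff_one, PowerSeries.coeff_X, add_comm]
  · intro i _
    simp [PowerSeries.coeff_one, PowerSeries.coeff_X]

/-- `(1 + n) ^ k = exp(k log (1 + n))` for a locally nilpotent operator `n`. -/
theorem one_add_pow_apply {v : V} {K : ℕ} (hK : ∀ k, K ≤ k → (n ^ k) v = 0) (k : ℕ) :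
    ((1 + n) ^ k) v = ∑ i ∈ Finset.range K,
      ((k : ℂ) ^ i / i.factorial) • (seriesOp hn (PowerSeries.log ℂ) ^ i) v := by
  simp only [← seriesOp_one_add_X hn, ← seriesOp_pow, seriesOp_apply hn _ hK, Finset.smul_sum,
    smul_smul]
  rw [Finset.sum_comm]
  refine Finset.sum_congr rfl fun j hj => ?_
  rw [← Finset.sum_smul, sum_coeff_log_pow _ _ _ (Finset.mem_range.mp hj)]

theorem seriesOp_log_pow_eq_zero {v : V} {K : ℕ} (hK : ∀ k, K ≤ k → (n ^ k) v = 0) :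
    ∀ k, K ≤ k → (seriesOp hn (PowerSeries.log ℂ) ^ k) v = 0 := by
  intro k hk
  rw [← seriesOp_pow, seriesOp_apply hn _ hK]
  refine Finset.sum_eq_zero fun j hj => ?_
  rw [Finset.mem_range] at hj
  rw [coeff_pow_eq_zero_of_lt PowerSeries.constantCoeff_log (by omega), zero_smul]

end powerSeriesOp

/-! ### The operators attached to an automorphism -/

namespace Automorphism

variable {V : Type*} [AddCommGroup V] [Module ℂ V] {𝒱 : VertexOperatorAlgebra V}
  (g : Automorphism 𝒱)

theorem op_mode (u v : V) (k : ℤ) : g.op (𝒱.mode u k v) = 𝒱.mode (g.op u) k (g.op v) :=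
  g.map_mode u v k

theorem op_L (n : ℤ) (v : V) : g.op (𝒱.L n v) = 𝒱.L n (g.op v) := by
  rw [VertexOperatorAlgebra.L, op_mode, show g.op 𝒱.conf = 𝒱.conf from g.map_conf]

/-- The number `ε ∈ {0, 1}` that tells whether `Re a > 0`; it is the eigenvalue of
`L(0) - ℒ + A_V` on `V^[a + ℤ]`. -/
def eps (a : Strip) : ℤ := if (a : ℂ).re = 0 then 0 else 1

theorem l_eq (m : ℤ) (a : Strip) : l m a = m + (a - eps a : ℂ) := by
  rw [l, eps]
  split_ifs <;> push_cast <;> ring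

theorem op_mem_gen (a : Strip) {v : V} (hv : v ∈ g.gen a) : g.op v ∈ g.gen a :=
  Module.End.mapsTo_maxGenEigenspace_of_comm (f := g.op) (g := g.op) (Commute.refl _) _ hv

theorem mem_gen_of_sub_mem {a : Strip} {v : V}
    (hv : (g.op - a.eig • (1 : Module.End ℂ V)) v ∈ g.gen a) : v ∈ g.gen a := by
  obtain ⟨k, hk⟩ := (Module.End.mem_maxGenEigenspace _ _ _).mp hv
  refine (Module.End.mem_maxGenEigenspace _ _ _).mpr ⟨k + 1, ?_⟩
  rw [pow_succ, Module.End.mul_apply, hk]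

/-- The modes respect the grading by generalized eigenspaces of `g`. -/
theorem mode_mem_gen {a b c : Strip} (h : c.eig = a.eig * b.eig) {u v : V} (hu : u ∈ g.gen a)
    (hv : v ∈ g.gen b) (k : ℤ) : 𝒱.mode u k v ∈ g.gen c := by
  obtain ⟨r, hr⟩ := (Module.End.mem_maxGenEigenspace _ _ _).mp hu
  obtain ⟨s, hs⟩ := (Module.End.mem_maxGenEigenspace _ _ _).mp hv
  clear hu hv
  induction hN : r + s using Nat.strong_induction_on generalizing r s u v with
  | _ N ih =>
    subst hN
    rcases r with _ | r
    · rw [pow_zero, Module.End.one_apply] at hr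
      simp [hr]
    rcases s with _ | s
    · rw [pow_zero, Module.End.one_apply] at hs
      simp [hs]
    apply mem_gen_of_sub_mem
    have e : (g.op - c.eig • (1 : Module.End ℂ V)) (𝒱.mode u k v)
        = 𝒱.mode ((g.op - a.eig • (1 : Module.End ℂ V)) u) k (g.op v)
          + a.eig • 𝒱.mode u k ((g.op - b.eig • (1 : Module.End ℂ V)) v) := by
      simp only [LinearMap.sub_apply, LinearMap.smul_apply, Module.End.one_apply, op_mode, h,
        map_sub, map_smul]
      rw [← 𝒱.modeₗ_apply k (_ - _)]
      simp only [map_sub, map_smul, LinearMap.sub_apply, LinearMap.smul_apply,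
        VertexOperatorAlgebra.modeₗ_apply]
      module
    rw [e]
    refine Submodule.add_mem _ (ih (r + (s + 1)) (by omega) r ?_ (s + 1) ?_ rfl)
      (Submodule.smul_mem _ _ (ih (r + 1 + s) (by omega) (r + 1) hr s ?_ rfl))
    · rw [← Module.End.mul_apply, ← pow_succ]
      exact hr
    · have hc : Commute g.op ((g.op - b.eig • (1 : Module.End ℂ V)) ^ (s + 1)) :=
        ((Commute.refl _).sub_right ((Commute.one_right _).smul_right _)).pow_right _
      rw [← Module.End.mul_apply, ← hc.eq, Module.End.mul_apply, hs, map_zero]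
    · rw [← Module.End.mul_apply, ← pow_succ]
      exact hs

theorem L_mem_gen (n : ℤ) {a : Strip} {v : V} (hv : v ∈ g.gen a) : 𝒱.L n v ∈ g.gen a := by
  have : Commute g.op (𝒱.L n) := LinearMap.ext fun v => g.op_L n v
  exact Module.End.mapsTo_maxGenEigenspace_of_comm this _ hv

/-- Linear statements on `V^[a + ℤ]` may be checked on vectors that are homogeneous for both
gradings. -/
theorem gen_induction {a : Strip} {P : V → Prop} (h0 : P 0) (hadd : ∀ x y, P x → P y → P (x + y))
    (hh : ∀ m, ∀ x ∈ 𝒱.wt m, x ∈ g.gen a → P x) {v : V} (hv : v ∈ g.gen a) : P v := by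
  have h1 : v ∈ g.gen a ⊓ ⨆ μ, (𝒱.L 0).genEigenspace μ 1 := by
    refine ⟨hv, ?_⟩
    have h2 : (⊤ : Submodule ℂ V) ≤ ⨆ μ, (𝒱.L 0).genEigenspace μ 1 := by
      rw [← 𝒱.wt_isInternal.submodule_iSup_eq_top]
      exact iSup_le fun n => le_iSup (fun μ => (𝒱.L 0).genEigenspace μ 1) (n : ℂ)
    exact h2 Submodule.mem_top
  have h3 := inf_iSup_genEigenspace_le (𝒱.L 0) (fun x hx => g.L_mem_gen 0 hx) 1 h1
  clear h1 hv
  induction h3 using Submodule.iSup_induction' with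
  | zero => exact h0
  | add x y _ _ hx hy => exact hadd x y hx hy
  | mem μ x hx =>
    -- an eigenvector of `L(0)` is a homogeneous vector or zero
    by_cases hμ : ∃ n : ℤ, μ = n
    · obtain ⟨n, rfl⟩ := hμ
      exact hh n x hx.2 hx.1
    · suffices x = 0 by rwa [this]
      have hd := (Module.End.independent_genEigenspace (𝒱.L 0) 1) μ
      refine Submodule.disjoint_def.mp hd x hx.2 ?_
      have h2 : (⊤ : Submodule ℂ V) ≤ ⨆ ν, ⨆ (_ : ν ≠ μ), (𝒱.L 0).genEigenspace ν 1 := by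
        rw [← 𝒱.wt_isInternal.submodule_iSup_eq_top]
        refine iSup_le fun n => ?_
        exact le_iSup₂_of_le (n : ℂ) (fun h => hμ ⟨n, h.symm⟩) le_rfl
      exact h2 Submodule.mem_top

/-- Linear statements may be checked on vectors that are homogeneous for both gradings. -/
theorem hom_induction {P : V → Prop} (h0 : P 0) (hadd : ∀ x y, P x → P y → P (x + y))
    (hh : ∀ m a, ∀ x ∈ 𝒱.wt m, x ∈ g.gen a → P x) (v : V) : P v := by
  have hv : v ∈ ⨆ i, g.gen i := g.gen_isInternal.submodule_iSup_eq_top ▸ Submodule.mem_top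
  induction hv using Submodule.iSup_induction' with
  | mem a x hx => exact g.gen_induction h0 hadd (fun m x h1 h2 => hh m a x h1 h2) hx
  | zero => exact h0
  | add x y _ _ hx hy => exact hadd x y hx hy

theorem gen_top_induction {P : V → Prop} (h0 : P 0) (hadd : ∀ x y, P x → P y → P (x + y))
    (hh : ∀ a, ∀ x ∈ g.gen a, P x) (v : V) : P v :=
  g.hom_induction h0 hadd (fun _ a x _ hx => hh a x hx) v

theorem A_apply {a : Strip} {v : V} (hv : v ∈ g.gen a) : g.A v = (a : ℂ) • v :=
  byGrading_apply _ _ _ hv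

theorem unipotent_apply {a : Strip} {v : V} (hv : v ∈ g.gen a) :
    g.unipotent v = a.eig⁻¹ • g.op v :=
  byGrading_apply _ _ _ hv

theorem LL_apply_hom {m : ℤ} {a : Strip} {v : V} (hm : v ∈ 𝒱.wt m) (hv : v ∈ g.gen a) :
    g.LL v = l m a • v := by
  rw [LL, byGrading_apply _ _ _ hm, byGrading_apply _ _ _ hv]
  rfl

theorem LL_apply {a : Strip} {v : V} (hv : v ∈ g.gen a) :
    g.LL v = 𝒱.L 0 v + (a - eps a : ℂ) • v := by
  refine g.gen_induction (P := fun v => g.LL v = 𝒱.L 0 v + (a - eps a : ℂ) • v) (by simp) ?_ ?_ hv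
  · intro x y hx hy
    rw [map_add, hx, hy, map_add]
    module
  · intro m x hm hx
    rw [g.LL_apply_hom hm hx, 𝒱.mem_wt.mp hm, l_eq]
    module

theorem E_apply {a : Strip} {v : V} (hv : v ∈ g.gen a) : g.E v = (eps a : ℂ) • v := by
  simp only [E, LinearMap.add_apply, LinearMap.sub_apply, g.LL_apply hv, g.A_apply hv]
  module

theorem unipotent_mode (u v : V) (k : ℤ) :
    g.unipotent (𝒱.mode u k v) = 𝒱.mode (g.unipotent u) k (g.unipotent v) := by
  refine g.gen_top_induction (P := fun u => g.unipotent (𝒱.mode u k v)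
    = 𝒱.mode (g.unipotent u) k (g.unipotent v)) (by simp) ?_ ?_ u
  · intro x y hx hy
    simp only [VertexOperatorAlgebra.mode_add, LinearMap.add_apply, map_add, hx, hy]
  intro a u hu
  refine g.gen_top_induction (P := fun v => g.unipotent (𝒱.mode u k v)
    = 𝒱.mode (g.unipotent u) k (g.unipotent v)) (by simp) ?_ ?_ v
  · intro x y hx hy
    simp only [map_add, hx, hy]
  intro b v hv
  obtain ⟨c, hc⟩ := Strip.exists_eig (mul_ne_zero a.eig_ne_zero b.eig_ne_zero)
  rw [g.unipotent_apply (g.mode_mem_gen hc hu hv k), g.unipotent_apply hu, g.unipotent_apply hv,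
    op_mode, hc, VertexOperatorAlgebra.mode_smul, map_smul, LinearMap.smul_apply, smul_smul,
    mul_inv, mul_comm]

theorem N_eq_seriesOp :
    g.N = twoPiI⁻¹ • seriesOp g.unipotent_locally_nilpotent (PowerSeries.log ℂ) := by
  ext v
  obtain ⟨K, hK⟩ := g.unipotent_locally_nilpotent v
  rw [LinearMap.smul_apply, seriesOp_apply _ _ (K := K + 1) fun k hk => hK k (by omega)]
  change ∑ᶠ j : ℕ, (((-1 : ℂ) ^ j / (twoPiI * (j + 1))) • (g.unipotent - 1) ^ (j + 1)) v = _
  rw [finsum_nat_eq_sum_range (K := K), Finset.sum_range_succ', smul_add, Finset.smul_sum]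
  · simp only [PowerSeries.coeff_log, if_true, zero_smul, smul_zero, add_zero]
    refine Finset.sum_congr rfl fun j _ => ?_
    rw [LinearMap.smul_apply, smul_smul, if_neg j.succ_ne_zero]
    congr 1
    simp only [map_div₀, map_pow, map_neg, map_one, map_natCast]
    push_cast
    rw [pow_add, pow_add]
    field_simp
  · intro j hj
    rw [LinearMap.smul_apply, hK _ (by omega), smul_zero]

theorem unipotent_pow_apply (v : V) : ∃ K : ℕ, (∀ i, K ≤ i → (g.N ^ i) v = 0) ∧
    ∀ k : ℕ, (g.unipotent ^ k) v
      = ∑ i ∈ Finset.range K, ((twoPiI * k) ^ i / i.factorial : ℂ) • (g.N ^ i) v := by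
  obtain ⟨K, hK⟩ := g.unipotent_locally_nilpotent v
  refine ⟨K, fun i hi => ?_, fun k => ?_⟩
  · rw [N_eq_seriesOp, smul_pow, LinearMap.smul_apply, seriesOp_log_pow_eq_zero _ hK i hi, smul_zero]
  · have h := one_add_pow_apply g.unipotent_locally_nilpotent hK k
    rw [add_sub_cancel] at h
    rw [h]
    refine Finset.sum_congr rfl fun i _ => ?_
    rw [N_eq_seriesOp, smul_pow, LinearMap.smul_apply, smul_smul]
    congr 1
    rw [mul_pow, inv_pow]
    have := pow_ne_zero i twoPiI_ne_zero
    field_simp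

theorem N_locally_nilpotent (v : V) : ∃ K : ℕ, ∀ i, K ≤ i → (g.N ^ i) v = 0 :=
  (g.unipotent_pow_apply v).imp fun _ h => h.1

/-- As `g_u = e ^ (2 π i 𝒩)` respects all modes, its logarithm is a derivation. -/
theorem N_mode (u v : V) (k : ℤ) :
    g.N (𝒱.mode u k v) = 𝒱.mode (g.N u) k v + 𝒱.mode u k (g.N v) := by
  obtain ⟨K₁, hu, hu'⟩ := g.unipotent_pow_apply u
  obtain ⟨K₂, hv, hv'⟩ := g.unipotent_pow_apply v
  obtain ⟨K₃, hw, hw'⟩ := g.unipotent_pow_apply (𝒱.mode u k v)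
  set K := K₁ + K₂ + K₃ + 2 with hK
  have ext : ∀ (x : V) (K' : ℕ) (_ : ∀ i, K' ≤ i → (g.N ^ i) x = 0) (_ : K' ≤ K) (s : ℂ),
      ∑ i ∈ Finset.range K', (s ^ i / i.factorial : ℂ) • (g.N ^ i) x
        = ∑ i ∈ Finset.range K, (s ^ i / i.factorial : ℂ) • (g.N ^ i) x := by
    intro x K' hx hK' s
    refine Finset.sum_subset (Finset.range_mono hK') fun i _ hi => ?_
    rw [hx i (by simpa using hi), smul_zero]
  have hpow : ∀ n : ℕ, (g.unipotent ^ n) (𝒱.mode u k v)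
      = 𝒱.mode ((g.unipotent ^ n) u) k ((g.unipotent ^ n) v) := by
    intro n
    induction n with
    | zero => simp
    | succ n ih => rw [pow_succ', Module.End.mul_apply, ih, unipotent_mode]; rfl
  set F : ℕ → ℕ → V := fun i j => ((i.factorial : ℂ)⁻¹ * (j.factorial : ℂ)⁻¹) •
    𝒱.mode ((g.N ^ i) u) k ((g.N ^ j) v) with hF
  have hF0 : ∀ i j, K ≤ i + j → F i j = 0 := by
    intro i j hij
    simp only [hF]
    by_cases hi : K₁ ≤ i
    · simp [hu i hi]
    · rw [hv j (by omega), map_zero, smul_zero]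
  have hS : (Set.range fun n : ℕ => twoPiI * (n : ℂ)).Infinite :=
    Set.infinite_range_of_injective fun a b hab => by
      exact_mod_cast mul_left_cancel₀ twoPiI_ne_zero hab
  have key := eq_zero_of_sum_pow_smul_eq_zero hS (K := K)
    (a := fun t => (t.factorial : ℂ)⁻¹ • (g.N ^ t) (𝒱.mode u k v)
      - ∑ p ∈ antidiagonal t, F p.1 p.2) (by
    rintro _ ⟨n, rfl⟩
    simp only [smul_sub, Finset.sum_sub_distrib]
    rw [sub_eq_zero]
    have h1 := hpow n
    rw [hw', hu', hv', ext _ K₃ hw (by omega), ext _ K₁ hu (by omega), ext _ K₂ hv (by omega),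
      VertexOperatorAlgebra.mode_sum, LinearMap.sum_apply] at h1
    simp only [map_sum, VertexOperatorAlgebra.mode_smul, LinearMap.smul_apply, map_smul,
      smul_smul] at h1
    have h2 : ∑ i ∈ Finset.range K, (twoPiI * (n : ℂ)) ^ i • (i.factorial : ℂ)⁻¹ •
          (g.N ^ i) (𝒱.mode u k v)
        = ∑ i ∈ Finset.range K, ((twoPiI * n) ^ i / i.factorial : ℂ) •
          (g.N ^ i) (𝒱.mode u k v) :=
      Finset.sum_congr rfl fun i _ => by rw [smul_smul, div_eq_mul_inv]
    rw [h2, h1]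
    have h3 : ∑ t ∈ Finset.range K, (twoPiI * (n : ℂ)) ^ t • ∑ p ∈ antidiagonal t, F p.1 p.2
        = ∑ t ∈ Finset.range K, ∑ p ∈ antidiagonal t,
          (twoPiI * (n : ℂ)) ^ (p.1 + p.2) • F p.1 p.2 := by
      refine Finset.sum_congr rfl fun t _ => ?_
      rw [Finset.smul_sum]
      refine Finset.sum_congr rfl fun p hp => ?_
      rw [mem_antidiagonal.mp hp]
    rw [h3, ← sum_range_sum_range_eq_antidiagonal
      (f := fun i j => (twoPiI * (n : ℂ)) ^ (i + j) • F i j)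
      (fun i j hij => by rw [hF0 i j hij, smul_zero])]
    refine Finset.sum_congr rfl fun i _ => Finset.sum_congr rfl fun j _ => ?_
    simp only [hF, smul_smul]
    congr 1
    rw [pow_add]
    ring) 1 (by omega)
  rw [sub_eq_zero] at key
  simpa [hF, Finset.Nat.antidiagonal_succ, add_comm] using key

theorem N_map_mem {S : Submodule ℂ V} (h : ∀ v ∈ S, g.unipotent v ∈ S) : ∀ v ∈ S, g.N v ∈ S := by
  intro v hv
  obtain ⟨K, hK⟩ := g.unipotent_locally_nilpotent v
  rw [N_eq_seriesOp, LinearMap.smul_apply, seriesOp_apply _ _ hK]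
  refine S.smul_mem _ (S.sum_mem fun j hj => S.smul_mem _ ?_)
  clear hK hj
  induction j with
  | zero => simpa
  | succ j ih =>
    rw [pow_succ', Module.End.mul_apply, LinearMap.sub_apply]
    exact S.sub_mem (h _ ih) ih

theorem N_comm {f : Module.End ℂ V} (h : ∀ v, f (g.unipotent v) = g.unipotent (f v)) (v : V) :
    f (g.N v) = g.N (f v) := by
  have hp : ∀ (j : ℕ) (x : V), f (((g.unipotent - 1) ^ j) x) = ((g.unipotent - 1) ^ j) (f x) := by
    intro j
    induction j with
    | zero => simp
    | succ j ih =>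
      intro x
      rw [pow_succ, Module.End.mul_apply, Module.End.mul_apply, ih]
      simp [h]
  obtain ⟨K, hK⟩ := g.unipotent_locally_nilpotent v
  rw [N_eq_seriesOp, LinearMap.smul_apply, LinearMap.smul_apply, seriesOp_apply _ _ hK, map_smul,
    seriesOp_apply _ _ (v := f v) (K := K), map_sum]
  · simp only [map_smul, hp]
  · intro k hk
    rw [← hp, hK k hk, map_zero]

theorem unipotent_mem_gen {a : Strip} {v : V} (hv : v ∈ g.gen a) : g.unipotent v ∈ g.gen a := by
  rw [g.unipotent_apply hv]
  exact Submodule.smul_mem _ _ (g.op_mem_gen a hv)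

theorem N_mem_gen {a : Strip} {v : V} (hv : v ∈ g.gen a) : g.N v ∈ g.gen a :=
  g.N_map_mem (fun _ h => g.unipotent_mem_gen h) v hv

/-- An operator that commutes with `g` commutes with `g_u`. -/
theorem unipotent_comm {f : Module.End ℂ V} (h : ∀ v, f (g.op v) = g.op (f v)) (v : V) :
    f (g.unipotent v) = g.unipotent (f v) := by
  refine g.gen_top_induction (P := fun v => f (g.unipotent v) = g.unipotent (f v)) (by simp)
    (fun x y hx hy => by simp only [map_add, hx, hy]) (fun a x hx => ?_) v
  have : f x ∈ g.gen a :=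
    Module.End.mapsTo_maxGenEigenspace_of_comm (LinearMap.ext fun v => (h v).symm) _ hx
  rw [g.unipotent_apply hx, g.unipotent_apply this, map_smul, h]

theorem N_comm_of_op {f : Module.End ℂ V} (h : ∀ v, f (g.op v) = g.op (f v)) (v : V) :
    f (g.N v) = g.N (f v) :=
  g.N_comm (g.unipotent_comm h) v

theorem L_N (n : ℤ) (v : V) : 𝒱.L n (g.N v) = g.N (𝒱.L n v) :=
  g.N_comm_of_op (fun v => (g.op_L n v).symm) v

theorem op_N (v : V) : g.op (g.N v) = g.N (g.op v) :=
  g.N_comm_of_op (fun _ => rfl) v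

theorem N_mem_wt {m : ℤ} {v : V} (hv : v ∈ 𝒱.wt m) : g.N v ∈ 𝒱.wt m := by
  rw [𝒱.mem_wt] at *
  rw [L_N, hv, map_smul]

theorem N_pow_mem {S : Submodule ℂ V} (h : ∀ v ∈ S, g.N v ∈ S) (i : ℕ) :
    ∀ v ∈ S, (g.N ^ i) v ∈ S := by
  induction i with
  | zero => simp
  | succ i ih =>
    intro v hv
    rw [pow_succ', Module.End.mul_apply]
    exact h _ (ih v hv)

/-- The exponent `ℒ + 𝒩` of `1 + x` in the definition of `*_g`. -/
abbrev T : Module.End ℂ V := g.LL + g.N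

theorem T_apply {a : Strip} {v : V} (hv : v ∈ g.gen a) :
    g.T v = 𝒱.L 0 v + (a - eps a : ℂ) • v + g.N v := by
  rw [LinearMap.add_apply, g.LL_apply hv]

theorem T_mem_gen {a : Strip} {v : V} (hv : v ∈ g.gen a) : g.T v ∈ g.gen a := by
  rw [g.T_apply hv]
  exact Submodule.add_mem _ (Submodule.add_mem _ (g.L_mem_gen 0 hv) (Submodule.smul_mem _ _ hv))
    (g.N_mem_gen hv)

theorem T_mem_wt {m : ℤ} {v : V} (hv : v ∈ 𝒱.wt m) : g.T v ∈ 𝒱.wt m := by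
  refine Submodule.add_mem _ ?_ (g.N_mem_wt hv)
  rw [𝒱.mem_wt]
  have hc : ∀ v, 𝒱.L 0 (g.LL v) = g.LL (𝒱.L 0 v) := by
    refine g.gen_top_induction (P := fun v => 𝒱.L 0 (g.LL v) = g.LL (𝒱.L 0 v)) (by simp)
      (fun x y hx hy => by simp only [map_add, hx, hy]) fun a x hx => ?_
    rw [g.LL_apply hx, g.LL_apply (g.L_mem_gen 0 hx), map_add, map_smul]
  rw [hc, 𝒱.mem_wt.mp hv, map_smul]

theorem T_mem_fil {n : ℤ} {v : V} (hv : v ∈ 𝒱.fil n) : g.T v ∈ 𝒱.fil n :=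
  𝒱.fil_induction (P := fun v => g.T v ∈ 𝒱.fil n) (by simp)
    (fun x y hx hy => by rw [map_add]; exact Submodule.add_mem _ hx hy)
    (fun _ hm _ hx => 𝒱.wt_le_fil hm (g.T_mem_wt hx)) hv

/-- The operator `ℒ + 𝒩` is a derivation of the modes up to the degree of `x ^ (-k-1)` and the
carry `d` in the addition `a + b = c` of strip elements, shifted by `ε`. -/
theorem mode_T {a b c : Strip} {d : ℤ} (h : (c : ℂ) - eps c = a - eps a + (b - eps b) + d)
    {u v : V} (hu : u ∈ g.gen a) (hv : v ∈ g.gen b) (k : ℤ) :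
    g.T (𝒱.mode u k v) = 𝒱.mode (g.T u) k v + 𝒱.mode u k (g.T v)
      - ((k : ℂ) + 1 - d) • 𝒱.mode u k v := by
  have hc : c.eig = a.eig * b.eig := by
    rw [Strip.eig, Strip.eig, Strip.eig, ← Complex.exp_add]
    refine Complex.exp_eq_exp_iff_exists_int.mpr ⟨eps c - eps a - eps b + d, ?_⟩
    rw [sub_eq_iff_eq_add.mp h, twoPiI]
    push_cast
    ring
  rw [g.T_apply (g.mode_mem_gen hc hu hv k), g.T_apply hu, g.T_apply hv, 𝒱.L_zero_mode, g.N_mode, h]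
  simp only [VertexOperatorAlgebra.mode_add, VertexOperatorAlgebra.mode_smul, map_add, map_smul,
    LinearMap.add_apply, LinearMap.smul_apply]
  module

end Automorphism

end

end TwistedZhu

namespace TwistedZhu

noncomputable section

open Finset.HasAntidiagonal (antidiagonal mem_antidiagonal)

/-! ### Residue products and their Jacobi identity -/

namespace VertexOperatorAlgebra

variable {V : Type*} [AddCommGroup V] [Module ℂ V] (𝒱 : VertexOperatorAlgebra V)

/-- The product `Res_x x ^ k Y((1 + x) ^ S u, x) v` for an operator `S`. -/
def resOp (S : Module.End ℂ V) (k : ℤ) (u v : V) : V :=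
  ∑ᶠ j : ℕ, 𝒱.mode (binomOp S j u) (j + k) v

/-- The operator `S` preserves the weight filtration. -/
def PreservesFil (S : Module.End ℂ V) : Prop := ∀ n, ∀ v ∈ 𝒱.fil n, S v ∈ 𝒱.fil n

variable {𝒱} {S : Module.End ℂ V} (hS : 𝒱.PreservesFil S)

include hS

theorem PreservesFil.binomOp_mem {n : ℤ} {v : V} (hv : v ∈ 𝒱.fil n) (j : ℕ) :
    binomOp S j v ∈ 𝒱.fil n :=
  binomOp_apply_mem S (hS n) j v hv

theorem PreservesFil.resOp_eq_sum {m n K k : ℤ} {u v : V} {N : ℕ}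
    (hK : ∀ x ∈ 𝒱.fil m, ∀ y ∈ 𝒱.fil n, ∀ k, K ≤ k → 𝒱.mode x k y = 0) (hu : u ∈ 𝒱.fil m)
    (hv : v ∈ 𝒱.fil n) (hN : K ≤ N + k) :
    𝒱.resOp S k u v = ∑ j ∈ Finset.range N, 𝒱.mode (binomOp S j u) (j + k) v :=
  finsum_nat_eq_sum_range fun j hj => hK _ (hS.binomOp_mem hu j) _ hv _ (by omega)

theorem PreservesFil.exists_resOp_eq_sum (u v : V) (k : ℤ) :
    ∃ N₀ : ℕ, ∀ N, N₀ ≤ N →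
      𝒱.resOp S k u v = ∑ j ∈ Finset.range N, 𝒱.mode (binomOp S j u) (j + k) v := by
  obtain ⟨m, hu⟩ := 𝒱.exists_mem_fil u
  obtain ⟨n, hv⟩ := 𝒱.exists_mem_fil v
  obtain ⟨K, hK⟩ := 𝒱.exists_mode_fil_eq_zero m n
  exact ⟨(K - k).toNat, fun N hN => hS.resOp_eq_sum hK hu hv (by omega)⟩

theorem PreservesFil.resOp_add_left (k : ℤ) (u u' v : V) :
    𝒱.resOp S k (u + u') v = 𝒱.resOp S k u v + 𝒱.resOp S k u' v := by
  obtain ⟨N₁, h₁⟩ := hS.exists_resOp_eq_sum u v k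
  obtain ⟨N₂, h₂⟩ := hS.exists_resOp_eq_sum u' v k
  obtain ⟨N₃, h₃⟩ := hS.exists_resOp_eq_sum (u + u') v k
  rw [h₁ (N₁ + N₂ + N₃) (by omega), h₂ (N₁ + N₂ + N₃) (by omega), h₃ (N₁ + N₂ + N₃) (by omega),
    ← Finset.sum_add_distrib]
  simp only [map_add, mode_add, LinearMap.add_apply]

theorem PreservesFil.resOp_add_right (k : ℤ) (u v v' : V) :
    𝒱.resOp S k u (v + v') = 𝒱.resOp S k u v + 𝒱.resOp S k u v' := by
  obtain ⟨N₁, h₁⟩ := hS.exists_resOp_eq_sum u v k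
  obtain ⟨N₂, h₂⟩ := hS.exists_resOp_eq_sum u v' k
  obtain ⟨N₃, h₃⟩ := hS.exists_resOp_eq_sum u (v + v') k
  rw [h₁ (N₁ + N₂ + N₃) (by omega), h₂ (N₁ + N₂ + N₃) (by omega), h₃ (N₁ + N₂ + N₃) (by omega),
    ← Finset.sum_add_distrib]
  simp only [map_add]

/-- The residue product as a bilinear map. -/
def PreservesFil.resₗ (k : ℤ) : V →ₗ[ℂ] V →ₗ[ℂ] V :=
  LinearMap.mk₂ ℂ (𝒱.resOp S k) (hS.resOp_add_left k)
    (fun r u v => by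
      simp only [resOp, map_smul, mode_smul, LinearMap.smul_apply]
      rw [smul_finsum])
    (hS.resOp_add_right k)
    (fun r u v => by
      simp only [resOp, map_smul]
      rw [smul_finsum])

theorem PreservesFil.resOp_mem_fil {m n : ℤ} {u v : V} (hu : u ∈ 𝒱.fil m) (hv : v ∈ 𝒱.fil n)
    (k : ℤ) : 𝒱.resOp S k u v ∈ 𝒱.fil (m + n - k - 1) := by
  obtain ⟨N, h⟩ := hS.exists_resOp_eq_sum u v k
  rw [h N le_rfl]
  refine Submodule.sum_mem _ fun j _ => ?_
  exact 𝒱.fil_mono (by omega) (𝒱.mode_mem_fil (hS.binomOp_mem hu j) hv (j + k))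

omit hS in
/-- The Jacobi identity for residue products: if `S = A ⊗ 1 + 1 ⊗ B + r - k` on products `x_k y`,
that is, `(1 + y) ^ S` corresponds to `(1 + y) ^ A ⊗ (1 + y) ^ B` under the change of variables
`x - y = x₀ (1 + y)`, then products of products are expressed by iterated products. It results
from the Jacobi identity of `V` for `(1 + x) ^ A u`, `(1 + y) ^ B v` and the function
`y ^ q (x - y) ^ r`. -/
theorem resOp_resOp {A B : Module.End ℂ V} (hS : 𝒱.PreservesFil S) (hA : 𝒱.PreservesFil A)
    (hB : 𝒱.PreservesFil B)
    {P Q : Submodule ℂ V} (hP : ∀ x ∈ P, A x ∈ P) (hQ : ∀ y ∈ Q, B y ∈ Q) {r : ℤ}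
    (h : ∀ x ∈ P, ∀ y ∈ Q, ∀ k : ℤ, S (𝒱.mode x k y)
      = 𝒱.mode (A x) k y + 𝒱.mode x k (B y) + ((r : ℂ) - k) • 𝒱.mode x k y)
    {u v : V} (hu : u ∈ P) (hv : v ∈ Q) (w : V) (q : ℤ) :
    ∃ I₀ : ℕ, ∀ I, I₀ ≤ I → 𝒱.resOp S q (𝒱.resOp A r u v) w
      = ∑ i ∈ Finset.range I, ((-1 : ℂ) ^ i * ((Ring.choose r i : ℤ) : ℂ)) •
        (𝒱.resOp A (r - i) u (𝒱.resOp B (q + i) v w)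
          - (-1 : ℂ) ^ r • 𝒱.resOp B (q + r - i) v (𝒱.resOp A i u w)) := by
  obtain ⟨mu, hmu⟩ := 𝒱.exists_mem_fil u
  obtain ⟨mv, hmv⟩ := 𝒱.exists_mem_fil v
  obtain ⟨mw, hmw⟩ := 𝒱.exists_mem_fil w
  obtain ⟨K₁, h₁⟩ := 𝒱.exists_mode_fil_eq_zero mu mv
  obtain ⟨K₂, h₂⟩ := 𝒱.exists_mode_fil_eq_zero mv mw
  obtain ⟨K₃, h₃⟩ := 𝒱.exists_mode_fil_eq_zero mu mw
  obtain ⟨K₄, h₄⟩ := 𝒱.exists_mode_fil_eq_zero mu (mv + mw - q - 1)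
  obtain ⟨K₅, h₅⟩ := 𝒱.exists_mode_fil_eq_zero mv (mu + mw - 1)
  obtain ⟨K₆, h₆⟩ := 𝒱.exists_mode_fil_eq_zero (mu + mv - r - 1) mw
  set I₀ : ℕ := (K₁ - r).toNat + (K₂ - q).toNat + K₃.toNat with hI₀
  refine ⟨I₀, fun I hI => ?_⟩
  set N : ℕ := (K₄ - r).toNat + (K₅ - q - r).toNat + (K₆ - q).toNat + (K₂ - q).toNat
    + K₃.toNat + I with hN
  have hβ : ∀ p, binomOp A p u ∈ 𝒱.fil mu := fun p => hA.binomOp_mem hmu p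
  have hγ : ∀ p, binomOp B p v ∈ 𝒱.fil mv := fun p => hB.binomOp_mem hmv p
  have e1 : 𝒱.resOp A r u v = ∑ i ∈ Finset.range I, 𝒱.mode (binomOp A i u) (i + r) v :=
    hA.resOp_eq_sum h₁ hmu hmv (by omega)
  have e2 : ∀ i ∈ Finset.range I, 𝒱.resOp A (r - i) u (𝒱.resOp B (q + i) v w)
      = ∑ p ∈ Finset.range N, ∑ s ∈ Finset.range N,
        𝒱.mode (binomOp A p u) (p + (r - i)) (𝒱.mode (binomOp B s v) (s + (q + i)) w) := by
    intro i hi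
    rw [Finset.mem_range] at hi
    rw [hA.resOp_eq_sum h₄ (N := N) hmu
      (𝒱.fil_mono (by omega) (hB.resOp_mem_fil hmv hmw (q + i))) (by omega)]
    refine Finset.sum_congr rfl fun p _ => ?_
    rw [hB.resOp_eq_sum h₂ (N := N) hmv hmw (by omega), map_sum]
  have e3 : ∀ i ∈ Finset.range I, 𝒱.resOp B (q + r - i) v (𝒱.resOp A i u w)
      = ∑ p ∈ Finset.range N, ∑ s ∈ Finset.range N,
        𝒱.mode (binomOp B s v) (s + (q + r - i)) (𝒱.mode (binomOp A p u) (p + i) w) := by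
    intro i hi
    rw [Finset.mem_range] at hi
    rw [hB.resOp_eq_sum h₅ (N := N) hmv
      (𝒱.fil_mono (by omega) (hA.resOp_mem_fil hmu hmw i)) (by omega), Finset.sum_comm]
    refine Finset.sum_congr rfl fun p _ => ?_
    rw [hA.resOp_eq_sum h₃ (N := N) hmu hmw (by omega), map_sum]
  have jac : ∀ p s : ℕ, ∑ i ∈ Finset.range I, ((Ring.choose (p : ℤ) i : ℤ) : ℂ) •
        𝒱.mode (𝒱.mode (binomOp A p u) (r + i) (binomOp B s v)) (p + (q + s) - i) w
      = ∑ i ∈ Finset.range I, ((-1 : ℂ) ^ i * ((Ring.choose r i : ℤ) : ℂ)) •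
        (𝒱.mode (binomOp A p u) (p + (r - i)) (𝒱.mode (binomOp B s v) (s + (q + i)) w)
          - (-1 : ℂ) ^ r • 𝒱.mode (binomOp B s v) (s + (q + r - i))
            (𝒱.mode (binomOp A p u) (p + i) w)) := by
    intro p s
    have hj := 𝒱.mode_jacobi (binomOp A p u) (binomOp B s v) w r p (q + s)
    rw [finsum_nat_eq_sum_range (K := I), finsum_nat_eq_sum_range (K := I)] at hj
    · rw [hj]
      refine Finset.sum_congr rfl fun i _ => ?_
      rw [show (p + r - i : ℤ) = p + (r - i) by ring, show (q + s + i : ℤ) = s + (q + i) by ring,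
        show (q + s + r - i : ℤ) = s + (q + r - i) by ring]
    · intro i hi
      rw [h₂ _ (hγ s) _ hmw _ (by omega), h₃ _ (hβ p) _ hmw _ (by omega)]
      simp
    · intro i hi
      rw [h₁ _ (hβ p) _ (hγ s) _ (by omega)]
      simp
  have e4 : ∑ i ∈ Finset.range I, ((-1 : ℂ) ^ i * ((Ring.choose r i : ℤ) : ℂ)) •
        (𝒱.resOp A (r - i) u (𝒱.resOp B (q + i) v w)
          - (-1 : ℂ) ^ r • 𝒱.resOp B (q + r - i) v (𝒱.resOp A i u w))
      = ∑ i ∈ Finset.range I, ∑ p ∈ Finset.range N, ∑ s ∈ Finset.range N,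
        ((Ring.choose (p : ℤ) i : ℤ) : ℂ) •
        𝒱.mode (𝒱.mode (binomOp A p u) (r + i) (binomOp B s v)) (p + (q + s) - i) w := by
    have swap : ∀ f : ℕ → ℕ → ℕ → V, ∑ i ∈ Finset.range I, ∑ p ∈ Finset.range N,
        ∑ s ∈ Finset.range N, f i p s = ∑ p ∈ Finset.range N, ∑ s ∈ Finset.range N,
          ∑ i ∈ Finset.range I, f i p s := by
      intro f
      rw [Finset.sum_comm]
      refine Finset.sum_congr rfl fun p _ => ?_
      rw [Finset.sum_comm]
    rw [swap]
    simp only [jac]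
    rw [← swap]
    refine Finset.sum_congr rfl fun i hi => ?_
    rw [e2 i hi, e3 i hi]
    simp only [Finset.smul_sum, ← Finset.sum_sub_distrib]
  rw [e4, e1, hS.resOp_eq_sum h₆ (N := N) (Submodule.sum_mem _ fun i _ =>
    𝒱.fil_mono (by omega) (𝒱.mode_mem_fil (hβ i) hmv (i + r))) hmw (by omega)]
  simp only [map_sum, mode_sum, LinearMap.sum_apply]
  rw [Finset.sum_comm]
  refine Finset.sum_congr rfl fun i hi => ?_
  rw [Finset.mem_range] at hi
  have hmem : ∀ p s : ℕ, 𝒱.mode (binomOp A p u) (r + i) (binomOp B s v)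
      ∈ 𝒱.fil (mu + mv - r - 1) := fun p s =>
    𝒱.fil_mono (by omega) (𝒱.mode_mem_fil (hβ p) (hγ s) (r + i))
  -- the substitution `x = y + x₀`, that is `p = p' + i`
  have e5 : ∑ p ∈ Finset.range N, ∑ s ∈ Finset.range N, ((Ring.choose (p : ℤ) i : ℤ) : ℂ) •
        𝒱.mode (𝒱.mode (binomOp A p u) (r + i) (binomOp B s v)) (p + (q + s) - i) w
      = ∑ p ∈ Finset.range N, ∑ s ∈ Finset.range N,
        𝒱.mode (𝒱.modeₗ (r + i) (binomOp (A - (i : ℂ) • 1) p (binomOp A i u)) (binomOp B s v))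
          (((p + s : ℕ) : ℤ) + q) w := by
    rw [sum_range_shift i]
    · refine Finset.sum_congr rfl fun p _ => Finset.sum_congr rfl fun s _ => ?_
      rw [← choose_smul_binomOp, Ring.choose_natCast, Int.cast_natCast, map_smul,
        LinearMap.smul_apply, mode_smul, LinearMap.smul_apply, modeₗ_apply]
      congr 3
      push_cast
      ring
    · intro p hp
      refine Finset.sum_eq_zero fun s _ => ?_
      rw [h₆ _ (hmem p s) _ hmw _ (by omega), smul_zero]
    · intro p hp
      refine Finset.sum_eq_zero fun s _ => ?_
      rw [Ring.choose_natCast, Nat.choose_eq_zero_of_lt hp]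
      simp
  rw [e5, sum_range_sum_range_eq_antidiagonal (f := fun p s =>
    𝒱.mode (𝒱.modeₗ (r + i) (binomOp (A - (i : ℂ) • 1) p (binomOp A i u)) (binomOp B s v))
          (((p + s : ℕ) : ℤ) + q) w)]
  · refine Finset.sum_congr rfl fun t _ => ?_
    have hA' : ∀ x ∈ P, (A - (i : ℂ) • (1 : Module.End ℂ V)) x ∈ P := fun x hx =>
      P.sub_mem (hP x hx) (P.smul_mem _ hx)
    rw [show (i + r : ℤ) = r + i by ring, ← modeₗ_apply 𝒱 (r + i), binomOp_bilin
      (A := A - (i : ℂ) • 1) (B := B) (𝒱.modeₗ (r + i)) hA' hQ ?_ t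
      (binomOp_apply_mem A hP i u hu) hv, mode_sum, LinearMap.sum_apply]
    · refine Finset.sum_congr rfl fun p hp => ?_
      rw [mem_antidiagonal.mp hp]
    · intro x hx y hy
      rw [modeₗ_apply, h x hx y hy]
      simp only [LinearMap.sub_apply, LinearMap.smul_apply, Module.End.one_apply, map_sub,
        map_smul, modeₗ_apply]
      push_cast
      module
  · intro p s hps
    have hmem' : 𝒱.modeₗ (r + i) (binomOp (A - (i : ℂ) • 1) p (binomOp A i u)) (binomOp B s v)
        ∈ 𝒱.fil (mu + mv - r - 1) := by
      rw [← choose_smul_binomOp, map_smul, LinearMap.smul_apply]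
      exact Submodule.smul_mem _ _ (hmem _ _)
    exact h₆ _ hmem' _ hmw _ (by omega)

omit hS in
/-- `(1 + x) ^ (S + 1) = (1 + x) ^ S + x (1 + x) ^ S`. -/
theorem PreservesFil.resOp_add_one (hS : 𝒱.PreservesFil S) (k : ℤ) (u v : V) :
    𝒱.resOp (S + 1) k u v = 𝒱.resOp S k u v + 𝒱.resOp S (k + 1) u v := by
  have hS' : 𝒱.PreservesFil (S + 1) := fun n v hv => Submodule.add_mem _ (hS n v hv) hv
  obtain ⟨N₁, h₁⟩ := hS.exists_resOp_eq_sum u v k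
  obtain ⟨N₂, h₂⟩ := hS.exists_resOp_eq_sum u v (k + 1)
  obtain ⟨N₃, h₃⟩ := hS'.exists_resOp_eq_sum u v k
  have pascal : ∀ j (x : V), binomOp (S + 1) (j + 1) x = binomOp S (j + 1) x + binomOp S j x := by
    intro j x
    have := binomOp_bilin (A := S) (B := (1 : Module.End ℂ ℂ)) (S := S + 1) (P := ⊤) (Q := ⊤)
      ((LinearMap.lsmul ℂ V).flip) (by simp) (by simp) (by simp) (j + 1) (v := x) (by simp)
      (w := 1) (by simp)
    have hb : ∀ i, binomOp (1 : Module.End ℂ ℂ) (i + 2) 1 = 0 := by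
      intro i
      induction i with
      | zero =>
        have h := binomOp_succ_apply (1 : Module.End ℂ ℂ) 1 1
        have h' := binomOp_succ_apply (1 : Module.End ℂ ℂ) 0 1
        simp only [CharP.cast_eq_zero, zero_add, one_smul, binomOp_zero, Module.End.one_apply,
          zero_smul, sub_zero] at h'
        rw [h'] at h
        simpa [show (1 : ℂ) + 1 ≠ 0 by norm_num] using h
      | succ i ih =>
        have h := binomOp_succ_apply (1 : Module.End ℂ ℂ) (i + 2) 1
        rw [ih, map_zero, smul_zero, sub_zero, smul_eq_zero] at h
        exact h.resolve_left (by exact_mod_cast (i + 2).succ_ne_zero)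
    have h1 : binomOp (1 : Module.End ℂ ℂ) 1 1 = 1 := by
      have h := binomOp_succ_apply (1 : Module.End ℂ ℂ) 0 1
      simpa using h
    rw [show ((LinearMap.lsmul ℂ V).flip x) 1 = x by simp] at this
    rw [this]
    rcases j with _ | j
    · simp [Finset.Nat.antidiagonal_succ, h1, add_comm]
    · rw [Finset.Nat.sum_antidiagonal_succ', Finset.Nat.sum_antidiagonal_succ',
        Finset.sum_eq_zero]
      · simp [h1]
      · intro p _
        simp [hb]
  set N := N₁ + N₂ + N₃ with hN
  rw [h₁ (N + 1) (by omega), h₂ N (by omega), h₃ (N + 1) (by omega), Finset.sum_range_succ',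
    Finset.sum_range_succ', add_right_comm, ← Finset.sum_add_distrib]
  congr 1
  swap
  · simp
  refine Finset.sum_congr rfl fun j _ => ?_
  rw [pascal, mode_add, LinearMap.add_apply]
  push_cast
  congr 3
  ring

end VertexOperatorAlgebra

end

end TwistedZhu

namespace TwistedZhu

noncomputable section

/-! ### The algebra `A_g(V)` -/

namespace Automorphism

variable {V : Type*} [AddCommGroup V] [Module ℂ V] {𝒱 : VertexOperatorAlgebra V}
  (g : Automorphism 𝒱)

theorem preservesFil_T : 𝒱.PreservesFil g.T := fun _ _ hv => g.T_mem_fil hv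

theorem res_eq (k : ℤ) (u v : V) : g.res k u v = 𝒱.resOp g.T k u v := rfl

/-- `(u, v) ↦ Res_x x ^ k Y((1 + x) ^ (ℒ + 𝒩) u, x) v` as a bilinear map. -/
def resₗ (k : ℤ) : V →ₗ[ℂ] V →ₗ[ℂ] V := g.preservesFil_T.resₗ k

theorem preservesFil_T_add (e : ℕ) : 𝒱.PreservesFil (g.T + (e : ℂ) • 1) := fun _ _ hv =>
  Submodule.add_mem _ (g.T_mem_fil hv) (Submodule.smul_mem _ _ hv)

/-- Residue products with exponent `ℒ + 𝒩 + e` are combinations of the products `res`. -/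
theorem resOp_T_add_mem (O : Submodule ℂ V) (e : ℕ) (k : ℤ) (u v : V)
    (h : ∀ j : ℕ, j ≤ e → g.res (k + j) u v ∈ O) :
    𝒱.resOp (g.T + (e : ℂ) • 1) k u v ∈ O := by
  induction e generalizing k with
  | zero =>
    have := h 0 le_rfl
    rw [Nat.cast_zero, add_zero] at this
    rw [Nat.cast_zero, zero_smul, add_zero]
    exact this
  | succ e ih =>
    have e1 : g.T + ((e + 1 : ℕ) : ℂ) • (1 : Module.End ℂ V) = g.T + (e : ℂ) • 1 + 1 := by
      push_cast
      module
    rw [e1, (g.preservesFil_T_add e).resOp_add_one]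
    refine O.add_mem (ih k fun j hj => h j (by omega)) (ih (k + 1) fun j hj => ?_)
    have := h (j + 1) (by omega)
    push_cast at this
    rwa [show k + 1 + (j : ℤ) = k + (j + 1) by ring]

theorem resOp_T_zero (k : ℤ) (u v : V) :
    𝒱.resOp (g.T + ((0 : ℕ) : ℂ) • 1) k u v = g.res k u v := by
  rw [Nat.cast_zero, zero_smul, add_zero]
  rfl

/-- The Jacobi identity for the products `res`. Here `d` is the carry of the addition `a + b = c`
in the strip, and the exponent `e = d - r - 1` is the one that makes the left side a plain
product. -/
theorem res_res {a b c : Strip} {d : ℤ} (h : (c : ℂ) - eps c = a - eps a + (b - eps b) + d)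
    {u v : V} (hu : u ∈ g.gen a) (hv : v ∈ g.gen b) (w : V) (q r : ℤ) (e : ℕ)
    (he : (e : ℤ) = d - r - 1) :
    ∃ I₀ : ℕ, ∀ I, I₀ ≤ I → g.res q (g.res r u v) w
      = ∑ i ∈ Finset.range I, ((-1 : ℂ) ^ i * ((Ring.choose r i : ℤ) : ℂ)) •
        (g.res (r - i) u (𝒱.resOp (g.T + (e : ℂ) • 1) (q + i) v w)
          - (-1 : ℂ) ^ r • 𝒱.resOp (g.T + (e : ℂ) • 1) (q + r - i) v (g.res i u w)) := by
  refine VertexOperatorAlgebra.resOp_resOp (P := g.gen a) (Q := g.gen b) g.preservesFil_T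
    g.preservesFil_T (g.preservesFil_T_add e) (fun x hx => g.T_mem_gen hx)
    (fun y hy => Submodule.add_mem _ (g.T_mem_gen hy) (Submodule.smul_mem _ _ hy)) ?_ hu hv w q
  intro x hx y hy k
  rw [g.mode_T h hx hy k]
  have he' : (e : ℂ) = d - r - 1 := by exact_mod_cast congrArg (Int.cast : ℤ → ℂ) he
  simp only [LinearMap.add_apply, LinearMap.smul_apply, Module.End.one_apply, map_add, map_smul,
    he']
  module

theorem eps_eq_zero {a : Strip} (h : (a : ℂ).re = 0) : eps a = 0 := if_pos h

theorem eps_eq_one {a : Strip} (h : (a : ℂ).re ≠ 0) : eps a = 1 := if_neg h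

/-- Addition without carry, when one of the real parts vanishes. -/
theorem exists_add_of_re_eq_zero {a b : Strip} (h : (a : ℂ).re = 0 ∨ (b : ℂ).re = 0) :
    ∃ c : Strip, (c : ℂ) = a + b ∧ (c : ℂ) - eps c = a - eps a + (b - eps b) + (0 : ℤ)
      ∧ eps c = eps a + eps b := by
  have ha := a.2
  have hb := b.2
  refine ⟨⟨(a : ℂ) + b, ?_, ?_⟩, rfl, ?_⟩
  · rw [Complex.add_re]
    linarith
  · rw [Complex.add_re]
    rcases h with h | h <;> linarith
  · have : eps ⟨(a : ℂ) + b, by rw [Complex.add_re]; linarith, by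
        rw [Complex.add_re]; rcases h with h | h <;> linarith⟩ = eps a + eps b := by
      simp only [eps, Complex.add_re]
      rcases h with h | h
      · simp [h]
      · simp [h]
    rw [this]
    refine ⟨?_, rfl⟩
    push_cast
    ring

theorem mode_mem_gen_add {a b c : Strip} {n : ℤ} (h : (c : ℂ) = a + b + n) {u v : V}
    (hu : u ∈ g.gen a) (hv : v ∈ g.gen b) (k : ℤ) : 𝒱.mode u k v ∈ g.gen c := by
  refine g.mode_mem_gen ?_ hu hv k
  rw [Strip.eig, Strip.eig, Strip.eig, ← Complex.exp_add]
  refine Complex.exp_eq_exp_iff_exists_int.mpr ⟨n, ?_⟩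
  rw [h, twoPiI]
  ring

theorem res_mem_gen {a b c : Strip} {n : ℤ} (h : (c : ℂ) = a + b + n) {u v : V}
    (hu : u ∈ g.gen a) (hv : v ∈ g.gen b) (k : ℤ) : g.res k u v ∈ g.gen c := by
  obtain ⟨N, hN⟩ := g.preservesFil_T.exists_resOp_eq_sum u v k
  rw [res_eq, hN N le_rfl]
  exact Submodule.sum_mem _ fun j _ => g.mode_mem_gen_add h
    (binomOp_apply_mem _ (fun x hx => g.T_mem_gen hx) _ _ hu) hv _

/-- The generators of `O_g(V)`, for homogeneous `u`. -/
theorem res_mem_O {a : Strip} {u : V} (hu : u ∈ g.gen a) (v : V) {k : ℤ} (hk : k ≤ eps a - 2) :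
    g.res k u v ∈ g.O := by
  refine Submodule.subset_span ⟨eps a - k, eps a, u, v, by omega, g.E_apply hu, ?_⟩
  rw [sub_sub_cancel]

/-- A vector with `E u = d u` is a sum of vectors in `V^[a + ℤ]` with `ε(a) = d`. -/
theorem E_induction {d : ℤ} {P : V → Prop} (h0 : P 0) (hadd : ∀ x y, P x → P y → P (x + y))
    (hh : ∀ a, eps a = d → ∀ x ∈ g.gen a, P x) {u : V} (hu : g.E u = (d : ℂ) • u) : P u := by
  have hEA : ∀ v, g.E (g.E v) = g.E v := by
    refine g.gen_top_induction (P := fun v => g.E (g.E v) = g.E v) (by simp)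
      (fun x y hx hy => by rw [map_add, map_add, hx, hy]) fun a x hx => ?_
    rw [g.E_apply hx, map_smul, g.E_apply hx, smul_smul]
    have : (eps a : ℂ) * eps a = eps a := by
      rw [eps]
      split_ifs <;> simp
    rw [this]
  -- the projection onto the eigenspace of `E` with eigenvalue `d`
  have key : ∀ v : V, (d = 1 → P (g.E v)) ∧ (d = 0 → P (v - g.E v)) := by
    refine g.gen_top_induction (P := fun v => (d = 1 → P (g.E v)) ∧ (d = 0 → P (v - g.E v)))
      (by simpa using ⟨fun _ => h0, fun _ => h0⟩) (fun x y hx hy => ?_) fun a x hx => ?_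
    · rw [map_add, add_sub_add_comm]
      exact ⟨fun hd => hadd _ _ (hx.1 hd) (hy.1 hd), fun hd => hadd _ _ (hx.2 hd) (hy.2 hd)⟩
    · rw [g.E_apply hx]
      have hea : eps a = 0 ∨ eps a = 1 := by
        rw [eps]
        split_ifs <;> simp
      rcases hea with h | h <;> rw [h]
      · refine ⟨fun _ => by simpa using h0, fun hd => ?_⟩
        simpa using hh a (h.trans hd.symm) x hx
      · refine ⟨fun hd => ?_, fun _ => by simpa using h0⟩
        simpa using hh a (h.trans hd.symm) x hx
  by_cases h1 : d = 1
  · have := (key u).1 h1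
    rwa [hu, h1, Int.cast_one, one_smul] at this
  by_cases h2 : d = 0
  · have := (key u).2 h2
    rwa [hu, h2, Int.cast_zero, zero_smul, sub_zero] at this
  · have h3 := hEA u
    rw [hu, map_smul, hu, smul_smul, ← sub_eq_zero, ← sub_smul, smul_eq_zero] at h3
    rcases h3 with h3 | h3
    · have : (d : ℂ) * (d - 1) = 0 := by linear_combination h3
      rcases mul_eq_zero.mp this with h4 | h4
      · exact absurd (by exact_mod_cast h4) h2
      · exact absurd (by exact_mod_cast sub_eq_zero.mp h4) h1
    · rwa [h3]

/-- To show that `O_g(V)` is contained in a subspace it suffices to consider homogeneous `u`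
and `v`. -/
theorem O_le {S : Submodule ℂ V} (h : ∀ a b, ∀ u ∈ g.gen a, ∀ v ∈ g.gen b, ∀ n : ℤ, 1 < n →
    g.res (eps a - n) u v ∈ S) : g.O ≤ S := by
  refine Submodule.span_le.mpr ?_
  rintro _ ⟨n, d, u, v, hn, hu, rfl⟩
  change g.resₗ (d - n) u v ∈ S
  refine g.E_induction (P := fun u => g.resₗ (d - n) u v ∈ S) (by simp)
    (fun x y hx hy => by rw [map_add, LinearMap.add_apply]; exact S.add_mem hx hy) ?_ hu
  rintro a rfl x hx
  refine g.gen_top_induction (P := fun v => g.resₗ (eps a - n) x v ∈ S) (by simp)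
    (fun x y hx hy => by rw [map_add]; exact S.add_mem hx hy) ?_ v
  exact fun b y hy => h a b x hx y hy n hn

theorem star_mem_O {a : Strip} (ha : (a : ℂ).re ≠ 0) {u : V} (hu : u ∈ g.gen a) (v : V) :
    g.res (-1) u v ∈ g.O :=
  g.res_mem_O hu v (by rw [eps_eq_one ha]; norm_num)

theorem res_vac (u : V) :
    g.res (-1) u 𝒱.vac = u := by
  rw [res, finsum_eq_single _ 0]
  · simpa [VertexOperatorAlgebra.mode] using 𝒱.creation u
  · intro j hj
    obtain ⟨i, rfl⟩ := Nat.exists_eq_succ_of_ne_zero hj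
    exact 𝒱.creation_nonneg _ _ (by push_cast; omega)

/-- `O_g(V)` is a left ideal. -/
theorem star_O (u : V) {v : V} (hv : v ∈ g.O) : g.res (-1) u v ∈ g.O := by
  refine g.gen_top_induction (P := fun u => g.resₗ (-1) u v ∈ g.O) (by simp)
    (fun x y hx hy => by rw [map_add, LinearMap.add_apply]; exact g.O.add_mem hx hy) ?_ u
  intro a u hu
  by_cases ha : (a : ℂ).re = 0
  swap
  · exact g.star_mem_O ha hu v
  suffices g.O ≤ g.O.comap (g.resₗ (-1) u) from this hv
  refine g.O_le fun b b' v hv w _ n hn => ?_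
  change g.res (-1) u (g.res (eps b - n) v w) ∈ g.O
  obtain ⟨c, hc, hcd, hce⟩ := exists_add_of_re_eq_zero (b := b) (Or.inl ha)
  obtain ⟨I₀, h⟩ := g.res_res hcd hu hv w (eps b - n) (-1) 0 (by norm_num)
  have h := h (I₀ + 1) (by omega)
  rw [Finset.sum_range_succ'] at h
  simp only [resOp_T_zero] at h
  simp only [CharP.cast_eq_zero, pow_zero, Ring.choose_zero_right, Int.cast_one, one_mul,
    one_smul, sub_zero, add_zero] at h
  rw [eps_eq_zero ha, zero_add] at hce
  have e : g.res (-1) u (g.res (eps b - n) v w) = g.res (eps b - n) (g.res (-1) u v) w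
      - ∑ i ∈ Finset.range I₀, ((-1 : ℂ) ^ (i + 1) * ((Ring.choose (-1 : ℤ) (i + 1) : ℤ) : ℂ)) •
        (g.res (-1 - (i + 1 : ℕ)) u (g.res (eps b - n + (i + 1 : ℕ)) v w)
          - (-1 : ℂ) ^ (-1 : ℤ) • g.res (eps b - n + -1 - (i + 1 : ℕ)) v (g.res (i + 1 : ℕ) u w))
      + (-1 : ℂ) ^ (-1 : ℤ) • g.res (eps b - n + -1) v (g.res 0 u w) := by
    rw [h]
    abel
  rw [e]
  refine g.O.add_mem (g.O.sub_mem ?_ (g.O.sum_mem fun i _ => g.O.smul_mem _ (g.O.sub_mem ?_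
    (g.O.smul_mem _ ?_)))) (g.O.smul_mem _ ?_)
  · exact g.res_mem_O (g.res_mem_gen (n := 0) (by simpa using hc) hu hv _) w (by omega)
  · exact g.res_mem_O hu _ (by rw [eps_eq_zero ha]; push_cast; omega)
  · exact g.res_mem_O hv _ (by push_cast; omega)
  · exact g.res_mem_O hv _ (by omega)

/-- `O_g(V)` is a right ideal. -/
theorem O_star {u : V} (hu : u ∈ g.O) (w : V) : g.res (-1) u w ∈ g.O := by
  suffices g.O ≤ g.O.comap ((g.resₗ (-1)).flip w) from this hu
  refine g.O_le fun a b u hu v hv n hn => ?_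
  change g.res (-1) (g.res (eps a - n) u v) w ∈ g.O
  -- both terms of the Jacobi identity with exponent `e = n - 1` consist of generators
  have main : ∀ c : Strip, eps a = eps b →
      (c : ℂ) - eps c = a - eps a + (b - eps b) + (eps a : ℤ) →
      g.res (-1) (g.res (eps a - n) u v) w ∈ g.O := by
    intro c hab hc
    obtain ⟨e, he⟩ := Int.eq_ofNat_of_zero_le (show 0 ≤ n - 1 by omega)
    obtain ⟨I₀, h⟩ := g.res_res hc hu hv w (-1) (eps a - n) e (by omega)
    rw [h I₀ le_rfl]
    refine g.O.sum_mem fun i _ => g.O.smul_mem _ (g.O.sub_mem (g.res_mem_O hu _ ?_)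
      (g.O.smul_mem _ (g.resOp_T_add_mem _ e _ _ _ fun j hj => g.res_mem_O hv _ ?_)))
    · omega
    · omega
  have ha := a.2
  have hb := b.2
  have off : ∀ (c : Strip) (m : ℤ), (c : ℂ) = a + b + m → (c : ℂ).re ≠ 0 →
      g.res (-1) (g.res (eps a - n) u v) w ∈ g.O := fun c m hc hre =>
    g.star_mem_O hre (g.res_mem_gen hc hu hv _) w
  by_cases ha0 : (a : ℂ).re = 0
  · obtain ⟨c, hc, hcd, hce⟩ := exists_add_of_re_eq_zero (b := b) (Or.inl ha0)
    by_cases hb0 : (b : ℂ).re = 0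
    · exact main c (by rw [eps_eq_zero ha0, eps_eq_zero hb0]) (by rw [hcd, eps_eq_zero ha0])
    · exact off c 0 (by simpa using hc) (by rw [hc, Complex.add_re, ha0, zero_add]; exact hb0)
  · by_cases hlt : (a : ℂ).re + (b : ℂ).re < 1
    · refine off ⟨(a : ℂ) + b, ?_, ?_⟩ 0 (by simp) ?_
      · rw [Complex.add_re]; linarith
      · rwa [Complex.add_re]
      · rw [Complex.add_re]
        have := lt_of_le_of_ne ha.1 (Ne.symm ha0)
        linarith
    · have hc1 : 0 ≤ ((a : ℂ) + b - 1).re := by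
        simp only [Complex.sub_re, Complex.add_re, Complex.one_re]; linarith
      have hc2 : ((a : ℂ) + b - 1).re < 1 := by
        simp only [Complex.sub_re, Complex.add_re, Complex.one_re]; linarith
      have hb0 : (b : ℂ).re ≠ 0 := by
        intro h
        rw [h] at hlt
        linarith
      by_cases hc0 : ((a : ℂ) + b - 1).re = 0
      · refine main ⟨(a : ℂ) + b - 1, hc1, hc2⟩ (by rw [eps_eq_one ha0, eps_eq_one hb0]) ?_
        rw [eps_eq_one ha0, eps_eq_one hb0, eps_eq_zero (a := ⟨(a : ℂ) + b - 1, hc1, hc2⟩) hc0]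
        push_cast
        ring
      · exact off ⟨(a : ℂ) + b - 1, hc1, hc2⟩ (-1) (by push_cast; ring) hc0

/-- The product `*_g` is associative modulo `O_g(V)`. -/
theorem star_assoc (u v w : V) :
    g.res (-1) (g.res (-1) u v) w - g.res (-1) u (g.res (-1) v w) ∈ g.O := by
  refine g.gen_top_induction (P := fun u => g.resₗ (-1) (g.resₗ (-1) u v) w
    - g.resₗ (-1) u (g.resₗ (-1) v w) ∈ g.O) (by simp) ?_ ?_ u
  · intro x y hx hy
    simp only [map_add, LinearMap.add_apply, add_sub_add_comm]
    exact g.O.add_mem hx hy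
  intro a u hu
  refine g.gen_top_induction (P := fun v => g.resₗ (-1) (g.resₗ (-1) u v) w
    - g.resₗ (-1) u (g.resₗ (-1) v w) ∈ g.O) (by simp) ?_ ?_ v
  · intro x y hx hy
    simp only [map_add, LinearMap.add_apply, add_sub_add_comm]
    exact g.O.add_mem hx hy
  intro b v hv
  change g.res (-1) (g.res (-1) u v) w - g.res (-1) u (g.res (-1) v w) ∈ g.O
  by_cases ha : (a : ℂ).re = 0
  · obtain ⟨c, hc, hcd, hce⟩ := exists_add_of_re_eq_zero (b := b) (Or.inl ha)
    by_cases hb : (b : ℂ).re = 0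
    · obtain ⟨I₀, h⟩ := g.res_res hcd hu hv w (-1) (-1) 0 (by norm_num)
      rw [h (I₀ + 1) (by omega), Finset.sum_range_succ']
      simp only [resOp_T_zero]
      simp only [CharP.cast_eq_zero, pow_zero, Ring.choose_zero_right, Int.cast_one, one_mul,
        one_smul, sub_zero, add_zero]
      rw [add_sub_assoc, sub_sub_cancel_left]
      refine g.O.add_mem (g.O.sum_mem fun i _ => g.O.smul_mem _ (g.O.sub_mem ?_
        (g.O.smul_mem _ ?_))) (g.O.neg_mem (g.O.smul_mem _ ?_))
      · exact g.res_mem_O hu _ (by rw [eps_eq_zero ha]; push_cast; omega)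
      · exact g.res_mem_O hv _ (by rw [eps_eq_zero hb]; push_cast; omega)
      · exact g.res_mem_O hv _ (by rw [eps_eq_zero hb]; norm_num)
    · refine g.O.sub_mem (g.star_mem_O (a := c) ?_
        (g.res_mem_gen (n := 0) (by simpa using hc) hu hv _) w)
        (g.star_O _ (g.star_mem_O hb hv w))
      rw [hc, Complex.add_re, ha, zero_add]
      exact hb
  · exact g.O.sub_mem (g.O_star (g.star_mem_O ha hu v) w) (g.star_mem_O ha hu _)

theorem op_vac : g.op 𝒱.vac = 𝒱.vac := g.map_vac

/-- The class of `0` in `ℂ / ℤ`. -/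
def zeroStrip : Strip := ⟨0, by simp⟩

theorem eig_zeroStrip : zeroStrip.eig = 1 := by simp [zeroStrip, Strip.eig]

theorem mem_gen_zeroStrip {v : V} (h : g.op v = v) : v ∈ g.gen zeroStrip := by
  refine (Module.End.mem_maxGenEigenspace _ _ _).mpr ⟨1, ?_⟩
  simp [eig_zeroStrip, h]

theorem N_eq_zero {v : V} (h : g.op v = v) : g.N v = 0 := by
  have h1 : (g.unipotent - 1) v = 0 := by
    rw [LinearMap.sub_apply, g.unipotent_apply (g.mem_gen_zeroStrip h), h, eig_zeroStrip]
    simp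
  rw [N_eq_seriesOp, LinearMap.smul_apply, seriesOp_apply (K := 1)]
  · simp
  · intro k hk
    obtain ⟨i, rfl⟩ := Nat.exists_eq_add_of_le' hk
    rw [pow_succ, Module.End.mul_apply, h1, map_zero]

theorem L_vac {n : ℤ} (hn : -1 ≤ n) : 𝒱.L n 𝒱.vac = 0 :=
  𝒱.creation_nonneg _ _ (by omega)

theorem T_vac : g.T 𝒱.vac = 0 := by
  rw [g.T_apply (g.mem_gen_zeroStrip g.op_vac), L_vac (by norm_num), g.N_eq_zero g.op_vac,
    eps_eq_zero (a := zeroStrip) (by simp [zeroStrip])]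
  simp [zeroStrip]

theorem binomOp_eq_zero {S : Module.End ℂ V} {v : V} (h : S v = 0) {j : ℕ} (hj : j ≠ 0) :
    binomOp S j v = 0 := by
  obtain ⟨i, rfl⟩ := Nat.exists_eq_succ_of_ne_zero hj
  induction i with
  | zero =>
    have := binomOp_succ_apply S 0 v
    simpa [h] using this
  | succ i ih =>
    have := binomOp_succ_apply S (i + 1) v
    rw [ih (Nat.succ_ne_zero i), map_zero, smul_zero, sub_zero, smul_eq_zero] at this
    exact this.resolve_left (by exact_mod_cast (i + 1).succ_ne_zero)

theorem res_vac_left (v : V) : g.res (-1) 𝒱.vac v = v := by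
  rw [res, finsum_eq_single _ 0]
  · have := 𝒱.vac_mode (-1) v
    simpa [VertexOperatorAlgebra.mode] using this
  · intro j hj
    rw [binomOp_eq_zero g.T_vac hj]
    simp

theorem op_T (v : V) : g.op (g.T v) = g.T (g.op v) := by
  refine g.gen_top_induction (P := fun v => g.op (g.T v) = g.T (g.op v)) (by simp)
    (fun x y hx hy => by simp only [map_add, hx, hy]) (fun a x hx => ?_) v
  rw [g.T_apply hx, g.T_apply (g.op_mem_gen a hx)]
  simp only [map_add, map_smul, op_L, op_N]

theorem op_res (k : ℤ) (u v : V) : g.op (g.res k u v) = g.res k (g.op u) (g.op v) := by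
  obtain ⟨N₁, h₁⟩ := g.preservesFil_T.exists_resOp_eq_sum u v k
  obtain ⟨N₂, h₂⟩ := g.preservesFil_T.exists_resOp_eq_sum (g.op u) (g.op v) k
  rw [res_eq, res_eq, h₁ (N₁ + N₂) (by omega), h₂ (N₁ + N₂) (by omega), map_sum]
  simp only [op_mode, binomOp_map g.op g.op_T]

theorem op_mem_O {u : V} (hu : u ∈ g.O) : g.op u ∈ g.O := by
  suffices g.O ≤ g.O.comap g.op from this hu
  refine g.O_le fun a b u hu v _ n hn => ?_
  rw [Submodule.mem_comap, op_res]
  exact g.res_mem_O (g.op_mem_gen a hu) _ (by omega)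

theorem L_neg_one_eq (u : V) : 𝒱.L (-1) u = 𝒱.mode u (-2) 𝒱.vac := by
  have h := 𝒱.mode_L_neg_one u (-1) 𝒱.vac
  have h' : 𝒱.mode (𝒱.L (-1) u) (-1) 𝒱.vac = 𝒱.L (-1) u := 𝒱.creation _
  rw [h'] at h
  rw [h]
  norm_num

/-- The relation `L(-1) u ≡ - (ℒ + 𝒩) u` in `A_g(V)`. -/
theorem L_neg_one_add_T_mem_O {a : Strip} (ha : (a : ℂ).re = 0) {u : V} (hu : u ∈ g.gen a) :
    𝒱.L (-1) u + g.T u ∈ g.O := by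
  have h := g.res_mem_O hu 𝒱.vac (k := -2) (by rw [eps_eq_zero ha]; norm_num)
  have e : g.res (-2) u 𝒱.vac = 𝒱.L (-1) u + g.T u := by
    rw [res, finsum_nat_eq_sum_range (K := 2)]
    · have h1 : binomOp g.T 1 u = g.T u := by
        have := binomOp_succ_apply g.T 0 u
        simpa using this
      have h2 : 𝒱.mode (g.T u) (-1) 𝒱.vac = g.T u := 𝒱.creation _
      rw [Finset.sum_range_succ, Finset.sum_range_one, h1, L_neg_one_eq, binomOp_zero]
      exact congrArg (𝒱.mode u (-2) 𝒱.vac + ·) h2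
    · intro j hj
      exact 𝒱.creation_nonneg _ _ (by omega)
  rwa [e] at h

end Automorphism

/-- The product on `V / O` induced by a bilinear product on `V` for which `O` is an ideal. -/
def quotientMul {V : Type*} [AddCommGroup V] [Module ℂ V] (O : Submodule ℂ V)
    (B : V →ₗ[ℂ] V →ₗ[ℂ] V) (left : ∀ u, ∀ v ∈ O, B u v ∈ O)
    (right : ∀ u ∈ O, ∀ v, B u v ∈ O) : (V ⧸ O) →ₗ[ℂ] (V ⧸ O) →ₗ[ℂ] (V ⧸ O) :=
  O.liftQ ((O.liftQ ((B.flip).compr₂ O.mkQ) fun v hv => LinearMap.ext fun u =>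
      (Submodule.Quotient.mk_eq_zero O).mpr (left u v hv)).flip) fun u hu =>
    Submodule.linearMap_qext _ (LinearMap.ext fun v =>
      (Submodule.Quotient.mk_eq_zero O).mpr (right u hu v))

theorem quotientMul_mk {V : Type*} [AddCommGroup V] [Module ℂ V] (O : Submodule ℂ V)
    (B : V →ₗ[ℂ] V →ₗ[ℂ] V) (left : ∀ u, ∀ v ∈ O, B u v ∈ O)
    (right : ∀ u ∈ O, ∀ v, B u v ∈ O) (u v : V) :
    quotientMul O B left right (O.mkQ u) (O.mkQ v) = O.mkQ (B u v) := by
  rfl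

/-- A bilinear product that satisfies the axioms of an associative algebra modulo a subspace
induces an algebra structure on the quotient. -/
def InducedAlgebra.ofBilinear {V : Type*} [AddCommGroup V] [Module ℂ V]
    {𝒱 : VertexOperatorAlgebra V} (g : Automorphism 𝒱) (prod : V → V → V) (O : Submodule ℂ V)
    (B : V →ₗ[ℂ] V →ₗ[ℂ] V) (hB : ∀ u v, B u v = prod u v)
    (left : ∀ u, ∀ v ∈ O, B u v ∈ O) (right : ∀ u ∈ O, ∀ v, B u v ∈ O)
    (assoc : ∀ u v w, B (B u v) w - B u (B v w) ∈ O)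
    (vac_left : ∀ u, B 𝒱.vac u = u) (vac_right : ∀ u, B u 𝒱.vac = u)
    (op_mem : ∀ u ∈ O, g.op u ∈ O) : InducedAlgebra g prod O where
  mul := quotientMul O B left right
  mul_mk u v := by rw [quotientMul_mk, hB]
  mul_assoc x y z := by
    obtain ⟨u, rfl⟩ := O.mkQ_surjective x
    obtain ⟨v, rfl⟩ := O.mkQ_surjective y
    obtain ⟨w, rfl⟩ := O.mkQ_surjective z
    simp only [quotientMul_mk]
    exact (Submodule.Quotient.eq O).mpr (assoc u v w)
  one_mul x := by
    obtain ⟨u, rfl⟩ := O.mkQ_surjective x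
    rw [quotientMul_mk, vac_left]
  mul_one x := by
    obtain ⟨u, rfl⟩ := O.mkQ_surjective x
    rw [quotientMul_mk, vac_right]
  gact := O.mapQ O g.op op_mem
  gact_mk u := Submodule.mapQ_apply _ _ _ _

/-- The algebra `A_g(V)`. -/
def zhuAlgebra {V : Type*} [AddCommGroup V] [Module ℂ V] {𝒱 : VertexOperatorAlgebra V}
    (g : Automorphism 𝒱) : ZhuAlgebra g :=
  InducedAlgebra.ofBilinear g g.star g.O (g.resₗ (-1)) (fun _ _ => rfl)
    (fun u _ hv => g.star_O u hv) (fun _ hu v => g.O_star hu v) g.star_assoc g.res_vac_left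
    g.res_vac fun _ hu => g.op_mem_O hu

end

end TwistedZhu

namespace TwistedZhu

noncomputable section

open Finset.HasAntidiagonal (antidiagonal mem_antidiagonal)

/-! ### Formal vector fields on the line -/

section formal

open PowerSeries

theorem X_pow_dvd_derivative {k : ℕ} {p : PowerSeries ℂ} (h : (X : PowerSeries ℂ) ^ (k + 1) ∣ p) :
    (X : PowerSeries ℂ) ^ k ∣ derivative ℂ p := by
  rw [X_pow_dvd_iff] at *
  intro m hm
  rw [coeff_derivative, h _ (by omega), zero_mul]

/-- A vector field that vanishes to second order raises the order of a function. -/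
theorem X_pow_dvd_mul_derivative {h : PowerSeries ℂ} (hh : (X : PowerSeries ℂ) ^ 2 ∣ h) {k : ℕ}
    {p : PowerSeries ℂ} (hp : (X : PowerSeries ℂ) ^ k ∣ p) :
    (X : PowerSeries ℂ) ^ (k + 1) ∣ h * derivative ℂ p := by
  rcases k with _ | k
  · exact dvd_mul_of_dvd_left (dvd_trans (pow_dvd_pow _ (by omega)) hh) _
  · rw [show k + 1 + 1 = 2 + k by ring, pow_add]
    exact mul_dvd_mul hh (X_pow_dvd_derivative hp)

/-- The derivation `h d/dx` of `ℂ⟦x⟧`. -/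
def fieldDer (h : PowerSeries ℂ) : Module.End ℂ (PowerSeries ℂ) :=
  LinearMap.mulLeft ℂ h ∘ₗ (derivative ℂ).toLinearMap

theorem fieldDer_apply (h p : PowerSeries ℂ) : fieldDer h p = h * derivative ℂ p := rfl

/-- The coefficients of `d/dx` in the Lie series `exp(ad (h d/dx)) (d/dx)`, up to the factor
`1 / k!`. -/
def lieIterate (h : PowerSeries ℂ) : ℕ → PowerSeries ℂ
  | 0 => 1
  | k + 1 => h * derivative ℂ (lieIterate h k) - derivative ℂ h * lieIterate h k

theorem X_pow_dvd_lieIterate {h : PowerSeries ℂ} (hh : (X : PowerSeries ℂ) ^ 2 ∣ h) (k : ℕ) :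
    (X : PowerSeries ℂ) ^ k ∣ lieIterate h k := by
  induction k with
  | zero => simp
  | succ k ih =>
    refine dvd_sub (X_pow_dvd_mul_derivative hh ih) ?_
    rw [show k + 1 = 1 + k by ring, pow_add]
    exact mul_dvd_mul (X_pow_dvd_derivative hh) ih

/-- The `k`-th term of the exponential series of `- h d/dx`. -/
def expTerm (h : PowerSeries ℂ) (k : ℕ) : Module.End ℂ (PowerSeries ℂ) :=
  ((-1 : ℂ) ^ k / k.factorial) • fieldDer h ^ k

theorem succ_smul_coeff_succ (k : ℕ) :
    ((k : ℂ) + 1) * ((-1 : ℂ) ^ (k + 1) / (k + 1).factorial) = -((-1 : ℂ) ^ k / k.factorial) := by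
  have h : (k.factorial : ℂ) ≠ 0 := by exact_mod_cast k.factorial_ne_zero
  have h' : (k : ℂ) + 1 ≠ 0 := by exact_mod_cast k.succ_ne_zero
  rw [Nat.factorial_succ]
  push_cast
  field_simp
  ring

theorem succ_mul_inv_factorial (k : ℕ) :
    ((k : ℂ) + 1) * (((k + 1).factorial : ℂ))⁻¹ = ((k.factorial : ℂ))⁻¹ := by
  have h : (k.factorial : ℂ) ≠ 0 := by exact_mod_cast k.factorial_ne_zero
  have h' : (k : ℂ) + 1 ≠ 0 := by exact_mod_cast k.succ_ne_zero
  rw [Nat.factorial_succ]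
  push_cast
  field_simp

theorem expTerm_succ' (h : PowerSeries ℂ) (k : ℕ) (p : PowerSeries ℂ) :
    ((k : ℂ) + 1) • expTerm h (k + 1) p = - expTerm h k (fieldDer h p) := by
  simp only [expTerm, LinearMap.smul_apply, smul_smul, succ_smul_coeff_succ, pow_succ (fieldDer h),
    Module.End.mul_apply, neg_smul]

theorem X_pow_dvd_expTerm {h : PowerSeries ℂ} (hh : (X : PowerSeries ℂ) ^ 2 ∣ h) (k : ℕ) {j : ℕ}
    {p : PowerSeries ℂ} (hp : (X : PowerSeries ℂ) ^ j ∣ p) :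
    (X : PowerSeries ℂ) ^ (k + j) ∣ expTerm h k p := by
  rw [expTerm, LinearMap.smul_apply]
  refine dvd_smul_of_dvd _ ?_
  induction k with
  | zero => simpa
  | succ k ih =>
    rw [pow_succ', Module.End.mul_apply, show k + 1 + j = k + j + 1 by ring]
    exact X_pow_dvd_mul_derivative hh ih

/-- `d/dx ∘ exp(- h d/dx) = exp(- h d/dx) ∘ exp(ad (h d/dx)) (d/dx)`, degree by degree. -/
theorem derivative_expTerm (h : PowerSeries ℂ) (k : ℕ) (p : PowerSeries ℂ) :
    derivative ℂ (expTerm h k p) = ∑ x ∈ antidiagonal k,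
      expTerm h x.1 (((x.2.factorial : ℂ)⁻¹ • lieIterate h x.2) * derivative ℂ p) := by
  induction k generalizing p with
  | zero => simp [expTerm, lieIterate]
  | succ k ih =>
    have h' : (k : ℂ) + 1 ≠ 0 := by exact_mod_cast k.succ_ne_zero
    apply smul_right_injective _ h'
    change ((k : ℂ) + 1) • _ = ((k : ℂ) + 1) • _
    rw [← sum_antidiagonal_succ_smul (fun a b => expTerm h a
        (((b.factorial : ℂ)⁻¹ • lieIterate h b) * derivative ℂ p)),
      ← Derivation.map_smul, expTerm_succ', Derivation.map_neg, ih, ← Finset.sum_neg_distrib]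
    refine Finset.sum_congr rfl fun x _ => ?_
    rw [expTerm_succ', ← map_smul, ← smul_mul_assoc, smul_smul, succ_mul_inv_factorial,
      ← map_neg, ← map_neg, ← map_add]
    congr 1
    simp only [fieldDer_apply, lieIterate, Derivation.leibniz, smul_eq_mul, smul_mul_assoc,
      Derivation.map_smul, mul_smul_comm, ← smul_neg, ← smul_add]
    congr 1
    ring

/-- If `exp(- h d/dx) x = (e ^ (τ x) - 1) / τ`, then `exp(ad (h d/dx)) (d/dx) = (1 + τ x) d/dx`. -/
theorem sum_lieIterate {h : PowerSeries ℂ} (hh : (X : PowerSeries ℂ) ^ 2 ∣ h) {τ : ℂ}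
    {f : PowerSeries ℂ} (hf : derivative ℂ f = 1 + C τ * f) {M : ℕ}
    (hexp : (X : PowerSeries ℂ) ^ (M + 1) ∣ ∑ k ∈ Finset.range M, expTerm h k X - f) :
    (X : PowerSeries ℂ) ^ M ∣
      ∑ k ∈ Finset.range M, ((k.factorial : ℂ)⁻¹ • lieIterate h k) - (1 + C τ * X) := by
  rcases M with _ | M
  · simp
  set G := ∑ k ∈ Finset.range (M + 1), ((k.factorial : ℂ)⁻¹ • lieIterate h k) with hG
  set e : Module.End ℂ (PowerSeries ℂ) := ∑ k ∈ Finset.range (M + 1), expTerm h k with he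
  have hdvd : ∀ a b : ℕ, (X : PowerSeries ℂ) ^ (a + b) ∣
      expTerm h a ((b.factorial : ℂ)⁻¹ • lieIterate h b) := fun a b =>
    X_pow_dvd_expTerm hh a (dvd_smul_of_dvd _ (X_pow_dvd_lieIterate hh b))
  have hD1 : ∀ k, expTerm h (k + 1) 1 = 0 := by
    intro k
    rw [expTerm, LinearMap.smul_apply, pow_succ (fieldDer h), Module.End.mul_apply, fieldDer_apply]
    simp
  have he1 : e 1 = 1 := by
    rw [he, LinearMap.sum_apply, Finset.sum_range_succ', Finset.sum_eq_zero fun k _ => hD1 k]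
    simp [expTerm]
  have h1 : (X : PowerSeries ℂ) ^ (M + 1) ∣ e G - derivative ℂ (e X) := by
    have e1 : derivative ℂ (e X) = ∑ t ∈ Finset.range (M + 1), ∑ x ∈ antidiagonal t,
        expTerm h x.1 ((x.2.factorial : ℂ)⁻¹ • lieIterate h x.2) := by
      rw [he, LinearMap.sum_apply, map_sum]
      refine Finset.sum_congr rfl fun k _ => ?_
      rw [derivative_expTerm]
      simp
    have e2 : e G = ∑ a ∈ Finset.range (M + 1), ∑ b ∈ Finset.range (M + 1),
        expTerm h a ((b.factorial : ℂ)⁻¹ • lieIterate h b) := by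
      rw [he, LinearMap.sum_apply]
      refine Finset.sum_congr rfl fun a _ => ?_
      rw [hG, map_sum]
    rw [X_pow_dvd_iff]
    intro m hm
    rw [map_sub, e1, e2]
    simp only [map_sum]
    rw [sub_eq_zero, ← sum_range_sum_range_eq_antidiagonal
      (f := fun a b => coeff m (expTerm h a ((b.factorial : ℂ)⁻¹ • lieIterate h b)))]
    intro a b hab
    exact X_pow_dvd_iff.mp (hdvd a b) m (by omega)
  have h2 : (X : PowerSeries ℂ) ^ (M + 1) ∣ e (G - (1 + C τ * X)) := by
    have e3 : e (G - (1 + C τ * X)) = (e G - derivative ℂ (e X))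
        + derivative ℂ (e X - f) - C τ * (e X - f) := by
      have : C τ * X = τ • (X : PowerSeries ℂ) := by rw [smul_eq_C_mul]
      rw [map_sub, map_add, he1, this, map_smul, map_sub, hf, smul_eq_C_mul]
      ring
    rw [e3]
    have h3 : (X : PowerSeries ℂ) ^ (M + 1 + 1) ∣ e X - f := by
      rw [he, LinearMap.sum_apply]
      exact hexp
    exact dvd_sub (dvd_add h1 (X_pow_dvd_derivative h3))
      (dvd_mul_of_dvd_right (dvd_trans (pow_dvd_pow _ (by omega)) h3) _)
  -- the operator `e` preserves leading terms
  suffices ∀ j ≤ M + 1, (X : PowerSeries ℂ) ^ j ∣ G - (1 + C τ * X) from this _ le_rfl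
  intro j
  induction j with
  | zero => simp
  | succ j ih =>
    intro hj
    have h4 : G - (1 + C τ * X) = e (G - (1 + C τ * X))
        - ∑ k ∈ Finset.range M, expTerm h (k + 1) (G - (1 + C τ * X)) := by
      rw [he, LinearMap.sum_apply, Finset.sum_range_succ', add_sub_cancel_left]
      simp [expTerm]
    rw [h4]
    refine dvd_sub (dvd_trans (pow_dvd_pow _ hj) h2) (Finset.dvd_sum fun k _ => ?_)
    exact dvd_trans (pow_dvd_pow _ (by omega)) (X_pow_dvd_expTerm hh (k + 1) (ih (by omega)))

/-- The vector field `∑_{j ≥ 1} A_j x ^ (j+1)`. -/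
def coordField : PowerSeries ℂ := mk fun i => if i < 2 then 0 else coordCoeff (i - 1)

theorem X_sq_dvd_coordField : (X : PowerSeries ℂ) ^ 2 ∣ coordField := by
  rw [X_pow_dvd_iff]
  intro m hm
  rw [coordField, coeff_mk, if_pos hm]

/-- The coordinate change `(e ^ (2 π i x) - 1) / (2 π i)`. -/
def coordSeries : PowerSeries ℂ :=
  mk fun n => if n = 0 then 0 else twoPiI ^ n / (twoPiI * n.factorial)

theorem derivative_coordSeries : derivative ℂ coordSeries = 1 + C twoPiI * coordSeries := by
  ext n
  have h0 := twoPiI_ne_zero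
  have h : (n.factorial : ℂ) ≠ 0 := by exact_mod_cast n.factorial_ne_zero
  have h' : (n : ℂ) + 1 ≠ 0 := by exact_mod_cast n.succ_ne_zero
  rw [coeff_derivative, map_add, coeff_C_mul, coordSeries, coeff_mk, coeff_mk, coeff_one,
    if_neg n.succ_ne_zero, Nat.factorial_succ]
  push_cast
  split_ifs with hn
  · subst hn
    simp [h0]
  · field_simp
    ring

theorem X_pow_dvd_sum_expTerm_sub (M : ℕ) : (X : PowerSeries ℂ) ^ (M + 1) ∣
    ∑ k ∈ Finset.range M, expTerm coordField k X - coordSeries := by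
  have hD : ∀ k, expTerm coordField k X
      = ((-1 : ℂ) ^ k / k.factorial) • (coordDer coordCoeff)^[k] X := by
    intro k
    rw [expTerm, LinearMap.smul_apply, Module.End.pow_apply]
    rfl
  rw [X_pow_dvd_iff]
  intro n hn
  rw [map_sub, coordSeries, coeff_mk, ← coordCoeff_spec n, map_sum, sub_eq_zero]
  simp only [hD, coeff_smul, smul_eq_mul]
  have hz : ∀ k, n ≤ k → (-1 : ℂ) ^ k / k.factorial *
      coeff n ((coordDer coordCoeff)^[k] X) = 0 := fun k hk => by
    rw [coeff_coordDer_iterate_eq_zero _ k n hk, mul_zero]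
  rw [← finsum_nat_eq_sum_range (K := M), ← finsum_nat_eq_sum_range (K := n + 1)]
  · exact fun k hk => hz k (by omega)
  · exact fun k hk => hz k (by omega)

end formal

/-! ### The action of formal vector fields on a vertex operator algebra -/

namespace VertexOperatorAlgebra

open PowerSeries

variable {V : Type*} [AddCommGroup V] [Module ℂ V] (𝒱 : VertexOperatorAlgebra V)

theorem L_mem_fil {n : ℤ} (j : ℤ) {v : V} (hv : v ∈ 𝒱.fil n) : 𝒱.L j v ∈ 𝒱.fil (n - j) :=
  𝒱.fil_induction (P := fun v => 𝒱.L j v ∈ 𝒱.fil (n - j)) (by simp)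
    (fun x y hx hy => by rw [map_add]; exact Submodule.add_mem _ hx hy)
    (fun m hm x hx => 𝒱.wt_le_fil (by omega) (𝒱.L_mem_wt hx)) hv

theorem exists_L_eq_zero (n : ℤ) : ∃ K : ℕ, ∀ v ∈ 𝒱.fil n, ∀ j : ℤ, (K : ℤ) ≤ j + 1 →
    𝒱.L j v = 0 := by
  obtain ⟨N, hN⟩ := 𝒱.exists_fil_eq_bot
  refine ⟨(n - N + 2).toNat, fun v hv j hj => ?_⟩
  have h := 𝒱.L_mem_fil j hv
  rwa [hN _ (by omega), Submodule.mem_bot] at h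

/-- The action `∑_n p_n L(n-1)` of the vector field `p(x) d/dx`. -/
def vect (p : PowerSeries ℂ) : Module.End ℂ V :=
  locSum (fun n => coeff n p • 𝒱.L (n - 1)) fun v => by
    obtain ⟨n, hn⟩ := 𝒱.exists_mem_fil v
    obtain ⟨K, hK⟩ := 𝒱.exists_L_eq_zero n
    exact ⟨K, fun k hk => by rw [LinearMap.smul_apply, hK v hn _ (by omega), smul_zero]⟩

theorem vect_apply (p : PowerSeries ℂ) {v : V} {K : ℕ}
    (hK : ∀ j : ℤ, (K : ℤ) ≤ j + 1 → 𝒱.L j v = 0) :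
    𝒱.vect p v = ∑ n ∈ Finset.range K, coeff n p • 𝒱.L (n - 1) v := by
  change ∑ᶠ n : ℕ, (coeff n p • 𝒱.L (n - 1)) v = _
  refine finsum_nat_eq_sum_range fun j hj => ?_
  rw [LinearMap.smul_apply, hK _ (by omega), smul_zero]

theorem exists_vect_apply (v : V) : ∃ K₀ : ℕ, ∀ K, K₀ ≤ K → ∀ p : PowerSeries ℂ,
    𝒱.vect p v = ∑ n ∈ Finset.range K, coeff n p • 𝒱.L (n - 1) v := by
  obtain ⟨n, hn⟩ := 𝒱.exists_mem_fil v
  obtain ⟨K, hK⟩ := 𝒱.exists_L_eq_zero n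
  exact ⟨K, fun K' hK' p => 𝒱.vect_apply p fun j hj => hK v hn j (by omega)⟩

theorem vect_add (p q : PowerSeries ℂ) : 𝒱.vect (p + q) = 𝒱.vect p + 𝒱.vect q := by
  ext v
  obtain ⟨K, hK⟩ := 𝒱.exists_vect_apply v
  rw [LinearMap.add_apply, hK K le_rfl, hK K le_rfl, hK K le_rfl, ← Finset.sum_add_distrib]
  simp only [map_add, add_smul]

theorem vect_smul (r : ℂ) (p : PowerSeries ℂ) : 𝒱.vect (r • p) = r • 𝒱.vect p := by
  ext v
  obtain ⟨K, hK⟩ := 𝒱.exists_vect_apply v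
  rw [LinearMap.smul_apply, hK K le_rfl, hK K le_rfl, Finset.smul_sum]
  simp only [coeff_smul, smul_assoc]

/-- The action of vector fields as a linear map. -/
def vectₗ : PowerSeries ℂ →ₗ[ℂ] Module.End ℂ V where
  toFun := 𝒱.vect
  map_add' := 𝒱.vect_add
  map_smul' := 𝒱.vect_smul

theorem vectₗ_apply (p : PowerSeries ℂ) : 𝒱.vectₗ p = 𝒱.vect p := rfl

theorem vect_mem_fil {p : PowerSeries ℂ} {a : ℕ} (hp : (X : PowerSeries ℂ) ^ a ∣ p) {n : ℤ} {v : V}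
    (hv : v ∈ 𝒱.fil n) : 𝒱.vect p v ∈ 𝒱.fil (n + 1 - a) := by
  obtain ⟨K, hK⟩ := 𝒱.exists_vect_apply v
  rw [hK K le_rfl]
  refine Submodule.sum_mem _ fun m _ => ?_
  by_cases hm : m < a
  · rw [X_pow_dvd_iff.mp hp m hm, zero_smul]
    exact Submodule.zero_mem _
  · exact Submodule.smul_mem _ _ (𝒱.fil_mono (by omega) (𝒱.L_mem_fil _ hv))

/-- The two terms of the bracket of `p(x) d/dx` and `q(x) d/dx`. -/
theorem vect_derivative_mul {v : V} {K : ℕ} (hK : ∀ j : ℤ, (K : ℤ) ≤ j + 2 → 𝒱.L j v = 0)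
    (p q : PowerSeries ℂ) :
    𝒱.vect (PowerSeries.derivative ℂ p * q) v = ∑ m ∈ Finset.range (K + 1), ∑ n ∈ Finset.range (K + 1),
      (m * (coeff m p * coeff n q)) • 𝒱.L (m + n - 2) v := by
  have e1 : ∀ a : ℕ, (K : ℕ) ≤ a → 𝒱.L (a - 1) v = 0 := fun a ha => hK _ (by omega)
  rw [𝒱.vect_apply (K := K) _ (fun j hj => hK j (by omega)), Finset.sum_range_succ']
  have e2 : ∑ n ∈ Finset.range K, coeff n (PowerSeries.derivative ℂ p * q) • 𝒱.L (n - 1) v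
      = ∑ t ∈ Finset.range K, ∑ x ∈ antidiagonal t,
        (((x.1 : ℂ) + 1) * (coeff (x.1 + 1) p * coeff x.2 q)) • 𝒱.L ((x.1 + x.2 : ℕ) - 1) v := by
    refine Finset.sum_congr rfl fun t _ => ?_
    rw [coeff_mul, Finset.sum_smul]
    refine Finset.sum_congr rfl fun x hx => ?_
    rw [coeff_derivative, mem_antidiagonal.mp hx]
    congr 1
    ring
  rw [e2, ← sum_range_sum_range_eq_antidiagonal (f := fun a b =>
    (((a : ℂ) + 1) * (coeff (a + 1) p * coeff b q)) • 𝒱.L ((a + b : ℕ) - 1) v)]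
  · have e3 : ∑ n ∈ Finset.range (K + 1), (((0 : ℕ) : ℂ) * (coeff 0 p * coeff n q)) •
        𝒱.L ((0 : ℕ) + n - 2) v = 0 := by simp
    rw [e3, add_zero]
    refine Finset.sum_congr rfl fun a _ => ?_
    rw [Finset.sum_range_succ, hK ((a + 1 : ℕ) + (K : ℕ) - 2) (by push_cast; omega), smul_zero,
      add_zero]
    refine Finset.sum_congr rfl fun b _ => ?_
    push_cast
    congr 2
    ring_nf
  · intro a b hab
    rw [e1 _ hab, smul_zero]

theorem L_commutator {m n : ℤ} (hm : -1 ≤ m) (hn : -1 ≤ n) (v : V) :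
    𝒱.L m (𝒱.L n v) - 𝒱.L n (𝒱.L m v) = ((m : ℂ) - n) • 𝒱.L (m + n) v := by
  refine (𝒱.virasoro m n v).trans ?_
  change ((m : ℂ) - n) • 𝒱.L (m + n) v + _ = _
  split_ifs with h
  · have h1 : m = -1 ∨ m = 0 ∨ m = 1 := by omega
    rcases h1 with rfl | rfl | rfl <;> norm_num
  · rw [add_zero]

/-- `[p d/dx, q d/dx]` acts as `(p' q - p q') d/dx`. There is no central term, as only the modes
`L(n)` with `n ≥ -1` occur. -/
theorem vect_commutator (p q : PowerSeries ℂ) (v : V) :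
    𝒱.vect p (𝒱.vect q v) - 𝒱.vect q (𝒱.vect p v)
      = 𝒱.vect (PowerSeries.derivative ℂ p * q - p * PowerSeries.derivative ℂ q) v := by
  obtain ⟨n, hn⟩ := 𝒱.exists_mem_fil v
  obtain ⟨K, hK⟩ := 𝒱.exists_L_eq_zero (n + 1)
  have h1 : ∀ j : ℤ, ((K + 1 : ℕ) : ℤ) ≤ j + 2 → 𝒱.L j v = 0 := fun j hj =>
    hK v (𝒱.fil_mono (by omega) hn) j (by push_cast at hj; omega)
  have h2 : ∀ p q : PowerSeries ℂ, 𝒱.vect p (𝒱.vect q v)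
      = ∑ a ∈ Finset.range (K + 1 + 1), ∑ b ∈ Finset.range (K + 1 + 1),
        (coeff a p * coeff b q) • 𝒱.L (a - 1) (𝒱.L (b - 1) v) := by
    intro p q
    rw [𝒱.vect_apply (K := K + 1 + 1) q (fun j hj => h1 j (by push_cast at *; omega)), map_sum,
      Finset.sum_comm]
    refine Finset.sum_congr rfl fun b _ => ?_
    rw [map_smul, 𝒱.vect_apply (K := K + 1 + 1) p, Finset.smul_sum]
    · refine Finset.sum_congr rfl fun a _ => ?_
      rw [smul_smul, mul_comm]
    · intro j hj
      exact hK _ (𝒱.fil_mono (by omega) (𝒱.L_mem_fil _ hn)) j (by push_cast at hj; omega)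
  have h3 : 𝒱.vect (PowerSeries.derivative ℂ p * q - p * PowerSeries.derivative ℂ q)
      = 𝒱.vect (PowerSeries.derivative ℂ p * q) - 𝒱.vect (PowerSeries.derivative ℂ q * p) := by
    rw [← vectₗ_apply, map_sub, mul_comm p]
    rfl
  rw [h3, LinearMap.sub_apply, 𝒱.vect_derivative_mul h1, 𝒱.vect_derivative_mul h1, h2, h2,
    Finset.sum_comm (f := fun a b => (coeff a q * coeff b p) • 𝒱.L (a - 1) (𝒱.L (b - 1) v)),
    Finset.sum_comm (f := fun (a b : ℕ) => ((a : ℂ) * (coeff a q * coeff b p)) •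
      𝒱.L (a + b - 2) v)]
  simp only [← Finset.sum_sub_distrib]
  refine Finset.sum_congr rfl fun a _ => Finset.sum_congr rfl fun b _ => ?_
  have h4 := 𝒱.L_commutator (m := a - 1) (n := b - 1) (by omega) (by omega) v
  rw [show ((a : ℤ) - 1 + (b - 1)) = a + b - 2 by ring] at h4
  rw [show ((b : ℤ) + a - 2) = a + b - 2 by ring, mul_comm (coeff b q), ← smul_sub, h4, smul_smul,
    ← sub_smul]
  push_cast
  congr 1
  ring

theorem vect_one : 𝒱.vect 1 = 𝒱.L (-1) := by
  ext v
  obtain ⟨K, hK⟩ := 𝒱.exists_vect_apply v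
  rw [hK (K + 1) (by omega), Finset.sum_range_succ', Finset.sum_eq_zero]
  · simp
  · intro i _
    simp [coeff_one]

theorem vect_X : 𝒱.vect X = 𝒱.L 0 := by
  ext v
  obtain ⟨K, hK⟩ := 𝒱.exists_vect_apply v
  rw [hK (K + 2) (by omega), Finset.sum_range_succ', Finset.sum_range_succ', Finset.sum_eq_zero]
  · simp [coeff_X]
  · intro i _
    simp [coeff_X]

theorem LPlus_eq_vect : 𝒱.LPlus = 𝒱.vect coordField := by
  ext v
  obtain ⟨n, hn⟩ := 𝒱.exists_mem_fil v
  obtain ⟨K, hK⟩ := 𝒱.exists_L_eq_zero n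
  rw [𝒱.vect_apply (K := K + 2) _ fun j hj => hK v hn j (by push_cast at hj; omega)]
  change ∑ᶠ j : ℕ, (coordCoeff (j + 1) • 𝒱.L (j + 1)) v = _
  rw [finsum_nat_eq_sum_range (K := K), Finset.sum_range_succ', Finset.sum_range_succ']
  · simp only [coordField, coeff_mk]
    simp only [zero_lt_two, if_true, zero_smul, add_zero, zero_add, one_lt_two]
    refine Finset.sum_congr rfl fun j _ => ?_
    rw [if_neg (by omega), LinearMap.smul_apply]
    push_cast
    congr 3
    ring
  · intro j hj
    rw [LinearMap.smul_apply, hK v hn _ (by omega), smul_zero]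

/-! ### The operator `exp(-L_+)` and the translation operator -/

/-- The `k`-th term of the exponential series of `- L_+`. -/
def expLTerm (k : ℕ) : Module.End ℂ V := ((-1 : ℂ) ^ k / k.factorial) • 𝒱.LPlus ^ k

@[simp]
theorem expLTerm_zero : 𝒱.expLTerm 0 = 1 := by simp [expLTerm]

theorem expLTerm_succ (k : ℕ) : ((k : ℂ) + 1) • 𝒱.expLTerm (k + 1)
    = -(𝒱.LPlus * 𝒱.expLTerm k) := by
  simp only [expLTerm, smul_smul, succ_smul_coeff_succ, pow_succ' 𝒱.LPlus, neg_smul,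
    mul_smul_comm]

theorem expLTerm_mem_fil (k : ℕ) {n : ℤ} {v : V} (hv : v ∈ 𝒱.fil n) :
    𝒱.expLTerm k v ∈ 𝒱.fil (n - k) :=
  Submodule.smul_mem _ _ (𝒱.LPlus_pow_mem k hv)

theorem expNegLPlus_apply {v : V} {K : ℕ} (hK : ∀ k, K ≤ k → 𝒱.expLTerm k v = 0) :
    𝒱.expNegLPlus v = ∑ k ∈ Finset.range K, 𝒱.expLTerm k v :=
  finsum_nat_eq_sum_range hK

theorem exists_expLTerm_eq_zero (n : ℤ) :
    ∃ K : ℕ, ∀ v ∈ 𝒱.fil n, ∀ k, K ≤ k → 𝒱.expLTerm k v = 0 := by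
  obtain ⟨N, hN⟩ := 𝒱.exists_fil_eq_bot
  refine ⟨(n - N + 1).toNat, fun v hv k hk => ?_⟩
  have h := 𝒱.expLTerm_mem_fil k hv
  rwa [hN _ (by omega), Submodule.mem_bot] at h

theorem expNegLPlus_mem_fil {n : ℤ} {v : V} (hv : v ∈ 𝒱.fil n) : 𝒱.expNegLPlus v ∈ 𝒱.fil n := by
  obtain ⟨K, hK⟩ := 𝒱.exists_expLTerm_eq_zero n
  rw [𝒱.expNegLPlus_apply (hK v hv)]
  exact Submodule.sum_mem _ fun k _ => 𝒱.fil_mono (by omega) (𝒱.expLTerm_mem_fil k hv)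

theorem expLTerm_L_neg_one (k : ℕ) (v : V) : 𝒱.expLTerm k (𝒱.L (-1) v)
    = ∑ x ∈ antidiagonal k, 𝒱.vect ((x.1.factorial : ℂ)⁻¹ • lieIterate coordField x.1)
      (𝒱.expLTerm x.2 v) := by
  induction k with
  | zero => simp [lieIterate, vect_one]
  | succ k ih =>
    have h' : (k : ℂ) + 1 ≠ 0 := by exact_mod_cast k.succ_ne_zero
    apply smul_right_injective _ h'
    change ((k : ℂ) + 1) • _ = ((k : ℂ) + 1) • _
    rw [← sum_antidiagonal_succ_smul (fun a b =>
      𝒱.vect ((a.factorial : ℂ)⁻¹ • lieIterate coordField a) (𝒱.expLTerm b v)),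
      ← LinearMap.smul_apply, expLTerm_succ, LinearMap.neg_apply, Module.End.mul_apply, ih,
      map_sum, ← Finset.sum_neg_distrib]
    refine Finset.sum_congr rfl fun x _ => ?_
    have e1 : ∀ p y, ((x.1 : ℂ) + 1) • 𝒱.vect (((x.1 + 1).factorial : ℂ)⁻¹ • p) y
        = 𝒱.vect ((x.1.factorial : ℂ)⁻¹ • p) y := fun p y => by
      rw [← LinearMap.smul_apply, ← vect_smul, smul_smul, succ_mul_inv_factorial]
    have e2 : ∀ p, ((x.2 : ℂ) + 1) • 𝒱.vect p (𝒱.expLTerm (x.2 + 1) v)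
        = -𝒱.vect p (𝒱.LPlus (𝒱.expLTerm x.2 v)) := fun p => by
      rw [← map_smul, ← LinearMap.smul_apply, expLTerm_succ, LinearMap.neg_apply, map_neg]
      rfl
    rw [e1, e2]
    set q := lieIterate coordField x.1 with hq
    have h1 := 𝒱.vect_commutator coordField q (𝒱.expLTerm x.2 v)
    have h2 : lieIterate coordField (x.1 + 1)
        = -(PowerSeries.derivative ℂ coordField * q - coordField * PowerSeries.derivative ℂ q) := by
      rw [hq]
      simp only [lieIterate]
      ring
    rw [h2, smul_neg, ← vectₗ_apply 𝒱 (-_), map_neg, vectₗ_apply, LinearMap.neg_apply]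
    have e3 : ∀ (r : ℂ) p y, 𝒱.vect (r • p) y = r • 𝒱.vect p y := fun r p y => by
      rw [vect_smul, LinearMap.smul_apply]
    rw [e3, e3, e3, ← h1, LPlus_eq_vect, map_smul, smul_sub]
    abel

/-- Conjugation with `exp(-L_+)` maps `L(-1)` to `L(-1) + 2 π i L(0)`. -/
theorem expNegLPlus_L_neg_one (v : V) : 𝒱.expNegLPlus (𝒱.L (-1) v)
    = 𝒱.L (-1) (𝒱.expNegLPlus v) + twoPiI • 𝒱.L 0 (𝒱.expNegLPlus v) := by
  obtain ⟨n, hn⟩ := 𝒱.exists_mem_fil v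
  obtain ⟨N, hN⟩ := 𝒱.exists_fil_eq_bot
  obtain ⟨K₁, h₁⟩ := 𝒱.exists_expLTerm_eq_zero (n + 1)
  obtain ⟨K₂, h₂⟩ := 𝒱.exists_L_eq_zero n
  set K := K₁ + K₂ + (n - N + 2).toNat with hK
  have hL : 𝒱.L (-1) v ∈ 𝒱.fil (n + 1) := 𝒱.fil_mono (by omega) (𝒱.L_mem_fil (-1) hn)
  have hE := 𝒱.expNegLPlus_apply (K := K) fun k hk =>
    h₁ v (𝒱.fil_mono (by omega) hn) k (by omega)
  rw [𝒱.expNegLPlus_apply (K := K) fun k hk => h₁ _ hL k (by omega)]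
  simp only [expLTerm_L_neg_one]
  rw [← sum_range_sum_range_eq_antidiagonal (f := fun a b =>
    𝒱.vect ((a.factorial : ℂ)⁻¹ • lieIterate coordField a) (𝒱.expLTerm b v))]
  · simp only [← map_sum, ← hE, ← LinearMap.sum_apply]
    simp only [← vectₗ_apply, ← map_sum]
    rw [vectₗ_apply, 𝒱.vect_apply (K := K) _ fun j hj =>
      h₂ _ (𝒱.expNegLPlus_mem_fil hn) j (by omega)]
    have h3 := sum_lieIterate X_sq_dvd_coordField derivative_coordSeries
      (X_pow_dvd_sum_expTerm_sub K)
    rw [X_pow_dvd_iff] at h3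
    have h4 : ∀ m ∈ Finset.range K, coeff m (∑ k ∈ Finset.range K,
        ((k.factorial : ℂ)⁻¹ • lieIterate coordField k)) • 𝒱.L (m - 1) (𝒱.expNegLPlus v)
        = coeff m (1 + C twoPiI * X : PowerSeries ℂ) • 𝒱.L (m - 1) (𝒱.expNegLPlus v) := by
      intro m hm
      rw [sub_eq_zero.mp ((map_sub _ _ _).symm.trans (h3 m (Finset.mem_range.mp hm)))]
    rw [Finset.sum_congr rfl h4, ← 𝒱.vect_apply (K := K) _ fun j hj =>
      h₂ _ (𝒱.expNegLPlus_mem_fil hn) j (by omega), ← smul_eq_C_mul, vect_add, vect_smul, vect_one,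
      vect_X]
    rfl
  · intro a b hab
    have h5 := 𝒱.vect_mem_fil (dvd_smul_of_dvd ((a.factorial : ℂ)⁻¹)
      (X_pow_dvd_lieIterate X_sq_dvd_coordField a)) (𝒱.expLTerm_mem_fil b hn)
    rwa [hN _ (by omega), Submodule.mem_bot] at h5

end VertexOperatorAlgebra

end

end TwistedZhu

namespace TwistedZhu

noncomputable section

open Finset.HasAntidiagonal (antidiagonal mem_antidiagonal)

namespace VertexOperatorAlgebra

open PowerSeries

variable {V : Type*} [AddCommGroup V] [Module ℂ V] (𝒱 : VertexOperatorAlgebra V)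

/-! ### Conjugation of modes with `exp(-L_+)` -/

/-- The bracket `T ↦ [T, L(-1)]`. -/
def translAd : Module.End ℂ (Module.End ℂ V) :=
  LinearMap.mulRight ℂ (𝒱.L (-1)) - LinearMap.mulLeft ℂ (𝒱.L (-1))

theorem translAd_apply (T : Module.End ℂ V) :
    𝒱.translAd T = T * 𝒱.L (-1) - 𝒱.L (-1) * T := rfl

/-- The coefficient of `x ^ k` in `exp(-x L(-1)) T exp(x L(-1))`. -/
def translCoeff (k : ℕ) : Module.End ℂ (Module.End ℂ V) :=
  (k.factorial : ℂ)⁻¹ • 𝒱.translAd ^ k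

@[simp]
theorem translCoeff_zero (T : Module.End ℂ V) : 𝒱.translCoeff 0 T = T := by simp [translCoeff]

theorem translCoeff_succ (k : ℕ) (T : Module.End ℂ V) :
    ((k : ℂ) + 1) • 𝒱.translCoeff (k + 1) T
      = 𝒱.translCoeff k T * 𝒱.L (-1) - 𝒱.L (-1) * 𝒱.translCoeff k T := by
  rw [translCoeff, LinearMap.smul_apply, smul_smul, succ_mul_inv_factorial, pow_succ',
    Module.End.mul_apply, ← map_smul, translAd_apply]
  rfl

theorem translCoeff_mul (k : ℕ) (S T : Module.End ℂ V) : 𝒱.translCoeff k (S * T)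
    = ∑ x ∈ antidiagonal k, 𝒱.translCoeff x.1 S * 𝒱.translCoeff x.2 T := by
  induction k with
  | zero => simp
  | succ k ih =>
    have h' : (k : ℂ) + 1 ≠ 0 := by exact_mod_cast k.succ_ne_zero
    apply smul_right_injective _ h'
    change ((k : ℂ) + 1) • _ = ((k : ℂ) + 1) • _
    rw [← sum_antidiagonal_succ_smul (fun a b => 𝒱.translCoeff a S * 𝒱.translCoeff b T),
      translCoeff_succ, ih, Finset.sum_mul, Finset.mul_sum, ← Finset.sum_sub_distrib]
    refine Finset.sum_congr rfl fun x _ => ?_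
    rw [← smul_mul_assoc, ← mul_smul_comm, translCoeff_succ, translCoeff_succ]
    noncomm_ring

/-- The Taylor coefficient `p^(k) / k!` of a power series. -/
def taylorCoeff (p : PowerSeries ℂ) (k : ℕ) : PowerSeries ℂ :=
  PowerSeries.mk fun i => ((i + k).choose k : ℂ) * coeff (i + k) p

theorem taylorCoeff_succ (p : PowerSeries ℂ) (k : ℕ) :
    ((k : ℂ) + 1) • taylorCoeff p (k + 1) = PowerSeries.derivative ℂ (taylorCoeff p k) := by
  ext i
  rw [coeff_smul, coeff_derivative, taylorCoeff, taylorCoeff, coeff_mk, coeff_mk, smul_eq_mul,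
    show i + (k + 1) = i + 1 + k by ring]
  have h : ((i + 1 + k).choose (k + 1) : ℂ) * (k + 1) = ((i + 1 + k).choose k : ℂ) * (i + 1) := by
    have := Nat.choose_succ_right_eq (i + 1 + k) k
    rw [Nat.add_sub_cancel] at this
    exact_mod_cast this
  linear_combination coeff (i + 1 + k) p * h

theorem translCoeff_vect (p : PowerSeries ℂ) (k : ℕ) :
    𝒱.translCoeff k (𝒱.vect p) = 𝒱.vect (taylorCoeff p k) := by
  induction k with
  | zero =>
    rw [translCoeff_zero]
    congr 1
    ext i
    simp [taylorCoeff]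
  | succ k ih =>
    have h' : (k : ℂ) + 1 ≠ 0 := by exact_mod_cast k.succ_ne_zero
    apply smul_right_injective _ h'
    change ((k : ℂ) + 1) • _ = ((k : ℂ) + 1) • _
    rw [translCoeff_succ, ih, ← vect_smul, taylorCoeff_succ]
    ext v
    have := 𝒱.vect_commutator (taylorCoeff p k) 1 v
    rw [Derivation.map_one_eq_zero, mul_zero, sub_zero, mul_one, vect_one] at this
    exact this

theorem L_mode_commutator (n : ℕ) (u v : V) (m : ℤ) :
    𝒱.L (n - 1) (𝒱.mode u m v) - 𝒱.mode u m (𝒱.L (n - 1) v)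
      = ∑ x ∈ antidiagonal n, (((x.1 + x.2).choose x.2 : ℕ) : ℂ) •
        𝒱.mode (𝒱.L (x.1 - 1) u) (m + x.2) v := by
  have h := 𝒱.mode_commutator 𝒱.conf u v n m
  rw [finsum_nat_eq_sum_range (K := n + 1)] at h
  · rw [Finset.Nat.sum_antidiagonal_eq_sum_range_succ (f := fun a b =>
      (((a + b).choose b : ℕ) : ℂ) • 𝒱.mode (𝒱.L (a - 1) u) (m + b) v)]
    simp only [L, sub_add_cancel]
    rw [h]
    refine Finset.sum_congr rfl fun i hi => ?_
    have hi' : i ≤ n := Nat.lt_succ_iff.mp (Finset.mem_range.mp hi)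
    rw [Ring.choose_natCast, Int.cast_natCast, Nat.add_sub_cancel' hi', Nat.choose_symm hi',
      show (n : ℤ) + m - i = m + (n - i : ℕ) by omega]
  · intro i hi
    rw [Ring.choose_natCast, Nat.choose_eq_zero_of_lt (by omega)]
    simp

/-- The commutator of the action of a vector field with a mode, uniformly on filtration pieces. -/
theorem exists_vect_mode_commutator (p : PowerSeries ℂ) (a b m : ℤ) : ∃ K₀ : ℕ, ∀ K, K₀ ≤ K →
    ∀ u ∈ 𝒱.fil a, ∀ v ∈ 𝒱.fil b, ∀ m', m ≤ m' →
      𝒱.vect p (𝒱.mode u m' v) - 𝒱.mode u m' (𝒱.vect p v)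
        = ∑ k ∈ Finset.range K, 𝒱.mode (𝒱.translCoeff k (𝒱.vect p) u) (m' + k) v := by
  obtain ⟨K₁, h₁⟩ := 𝒱.exists_L_eq_zero a
  obtain ⟨K₂, h₂⟩ := 𝒱.exists_L_eq_zero b
  obtain ⟨K₃, h₃⟩ := 𝒱.exists_L_eq_zero (a + b - m - 1)
  obtain ⟨N, hN⟩ := 𝒱.exists_fil_eq_bot
  refine ⟨K₁ + K₂ + K₃ + (a + b - m - N + 1).toNat, fun K hK u hu v hv m' hm' => ?_⟩
  rw [𝒱.vect_apply (K := K) p fun j hj => h₂ v hv j (by omega),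
    𝒱.vect_apply (K := K) p fun j hj => h₃ _ (𝒱.fil_mono (by omega) (𝒱.mode_mem_fil hu hv m')) j
      (by omega), map_sum, ← Finset.sum_sub_distrib]
  simp only [map_smul, ← smul_sub, L_mode_commutator, translCoeff_vect]
  have e : ∀ k : ℕ, 𝒱.mode (𝒱.vect (taylorCoeff p k) u) (m' + k) v
      = ∑ i ∈ Finset.range K, coeff (i + k) p • (((i + k).choose k : ℕ) : ℂ) •
        𝒱.mode (𝒱.L (i - 1) u) (m' + k) v := by
    intro k
    rw [𝒱.vect_apply (K := K) _ fun j hj => h₁ u hu j (by omega), mode_sum, LinearMap.sum_apply]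
    refine Finset.sum_congr rfl fun i _ => ?_
    rw [mode_smul, LinearMap.smul_apply, smul_smul, taylorCoeff, coeff_mk, mul_comm]
  simp only [e]
  rw [Finset.sum_comm, sum_range_sum_range_eq_antidiagonal (f := fun i k =>
    coeff (i + k) p • (((i + k).choose k : ℕ) : ℂ) • 𝒱.mode (𝒱.L (i - 1) u) (m' + k) v)]
  · refine Finset.sum_congr rfl fun n _ => ?_
    rw [Finset.smul_sum]
    refine Finset.sum_congr rfl fun x hx => ?_
    rw [mem_antidiagonal.mp hx]
  · intro i k hik
    have h := 𝒱.mode_mem_fil (𝒱.L_mem_fil (i - 1) hu) hv (m' + k)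
    rw [hN _ (by omega), Submodule.mem_bot] at h
    rw [h, smul_zero, smul_zero]

theorem translCoeff_mem_fil {T : Module.End ℂ V} {s : ℤ}
    (hT : ∀ n, ∀ v ∈ 𝒱.fil n, T v ∈ 𝒱.fil (n + s)) (k : ℕ) :
    ∀ n, ∀ v ∈ 𝒱.fil n, 𝒱.translCoeff k T v ∈ 𝒱.fil (n + s + k) := by
  induction k with
  | zero => simpa using hT
  | succ k ih =>
    intro n v hv
    have h' : (k : ℂ) + 1 ≠ 0 := by exact_mod_cast k.succ_ne_zero
    have h := LinearMap.congr_fun (𝒱.translCoeff_succ k T) v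
    rw [LinearMap.smul_apply, ← eq_inv_smul_iff₀ h'] at h
    rw [h]
    refine Submodule.smul_mem _ _ (Submodule.sub_mem _ ?_ ?_)
    · exact 𝒱.fil_mono (by push_cast; omega) (ih _ _ (𝒱.L_mem_fil (-1) hv))
    · exact 𝒱.fil_mono (by push_cast; omega) (𝒱.L_mem_fil (-1) (ih _ _ hv))

theorem translCoeff_expLTerm_succ (k a : ℕ) :
    ((a : ℂ) + 1) • 𝒱.translCoeff k (𝒱.expLTerm (a + 1))
      = -∑ x ∈ antidiagonal k, 𝒱.translCoeff x.1 𝒱.LPlus * 𝒱.translCoeff x.2 (𝒱.expLTerm a) := by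
  rw [← map_smul, expLTerm_succ, map_neg, translCoeff_mul]

theorem translCoeff_expLTerm_mem_fil (k a : ℕ) {n : ℤ} {v : V} (hv : v ∈ 𝒱.fil n) :
    𝒱.translCoeff k (𝒱.expLTerm a) v ∈ 𝒱.fil (n - a + k) := by
  have := 𝒱.translCoeff_mem_fil (T := 𝒱.expLTerm a) (s := -a)
    (fun n v hv => by simpa [sub_eq_add_neg] using 𝒱.expLTerm_mem_fil a hv) k n v hv
  rwa [← sub_eq_add_neg] at this

theorem translCoeff_LPlus_mem_fil (k : ℕ) {n : ℤ} {v : V} (hv : v ∈ 𝒱.fil n) :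
    𝒱.translCoeff k 𝒱.LPlus v ∈ 𝒱.fil (n + 1) := by
  rw [LPlus_eq_vect, translCoeff_vect]
  exact 𝒱.fil_mono (by simp) (𝒱.vect_mem_fil (a := 0) (by simp) hv)

/-- A bound for the weights in `translCoeff k (expLTerm a) v` that is uniform in `k`. -/
theorem translCoeff_expLTerm_mem_fil_add (a : ℕ) : ∀ (k : ℕ) {n : ℤ} {v : V}, v ∈ 𝒱.fil n →
    𝒱.translCoeff k (𝒱.expLTerm a) v ∈ 𝒱.fil (n + a) := by
  induction a with
  | zero =>
    intro k n v hv
    rcases k with _ | k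
    · simpa using hv
    · have : 𝒱.translCoeff (k + 1) (1 : Module.End ℂ V) = 0 := by
        rw [translCoeff, LinearMap.smul_apply, pow_succ, Module.End.mul_apply, translAd_apply]
        simp
      simp [this]
  | succ a ih =>
    intro k n v hv
    have h' : (a : ℂ) + 1 ≠ 0 := by exact_mod_cast a.succ_ne_zero
    have h := LinearMap.congr_fun (𝒱.translCoeff_expLTerm_succ k a) v
    rw [LinearMap.smul_apply, ← eq_inv_smul_iff₀ h'] at h
    rw [h, LinearMap.neg_apply, LinearMap.sum_apply]
    refine Submodule.smul_mem _ _ (Submodule.neg_mem _ (Submodule.sum_mem _ fun x _ => ?_))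
    exact 𝒱.fil_mono (by push_cast; omega) (𝒱.translCoeff_LPlus_mem_fil x.1 (ih x.2 hv))

theorem expLTerm_mode (u v : V) (m : ℤ) (i : ℕ) : ∃ K₀ : ℕ, ∀ K, K₀ ≤ K →
    𝒱.expLTerm i (𝒱.mode u m v) = ∑ x ∈ antidiagonal i, ∑ k ∈ Finset.range K,
      𝒱.mode (𝒱.translCoeff k (𝒱.expLTerm x.1) u) (m + k) (𝒱.expLTerm x.2 v) := by
  obtain ⟨nu, hu⟩ := 𝒱.exists_mem_fil u
  obtain ⟨nv, hv⟩ := 𝒱.exists_mem_fil v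
  obtain ⟨N, hN⟩ := 𝒱.exists_fil_eq_bot
  induction i with
  | zero =>
    refine ⟨1, fun K hK => ?_⟩
    obtain ⟨K, rfl⟩ := Nat.exists_eq_add_of_le' hK
    have : ∀ k, 𝒱.translCoeff (k + 1) (1 : Module.End ℂ V) = 0 := fun k => by
      rw [translCoeff, LinearMap.smul_apply, pow_succ, Module.End.mul_apply, translAd_apply]
      simp
    simp [Finset.sum_range_succ', this]
  | succ i ih =>
    obtain ⟨K₁, h₁⟩ := ih
    obtain ⟨K₂, h₂⟩ := 𝒱.exists_vect_mode_commutator coordField (nu + i) nv m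
    refine ⟨K₁ + K₂ + (nu + i + 1 + nv - m - N).toNat, fun K hK => ?_⟩
    have h' : (i : ℂ) + 1 ≠ 0 := by exact_mod_cast i.succ_ne_zero
    apply smul_right_injective _ h'
    change ((i : ℂ) + 1) • _ = ((i : ℂ) + 1) • _
    rw [← sum_antidiagonal_succ_smul (fun a b => ∑ k ∈ Finset.range K,
      𝒱.mode (𝒱.translCoeff k (𝒱.expLTerm a) u) (m + k) (𝒱.expLTerm b v)),
      ← LinearMap.smul_apply, expLTerm_succ, LinearMap.neg_apply, Module.End.mul_apply,
      h₁ K (by omega), map_sum, ← Finset.sum_neg_distrib]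
    refine Finset.sum_congr rfl fun x hx => ?_
    have hx1 : x.1 ≤ i := by have := mem_antidiagonal.mp hx; omega
    set y := 𝒱.expLTerm x.2 v with hy
    have hyv : y ∈ 𝒱.fil nv := 𝒱.fil_mono (by omega) (𝒱.expLTerm_mem_fil x.2 hv)
    have e1 : ∀ k, ((x.2 : ℂ) + 1) • 𝒱.mode (𝒱.translCoeff k (𝒱.expLTerm x.1) u) (m + k)
        (𝒱.expLTerm (x.2 + 1) v)
        = -𝒱.mode (𝒱.translCoeff k (𝒱.expLTerm x.1) u) (m + k) (𝒱.LPlus y) := by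
      intro k
      rw [← map_smul, ← LinearMap.smul_apply, expLTerm_succ, LinearMap.neg_apply, map_neg]
      rfl
    have e2 : ∀ k, ((x.1 : ℂ) + 1) • 𝒱.mode (𝒱.translCoeff k (𝒱.expLTerm (x.1 + 1)) u) (m + k) y
        = -∑ z ∈ antidiagonal k, 𝒱.mode (𝒱.translCoeff z.1 𝒱.LPlus
          (𝒱.translCoeff z.2 (𝒱.expLTerm x.1) u)) (m + z.2 + z.1) y := by
      intro k
      rw [← LinearMap.smul_apply, ← mode_smul, ← LinearMap.smul_apply, translCoeff_expLTerm_succ,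
        LinearMap.neg_apply, LinearMap.sum_apply, ← modeₗ_apply, map_neg, map_sum,
        LinearMap.neg_apply, LinearMap.sum_apply]
      congr 1
      refine Finset.sum_congr rfl fun z hz => ?_
      rw [← mem_antidiagonal.mp hz, modeₗ_apply, Module.End.mul_apply,
        show m + ((z.1 + z.2 : ℕ) : ℤ) = m + z.2 + z.1 by push_cast; ring]
    rw [Finset.smul_sum, Finset.smul_sum]
    simp only [e1, e2, Finset.sum_neg_distrib]
    rw [← sum_range_sum_range_eq_antidiagonal (f := fun l k => 𝒱.mode (𝒱.translCoeff l 𝒱.LPlus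
          (𝒱.translCoeff k (𝒱.expLTerm x.1) u)) (m + k + l) y), Finset.sum_comm, ← neg_add,
      ← Finset.sum_add_distrib, map_sum]
    · congr 1
      refine Finset.sum_congr rfl fun k _ => ?_
      have := h₂ K (by omega) (𝒱.translCoeff k (𝒱.expLTerm x.1) u)
        (𝒱.fil_mono (by omega) (𝒱.translCoeff_expLTerm_mem_fil_add x.1 k hu)) y hyv (m + k)
        (by omega)
      rw [LPlus_eq_vect, ← sub_eq_iff_eq_add.mp this]
    · intro l k hlk
      have h := 𝒱.mode_mem_fil (𝒱.translCoeff_LPlus_mem_fil l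
        (𝒱.translCoeff_expLTerm_mem_fil_add x.1 k hu)) hyv (m + k + l)
      rwa [hN _ (by omega), Submodule.mem_bot] at h

theorem translCoeff_expNegLPlus (k : ℕ) (v : V) : ∃ I₀ : ℕ, ∀ I, I₀ ≤ I →
    𝒱.translCoeff k 𝒱.expNegLPlus v
      = ∑ a ∈ Finset.range I, 𝒱.translCoeff k (𝒱.expLTerm a) v := by
  induction k generalizing v with
  | zero =>
    obtain ⟨n, hn⟩ := 𝒱.exists_mem_fil v
    obtain ⟨K, hK⟩ := 𝒱.exists_expLTerm_eq_zero n
    refine ⟨K, fun I hI => ?_⟩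
    simp only [translCoeff_zero]
    exact 𝒱.expNegLPlus_apply fun k hk => hK v hn k (by omega)
  | succ k ih =>
    obtain ⟨I₁, h₁⟩ := ih v
    obtain ⟨I₂, h₂⟩ := ih (𝒱.L (-1) v)
    refine ⟨I₁ + I₂, fun I hI => ?_⟩
    have h' : (k : ℂ) + 1 ≠ 0 := by exact_mod_cast k.succ_ne_zero
    apply smul_right_injective _ h'
    change ((k : ℂ) + 1) • _ = ((k : ℂ) + 1) • _
    have e : ∀ T, ((k : ℂ) + 1) • 𝒱.translCoeff (k + 1) T v
        = 𝒱.translCoeff k T (𝒱.L (-1) v) - 𝒱.L (-1) (𝒱.translCoeff k T v) := fun T =>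
      LinearMap.congr_fun (𝒱.translCoeff_succ k T) v
    simp only [Finset.smul_sum, e]
    rw [h₁ I (by omega), h₂ I (by omega), map_sum, Finset.sum_sub_distrib]

/-- `exp(-L_+) Y(u, x) exp(L_+) = Y(exp(-x L(-1)) exp(-L_+) exp(x L(-1)) u, x)`, in components. -/
theorem expNegLPlus_mode_translCoeff (u v : V) (m : ℤ) : ∃ K₀ : ℕ, ∀ K, K₀ ≤ K →
    𝒱.expNegLPlus (𝒱.mode u m v) = ∑ k ∈ Finset.range K,
      𝒱.mode (𝒱.translCoeff k 𝒱.expNegLPlus u) (m + k) (𝒱.expNegLPlus v) := by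
  obtain ⟨nu, hu⟩ := 𝒱.exists_mem_fil u
  obtain ⟨nv, hv⟩ := 𝒱.exists_mem_fil v
  obtain ⟨N, hN⟩ := 𝒱.exists_fil_eq_bot
  obtain ⟨I₁, h₁⟩ := 𝒱.exists_expLTerm_eq_zero nv
  obtain ⟨I₂, h₂⟩ := 𝒱.exists_expLTerm_eq_zero (nu + nv - m - 1)
  choose K hK using fun i => 𝒱.expLTerm_mode u v m i
  choose J hJ using fun k => 𝒱.translCoeff_expNegLPlus k u
  set I := I₁ + I₂ + (nu + nv - m - N).toNat with hI
  refine ⟨∑ i ∈ Finset.range I, K i + (nu + I + nv - m - N).toNat, fun R hR => ?_⟩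
  set I' := I + ∑ k ∈ Finset.range R, J k with hI'
  have hz : ∀ a b k : ℕ, I ≤ a + b → 𝒱.mode (𝒱.translCoeff k (𝒱.expLTerm a) u) (m + k)
      (𝒱.expLTerm b v) = 0 := by
    intro a b k hab
    have h := 𝒱.mode_mem_fil (𝒱.translCoeff_expLTerm_mem_fil k a hu) (𝒱.expLTerm_mem_fil b hv)
      (m + k)
    rwa [hN _ (by omega), Submodule.mem_bot] at h
  have e1 : ∀ i ∈ Finset.range I', 𝒱.expLTerm i (𝒱.mode u m v)
      = ∑ x ∈ antidiagonal i, ∑ k ∈ Finset.range R,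
        𝒱.mode (𝒱.translCoeff k (𝒱.expLTerm x.1) u) (m + k) (𝒱.expLTerm x.2 v) := by
    intro i _
    by_cases hi : i < I
    · refine hK i R (le_trans ?_ (le_trans (Nat.le_add_right _ _) hR))
      exact Finset.single_le_sum (f := K) (fun _ _ => Nat.zero_le _) (Finset.mem_range.mpr hi)
    · rw [h₂ _ (𝒱.mode_mem_fil hu hv m) i (by omega)]
      symm
      refine Finset.sum_eq_zero fun x hx => Finset.sum_eq_zero fun k _ => hz _ _ _ ?_
      rw [mem_antidiagonal.mp hx]
      omega
  rw [𝒱.expNegLPlus_apply (K := I') fun k hk => h₂ _ (𝒱.mode_mem_fil hu hv m) k (by omega),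
    Finset.sum_congr rfl e1, ← sum_range_sum_range_eq_antidiagonal (f := fun a b =>
      ∑ k ∈ Finset.range R,
        𝒱.mode (𝒱.translCoeff k (𝒱.expLTerm a) u) (m + k) (𝒱.expLTerm b v))]
  · simp only [Finset.sum_comm (t := Finset.range R)]
    refine Finset.sum_congr rfl fun k hk => ?_
    have hJk : J k ≤ I' := le_trans
      (Finset.single_le_sum (f := J) (fun _ _ => Nat.zero_le _) hk) (Nat.le_add_left _ _)
    rw [hJ k I' hJk, 𝒱.expNegLPlus_apply (K := I') fun k hk => h₁ _ hv k (by omega), mode_sum,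
      LinearMap.sum_apply]
    simp only [map_sum]
  · intro a b hab
    exact Finset.sum_eq_zero fun k _ => hz _ _ _ (by omega)

/-- The exponential series `e ^ (2 π i m x)`. -/
def expSeries (m : ℤ) : PowerSeries ℂ := rescale (twoPiI * m) (exp ℂ)

theorem derivative_expSeries (m : ℤ) :
    PowerSeries.derivative ℂ (expSeries m) = (twoPiI * m) • expSeries m := by
  ext n
  have h : (n.factorial : ℂ) ≠ 0 := by exact_mod_cast n.factorial_ne_zero
  have h' : (n : ℂ) + 1 ≠ 0 := by exact_mod_cast n.succ_ne_zero
  rw [coeff_derivative, coeff_smul, expSeries, coeff_rescale, coeff_rescale, coeff_exp, coeff_exp,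
    Nat.factorial_succ]
  simp only [smul_eq_mul, map_div₀, map_one, map_natCast, pow_succ]
  push_cast
  field_simp

theorem expSeries_add (m n : ℤ) : expSeries (m + n) = expSeries m * expSeries n := by
  rw [expSeries, expSeries, expSeries, exp_mul_exp_eq_exp_add]
  congr 1
  push_cast
  ring_nf

theorem expSeries_zero : expSeries 0 = 1 := by
  rw [expSeries, Int.cast_zero, mul_zero, rescale_zero]
  simp

theorem one_add_mul_coordSeries : 1 + C twoPiI * coordSeries = expSeries 1 := by
  ext n
  have h0 := twoPiI_ne_zero
  rw [map_add, coeff_C_mul, coordSeries, coeff_mk, expSeries, coeff_rescale, coeff_exp, coeff_one]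
  split_ifs with hn
  · subst hn
    simp
  · simp
    field_simp

/-- The series `(f(x) - x) ^ i / i! e ^ (2 π i m x)` for `f(x) = (e ^ (2 π i x) - 1) / (2 π i)`. -/
def transSeries (m : ℤ) (i : ℕ) : PowerSeries ℂ :=
  (i.factorial : ℂ)⁻¹ • ((coordSeries - X) ^ i * expSeries m)

theorem X_sq_dvd_coordSeries_sub : (X : PowerSeries ℂ) ^ 2 ∣ coordSeries - X := by
  rw [X_pow_dvd_iff]
  intro n hn
  have h0 := twoPiI_ne_zero
  have : n = 0 ∨ n = 1 := by omega
  rcases this with rfl | rfl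
  · simp [coordSeries]
  · simp [coordSeries, h0]

theorem coeff_transSeries_eq_zero (m : ℤ) {i k : ℕ} (h : k < 2 * i) :
    coeff k (transSeries m i) = 0 := by
  refine X_pow_dvd_iff.mp (dvd_smul_of_dvd _ (dvd_mul_of_dvd_left ?_ _)) k h
  rw [pow_mul]
  exact pow_dvd_pow_of_dvd X_sq_dvd_coordSeries_sub i

theorem derivative_transSeries_zero (m : ℤ) :
    PowerSeries.derivative ℂ (transSeries m 0) = (twoPiI * m) • transSeries m 0 := by
  simp [transSeries, derivative_expSeries]

theorem derivative_transSeries_succ (m : ℤ) (i : ℕ) :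
    PowerSeries.derivative ℂ (transSeries m (i + 1)) = transSeries (m + 1) i - transSeries m i
      + (twoPiI * m) • transSeries m (i + 1) := by
  have h' : (i : ℂ) + 1 ≠ 0 := by exact_mod_cast i.succ_ne_zero
  have h1 : PowerSeries.derivative ℂ (coordSeries - X) = expSeries 1 - 1 := by
    rw [map_sub, derivative_coordSeries, one_add_mul_coordSeries]
    simp
  have h2 : ((i + 1 : ℕ) : PowerSeries ℂ) = C ((i : ℂ) + 1) := by
    push_cast
    simp
  rw [transSeries, transSeries, transSeries, Derivation.map_smul, Derivation.leibniz,
    Derivation.leibniz_pow, h1, derivative_expSeries, expSeries_add]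
  rw [← succ_mul_inv_factorial i]
  simp only [smul_eq_C_mul, nsmul_eq_mul, smul_eq_mul, Nat.add_sub_cancel, h2, map_mul]
  ring

/-- The coefficient of `x ^ k` in `exp((f(x) - x) L(-1)) e ^ (2 π i x L(0))`. -/
def transOp (k : ℕ) : Module.End ℂ V :=
  byGrading 𝒱.wt 𝒱.wt_isInternal fun m =>
    ∑ i ∈ Finset.range (k + 1), coeff k (transSeries m i) • 𝒱.L (-1) ^ i

theorem transOp_apply {m : ℤ} {v : V} (hv : v ∈ 𝒱.wt m) {k I : ℕ} (hI : k < I) :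
    𝒱.transOp k v = ∑ i ∈ Finset.range I, coeff k (transSeries m i) • (𝒱.L (-1) ^ i) v := by
  rw [transOp, byGrading_apply _ _ _ hv, LinearMap.sum_apply]
  refine Finset.sum_subset (fun x hx => ?_) fun x _ hx => ?_
  · rw [Finset.mem_range] at *
    omega
  · rw [Finset.mem_range, not_lt] at hx
    rw [coeff_transSeries_eq_zero m (by omega), zero_smul]
    rfl

theorem transOp_zero (v : V) : 𝒱.transOp 0 v = v := by
  refine 𝒱.wt_induction (P := fun v => 𝒱.transOp 0 v = v) (by simp)
    (fun x y hx hy => by rw [map_add, hx, hy]) (fun m x hx => ?_) v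
  rw [𝒱.transOp_apply hx (I := 1) (by omega)]
  have h1 : constantCoeff (expSeries m) = 1 := by
    rw [← coeff_zero_eq_constantCoeff_apply, expSeries, coeff_rescale]
    simp
  simp [transSeries, h1]

theorem transOp_succ (k : ℕ) (v : V) : ((k : ℂ) + 1) • 𝒱.transOp (k + 1) v
    = 𝒱.transOp k (𝒱.L (-1) v + twoPiI • 𝒱.L 0 v) - 𝒱.L (-1) (𝒱.transOp k v) := by
  refine 𝒱.wt_induction (P := fun v => ((k : ℂ) + 1) • 𝒱.transOp (k + 1) v
    = 𝒱.transOp k (𝒱.L (-1) v + twoPiI • 𝒱.L 0 v) - 𝒱.L (-1) (𝒱.transOp k v)) (by simp)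
    (fun x y hx hy => by simp only [map_add, smul_add, hx, hy, add_sub_add_comm] at *; abel)
    (fun m x hx => ?_) v
  have hx' : 𝒱.L (-1) x ∈ 𝒱.wt (m + 1) := by simpa using 𝒱.L_mem_wt (j := -1) hx
  rw [map_add, map_smul, 𝒱.mem_wt.mp hx, map_smul, 𝒱.transOp_apply hx' (I := k + 1) (by omega),
    𝒱.transOp_apply hx (k := k + 1) (I := k + 1 + 1) (by omega)]
  have e0 : 𝒱.transOp k x = ∑ i ∈ Finset.range (k + 1),
      coeff k (transSeries m i) • (𝒱.L (-1) ^ i) x := 𝒱.transOp_apply hx (by omega)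
  have e1 : 𝒱.transOp k x = ∑ i ∈ Finset.range (k + 1 + 1),
      coeff k (transSeries m i) • (𝒱.L (-1) ^ i) x := 𝒱.transOp_apply hx (by omega)
  have e2 : ∀ i, ((k : ℂ) + 1) * coeff (k + 1) (transSeries m i)
      = coeff k (PowerSeries.derivative ℂ (transSeries m i)) := fun i => by
    rw [coeff_derivative, mul_comm]
  have e3 : 𝒱.L (-1) (𝒱.transOp k x) = ∑ i ∈ Finset.range (k + 1),
      coeff k (transSeries m i) • (𝒱.L (-1) ^ (i + 1)) x := by
    rw [e0, map_sum]
    refine Finset.sum_congr rfl fun i _ => ?_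
    rw [map_smul, pow_succ', Module.End.mul_apply]
  have e4 : ∀ i, (𝒱.L (-1) ^ i) (𝒱.L (-1) x) = (𝒱.L (-1) ^ (i + 1)) x := fun i => by
    rw [pow_succ, Module.End.mul_apply]
  rw [e3, e1, Finset.smul_sum, Finset.sum_range_succ' _ (k + 1), Finset.sum_range_succ' _ (k + 1)]
  simp only [e4, smul_smul, mul_assoc, e2, derivative_transSeries_zero, derivative_transSeries_succ, map_add,
    map_sub, coeff_smul, smul_eq_mul, add_smul, sub_smul, Finset.sum_add_distrib,
    Finset.sum_sub_distrib, Finset.smul_sum, smul_add]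
  abel

theorem translCoeff_expNegLPlus_eq (k : ℕ) (v : V) :
    𝒱.translCoeff k 𝒱.expNegLPlus v = 𝒱.transOp k (𝒱.expNegLPlus v) := by
  induction k generalizing v with
  | zero => rw [translCoeff_zero, transOp_zero]
  | succ k ih =>
    have h' : (k : ℂ) + 1 ≠ 0 := by exact_mod_cast k.succ_ne_zero
    apply smul_right_injective _ h'
    change ((k : ℂ) + 1) • _ = ((k : ℂ) + 1) • _
    rw [← LinearMap.smul_apply, translCoeff_succ, transOp_succ, LinearMap.sub_apply,
      Module.End.mul_apply, Module.End.mul_apply, ih, ih, expNegLPlus_L_neg_one]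

theorem expNegLPlus_mode (u v : V) (m : ℤ) : ∃ K₀ : ℕ, ∀ K, K₀ ≤ K →
    𝒱.expNegLPlus (𝒱.mode u m v) = ∑ k ∈ Finset.range K,
      𝒱.mode (𝒱.transOp k (𝒱.expNegLPlus u)) (m + k) (𝒱.expNegLPlus v) := by
  simpa only [translCoeff_expNegLPlus_eq] using 𝒱.expNegLPlus_mode_translCoeff u v m

end VertexOperatorAlgebra

end

end TwistedZhu

namespace TwistedZhu

noncomputable section

open Finset.HasAntidiagonal (antidiagonal mem_antidiagonal)

/-! ### Laurent series and the coordinate change -/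

section laurent

open HahnSeries (single ofPowerSeries C)

theorem coeff_C_mul (r : ℂ) (L : LaurentSeries ℂ) (c : ℤ) : (C r * L).coeff c = r * L.coeff c := by
  rw [HahnSeries.C_mul_eq_smul, HahnSeries.coeff_smul, smul_eq_mul]

/-- The Laurent series of order at least `d`. -/
def orderGe (d : ℤ) : Submodule ℂ (LaurentSeries ℂ) where
  carrier := {L | ∀ c < d, L.coeff c = 0}
  zero_mem' := fun _ _ => rfl
  add_mem' := fun hx hy c hc => by rw [HahnSeries.coeff_add, hx c hc, hy c hc, add_zero]
  smul_mem' := fun r x hx c hc => by rw [HahnSeries.coeff_smul, hx c hc, smul_zero]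

theorem mem_orderGe_iff {d : ℤ} {L : LaurentSeries ℂ} :
    L ∈ orderGe d ↔ ∃ p : PowerSeries ℂ, L = single d 1 * ofPowerSeries ℤ ℂ p := by
  constructor
  · intro h
    refine ⟨PowerSeries.mk fun n => L.coeff (d + n), ?_⟩
    ext c
    rw [HahnSeries.coeff_single_mul, one_mul, PowerSeries.coeff_coe]
    split_ifs with hc
    · exact h c (by omega)
    · rw [PowerSeries.coeff_mk]
      congr 1
      omega
  · rintro ⟨p, rfl⟩ c hc
    rw [HahnSeries.coeff_single_mul, one_mul, PowerSeries.coeff_coe, if_pos (by omega)]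

theorem mul_mem_orderGe {d e : ℤ} {L M : LaurentSeries ℂ} (hL : L ∈ orderGe d)
    (hM : M ∈ orderGe e) : L * M ∈ orderGe (d + e) := by
  obtain ⟨p, rfl⟩ := mem_orderGe_iff.mp hL
  obtain ⟨q, rfl⟩ := mem_orderGe_iff.mp hM
  refine mem_orderGe_iff.mpr ⟨p * q, ?_⟩
  rw [mul_mul_mul_comm, HahnSeries.single_mul_single, mul_one, map_mul]

theorem orderGe_mono {d e : ℤ} (h : d ≤ e) : orderGe e ≤ orderGe d := fun _ hL c hc =>
  hL c (by omega)

theorem ofPowerSeries_mem_orderGe (p : PowerSeries ℂ) : ofPowerSeries ℤ ℂ p ∈ orderGe 0 :=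
  mem_orderGe_iff.mpr ⟨p, by simp⟩

theorem one_mem_orderGe : (1 : LaurentSeries ℂ) ∈ orderGe 0 := by
  simpa using ofPowerSeries_mem_orderGe 1

theorem pow_mem_orderGe {d : ℤ} {L : LaurentSeries ℂ} (hL : L ∈ orderGe d) (n : ℕ) :
    L ^ n ∈ orderGe (n * d) := by
  induction n with
  | zero => simpa using one_mem_orderGe
  | succ n ih =>
    rw [pow_succ]
    exact orderGe_mono (by push_cast; linarith) (mul_mem_orderGe ih hL)

theorem zpow_mem_orderGe {d : ℤ} {L : LaurentSeries ℂ} (hL : L ∈ orderGe d)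
    (hL' : L⁻¹ ∈ orderGe (-d)) (n : ℤ) : L ^ n ∈ orderGe (n * d) := by
  obtain ⟨k, rfl | rfl⟩ := n.eq_nat_or_neg
  · rw [zpow_natCast]
    exact pow_mem_orderGe hL k
  · rw [zpow_neg, ← inv_zpow, zpow_natCast]
    exact orderGe_mono (by linarith) (pow_mem_orderGe hL' k)

theorem inv_ofPowerSeries_mem_orderGe {p : PowerSeries ℂ}
    (hp : PowerSeries.constantCoeff p ≠ 0) : (ofPowerSeries ℤ ℂ p)⁻¹ ∈ orderGe 0 := by
  have h : ofPowerSeries ℤ ℂ p * ofPowerSeries ℤ ℂ p⁻¹ = 1 := by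
    rw [← map_mul, PowerSeries.mul_inv_cancel _ hp, map_one]
  rw [inv_eq_of_mul_eq_one_right h]
  exact ofPowerSeries_mem_orderGe _

theorem C_mul_mem_orderGe {d : ℤ} {L : LaurentSeries ℂ} (r : ℂ) (hL : L ∈ orderGe d) :
    C r * L ∈ orderGe d := fun c hc => by rw [coeff_C_mul, hL c hc, mul_zero]

/-- The binomial theorem for integral exponents, up to terms of order at least `K`. -/
theorem one_add_zpow_sub_mem_orderGe {B : LaurentSeries ℂ} (hB : B ∈ orderGe 1)
    (hB' : (1 + B)⁻¹ ∈ orderGe 0) (hne : 1 + B ≠ 0) (n : ℤ) (K : ℕ) :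
    (1 + B) ^ n - ∑ i ∈ Finset.range K, C ((Ring.choose n i : ℤ) : ℂ) * B ^ i ∈ orderGe K := by
  have h1B : 1 + B ∈ orderGe 0 :=
    Submodule.add_mem _ one_mem_orderGe (orderGe_mono (by norm_num) hB)
  have hBK : B ^ K ∈ orderGe K := by simpa using pow_mem_orderGe hB K
  have step : ∀ n : ℤ, ∃ r : ℂ, (1 + B) * ∑ i ∈ Finset.range K, C ((Ring.choose n i : ℤ) : ℂ) * B ^ i
      = ∑ i ∈ Finset.range K, C ((Ring.choose (n + 1) i : ℤ) : ℂ) * B ^ i + C r * B ^ K := by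
    intro n
    rcases K with _ | K
    · exact ⟨0, by simp⟩
    refine ⟨((Ring.choose n K : ℤ) : ℂ), ?_⟩
    rw [Finset.sum_range_succ' (fun i => C ((Ring.choose (n + 1) i : ℤ) : ℂ) * B ^ i)]
    simp only [Ring.choose_succ_succ, Int.cast_add, map_add, add_mul, Finset.sum_add_distrib]
    rw [one_mul, Finset.mul_sum]
    have e : ∀ i, B * (C ((Ring.choose n i : ℤ) : ℂ) * B ^ i)
        = C ((Ring.choose n i : ℤ) : ℂ) * B ^ (i + 1) := fun i => by ring
    simp only [e]
    rw [Finset.sum_range_succ (fun i => C ((Ring.choose n i : ℤ) : ℂ) * B ^ (i + 1)),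
      Finset.sum_range_succ' (fun i => C ((Ring.choose n i : ℤ) : ℂ) * B ^ i)]
    simp only [Ring.choose_zero_right]
    ring
  induction n using Int.induction_on with
  | zero =>
    rcases K with _ | K
    · simpa using one_mem_orderGe
    · rw [zpow_zero, Finset.sum_range_succ', Finset.sum_eq_zero]
      · simp
      · intro i _
        simp [Ring.choose_zero_succ]
  | succ n ih =>
    obtain ⟨r, hr⟩ := step n
    have h := Submodule.add_mem _ (mul_mem_orderGe h1B ih)
      (C_mul_mem_orderGe (d := 0 + K) r (by simpa using hBK))
    rw [zero_add] at h
    convert h using 1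
    rw [mul_sub, hr, zpow_add_one₀ hne]
    ring
  | pred n ih =>
    obtain ⟨r, hr⟩ := step (-n - 1)
    rw [sub_add_cancel] at hr
    have h := mul_mem_orderGe hB' (Submodule.sub_mem _ ih (C_mul_mem_orderGe r hBK))
    rw [zero_add] at h
    convert h using 1
    rw [sub_sub, ← hr, zpow_sub_one₀ hne, mul_sub, inv_mul_cancel_left₀ hne, mul_comm]

/-- The power series `(1 / 2 π i) log (1 + y)`. -/
def logPowerSeries : PowerSeries ℂ := twoPiI⁻¹ • PowerSeries.log ℂ

theorem logSeries_eq : logSeries = ofPowerSeries ℤ ℂ logPowerSeries := by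
  rw [logSeries, logPowerSeries]
  congr 1
  ext k
  rw [PowerSeries.coeff_mk, PowerSeries.coeff_smul, PowerSeries.coeff_log]
  split_ifs
  · simp
  · simp
    ring

theorem hasSubst_logPowerSeries : PowerSeries.HasSubst logPowerSeries :=
  PowerSeries.HasSubst.of_constantCoeff_zero' (by simp [logPowerSeries])

/-- The substitution `x = (1 / 2 π i) log (1 + y)`, with values in Laurent series. -/
def logSubst : PowerSeries ℂ →+* LaurentSeries ℂ :=
  (ofPowerSeries ℤ ℂ).comp (PowerSeries.substAlgHom hasSubst_logPowerSeries).toRingHom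

theorem logSubst_apply (p : PowerSeries ℂ) :
    logSubst p = ofPowerSeries ℤ ℂ (p.subst logPowerSeries) := by
  rw [← PowerSeries.coe_substAlgHom hasSubst_logPowerSeries]
  rfl

theorem logSubst_smul (r : ℂ) (p : PowerSeries ℂ) : logSubst (r • p) = C r * logSubst p := by
  rw [logSubst_apply, logSubst_apply, PowerSeries.subst_smul hasSubst_logPowerSeries,
    PowerSeries.smul_eq_C_mul, map_mul, HahnSeries.ofPowerSeries_C]

theorem logSubst_X : logSubst PowerSeries.X = logSeries := by
  rw [logSubst_apply, PowerSeries.subst_X hasSubst_logPowerSeries, logSeries_eq]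

/-- The factor `κ` in `(1 / 2 π i) log (1 + y) = y κ(y)`. -/
theorem exists_logSeries_eq : ∃ p : PowerSeries ℂ, PowerSeries.constantCoeff p ≠ 0 ∧
    logSeries = single 1 1 * ofPowerSeries ℤ ℂ p := by
  have h : (PowerSeries.X : PowerSeries ℂ) ∣ logPowerSeries :=
    PowerSeries.X_dvd_iff.mpr (by simp [logPowerSeries])
  obtain ⟨p, hp⟩ := h
  refine ⟨p, ?_, ?_⟩
  · have h1 := congrArg (PowerSeries.coeff 1) hp
    rw [show (1 : ℕ) = 0 + 1 from rfl, PowerSeries.coeff_succ_X_mul,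
      PowerSeries.coeff_zero_eq_constantCoeff_apply] at h1
    rw [← h1]
    simp [logPowerSeries, twoPiI_ne_zero]
  · rw [logSeries_eq, hp, map_mul, HahnSeries.ofPowerSeries_X]

theorem logSeries_ne_zero : logSeries ≠ 0 := by
  obtain ⟨p, hp, h⟩ := exists_logSeries_eq
  rw [h]
  refine mul_ne_zero (by simp) ?_
  rw [Ne, map_eq_zero_iff _ HahnSeries.ofPowerSeries_injective]
  rintro rfl
  simp at hp

theorem inv_single (d : ℤ) : (single d (1 : ℂ))⁻¹ = single (-d) 1 := by
  rw [HahnSeries.inv_single, inv_one]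

theorem single_one_zpow (n : ℤ) : (single 1 (1 : ℂ)) ^ n = single n 1 := by
  obtain ⟨k, rfl | rfl⟩ := n.eq_nat_or_neg
  · rw [zpow_natCast, HahnSeries.single_pow]
    simp
  · rw [zpow_neg, zpow_natCast, HahnSeries.single_pow, one_pow, inv_single]
    simp

theorem single_mem_orderGe (d : ℤ) : single d (1 : ℂ) ∈ orderGe d :=
  mem_orderGe_iff.mpr ⟨1, by simp⟩

theorem logSeries_mem_orderGe : logSeries ∈ orderGe 1 := by
  obtain ⟨p, _, h⟩ := exists_logSeries_eq
  exact mem_orderGe_iff.mpr ⟨p, h⟩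

theorem inv_logSeries_mem_orderGe : logSeries⁻¹ ∈ orderGe (-1) := by
  obtain ⟨p, hp, h⟩ := exists_logSeries_eq
  rw [h, mul_inv, inv_single]
  simpa using mul_mem_orderGe (single_mem_orderGe (-1)) (inv_ofPowerSeries_mem_orderGe hp)

theorem logSeries_zpow_mem_orderGe (n : ℤ) : logSeries ^ n ∈ orderGe n := by
  simpa using zpow_mem_orderGe logSeries_mem_orderGe inv_logSeries_mem_orderGe n

/-- Substitution is determined by finitely many terms, up to terms of high order. -/
theorem logSubst_sub_mem_orderGe (p : PowerSeries ℂ) (K : ℕ) :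
    logSubst p - ∑ k ∈ Finset.range K, C (PowerSeries.coeff k p) * logSeries ^ k ∈ orderGe K := by
  have h1 : (PowerSeries.X : PowerSeries ℂ) ^ K ∣
      p - ∑ k ∈ Finset.range K, PowerSeries.coeff k p • PowerSeries.X ^ k := by
    rw [PowerSeries.X_pow_dvd_iff]
    intro m hm
    rw [map_sub, map_sum, Finset.sum_eq_single m]
    · simp
    · intro k _ hk
      rw [PowerSeries.coeff_smul, PowerSeries.coeff_X_pow, if_neg (Ne.symm hk), smul_zero]
    · intro h
      exact absurd (Finset.mem_range.mpr hm) h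
  obtain ⟨q, hq⟩ := h1
  have h2 := congrArg logSubst hq
  simp only [map_sub, map_sum, logSubst_smul, map_pow, map_mul, logSubst_X] at h2
  rw [h2]
  have h3 : logSubst q ∈ orderGe 0 := by
    rw [logSubst_apply]
    exact ofPowerSeries_mem_orderGe _
  simpa using mul_mem_orderGe (pow_mem_orderGe logSeries_mem_orderGe K) h3

theorem logSubst_mem_orderGe {p : PowerSeries ℂ} {k : ℕ}
    (h : (PowerSeries.X : PowerSeries ℂ) ^ k ∣ p) : logSubst p ∈ orderGe k := by
  obtain ⟨q, rfl⟩ := h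
  rw [map_mul, map_pow, logSubst_X, logSubst_apply]
  simpa using mul_mem_orderGe (pow_mem_orderGe logSeries_mem_orderGe k)
    (ofPowerSeries_mem_orderGe _)

open VertexOperatorAlgebra (expSeries transSeries)

theorem logSubst_expSeries_one : logSubst (expSeries 1) = 1 + single 1 1 := by
  have h0 := twoPiI_ne_zero
  have h1 : (expSeries 1).subst logPowerSeries = 1 + PowerSeries.X := by
    rw [expSeries, Int.cast_one, mul_one, PowerSeries.rescale_eq_subst,
      PowerSeries.subst_comp_subst_apply (PowerSeries.HasSubst.smul_X' _) hasSubst_logPowerSeries,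
      PowerSeries.subst_smul hasSubst_logPowerSeries, PowerSeries.subst_X hasSubst_logPowerSeries,
      logPowerSeries, smul_smul, mul_inv_cancel₀ h0, one_smul, exp_subst_log]
  rw [logSubst_apply, h1, map_add, map_one, HahnSeries.ofPowerSeries_X]

theorem one_add_single_ne_zero : (1 : LaurentSeries ℂ) + single 1 1 ≠ 0 := by
  intro h
  have := congrArg (fun L : LaurentSeries ℂ => L.coeff 0) h
  simp at this

theorem logSubst_expSeries (m : ℤ) : logSubst (expSeries m) = (1 + single 1 1) ^ m := by
  have step : ∀ n : ℤ, logSubst (expSeries (n + 1)) = logSubst (expSeries n) * (1 + single 1 1) :=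
    fun n => by rw [VertexOperatorAlgebra.expSeries_add, map_mul, logSubst_expSeries_one]
  induction m using Int.induction_on with
  | zero => rw [VertexOperatorAlgebra.expSeries_zero, map_one, zpow_zero]
  | succ n ih => rw [step, ih, zpow_add_one₀ one_add_single_ne_zero]
  | pred n ih =>
    have h := step (-n - 1)
    rw [sub_add_cancel, ih] at h
    rw [zpow_sub_one₀ one_add_single_ne_zero, h, mul_inv_cancel_right₀ one_add_single_ne_zero]

theorem logSubst_coordSeries : logSubst coordSeries = C twoPiI⁻¹ * single 1 1 := by
  have h := congrArg logSubst VertexOperatorAlgebra.one_add_mul_coordSeries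
  rw [logSubst_expSeries_one, map_add, map_one, ← PowerSeries.smul_eq_C_mul, logSubst_smul,
    add_right_inj] at h
  rw [← h, ← mul_assoc, ← map_mul, inv_mul_cancel₀ twoPiI_ne_zero, map_one, one_mul]

theorem logSubst_transSeries (m : ℤ) (i : ℕ) : logSubst (transSeries m i)
    = C (i.factorial : ℂ)⁻¹ * ((C twoPiI⁻¹ * single 1 1 - logSeries) ^ i * (1 + single 1 1) ^ m) := by
  rw [transSeries, logSubst_smul, map_mul, map_pow, map_sub, logSubst_coordSeries, logSubst_X,
    logSubst_expSeries]

theorem inv_one_add_single_mem_orderGe :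
    ((1 : LaurentSeries ℂ) + single 1 1)⁻¹ ∈ orderGe 0 := by
  have h := inv_ofPowerSeries_mem_orderGe (p := 1 + PowerSeries.X) (by simp)
  rwa [map_add, map_one, HahnSeries.ofPowerSeries_X] at h

theorem coeff_one_add_single_zpow (m : ℤ) (j : ℕ) :
    (((1 : LaurentSeries ℂ) + single 1 1) ^ m).coeff j = ((Ring.choose m j : ℤ) : ℂ) := by
  have h := one_add_zpow_sub_mem_orderGe (single_mem_orderGe 1) inv_one_add_single_mem_orderGe
    one_add_single_ne_zero m (j + 1) j (by push_cast; omega)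
  rw [HahnSeries.coeff_sub, sub_eq_zero] at h
  rw [h, HahnSeries.coeff_sum, Finset.sum_eq_single j]
  · rw [coeff_C_mul, HahnSeries.single_pow]
    simp
  · intro k _ hk
    rw [coeff_C_mul, HahnSeries.single_pow,
      HahnSeries.coeff_single_of_ne (by simpa using Ne.symm hk), mul_zero]
  · intro h'
    exact absurd (Finset.self_mem_range_succ j) h'

theorem one_add_single_zpow_mem_orderGe (m : ℤ) :
    ((1 : LaurentSeries ℂ) + single 1 1) ^ m ∈ orderGe 0 := by
  have h1 : (1 : LaurentSeries ℂ) + single 1 1 ∈ orderGe 0 :=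
    Submodule.add_mem _ one_mem_orderGe (orderGe_mono (by norm_num) (single_mem_orderGe 1))
  simpa using zpow_mem_orderGe h1 (by simpa using inv_one_add_single_mem_orderGe) m

/-- The coefficients of `Y(e ^ ((f(x) - x) L(-1)) e ^ (2 π i x L(0)) w, x)` after the substitution
`x = (1 / 2 π i) log (1 + y)`: this is `Y((1 + y) ^ L(0) w, y / 2 π i)`. -/
theorem sum_choose_smul_coeff (m q c : ℤ) {K : ℕ} (hK : 2 * (c + q + 2) ≤ K) (hK' : 0 ≤ c + q + 2) :
    ∑ i ∈ Finset.range K, ∑ k ∈ Finset.range K,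
      (logSeries ^ (-(q + i - k) - 1)).coeff c * (PowerSeries.coeff k (transSeries m i) *
        (i.factorial * ((Ring.choose (-q - 1) i : ℤ) : ℂ)))
      = twoPiI ^ (q + 1) * (((1 : LaurentSeries ℂ) + single 1 1) ^ m).coeff (c + q + 1) := by
  set B : LaurentSeries ℂ := (C twoPiI⁻¹ * single 1 1 - logSeries) * logSeries⁻¹ with hBdef
  have hl := logSeries_ne_zero
  have h0 := twoPiI_ne_zero
  have h1B : 1 + B = C twoPiI⁻¹ * single 1 1 * logSeries⁻¹ := by
    rw [hBdef, sub_mul, mul_inv_cancel₀ hl]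
    ring
  have hdiff : C twoPiI⁻¹ * single 1 1 - logSeries ∈ orderGe 2 := by
    rw [← logSubst_coordSeries, ← logSubst_X, ← map_sub]
    exact logSubst_mem_orderGe VertexOperatorAlgebra.X_sq_dvd_coordSeries_sub
  have hB : B ∈ orderGe 1 := by
    have h := mul_mem_orderGe hdiff inv_logSeries_mem_orderGe
    rwa [show (2 : ℤ) + -1 = 1 from rfl] at h
  have hs : (single 1 1 : LaurentSeries ℂ) ≠ 0 := by simp
  have hC : (C twoPiI : LaurentSeries ℂ) ≠ 0 := by
    rw [Ne, map_eq_zero_iff _ HahnSeries.C_injective]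
    exact h0
  have hC' : (C twoPiI⁻¹ : LaurentSeries ℂ) ≠ 0 := by
    rw [Ne, map_eq_zero_iff _ HahnSeries.C_injective]
    exact inv_ne_zero h0
  have hCC : (C twoPiI⁻¹ : LaurentSeries ℂ) * C twoPiI = 1 := by
    rw [← map_mul, inv_mul_cancel₀ h0, map_one]
  have hne : 1 + B ≠ 0 := by
    rw [h1B]
    exact mul_ne_zero (mul_ne_zero hC' hs) (inv_ne_zero hl)
  have hB' : (1 + B)⁻¹ ∈ orderGe 0 := by
    have e : (1 + B)⁻¹ = C twoPiI * (single (-1) 1 * logSeries) := by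
      rw [h1B]
      refine inv_eq_of_mul_eq_one_right ?_
      rw [← inv_single]
      calc _ = (C twoPiI⁻¹ * C twoPiI) * (single 1 1 * (single 1 1)⁻¹)
            * (logSeries⁻¹ * logSeries) := by ring
        _ = 1 := by rw [hCC, mul_inv_cancel₀ hs, inv_mul_cancel₀ hl, one_mul, one_mul]
    have h := C_mul_mem_orderGe twoPiI
      (mul_mem_orderGe (single_mem_orderGe (-1)) logSeries_mem_orderGe)
    rw [e]
    simpa using h
  set P : LaurentSeries ℂ := (1 + single 1 1) ^ m with hP
  have hP0 : P ∈ orderGe 0 := one_add_single_zpow_mem_orderGe m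
  -- the inner sums are coefficients of substituted series
  have inner : ∀ i ∈ Finset.range K, ∑ k ∈ Finset.range K,
      (logSeries ^ (-(q + i - k) - 1)).coeff c * (PowerSeries.coeff k (transSeries m i) *
        (i.factorial * ((Ring.choose (-q - 1) i : ℤ) : ℂ)))
      = (logSeries ^ (-q - 1) * P * (C ((Ring.choose (-q - 1) i : ℤ) : ℂ) * B ^ i)).coeff c := by
    intro i _
    have e1 : ∀ k : ℕ, logSeries ^ (-(q + i - k) - 1)
        = logSeries ^ (-q - i - 1) * logSeries ^ k := fun k => by
      rw [← zpow_natCast logSeries k, ← zpow_add₀ hl]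
      congr 1
      ring
    have e2 : ∑ k ∈ Finset.range K, (logSeries ^ (-(q + i - k) - 1)).coeff c *
        PowerSeries.coeff k (transSeries m i)
        = (logSeries ^ (-q - i - 1) * logSubst (transSeries m i)).coeff c := by
      by_cases hi : c + q + 2 ≤ i
      · have hd : (PowerSeries.X : PowerSeries ℂ) ^ (2 * i) ∣ transSeries m i :=
          PowerSeries.X_pow_dvd_iff.mpr fun k hk =>
            VertexOperatorAlgebra.coeff_transSeries_eq_zero m hk
        rw [mul_mem_orderGe (logSeries_zpow_mem_orderGe (-q - i - 1)) (logSubst_mem_orderGe hd) c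
          (by push_cast; omega)]
        refine Finset.sum_eq_zero fun k _ => ?_
        by_cases hk : k < 2 * i
        · rw [VertexOperatorAlgebra.coeff_transSeries_eq_zero m hk, mul_zero]
        · rw [logSeries_zpow_mem_orderGe _ c (by omega), zero_mul]
      · have h := mul_mem_orderGe (logSeries_zpow_mem_orderGe (-q - i - 1))
          (logSubst_sub_mem_orderGe (transSeries m i) K) c (by omega)
        rw [mul_sub, HahnSeries.coeff_sub, sub_eq_zero] at h
        rw [h, Finset.mul_sum, HahnSeries.coeff_sum]
        refine Finset.sum_congr rfl fun k _ => ?_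
        rw [mul_left_comm, coeff_C_mul, e1, mul_comm]
    have e0 : logSeries ^ (-q - 1) * P * C ((Ring.choose (-q - 1) i : ℤ) : ℂ) * B ^ i
        = C ((Ring.choose (-q - 1) i : ℤ) : ℂ) * (logSeries ^ (-q - 1) * P * B ^ i) := by ring
    have hfac : (i.factorial : ℂ) ≠ 0 := by exact_mod_cast i.factorial_ne_zero
    simp only [← mul_assoc]
    rw [← Finset.sum_mul, ← Finset.sum_mul, e2, logSubst_transSeries,
      mul_left_comm _ (C _) _, e0, coeff_C_mul, coeff_C_mul]
    have e3 : logSeries ^ (-q - i - 1) * ((C twoPiI⁻¹ * single 1 1 - logSeries) ^ i * P)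
        = logSeries ^ (-q - 1) * P * B ^ i := by
      rw [hBdef, mul_pow, show -q - (i : ℤ) - 1 = -q - 1 + -(i : ℤ) by ring, zpow_add₀ hl,
        zpow_neg, zpow_natCast, inv_pow]
      ring
    rw [e3]
    field_simp
  rw [Finset.sum_congr rfl inner, ← HahnSeries.coeff_sum, ← Finset.mul_sum]
  have h := mul_mem_orderGe (mul_mem_orderGe (logSeries_zpow_mem_orderGe (-q - 1)) hP0)
    (one_add_zpow_sub_mem_orderGe hB hB' hne (-q - 1) K) c (by omega)
  rw [mul_sub, HahnSeries.coeff_sub, sub_eq_zero] at h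
  rw [← h]
  have e4 : logSeries ^ (-q - 1) * P * (1 + B) ^ (-q - 1)
      = C (twoPiI ^ (q + 1)) * (single (-(q + 1)) 1 * P) := by
    have e5 : logSeries ^ (-q - 1) * (1 + B) ^ (-q - 1)
        = C (twoPiI ^ (q + 1)) * single (-(q + 1)) 1 := by
      rw [← mul_zpow, h1B, mul_comm, inv_mul_cancel_right₀ hl, show -q - 1 = -(q + 1) by ring]
      rw [mul_zpow, single_one_zpow, map_inv₀, inv_zpow, zpow_neg, inv_inv, ← map_zpow₀]
    rw [mul_right_comm, e5, mul_assoc]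
  rw [e4, coeff_C_mul, HahnSeries.coeff_single_mul, one_mul]
  congr 2
  ring

end laurent

end

end TwistedZhu

namespace TwistedZhu

noncomputable section

open Finset.HasAntidiagonal (antidiagonal mem_antidiagonal)

/-! ### Transport of residue products by the coordinate change -/

theorem succ_mul_ringChoose (r : ℤ) (i : ℕ) :
    ((i : ℤ) + 1) * Ring.choose r (i + 1) = (r - i) * Ring.choose r i := by
  have h1 := Ring.descPochhammer_eq_factorial_smul_choose r (i + 1)
  have h2 := Ring.descPochhammer_eq_factorial_smul_choose r i
  have hf : (i.factorial : ℤ) ≠ 0 := by exact_mod_cast i.factorial_ne_zero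
  rw [descPochhammer_succ_right, Polynomial.smeval_mul, h2, Polynomial.smeval_sub,
    Polynomial.smeval_X, Polynomial.smeval_natCast, Nat.factorial_succ] at h1
  apply mul_left_cancel₀ hf
  simp only [nsmul_eq_mul, pow_zero, pow_one, Nat.cast_mul, Nat.cast_add, Nat.cast_one] at h1
  linear_combination -h1

theorem map_finsum_linear {ι V W : Type*} [AddCommGroup V] [Module ℂ V] [AddCommGroup W]
    [Module ℂ W] (F : V →ₗ[ℂ] W) {f : ι → V} (hf : (Function.support f).Finite) :
    F (∑ᶠ i, f i) = ∑ᶠ i, F (f i) :=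
  F.toAddMonoidHom.map_finsum hf

theorem finite_support_of_bounds {V : Type*} [Zero V] {f : ℤ → V} (a b : ℤ)
    (ha : ∀ n < a, f n = 0) (hb : ∀ n, b ≤ n → f n = 0) : (Function.support f).Finite := by
  refine (Set.finite_Ico a b).subset fun n hn => ⟨?_, ?_⟩
  · by_contra h
    exact hn (ha n (not_le.mp h))
  · by_contra h
    exact hn (hb n (not_lt.mp h))

theorem finsum_int_eq_finsum_nat {V : Type*} [AddCommMonoid V] {f : ℤ → V} (a : ℤ)
    (ha : ∀ n < a, f n = 0) : ∑ᶠ n, f n = ∑ᶠ j : ℕ, f (j + a) := by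
  have hinj : Function.Injective fun j : ℕ => (j : ℤ) + a := fun i j h => by
    simpa using h
  rw [← finsum_mem_range (f := f) hinj]
  refine finsum_congr fun n => ?_
  classical
  by_cases hn : n ∈ Set.range fun j : ℕ => (j : ℤ) + a
  · rw [finsum_eq_if, if_pos hn]
  · rw [finsum_eq_if, if_neg hn]
    refine ha n (not_le.mp fun h => hn ⟨(n - a).toNat, ?_⟩)
    change ((n - a).toNat : ℤ) + a = n
    omega

/-- The product rule `(1 + y) ^ (A + B) = (1 + y) ^ A (1 + y) ^ B` for commuting operators. -/
theorem binomOp_add {V : Type*} [AddCommGroup V] [Module ℂ V] {A B : Module.End ℂ V}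
    (h : Commute A B) (t : ℕ) (v : V) : binomOp (A + B) t v
      = ∑ p ∈ antidiagonal t, binomOp A p.1 (binomOp B p.2 v) := by
  let m : Polynomial ℂ →ₗ[ℂ] V →ₗ[ℂ] V := (Polynomial.aeval A).toLinearMap
  have hm : ∀ p w, m p w = Polynomial.aeval A p w := fun _ _ => rfl
  have hcomm : ∀ p : Polynomial ℂ, Commute B (Polynomial.aeval A p) := fun p => by
    rw [Polynomial.aeval_eq_sum_range]
    exact Commute.sum_right _ _ _ fun i _ => ((h.symm.pow_right i).smul_right _)
  have h1 := binomOp_bilin m (A := LinearMap.mulLeft ℂ Polynomial.X) (B := B) (S := A + B)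
    (P := ⊤) (Q := ⊤) (fun _ _ => Submodule.mem_top) (fun _ _ => Submodule.mem_top)
    (fun p _ w _ => by
      simp only [hm, LinearMap.mulLeft_apply, map_mul, Polynomial.aeval_X, LinearMap.add_apply,
        Module.End.mul_apply]
      rw [← Module.End.mul_apply B, (hcomm p).eq, Module.End.mul_apply]) t
    (v := 1) Submodule.mem_top (w := v) Submodule.mem_top
  rw [hm, map_one, Module.End.one_apply] at h1
  rw [h1]
  refine Finset.sum_congr rfl fun p _ => ?_
  have h2 := binomOp_map (m.flip (binomOp B p.2 v)) (T := LinearMap.mulLeft ℂ Polynomial.X)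
    (T' := A) (fun q => by simp [hm]) p.1 1
  simpa [hm] using h2

namespace VertexOperatorAlgebra

variable {V : Type*} [AddCommGroup V] [Module ℂ V] (𝒱 : VertexOperatorAlgebra V)

theorem mode_L_neg_one_pow (i : ℕ) (x : V) (n : ℤ) (y : V) : 𝒱.mode ((𝒱.L (-1) ^ i) x) n y
    = ((i.factorial : ℂ) * ((Ring.choose (-(n - i) - 1) i : ℤ) : ℂ)) • 𝒱.mode x (n - i) y := by
  induction i generalizing n with
  | zero => simp
  | succ i ih =>
    rw [pow_succ', Module.End.mul_apply, mode_L_neg_one, ih, smul_smul,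
      show n - 1 - i = n - (i + 1 : ℕ) by push_cast; ring]
    congr 1
    have h := congrArg (Int.cast (R := ℂ)) (succ_mul_ringChoose (-(n - (i + 1 : ℕ)) - 1) i)
    rw [Nat.factorial_succ]
    push_cast at h ⊢
    linear_combination -(i.factorial : ℂ) * h

/-- The operator `(2 π i) ^ L(0)`. -/
def scale : Module.End ℂ V := byGrading 𝒱.wt 𝒱.wt_isInternal fun n => twoPiI ^ n • LinearMap.id

theorem scale_apply {m : ℤ} {v : V} (hv : v ∈ 𝒱.wt m) : 𝒱.scale v = twoPiI ^ m • v :=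
  byGrading_apply _ _ _ hv

theorem scale_mem_wt {m : ℤ} {v : V} (hv : v ∈ 𝒱.wt m) : 𝒱.scale v ∈ 𝒱.wt m := by
  rw [𝒱.scale_apply hv]
  exact Submodule.smul_mem _ _ hv

theorem scale_mem_fil {n : ℤ} {v : V} (hv : v ∈ 𝒱.fil n) : 𝒱.scale v ∈ 𝒱.fil n :=
  𝒱.fil_induction (P := fun v => 𝒱.scale v ∈ 𝒱.fil n) (by simp)
    (fun x y hx hy => by rw [map_add]; exact Submodule.add_mem _ hx hy)
    (fun _ hm _ hx => 𝒱.wt_le_fil hm (𝒱.scale_mem_wt hx)) hv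

theorem scale_mode (u v : V) (q : ℤ) : 𝒱.scale (𝒱.mode u q v)
    = twoPiI ^ (-q - 1) • 𝒱.mode (𝒱.scale u) q (𝒱.scale v) := by
  have h0 := twoPiI_ne_zero
  refine 𝒱.wt_induction (P := fun u => 𝒱.scale (𝒱.mode u q v)
    = twoPiI ^ (-q - 1) • 𝒱.mode (𝒱.scale u) q (𝒱.scale v)) (by simp)
    (fun x y hx hy => by
      simp only [map_add, mode_add, LinearMap.add_apply, smul_add, hx, hy]) (fun m x hx => ?_) u
  refine 𝒱.wt_induction (P := fun v => 𝒱.scale (𝒱.mode x q v)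
    = twoPiI ^ (-q - 1) • 𝒱.mode (𝒱.scale x) q (𝒱.scale v)) (by simp)
    (fun y z hy hz => by simp only [map_add, smul_add, hy, hz]) (fun n y hy => ?_) v
  rw [𝒱.scale_apply (𝒱.mode_mem_wt hx hy q), 𝒱.scale_apply hx, 𝒱.scale_apply hy, mode_smul,
    LinearMap.smul_apply, map_smul, smul_smul, smul_smul, ← zpow_add₀ h0, ← zpow_add₀ h0]
  congr 2
  ring

theorem binomOp_L_zero {m : ℤ} {v : V} (hv : v ∈ 𝒱.wt m) (j : ℕ) :
    binomOp (𝒱.L 0) j v = ((Ring.choose m j : ℤ) : ℂ) • v := by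
  induction j with
  | zero => simp
  | succ j ih =>
    have h' : (j : ℂ) + 1 ≠ 0 := by exact_mod_cast j.succ_ne_zero
    apply smul_right_injective _ h'
    change ((j : ℂ) + 1) • _ = ((j : ℂ) + 1) • _
    have h := congrArg (Int.cast (R := ℂ)) (succ_mul_ringChoose m j)
    push_cast at h
    rw [binomOp_succ_apply, ih, map_smul, 𝒱.mem_wt.mp hv, smul_smul, smul_smul, smul_smul, h,
      ← sub_smul]
    congr 1
    ring

theorem preservesFil_L_zero : 𝒱.PreservesFil (𝒱.L 0) := fun n v hv => by
  simpa using 𝒱.L_mem_fil 0 hv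

theorem transOp_mem_fil (k : ℕ) {n : ℤ} {v : V} (hv : v ∈ 𝒱.fil n) :
    𝒱.transOp k v ∈ 𝒱.fil (n + k) := by
  refine 𝒱.fil_induction (P := fun v => 𝒱.transOp k v ∈ 𝒱.fil (n + k)) (by simp)
    (fun x y hx hy => by rw [map_add]; exact Submodule.add_mem _ hx hy) (fun m hm x hx => ?_) hv
  rw [𝒱.transOp_apply hx (I := k + 1) (by omega)]
  refine Submodule.sum_mem _ fun i hi => Submodule.smul_mem _ _ ?_
  have h : ∀ i : ℕ, (𝒱.L (-1) ^ i) x ∈ 𝒱.wt (m + i) := by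
    intro i
    induction i with
    | zero => simpa using hx
    | succ i ih =>
      rw [pow_succ', Module.End.mul_apply]
      have := 𝒱.L_mem_wt (j := -1) ih
      convert this using 2
      push_cast
      ring
  rw [Finset.mem_range] at hi
  exact 𝒱.wt_le_fil (by omega) (h i)

/-- The coefficient of `y ^ c` in `Y(u, (1 / 2 π i) log (1 + y)) v`. -/
def logMode (c : ℤ) (u v : V) : V :=
  ∑ᶠ n : ℤ, (logSeries ^ (-n - 1)).coeff c • 𝒱.mode u n v

theorem coeff_logSeries_zpow_eq_zero {n c : ℤ} (h : c < n) : (logSeries ^ n).coeff c = 0 :=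
  logSeries_zpow_mem_orderGe n c h

theorem scale_sum_transOp_of_mem_wt {m : ℤ} {x : V} (hx : x ∈ 𝒱.wt m) (y : V) (c : ℤ) :
    ∃ K₀ : ℕ, ∀ K, K₀ ≤ K → 𝒱.scale (∑ᶠ n : ℤ, (logSeries ^ (-n - 1)).coeff c •
      ∑ k ∈ Finset.range K, 𝒱.mode (𝒱.transOp k x) (n + k) y)
      = 𝒱.resOp (𝒱.L 0) (-c - 1) (𝒱.scale x) (𝒱.scale y) := by
  obtain ⟨Q, hQ⟩ := 𝒱.mode_eq_zero x y
  refine ⟨(2 * (c + Q + 2)).toNat, fun K hK => ?_⟩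
  have h0 := twoPiI_ne_zero
  -- the summands after the substitution `q = n + k - i`
  set G : ℕ × ℕ → ℤ → V := fun p q => ((logSeries ^ (-(q + p.1 - p.2) - 1)).coeff c *
    (PowerSeries.coeff p.2 (transSeries m p.1) *
      (p.1.factorial * ((Ring.choose (-q - 1) p.1 : ℤ) : ℂ)))) • 𝒱.mode x q y with hG
  have e1 : ∀ n : ℤ, (logSeries ^ (-n - 1)).coeff c •
      ∑ k ∈ Finset.range K, 𝒱.mode (𝒱.transOp k x) (n + k) y
      = ∑ p ∈ Finset.range K ×ˢ Finset.range K, G p (n + (p.2 - p.1)) := by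
    intro n
    rw [Finset.sum_product_right, Finset.smul_sum]
    refine Finset.sum_congr rfl fun k hk => ?_
    rw [𝒱.transOp_apply hx (Finset.mem_range.mp hk), mode_sum, LinearMap.sum_apply,
      Finset.smul_sum]
    refine Finset.sum_congr rfl fun i _ => ?_
    rw [mode_smul, LinearMap.smul_apply, mode_L_neg_one_pow, smul_smul, smul_smul, hG]
    dsimp only
    rw [show n + ((k : ℤ) - i) = n + k - i by ring, show n + (k : ℤ) - i + i - k = n by ring,
      mul_assoc]
  have fin : ∀ p, (Function.support (G p)).Finite := fun p =>
    finite_support_of_bounds (-c - 1 - p.1 + p.2) Q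
      (fun q hq => by rw [hG]; dsimp only; rw [coeff_logSeries_zpow_eq_zero (by omega), zero_mul, zero_smul])
      (fun q hq => by rw [hG]; dsimp only; rw [hQ q hq, smul_zero])
  have e2 : ∑ᶠ n : ℤ, ∑ p ∈ Finset.range K ×ˢ Finset.range K, G p (n + (p.2 - p.1))
      = ∑ᶠ q : ℤ, ∑ p ∈ Finset.range K ×ˢ Finset.range K, G p q := by
    rw [finsum_sum_comm _ (fun q p => G p q) fun p _ => fin p,
      finsum_sum_comm _ (fun (n : ℤ) (p : ℕ × ℕ) => G p (n + (p.2 - p.1))) fun p _ =>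
        (fin p).preimage (add_left_injective _).injOn]
    exact Finset.sum_congr rfl fun p _ =>
      finsum_comp_equiv (Equiv.addRight ((p.2 : ℤ) - p.1)) (f := G p)
  have e3 : ∀ q : ℤ, ∑ p ∈ Finset.range K ×ˢ Finset.range K, G p q
      = (twoPiI ^ (q + 1) * (((1 : LaurentSeries ℂ) + HahnSeries.single 1 1) ^ m).coeff
          (c + q + 1)) • 𝒱.mode x q y := by
    intro q
    by_cases hq : (Q : ℤ) ≤ q
    · rw [hQ q hq, smul_zero]
      exact Finset.sum_eq_zero fun p _ => by rw [hG]; dsimp only; rw [hQ q hq, smul_zero]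
    by_cases hq' : 0 ≤ c + q + 2
    · rw [← sum_choose_smul_coeff m q c (K := K) (by omega) hq', Finset.sum_smul,
        Finset.sum_product]
      simp only [Finset.sum_smul, hG]
    · rw [one_add_single_zpow_mem_orderGe m _ (by omega), mul_zero, zero_smul]
      refine Finset.sum_eq_zero fun p _ => ?_
      rw [hG]
      dsimp only
      by_cases hp : p.2 < 2 * p.1
      · rw [coeff_transSeries_eq_zero m hp, zero_mul, mul_zero, zero_smul]
      · rw [coeff_logSeries_zpow_eq_zero (by omega), zero_mul, zero_smul]
  simp only [e1]
  rw [e2]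
  simp only [e3]
  rw [map_finsum_linear]
  · have e4 : ∀ q : ℤ, 𝒱.scale ((twoPiI ^ (q + 1) *
        (((1 : LaurentSeries ℂ) + HahnSeries.single 1 1) ^ m).coeff (c + q + 1)) • 𝒱.mode x q y)
        = (((1 : LaurentSeries ℂ) + HahnSeries.single 1 1) ^ m).coeff (c + q + 1) •
          𝒱.mode (𝒱.scale x) q (𝒱.scale y) := fun q => by
      rw [map_smul, scale_mode, smul_smul]
      congr 1
      rw [mul_right_comm, ← zpow_add₀ h0, show q + 1 + (-q - 1) = 0 by ring, zpow_zero, one_mul]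
    simp only [e4]
    rw [finsum_int_eq_finsum_nat (-c - 1) fun q hq => by
      rw [one_add_single_zpow_mem_orderGe m _ (by omega), zero_smul], resOp]
    refine finsum_congr fun j => ?_
    rw [show c + ((j : ℤ) + (-c - 1)) + 1 = j by ring, coeff_one_add_single_zpow,
      𝒱.binomOp_L_zero (𝒱.scale_mem_wt hx), mode_smul, LinearMap.smul_apply]
  · refine finite_support_of_bounds (-c - 1) Q (fun q hq => ?_) fun q hq => ?_
    · rw [one_add_single_zpow_mem_orderGe m _ (by omega), mul_zero, zero_smul]
    · rw [hQ q hq, smul_zero]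

/-- `(2 π i) ^ L(0) Y(e ^ ((f(x) - x) L(-1)) e ^ (2 π i x L(0)) u, x) v`, with
`x = (1 / 2 π i) log (1 + y)`, is the series `Y((1 + y) ^ L(0) u', y) v'`, where `u'` and `v'` are
the images of `u` and `v` under `(2 π i) ^ L(0)`. -/
theorem scale_sum_transOp (x y : V) (c : ℤ) :
    ∃ K₀ : ℕ, ∀ K, K₀ ≤ K → 𝒱.scale (∑ᶠ n : ℤ, (logSeries ^ (-n - 1)).coeff c •
      ∑ k ∈ Finset.range K, 𝒱.mode (𝒱.transOp k x) (n + k) y)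
      = 𝒱.resOp (𝒱.L 0) (-c - 1) (𝒱.scale x) (𝒱.scale y) := by
  have fin : ∀ (x : V) (K : ℕ), (Function.support fun n : ℤ => (logSeries ^ (-n - 1)).coeff c •
      ∑ k ∈ Finset.range K, 𝒱.mode (𝒱.transOp k x) (n + k) y).Finite := by
    intro x K
    choose Q hQ using fun k => 𝒱.mode_eq_zero (𝒱.transOp k x) y
    refine finite_support_of_bounds (-c - 1) ((Finset.range K).sup Q : ℕ) (fun n hn => ?_)
      fun n hn => ?_
    · rw [coeff_logSeries_zpow_eq_zero (by omega), zero_smul]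
    · rw [Finset.sum_eq_zero, smul_zero]
      intro k hk
      have := Finset.le_sup (f := Q) hk
      exact hQ k _ (by omega)
  refine 𝒱.wt_induction (P := fun x => ∃ K₀ : ℕ, ∀ K, K₀ ≤ K →
      𝒱.scale (∑ᶠ n : ℤ, (logSeries ^ (-n - 1)).coeff c •
        ∑ k ∈ Finset.range K, 𝒱.mode (𝒱.transOp k x) (n + k) y)
      = 𝒱.resOp (𝒱.L 0) (-c - 1) (𝒱.scale x) (𝒱.scale y)) ⟨0, fun K _ => ?_⟩ ?_
    (fun m x hx => 𝒱.scale_sum_transOp_of_mem_wt hx y c) x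
  · simp [resOp]
  · rintro x x' ⟨K, hK⟩ ⟨K', hK'⟩
    refine ⟨max K K', fun J hJ => ?_⟩
    rw [map_add 𝒱.scale, 𝒱.preservesFil_L_zero.resOp_add_left,
      ← hK J (le_trans (le_max_left _ _) hJ), ← hK' J (le_trans (le_max_right _ _) hJ),
      ← map_add, ← finsum_add_distrib (fin x J) (fin x' J)]
    simp only [map_add, mode_add, LinearMap.add_apply, Finset.sum_add_distrib, smul_add]

theorem U1_apply (v : V) : 𝒱.U1 v = 𝒱.scale (𝒱.expNegLPlus v) := rfl

theorem U1_mem_fil {n : ℤ} {v : V} (hv : v ∈ 𝒱.fil n) : 𝒱.U1 v ∈ 𝒱.fil n :=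
  𝒱.scale_mem_fil (𝒱.expNegLPlus_mem_fil hv)

theorem finite_support_logMode (c : ℤ) (u v : V) : (Function.support fun n : ℤ =>
    (logSeries ^ (-n - 1)).coeff c • 𝒱.mode u n v).Finite := by
  obtain ⟨Q, hQ⟩ := 𝒱.mode_eq_zero u v
  refine finite_support_of_bounds (-c - 1) Q (fun n hn => ?_) fun n hn => ?_
  · rw [coeff_logSeries_zpow_eq_zero (by omega), zero_smul]
  · rw [hQ n hn, smul_zero]

/-- The coordinate change on vertex operators: `𝒰(1) Y(u, (1 / 2 π i) log (1 + y)) v` is equal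
to `Y((1 + y) ^ L(0) 𝒰(1) u, y) 𝒰(1) v`. -/
theorem U1_logMode (c : ℤ) (u v : V) :
    𝒱.U1 (𝒱.logMode c u v) = 𝒱.resOp (𝒱.L 0) (-c - 1) (𝒱.U1 u) (𝒱.U1 v) := by
  obtain ⟨a, ha⟩ := 𝒱.exists_mem_fil u
  obtain ⟨b, hb⟩ := 𝒱.exists_mem_fil v
  obtain ⟨N, hN⟩ := 𝒱.exists_fil_eq_bot
  obtain ⟨K₁, hK₁⟩ := 𝒱.scale_sum_transOp (𝒱.expNegLPlus u) (𝒱.expNegLPlus v) c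
  choose K₀ hK₀ using 𝒱.expNegLPlus_mode u v
  set K := max K₁ ((Finset.Ico (-c - 1) (a + b - N)).sup K₀) with hKdef
  rw [U1_apply, U1_apply, U1_apply, ← hK₁ K (le_max_left _ _), logMode,
    map_finsum_linear _ (𝒱.finite_support_logMode c u v)]
  congr 1
  refine finsum_congr fun n => ?_
  rw [map_smul]
  by_cases h1 : n < -c - 1
  · rw [coeff_logSeries_zpow_eq_zero (by omega), zero_smul, zero_smul]
  by_cases h2 : n < a + b - N
  · rw [hK₀ n K (le_trans (Finset.le_sup (f := K₀) (Finset.mem_Ico.mpr ⟨not_lt.mp h1, h2⟩))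
      (le_max_right _ _))]
  · have e1 : 𝒱.mode u n v = 0 := by
      have := 𝒱.mode_mem_fil ha hb n
      rwa [hN _ (by omega), Submodule.mem_bot] at this
    rw [e1, map_zero, Finset.sum_eq_zero]
    intro k _
    have := 𝒱.mode_mem_fil (𝒱.transOp_mem_fil k (𝒱.expNegLPlus_mem_fil ha))
      (𝒱.expNegLPlus_mem_fil hb) (n + k)
    rwa [hN _ (by omega), Submodule.mem_bot] at this

end VertexOperatorAlgebra

end

end TwistedZhu

namespace TwistedZhu

noncomputable section

open Finset.HasAntidiagonal (antidiagonal mem_antidiagonal)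

/-! ### The isomorphism of `Ã_g(V)` with `A_g(V)` -/

theorem coordCoeff_one : coordCoeff 1 = -twoPiI / 2 := by
  have h0 := twoPiI_ne_zero
  have h := coordCoeff_spec 2
  rw [Finset.sum_range_succ, Finset.sum_range_succ, Finset.sum_range_one,
    coeff_coordDer_iterate_eq_zero _ 2 2 le_rfl] at h
  simp only [Function.iterate_zero, id_eq, Function.iterate_one, coeff_coordDer_X,
    PowerSeries.coeff_X] at h
  norm_num at h
  field_simp at h
  linear_combination -h / 2

theorem coordCoeff_two : coordCoeff 2 = twoPiI ^ 2 / 12 := by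
  have h0 := twoPiI_ne_zero
  have h := coordCoeff_spec 3
  rw [Finset.sum_range_succ, Finset.sum_range_succ, Finset.sum_range_succ, Finset.sum_range_one,
    coeff_coordDer_iterate_eq_zero _ 3 3 le_rfl] at h
  have h2 : PowerSeries.coeff 3 ((coordDer coordCoeff)^[2] PowerSeries.X)
      = 2 * coordCoeff 1 ^ 2 := by
    rw [Function.iterate_succ_apply', coeff_coordDer, Function.iterate_one,
      Finset.Nat.sum_antidiagonal_eq_sum_range_succ_mk]
    simp only [Finset.sum_range_succ, coeff_coordDer_X]
    norm_num
    ring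
  rw [h2, coordCoeff_one] at h
  simp only [Function.iterate_zero, id_eq, Function.iterate_one, coeff_coordDer_X,
    PowerSeries.coeff_X] at h
  norm_num [Nat.factorial] at h
  field_simp at h
  linear_combination -h / 24

namespace VertexOperatorAlgebra

variable {V : Type*} [AddCommGroup V] [Module ℂ V] (𝒱 : VertexOperatorAlgebra V)

theorem conf_eq : 𝒱.conf = 𝒱.L (-2) 𝒱.vac := (𝒱.creation 𝒱.conf).symm

theorem vac_mem_wt : 𝒱.vac ∈ 𝒱.wt 0 := by
  rw [mem_wt, Automorphism.L_vac (by omega)]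
  simp

theorem L_conf {m : ℤ} (hm : 0 ≤ m) : 𝒱.L m 𝒱.conf
    = ((m : ℂ) + 2) • 𝒱.L (m - 2) 𝒱.vac + if m = 2 then (𝒱.c / 2) • 𝒱.vac else 0 := by
  have h : 𝒱.L m (𝒱.L (-2) 𝒱.vac) - 𝒱.L (-2) (𝒱.L m 𝒱.vac) = _ := 𝒱.virasoro m (-2) 𝒱.vac
  rw [Automorphism.L_vac (n := m) (by omega), map_zero, sub_zero, ← conf_eq] at h
  rw [h]
  congr 1
  · congr 1
    push_cast
    ring
  · by_cases hm2 : m = 2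
    · rw [if_pos (by omega), if_pos hm2, hm2]
      congr 1
      push_cast
      ring
    · rw [if_neg (by omega), if_neg hm2]

theorem conf_mem_wt : 𝒱.conf ∈ 𝒱.wt 2 := by
  rw [mem_wt, 𝒱.L_conf le_rfl, conf_eq]
  simp

theorem LPlus_vac : 𝒱.LPlus 𝒱.vac = 0 := by
  change ∑ᶠ j : ℕ, coordCoeff (j + 1) • 𝒱.L (j + 1) 𝒱.vac = 0
  rw [finsum_congr (g := fun _ => 0) fun j => by rw [Automorphism.L_vac (by omega), smul_zero], finsum_zero]

theorem LPlus_conf : 𝒱.LPlus 𝒱.conf = (twoPiI ^ 2 / 12 * (𝒱.c / 2)) • 𝒱.vac := by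
  change ∑ᶠ j : ℕ, coordCoeff (j + 1) • 𝒱.L (j + 1) 𝒱.conf = _
  rw [finsum_eq_single _ 1]
  · rw [𝒱.L_conf (by omega), Automorphism.L_vac (by omega), smul_zero, zero_add, if_pos (by norm_num),
      coordCoeff_two, smul_smul]
  · intro j hj
    rw [𝒱.L_conf (by omega), Automorphism.L_vac (by omega), smul_zero, zero_add, if_neg (by omega), smul_zero]

theorem expNegLPlus_vac : 𝒱.expNegLPlus 𝒱.vac = 𝒱.vac := by
  rw [𝒱.expNegLPlus_apply (K := 1), Finset.sum_range_one, expLTerm_zero, Module.End.one_apply]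
  intro k hk
  obtain ⟨k, rfl⟩ := Nat.exists_eq_add_of_le' hk
  rw [expLTerm, LinearMap.smul_apply, pow_succ 𝒱.LPlus, Module.End.mul_apply, LPlus_vac, map_zero,
    smul_zero]

theorem expNegLPlus_conf :
    𝒱.expNegLPlus 𝒱.conf = 𝒱.conf - (twoPiI ^ 2 / 12 * (𝒱.c / 2)) • 𝒱.vac := by
  rw [𝒱.expNegLPlus_apply (K := 2), Finset.sum_range_succ, Finset.sum_range_one, expLTerm_zero,
    Module.End.one_apply, expLTerm, LinearMap.smul_apply, pow_one 𝒱.LPlus, LPlus_conf, sub_eq_add_neg]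
  · simp
  · intro k hk
    obtain ⟨k, rfl⟩ := Nat.exists_eq_add_of_le' hk
    rw [expLTerm, LinearMap.smul_apply, pow_add 𝒱.LPlus, Module.End.mul_apply, pow_two 𝒱.LPlus,
      Module.End.mul_apply, LPlus_conf, map_smul, LPlus_vac, smul_zero, map_zero, smul_zero]

theorem U1_vac : 𝒱.U1 𝒱.vac = 𝒱.vac := by
  rw [U1_apply, expNegLPlus_vac, 𝒱.scale_apply 𝒱.vac_mem_wt, zpow_zero, one_smul]

theorem U1_confT : 𝒱.U1 𝒱.confT = 𝒱.conf := by
  have h0 := twoPiI_ne_zero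
  rw [confT, map_add, map_smul, map_smul, U1_vac, U1_apply, expNegLPlus_conf, map_sub, map_smul,
    𝒱.scale_apply 𝒱.vac_mem_wt, 𝒱.scale_apply 𝒱.conf_mem_wt, smul_sub, smul_smul, smul_smul,
    smul_smul]
  have e1 : (twoPiI ^ 2)⁻¹ * twoPiI ^ (2 : ℤ) = 1 := by
    rw [zpow_ofNat]
    field_simp
  rw [e1, one_smul, zpow_zero, mul_one, sub_add, ← sub_smul]
  convert sub_zero _
  convert zero_smul ℂ _
  field_simp
  ring

theorem expNegLPlus_sub_mem_fil {n : ℤ} {v : V} (hv : v ∈ 𝒱.fil n) :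
    𝒱.expNegLPlus v - v ∈ 𝒱.fil (n - 1) := by
  obtain ⟨K, hK⟩ := 𝒱.exists_expLTerm_eq_zero n
  rw [𝒱.expNegLPlus_apply (K := K + 1) fun k hk => hK v hv k (by omega), Finset.sum_range_succ',
    expLTerm_zero, Module.End.one_apply, add_sub_cancel_right]
  exact Submodule.sum_mem _ fun k _ => 𝒱.fil_mono (by omega) (𝒱.expLTerm_mem_fil (k + 1) hv)

theorem expNegLPlus_bijective : Function.Bijective 𝒱.expNegLPlus := by
  obtain ⟨N, hN⟩ := 𝒱.exists_fil_eq_bot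
  constructor
  · refine (injective_iff_map_eq_zero _).mpr fun v hv => ?_
    obtain ⟨n, hn⟩ := 𝒱.exists_mem_fil v
    have h : ∀ j : ℕ, v ∈ 𝒱.fil (n - j) := by
      intro j
      induction j with
      | zero => simpa using hn
      | succ j ih =>
        have := 𝒱.expNegLPlus_sub_mem_fil ih
        rw [hv, zero_sub, neg_mem_iff] at this
        convert this using 2
        push_cast
        ring
    have h1 := h (n - N + 1).toNat
    rwa [hN _ (by omega), Submodule.mem_bot] at h1
  · have h : ∀ j : ℕ, ∀ v ∈ 𝒱.fil (N - 1 + j), ∃ u, 𝒱.expNegLPlus u = v := by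
      intro j
      induction j with
      | zero =>
        intro v hv
        rw [hN _ (by simp), Submodule.mem_bot] at hv
        exact ⟨0, by rw [hv, map_zero]⟩
      | succ j ih =>
        intro v hv
        obtain ⟨u, hu⟩ := ih (𝒱.expNegLPlus v - v) (by
          have := 𝒱.expNegLPlus_sub_mem_fil hv
          convert this using 2
          push_cast
          ring)
        exact ⟨v - u, by rw [map_sub, hu, sub_sub_cancel]⟩
    intro v
    obtain ⟨n, hn⟩ := 𝒱.exists_mem_fil v
    exact h (n - (N - 1)).toNat v (𝒱.fil_mono (by omega) hn)

theorem scale_bijective : Function.Bijective 𝒱.scale := by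
  have h0 := twoPiI_ne_zero
  set J : Module.End ℂ V :=
    byGrading 𝒱.wt 𝒱.wt_isInternal fun n => twoPiI ^ (-n) • LinearMap.id with hJ
  have hJa : ∀ m, ∀ v ∈ 𝒱.wt m, J v = twoPiI ^ (-m) • v := fun m v hv => by
    rw [hJ, byGrading_apply _ _ _ hv]
    rfl
  refine Function.bijective_iff_has_inverse.mpr ⟨J, fun v => ?_, fun v => ?_⟩
  · refine 𝒱.wt_induction (P := fun v => J (𝒱.scale v) = v) (by simp)
      (fun x y hx hy => by rw [map_add, map_add, hx, hy]) (fun m x hx => ?_) v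
    rw [𝒱.scale_apply hx, map_smul, hJa m x hx, smul_smul, ← zpow_add₀ h0, add_neg_cancel,
      zpow_zero, one_smul]
  · refine 𝒱.wt_induction (P := fun v => 𝒱.scale (J v) = v) (by simp)
      (fun x y hx hy => by rw [map_add, map_add, hx, hy]) (fun m x hx => ?_) v
    rw [hJa m x hx, map_smul, 𝒱.scale_apply hx, smul_smul, ← zpow_add₀ h0, neg_add_cancel,
      zpow_zero, one_smul]

theorem U1_bijective : Function.Bijective 𝒱.U1 :=
  𝒱.scale_bijective.comp 𝒱.expNegLPlus_bijective

/-- `𝒰(1)` as a linear equivalence. -/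
def U1Equiv : V ≃ₗ[ℂ] V := LinearEquiv.ofBijective 𝒱.U1 𝒱.U1_bijective

end VertexOperatorAlgebra

namespace Automorphism

variable {V : Type*} [AddCommGroup V] [Module ℂ V] {𝒱 : VertexOperatorAlgebra V}
  (g : Automorphism 𝒱)

theorem op_LPlus (v : V) : g.op (𝒱.LPlus v) = 𝒱.LPlus (g.op v) := by
  obtain ⟨K, hK⟩ := 𝒱.exists_vect_apply v
  obtain ⟨K', hK'⟩ := 𝒱.exists_vect_apply (g.op v)
  rw [VertexOperatorAlgebra.LPlus_eq_vect, hK (max K K') (le_max_left _ _),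
    hK' (max K K') (le_max_right _ _), map_sum]
  simp only [map_smul, op_L]

theorem op_mem_fil {n : ℤ} {v : V} (hv : v ∈ 𝒱.fil n) : g.op v ∈ 𝒱.fil n :=
  𝒱.fil_induction (P := fun v => g.op v ∈ 𝒱.fil n) (by simp)
    (fun x y hx hy => by rw [map_add]; exact Submodule.add_mem _ hx hy)
    (fun _ hm _ hx => 𝒱.wt_le_fil hm (g.op_mem_wt hx)) hv

theorem op_expNegLPlus (v : V) : g.op (𝒱.expNegLPlus v) = 𝒱.expNegLPlus (g.op v) := by
  have hc : Commute g.op 𝒱.LPlus := LinearMap.ext fun v => g.op_LPlus v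
  obtain ⟨n, hn⟩ := 𝒱.exists_mem_fil v
  obtain ⟨K, hK⟩ := 𝒱.exists_expLTerm_eq_zero n
  rw [𝒱.expNegLPlus_apply (hK v hn), 𝒱.expNegLPlus_apply (hK _ (g.op_mem_fil hn)), map_sum]
  refine Finset.sum_congr rfl fun k _ => ?_
  rw [VertexOperatorAlgebra.expLTerm, LinearMap.smul_apply, LinearMap.smul_apply, map_smul]
  congr 1
  exact LinearMap.congr_fun (hc.pow_right k).eq v

theorem op_U1 (v : V) : g.op (𝒱.U1 v) = 𝒱.U1 (g.op v) := by
  have h : ∀ v, g.op (𝒱.scale v) = 𝒱.scale (g.op v) := fun v =>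
    𝒱.wt_induction (P := fun v => g.op (𝒱.scale v) = 𝒱.scale (g.op v)) (by simp)
      (fun x y hx hy => by simp only [map_add, hx, hy])
      (fun m x hx => by rw [𝒱.scale_apply hx, 𝒱.scale_apply (g.op_mem_wt hx), map_smul]) v
  rw [𝒱.U1_apply, 𝒱.U1_apply, h, op_expNegLPlus]

theorem U1_mem_gen {a : Strip} {v : V} (hv : v ∈ g.gen a) : 𝒱.U1 v ∈ g.gen a :=
  Module.End.mapsTo_maxGenEigenspace_of_comm (f := g.op) (g := 𝒱.U1)
    (LinearMap.ext fun v => g.op_U1 v) _ hv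

theorem U1_N (v : V) : 𝒱.U1 (g.N v) = g.N (𝒱.U1 v) :=
  g.N_comm_of_op (fun v => (g.op_U1 v).symm) v

/-- The exponent `ℒ - L(0) + 𝒩` of `1 + y` in the definition of `•_g`. -/
abbrev S : Module.End ℂ V := g.LL - 𝒱.L 0 + g.N

theorem S_apply {a : Strip} {v : V} (hv : v ∈ g.gen a) :
    g.S v = (a - eps a : ℂ) • v + g.N v := by
  rw [LinearMap.add_apply, LinearMap.sub_apply, g.LL_apply hv, add_sub_cancel_left]

theorem U1_S (v : V) : 𝒱.U1 (g.S v) = g.S (𝒱.U1 v) :=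
  g.gen_top_induction (P := fun v => 𝒱.U1 (g.S v) = g.S (𝒱.U1 v)) (by simp)
    (fun x y hx hy => by simp only [map_add] at *; rw [hx, hy])
    (fun a x hx => by rw [g.S_apply hx, g.S_apply (g.U1_mem_gen hx), map_add, map_smul, U1_N]) v

theorem U1_E (v : V) : 𝒱.U1 (g.E v) = g.E (𝒱.U1 v) :=
  g.gen_top_induction (P := fun v => 𝒱.U1 (g.E v) = g.E (𝒱.U1 v)) (by simp)
    (fun x y hx hy => by simp only [map_add] at *; rw [hx, hy])
    (fun a x hx => by rw [g.E_apply hx, g.E_apply (g.U1_mem_gen hx), map_smul]) v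

theorem T_eq : g.T = 𝒱.L 0 + g.S := by
  simp only [T, S]
  abel

theorem commute_L_zero_S : Commute (𝒱.L 0) g.S := LinearMap.ext fun v =>
  g.gen_top_induction (P := fun v => 𝒱.L 0 (g.S v) = g.S (𝒱.L 0 v)) (by simp)
    (fun x y hx hy => by simp only [map_add] at *; rw [hx, hy])
    (fun a x hx => by
      rw [g.S_apply hx, g.S_apply (g.L_mem_gen 0 hx), map_add, map_smul, L_N]) v

theorem preservesFil_S : 𝒱.PreservesFil g.S := fun n v hv => by
  have e : g.S v = g.T v - 𝒱.L 0 v := by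
    simp only [S, T, LinearMap.add_apply, LinearMap.sub_apply]
    abel
  rw [e]
  exact Submodule.sub_mem _ (g.T_mem_fil hv) (𝒱.preservesFil_L_zero n v hv)

theorem resT_eq_finsum (k : ℤ) (u v : V) :
    g.resT k u v = ∑ᶠ j : ℕ, 𝒱.logMode (-1 - k - j) (binomOp g.S j u) v := by
  obtain ⟨m, hu⟩ := 𝒱.exists_mem_fil u
  obtain ⟨n, hv⟩ := 𝒱.exists_mem_fil v
  obtain ⟨Q, hQ⟩ := 𝒱.exists_mode_fil_eq_zero m n
  refine finsum_curry _ (((Set.finite_Iio (Q - k).toNat).prod (Set.finite_Ico k Q)).subset ?_)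
  rintro ⟨j, q⟩ hjq
  have h1 : q < Q := by
    by_contra h
    refine hjq ?_
    dsimp only
    rw [hQ _ (g.preservesFil_S.binomOp_mem hu j) v hv q (not_lt.mp h), smul_zero]
  have h2 : k + j ≤ q := by
    by_contra h
    refine hjq ?_
    dsimp only
    rw [VertexOperatorAlgebra.coeff_logSeries_zpow_eq_zero (by omega), zero_smul]
  exact ⟨by simp only [Set.mem_Iio]; omega, by simp only [Set.mem_Ico]; omega⟩

/-- `𝒰(1)` carries the products `resT` to the products `res`. -/
theorem U1_resT (k : ℤ) (u v : V) : 𝒱.U1 (g.resT k u v) = g.res k (𝒱.U1 u) (𝒱.U1 v) := by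
  obtain ⟨m, hu⟩ := 𝒱.exists_mem_fil u
  obtain ⟨n, hv⟩ := 𝒱.exists_mem_fil v
  obtain ⟨Q, hQ⟩ := 𝒱.exists_mode_fil_eq_zero m n
  set K := (Q - k).toNat with hK
  have h1 : ∀ j : ℕ, K ≤ j → 𝒱.logMode (-1 - k - j) (binomOp g.S j u) v = 0 := by
    intro j hj
    rw [VertexOperatorAlgebra.logMode, finsum_congr (g := fun _ => 0), finsum_zero]
    intro q
    by_cases hq : Q ≤ q
    · rw [hQ _ (g.preservesFil_S.binomOp_mem hu j) v hv q hq, smul_zero]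
    · rw [VertexOperatorAlgebra.coeff_logSeries_zpow_eq_zero (by omega), zero_smul]
  have h2 : ∀ j : ℕ, 𝒱.U1 (𝒱.logMode (-1 - k - j) (binomOp g.S j u) v)
      = ∑ i ∈ Finset.range K,
        𝒱.mode (binomOp (𝒱.L 0) i (binomOp g.S j (𝒱.U1 u))) (i + (k + j)) (𝒱.U1 v) := by
    intro j
    rw [𝒱.U1_logMode, binomOp_map 𝒱.U1 g.U1_S, show -(-1 - k - j) - 1 = k + (j : ℤ) by ring]
    exact 𝒱.preservesFil_L_zero.resOp_eq_sum hQ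
      (g.preservesFil_S.binomOp_mem (𝒱.U1_mem_fil hu) j) (𝒱.U1_mem_fil hv) (by omega)
  rw [resT_eq_finsum, finsum_nat_eq_sum_range h1, map_sum]
  simp only [h2]
  rw [Finset.sum_comm, sum_range_sum_range_eq_antidiagonal (f := fun i j =>
    𝒱.mode (binomOp (𝒱.L 0) i (binomOp g.S j (𝒱.U1 u))) (i + (k + j)) (𝒱.U1 v))]
  · rw [res_eq, g.preservesFil_T.resOp_eq_sum (N := K) hQ (𝒱.U1_mem_fil hu) (𝒱.U1_mem_fil hv)
      (by omega)]
    refine Finset.sum_congr rfl fun t _ => ?_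
    rw [T_eq, binomOp_add g.commute_L_zero_S, 𝒱.mode_sum, LinearMap.sum_apply]
    refine Finset.sum_congr rfl fun p hp => ?_
    congr 2
    have := mem_antidiagonal.mp hp
    omega
  · intro i j hij
    exact hQ _ (𝒱.preservesFil_L_zero.binomOp_mem
      (g.preservesFil_S.binomOp_mem (𝒱.U1_mem_fil hu) j) i) _ (𝒱.U1_mem_fil hv) _ (by omega)

/-- The product `resT` as a bilinear map. -/
def resTₗ (k : ℤ) : V →ₗ[ℂ] V →ₗ[ℂ] V :=
  ((g.resₗ k).compl₁₂ 𝒱.U1 𝒱.U1).compr₂ 𝒱.U1Equiv.symm.toLinearMap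

theorem resTₗ_apply (k : ℤ) (u v : V) : g.resTₗ k u v = g.resT k u v := by
  change 𝒱.U1Equiv.symm (g.res k (𝒱.U1 u) (𝒱.U1 v)) = _
  rw [LinearEquiv.symm_apply_eq, ← U1_resT]
  rfl

theorem mem_OT_iff (u : V) : u ∈ g.OT ↔ 𝒱.U1 u ∈ g.O := by
  have h1 : g.OT ≤ g.O.comap 𝒱.U1 := by
    refine Submodule.span_le.mpr ?_
    rintro _ ⟨n, d, u, v, hn, hu, rfl⟩
    refine Submodule.subset_span ⟨n, d, 𝒱.U1 u, 𝒱.U1 v, hn, ?_, g.U1_resT _ _ _⟩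
    rw [← U1_E, hu, map_smul]
  have h2 : g.O ≤ g.OT.map 𝒱.U1 := by
    refine Submodule.span_le.mpr ?_
    rintro _ ⟨n, d, u, v, hn, hu, rfl⟩
    obtain ⟨u, rfl⟩ := 𝒱.U1_bijective.2 u
    obtain ⟨v, rfl⟩ := 𝒱.U1_bijective.2 v
    refine ⟨g.resT (d - n) u v, Submodule.subset_span ⟨n, d, u, v, hn, ?_, rfl⟩, g.U1_resT _ _ _⟩
    apply 𝒱.U1_bijective.1
    rw [U1_E, hu, map_smul]
  refine ⟨fun h => h1 h, fun h => ?_⟩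
  obtain ⟨x, hx, hxu⟩ := h2 h
  rwa [← 𝒱.U1_bijective.1 hxu]

end Automorphism

/-- The algebra `Ã_g(V)`. -/
def zhuAlgebraT {V : Type*} [AddCommGroup V] [Module ℂ V] {𝒱 : VertexOperatorAlgebra V}
    (g : Automorphism 𝒱) : ZhuAlgebraT g :=
  InducedAlgebra.ofBilinear g g.bullet g.OT (g.resTₗ (-1)) (g.resTₗ_apply (-1))
    (fun u v hv => by
      rw [g.mem_OT_iff] at *
      rw [g.resTₗ_apply, g.U1_resT]
      exact g.star_O _ hv)
    (fun u hu v => by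
      rw [g.mem_OT_iff] at *
      rw [g.resTₗ_apply, g.U1_resT]
      exact g.O_star hu _)
    (fun u v w => by
      rw [g.mem_OT_iff]
      simp only [g.resTₗ_apply, map_sub, g.U1_resT]
      exact g.star_assoc _ _ _)
    (fun u => 𝒱.U1_bijective.1 (by
      rw [g.resTₗ_apply, g.U1_resT, 𝒱.U1_vac, g.res_vac_left]))
    (fun u => 𝒱.U1_bijective.1 (by
      rw [g.resTₗ_apply, g.U1_resT, 𝒱.U1_vac, g.res_vac]))
    (fun u hu => by
      rw [g.mem_OT_iff] at *
      rw [← g.op_U1]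
      exact g.op_mem_O hu)

end

end TwistedZhu

namespace TwistedZhu

noncomputable section

open Filter Topology
open Finset.HasAntidiagonal (antidiagonal mem_antidiagonal)

/-! ### Entire functions with prescribed expansions -/

/-- The function `f` is analytic at `0` with Taylor series `p`. -/
def HasTaylor (f : ℂ → ℂ) (p : PowerSeries ℂ) : Prop :=
  AnalyticAt ℂ f 0 ∧ ∀ n : ℕ, iteratedDeriv n f 0 = n.factorial * PowerSeries.coeff n p

namespace HasTaylor

variable {f g : ℂ → ℂ} {p q : PowerSeries ℂ}

theorem of_analyticAt (hf : AnalyticAt ℂ f 0) :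
    HasTaylor f (PowerSeries.mk fun n => iteratedDeriv n f 0 / n.factorial) := by
  refine ⟨hf, fun n => ?_⟩
  have h : (n.factorial : ℂ) ≠ 0 := by exact_mod_cast n.factorial_ne_zero
  rw [PowerSeries.coeff_mk]
  field_simp

theorem of_hasFPowerSeriesAt {c : ℕ → ℂ}
    (h : HasFPowerSeriesAt f (FormalMultilinearSeries.ofScalars ℂ c) 0) :
    HasTaylor f (PowerSeries.mk c) := by
  refine ⟨h.analyticAt, fun n => ?_⟩
  have h1 := h.eq_formalMultilinearSeries h.analyticAt.hasFPowerSeriesAt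
  have h2 := congrFun (FormalMultilinearSeries.ofScalars_series_injective ℂ ℂ h1) n
  have h3 : (n.factorial : ℂ) ≠ 0 := by exact_mod_cast n.factorial_ne_zero
  rw [PowerSeries.coeff_mk, h2]
  field_simp

theorem add (hf : HasTaylor f p) (hg : HasTaylor g q) : HasTaylor (fun z => f z + g z) (p + q) :=
  ⟨hf.1.add hg.1, fun n => by
    rw [iteratedDeriv_fun_add hf.1.contDiffAt hg.1.contDiffAt, hf.2, hg.2, map_add, mul_add]⟩

theorem const (c : ℂ) : HasTaylor (fun _ => c) (PowerSeries.C c) :=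
  ⟨analyticAt_const, fun n => by
    rw [iteratedDeriv_const, PowerSeries.coeff_C]
    split_ifs with h
    · rw [h]
      simp
    · simp⟩

theorem id : HasTaylor (fun z => z) PowerSeries.X :=
  ⟨analyticAt_id, fun n => by
    rw [iteratedDeriv_fun_id_zero, PowerSeries.coeff_X]
    split_ifs with h
    · rw [h]
      simp
    · simp⟩

theorem mul (hf : HasTaylor f p) (hg : HasTaylor g q) : HasTaylor (fun z => f z * g z) (p * q) :=
  ⟨hf.1.mul hg.1, fun n => by
    rw [iteratedDeriv_fun_mul hf.1.contDiffAt hg.1.contDiffAt, PowerSeries.coeff_mul,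
      Finset.Nat.sum_antidiagonal_eq_sum_range_succ_mk, Finset.mul_sum]
    refine Finset.sum_congr rfl fun i hi => ?_
    have hi' : i ≤ n := by
      rw [Finset.mem_range] at hi
      omega
    rw [hf.2, hg.2, ← Nat.choose_mul_factorial_mul_factorial hi']
    push_cast
    ring⟩

theorem pow (hf : HasTaylor f p) (n : ℕ) : HasTaylor (fun z => f z ^ n) (p ^ n) := by
  induction n with
  | zero => simpa using const 1
  | succ n ih =>
    simp only [pow_succ]
    exact ih.mul hf

theorem sum {ι : Type*} {s : Finset ι} {f : ι → ℂ → ℂ} {p : ι → PowerSeries ℂ}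
    (h : ∀ i ∈ s, HasTaylor (f i) (p i)) :
    HasTaylor (fun z => ∑ i ∈ s, f i z) (∑ i ∈ s, p i) := by
  classical
  induction s using Finset.induction_on with
  | empty => simpa using const 0
  | insert a s ha ih =>
    simp only [Finset.sum_insert ha]
    exact (h a (Finset.mem_insert_self a s)).add
      (ih fun i hi => h i (Finset.mem_insert_of_mem hi))

theorem deriv (hf : HasTaylor f p) : HasTaylor (deriv f) (PowerSeries.derivative ℂ p) :=
  ⟨hf.1.deriv, fun n => by
    rw [← iteratedDeriv_succ', hf.2, PowerSeries.coeff_derivative, Nat.factorial_succ]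
    push_cast
    ring⟩

/-- Analytic functions that agree at points accumulating at `0` have the same Taylor series. -/
theorem unique (hf : HasTaylor f p) (hg : HasTaylor g q) (h : ∃ᶠ z in 𝓝[≠] 0, f z = g z) :
    p = q := by
  have h1 : f =ᶠ[𝓝 0] g := (hf.1.frequently_eq_iff_eventually_eq hg.1).mp h
  ext n
  have h2 : iteratedDeriv n f 0 = iteratedDeriv n g 0 := h1.iteratedDeriv_eq n
  rw [hf.2, hg.2] at h2
  exact mul_left_cancel₀ (by exact_mod_cast n.factorial_ne_zero) h2

end HasTaylor

/-- A property of all real points of an interval holds frequently near its inner points. -/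
theorem frequently_of_real {P : ℂ → Prop} {a b x : ℝ} (hx : x ∈ Set.Ico a b)
    (h : ∀ y : ℝ, y ∈ Set.Ioo a b → P y) : ∃ᶠ z in 𝓝[≠] (x : ℂ), P z := by
  have h1 : Tendsto (fun y : ℝ => (y : ℂ)) (𝓝[>] x) (𝓝[≠] (x : ℂ)) := by
    refine tendsto_nhdsWithin_iff.mpr ⟨?_, ?_⟩
    · exact (Complex.continuous_ofReal.tendsto x).mono_left nhdsWithin_le_nhds
    · filter_upwards [self_mem_nhdsWithin] with y hy
      simpa using (ne_of_gt hy : y ≠ x)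
  refine h1.frequently (Eventually.frequently ?_)
  filter_upwards [Ioo_mem_nhdsGT hx.2] with y hy
  exact h y ⟨lt_of_le_of_lt hx.1 hy.1, hy.2⟩

/-- A power series that converges on `(0, 1)` defines an analytic function on the unit disc. -/
theorem exists_analytic_of_hasSum {c : ℕ → ℂ} {F : ℝ → ℂ}
    (h : ∀ x : ℝ, 0 < x → x < 1 → HasSum (fun n => c n * (x : ℂ) ^ n) (F x)) :
    ∃ f : ℂ → ℂ, DifferentiableOn ℂ f (Metric.ball 0 1) ∧
      (∀ x : ℝ, 0 < x → x < 1 → f x = F x) ∧ f 0 = c 0 ∧ HasTaylor f (PowerSeries.mk c) := by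
  set p := FormalMultilinearSeries.ofScalars ℂ c with hp
  have hr : 1 ≤ p.radius := by
    refine ENNReal.le_of_forall_nnreal_lt fun r hr => ?_
    have hr1 : (r : ℝ) < 1 := by exact_mod_cast hr
    rcases eq_or_ne r 0 with rfl | hr0
    · simp
    · refine p.le_radius_of_summable_norm ?_
      have h1 := (h r (by positivity) hr1).summable.norm
      refine h1.congr fun n => ?_
      rw [hp, FormalMultilinearSeries.ofScalars_norm, norm_mul, norm_pow, Complex.norm_real]
      simp
  have hb : HasFPowerSeriesOnBall p.sum p 0 p.radius :=
    p.hasFPowerSeriesOnBall (lt_of_lt_of_le one_pos hr)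
  have hsum : ∀ z, p.sum z = ∑' n, c n * z ^ n := fun z =>
    FormalMultilinearSeries.ofScalars_sum_eq c z
  refine ⟨p.sum, ?_, fun x h0 h1 => ?_, ?_, ?_⟩
  · refine hb.differentiableOn.mono fun z hz => ?_
    have : edist z 0 < 1 := by
      rw [edist_dist]
      exact ENNReal.ofReal_lt_one.mpr hz
    exact lt_of_lt_of_le this hr
  · rw [hsum]
    exact (h x h0 h1).tsum_eq
  · rw [hsum, tsum_eq_single 0]
    · simp
    · intro n hn
      simp [hn]
  · exact HasTaylor.of_hasFPowerSeriesAt hb.hasFPowerSeriesAt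

/-- Liouville's theorem for functions of polynomial growth. -/
theorem exists_coeffs_of_tendsto (t : ℕ) : ∀ {f : ℂ → ℂ} {b : ℂ}, Differentiable ℂ f →
    Tendsto (fun z => f z / (z - 1) ^ t) (cocompact ℂ) (𝓝 b) →
    ∃ c : ℕ → ℂ, c t = b ∧ ∀ z, f z = ∑ k ∈ Finset.range (t + 1), c k * (z - 1) ^ k := by
  induction t with
  | zero =>
    intro f b hf hb
    refine ⟨fun _ => b, rfl, fun z => ?_⟩
    have h := hf.apply_eq_of_tendsto_cocompact z (by simpa using hb)
    simpa using h
  | succ t ih =>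
    intro f b hf hb
    have hg : Differentiable ℂ (dslope f 1) := by
      rw [← differentiableOn_univ] at *
      exact (Complex.differentiableOn_dslope univ_mem).mpr hf
    have hne : ∀ᶠ z : ℂ in cocompact ℂ, z ≠ 1 := by
      have := (Set.finite_singleton (1 : ℂ)).isCompact.compl_mem_cocompact
      filter_upwards [this] with z hz
      simpa using hz
    have hz1 : Tendsto (fun z : ℂ => (z - 1)⁻¹) (cocompact ℂ) (𝓝 0) := by
      rw [← Metric.cobounded_eq_cocompact]
      refine tendsto_inv₀_cobounded.comp ?_
      exact tendsto_sub_const_cobounded 1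
    have h1 : Tendsto (fun z => dslope f 1 z / (z - 1) ^ t) (cocompact ℂ) (𝓝 b) := by
      have h2 : Tendsto (fun z => f z / (z - 1) ^ (t + 1) - f 1 * ((z - 1)⁻¹) ^ (t + 1))
          (cocompact ℂ) (𝓝 b) := by
        have := hb.sub ((hz1.pow (t + 1)).const_mul (f 1))
        simpa using this
      refine h2.congr' ?_
      filter_upwards [hne] with z hz
      have hz' : z - 1 ≠ 0 := sub_ne_zero.mpr hz
      rw [dslope_of_ne _ hz, slope_def_field, inv_pow, pow_succ]
      field_simp
    obtain ⟨c, hc, hfc⟩ := ih hg h1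
    refine ⟨fun k => if k = 0 then f 1 else c (k - 1), by simp [hc], fun z => ?_⟩
    rw [Finset.sum_range_succ']
    have h3 : f z = f 1 + (z - 1) * dslope f 1 z := by
      have := sub_smul_dslope f 1 z
      rw [smul_eq_mul] at this
      rw [this]
      ring
    rw [h3, hfc z, Finset.mul_sum]
    simp only [Nat.succ_ne_zero, if_false, if_true, Nat.add_sub_cancel, pow_zero, mul_one]
    rw [add_comm]
    congr 1
    refine Finset.sum_congr rfl fun k _ => ?_
    rw [pow_succ]
    ring

/-- An identity between an entire function and a function of `e ^ ζ` extends from the negative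
real numbers to the left half plane. -/
theorem eq_comp_exp_of_real {F f : ℂ → ℂ} (hF : Differentiable ℂ F)
    (hf : DifferentiableOn ℂ f (Metric.ball 0 1))
    (h : ∀ x : ℝ, x < 0 → F x = f (Complex.exp x)) {ζ : ℂ} (hζ : ζ.re < 0) :
    F ζ = f (Complex.exp ζ) := by
  set U : Set ℂ := {z | z.re < 0} with hU
  have hUo : IsOpen U := isOpen_lt Complex.continuous_re continuous_const
  have hUc : IsPreconnected U := (convex_halfSpace_re_lt 0).isPreconnected
  have h1 : AnalyticOnNhd ℂ F U := (hF.differentiableOn).analyticOnNhd hUo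
  have h2 : AnalyticOnNhd ℂ (fun z => f (Complex.exp z)) U := by
    refine DifferentiableOn.analyticOnNhd ?_ hUo
    refine hf.comp Complex.differentiable_exp.differentiableOn fun z hz => ?_
    rw [mem_ball_zero_iff, Complex.norm_exp]
    exact Real.exp_lt_one_iff.mpr hz
  have h3 : (((-1 : ℝ) : ℂ)) ∈ U := by simp [hU]
  refine h1.eqOn_of_preconnected_of_frequently_eq h2 hUc h3 ?_ hζ
  exact frequently_of_real (a := -1) (b := 0) (by norm_num) fun y hy => h y hy.2

/-- An entire function `Φ` which is, for negative real numbers and for positive real numbers, a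
function of `e ^ ζ` that is analytic at `0` respectively at infinity, up to a factor `e ^ (t ζ)`, is
a polynomial in `e ^ ζ`. -/
theorem exists_polynomial_in_exp {Φ a b : ℂ → ℂ} {t : ℕ} (hΦ : Differentiable ℂ Φ)
    (ha : DifferentiableOn ℂ a (Metric.ball 0 1)) (hb : DifferentiableOn ℂ b (Metric.ball 0 1))
    (hA : ∀ x : ℝ, 0 < x → Φ x = (Complex.exp x - 1) ^ t * a (Complex.exp (-x)))
    (hB : ∀ x : ℝ, x < 0 → Φ x = (Complex.exp x - 1) ^ t * b (Complex.exp x)) :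
    ∃ c : ℕ → ℂ, c t = a 0 ∧ (∑ k ∈ Finset.range (t + 1), c k * (-1) ^ k = (-1) ^ t * b 0) ∧
      ∀ ζ, Φ ζ = ∑ k ∈ Finset.range (t + 1), c k * (Complex.exp ζ - 1) ^ k := by
  have hB' : ∀ ζ : ℂ, ζ.re < 0 → Φ ζ = (Complex.exp ζ - 1) ^ t * b (Complex.exp ζ) := fun ζ hζ =>
    eq_comp_exp_of_real (f := fun z => (z - 1) ^ t * b z) hΦ (by fun_prop) hB hζ
  have hA' : ∀ ζ : ℂ, 0 < ζ.re → Φ ζ = (Complex.exp ζ - 1) ^ t * a (Complex.exp (-ζ)) := by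
    intro ζ hζ
    have hexp : ∀ ζ : ℂ, (1 - Complex.exp (-ζ)) ^ t
        = Complex.exp (t * -ζ) * (Complex.exp ζ - 1) ^ t := fun ζ => by
      rw [Complex.exp_nat_mul, ← mul_pow, mul_sub, ← Complex.exp_add]
      simp
    have h := eq_comp_exp_of_real (F := fun ζ => Complex.exp (t * ζ) * Φ (-ζ))
      (f := fun z => (1 - z) ^ t * a z) (by fun_prop) (by fun_prop) (fun x hx => ?_)
      (ζ := -ζ) (by simpa using hζ)
    · rw [neg_neg, hexp, mul_assoc] at h
      exact mul_left_cancel₀ (Complex.exp_ne_zero _) h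
    · have h1 := hA (-x) (by linarith)
      have h2 := hexp (-x)
      rw [neg_neg] at h2
      push_cast at h1
      rw [neg_neg] at h1
      rw [h1, h2, mul_assoc]
  have hper : Function.Periodic Φ (2 * Real.pi * Complex.I) := by
    have h1 : AnalyticOnNhd ℂ Φ Set.univ := hΦ.differentiableOn.analyticOnNhd isOpen_univ
    have h2 : AnalyticOnNhd ℂ (fun ζ => Φ (ζ + 2 * Real.pi * Complex.I)) Set.univ :=
      (by fun_prop : Differentiable ℂ fun ζ =>
        Φ (ζ + 2 * Real.pi * Complex.I)).differentiableOn.analyticOnNhd isOpen_univ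
    have h3 := h2.eqOn_of_preconnected_of_frequently_eq h1 isPreconnected_univ
      (Set.mem_univ ((-1 : ℝ) : ℂ))
      (frequently_of_real (a := -1) (b := 0) (by norm_num) fun y hy => ?_)
    · exact fun ζ => h3 (Set.mem_univ ζ)
    · rw [hB' _ (by simpa using hy.2), hB' _ (by simpa using hy.2), Complex.exp_periodic]
  set H : ℂ → ℂ := fun z => if z = 0 then (-1) ^ t * b 0 else Φ (Complex.log z) with hHdef
  have hH : ∀ ζ, H (Complex.exp ζ) = Φ ζ := by
    intro ζ
    obtain ⟨n, hn⟩ := Complex.log_exp_exists ζ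
    rw [hHdef]
    dsimp only
    rw [if_neg (Complex.exp_ne_zero ζ), hn]
    exact hper.int_mul n ζ
  have hHball : ∀ z ∈ Metric.ball (0 : ℂ) 1, H z = (z - 1) ^ t * b z := by
    intro z hz
    by_cases hz0 : z = 0
    · rw [hHdef, hz0]
      simp
    · have h1 : (Complex.log z).re < 0 := by
        rw [Complex.log_re]
        exact Real.log_neg (norm_pos_iff.mpr hz0) (by simpa using hz)
      have h2 := hB' _ h1
      rw [← hH, Complex.exp_log hz0] at h2
      exact h2
  have hHd : Differentiable ℂ H := by
    intro z
    by_cases hz0 : z = 0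
    · have h1 : DifferentiableAt ℂ (fun z => (z - 1) ^ t * b z) z := by
        have : DifferentiableOn ℂ (fun z => (z - 1) ^ t * b z) (Metric.ball 0 1) := by fun_prop
        exact this.differentiableAt (Metric.isOpen_ball.mem_nhds (by simp [hz0]))
      refine h1.congr_of_eventuallyEq ?_
      filter_upwards [Metric.isOpen_ball.mem_nhds (show z ∈ Metric.ball (0 : ℂ) 1 by simp [hz0])]
        with y hy
      exact hHball y hy
    · rcases Complex.mem_slitPlane_or_neg_mem_slitPlane hz0 with hs | hs
      · have h1 : DifferentiableAt ℂ (fun z => Φ (Complex.log z)) z :=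
          (hΦ _).comp z (Complex.differentiableAt_log hs)
        refine h1.congr_of_eventuallyEq ?_
        filter_upwards [isOpen_ne.mem_nhds hz0] with y hy
        rw [hHdef]
        exact if_neg hy
      · have h1 : DifferentiableAt ℂ (fun z => Φ (Complex.log (-z) + Real.pi * Complex.I)) z := by
          have h2 : DifferentiableAt ℂ (fun z => Complex.log (-z) + Real.pi * Complex.I) z :=
            (differentiableAt_id.neg.clog hs).add_const _
          exact (hΦ _).comp z h2
        refine h1.congr_of_eventuallyEq ?_
        filter_upwards [isOpen_ne.mem_nhds hz0] with y hy
        rw [← hH, Complex.exp_add, Complex.exp_pi_mul_I, Complex.exp_log (neg_ne_zero.mpr hy)]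
        simp
  have hlim : Tendsto (fun z => H z / (z - 1) ^ t) (cocompact ℂ) (𝓝 (a 0)) := by
    have h1 : Tendsto (fun z : ℂ => a z⁻¹) (cocompact ℂ) (𝓝 (a 0)) := by
      rw [← Metric.cobounded_eq_cocompact]
      have h2 : ContinuousAt a 0 :=
        (ha.differentiableAt (Metric.isOpen_ball.mem_nhds (by simp))).continuousAt
      exact h2.tendsto.comp tendsto_inv₀_cobounded
    refine h1.congr' ?_
    have h2 : ∀ᶠ z : ℂ in cocompact ℂ, 1 < ‖z‖ := by
      rw [← Metric.cobounded_eq_cocompact]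
      exact tendsto_norm_cobounded_atTop.eventually_gt_atTop 1
    filter_upwards [h2] with z hz
    have hz0 : z ≠ 0 := by
      rintro rfl
      norm_num at hz
    have hz1 : z - 1 ≠ 0 := by
      intro h
      rw [sub_eq_zero.mp h] at hz
      norm_num at hz
    have h3 := hA' (Complex.log z) (by
      rw [Complex.log_re]
      exact Real.log_pos hz)
    rw [← hH, Complex.exp_neg, Complex.exp_log hz0] at h3
    rw [h3]
    field_simp
  obtain ⟨c, hc, hHc⟩ := exists_coeffs_of_tendsto t hHd hlim
  refine ⟨c, hc, ?_, fun ζ => ?_⟩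
  · have h1 := hHc 0
    rw [hHball 0 (by simp), zero_sub] at h1
    exact h1.symm
  · rw [← hH, hHc]

/-- The function `(1 + y) ^ l (log (1 + y)) ^ j / j!`. -/
def powLog (l : ℂ) (j : ℕ) (y : ℂ) : ℂ :=
  Complex.exp (l * Complex.log (1 + y)) * (Complex.log (1 + y) ^ j / j.factorial)

theorem analyticAt_log_one_add : AnalyticAt ℂ (fun y : ℂ => Complex.log (1 + y)) 0 :=
  (analyticAt_const.add analyticAt_id).clog (by simp)

theorem analyticAt_powLog (l : ℂ) (j : ℕ) : AnalyticAt ℂ (powLog l j) 0 := by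
  have h := analyticAt_log_one_add
  exact ((analyticAt_const.mul h).cexp).mul ((h.pow j).div_const)

/-- The Taylor series of `(1 + y) ^ l (log (1 + y)) ^ j / j!` at `0`. -/
def powLogSeries (l : ℂ) (j : ℕ) : PowerSeries ℂ :=
  PowerSeries.mk fun n => iteratedDeriv n (powLog l j) 0 / n.factorial

theorem hasTaylor_powLog (l : ℂ) (j : ℕ) : HasTaylor (powLog l j) (powLogSeries l j) :=
  HasTaylor.of_analyticAt (analyticAt_powLog l j)

theorem coeff_zero_powLogSeries (l : ℂ) (j : ℕ) :
    PowerSeries.coeff 0 (powLogSeries l j) = if j = 0 then 1 else 0 := by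
  rw [powLogSeries, PowerSeries.coeff_mk, iteratedDeriv_zero, powLog]
  rcases j with _ | j <;> simp

theorem deriv_powLog (l : ℂ) (j : ℕ) : ∀ᶠ y in 𝓝 (0 : ℂ), (1 + y) * deriv (powLog l j) y
    = l * powLog l j y + if j = 0 then 0 else powLog l (j - 1) y := by
  have h0 : ∀ᶠ y in 𝓝 (0 : ℂ), 1 + y ∈ Complex.slitPlane := by
    have : ContinuousAt (fun y : ℂ => 1 + y) 0 := by fun_prop
    exact this.eventually_mem (Complex.isOpen_slitPlane.mem_nhds (by simp))
  filter_upwards [h0] with y hy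
  have hne := Complex.slitPlane_ne_zero hy
  have h1 : HasDerivAt (fun y : ℂ => Complex.log (1 + y)) (1 + y)⁻¹ y := by
    have := ((hasDerivAt_id y).const_add 1).clog hy
    simpa using this
  have h2 : HasDerivAt (powLog l j) _ y :=
    ((h1.const_mul l).cexp).mul ((h1.pow j).div_const (j.factorial : ℂ))
  rw [h2.deriv, powLog]
  rcases j with _ | j
  · simp
    field_simp
  · have hf : (j.factorial : ℂ) ≠ 0 := by exact_mod_cast j.factorial_ne_zero
    have hf' : (j : ℂ) + 1 ≠ 0 := by exact_mod_cast j.succ_ne_zero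
    rw [if_neg (Nat.succ_ne_zero j), powLog, Nat.factorial_succ, Nat.add_sub_cancel]
    push_cast
    field_simp

theorem coeff_succ_powLogSeries (l : ℂ) (j n : ℕ) :
    ((n : ℂ) + 1) * PowerSeries.coeff (n + 1) (powLogSeries l j)
      = (l - n) * PowerSeries.coeff n (powLogSeries l j)
        + if j = 0 then 0 else PowerSeries.coeff n (powLogSeries l (j - 1)) := by
  have h1 := ((HasTaylor.const 1).add HasTaylor.id).mul (hasTaylor_powLog l j).deriv
  have h2 : HasTaylor (fun y => l * powLog l j y + if j = 0 then 0 else powLog l (j - 1) y)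
      (PowerSeries.C l * powLogSeries l j + if j = 0 then 0 else powLogSeries l (j - 1)) := by
    refine ((HasTaylor.const l).mul (hasTaylor_powLog l j)).add ?_
    split_ifs
    · simpa using HasTaylor.const 0
    · exact hasTaylor_powLog l (j - 1)
  have h3 := congrArg (PowerSeries.coeff n)
    (h1.unique h2 ((deriv_powLog l j).filter_mono nhdsWithin_le_nhds).frequently)
  rw [map_one, add_mul, one_mul, map_add, map_add, PowerSeries.coeff_derivative,
    PowerSeries.coeff_C_mul] at h3
  have h4 : PowerSeries.coeff n (PowerSeries.X * PowerSeries.derivative ℂ (powLogSeries l j))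
      = n * PowerSeries.coeff n (powLogSeries l j) := by
    rcases n with _ | n
    · simp
    · rw [PowerSeries.coeff_succ_X_mul, PowerSeries.coeff_derivative]
      push_cast
      ring
  have h5 : PowerSeries.coeff n (if j = 0 then 0 else powLogSeries l (j - 1))
      = if j = 0 then 0 else PowerSeries.coeff n (powLogSeries l (j - 1)) := by
    split_ifs <;> simp
  rw [h4, h5] at h3
  linear_combination h3

/-- If `T = l + N` with `N` nilpotent on the orbit of `u`, then
`(1 + y) ^ T u = ∑_j (1 + y) ^ l (log (1 + y)) ^ j / j! N ^ j u`. -/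
theorem binomOp_eq_sum_powLogSeries {V : Type*} [AddCommGroup V] [Module ℂ V]
    {T N : Module.End ℂ V} {l : ℂ} {u : V} {J : ℕ} (hN : (N ^ J) u = 0)
    (hT : ∀ j, T ((N ^ j) u) = l • (N ^ j) u + (N ^ (j + 1)) u) (i : ℕ) : binomOp T i u
      = ∑ j ∈ Finset.range J, PowerSeries.coeff i (powLogSeries l j) • (N ^ j) u := by
  induction i with
  | zero =>
    rcases J with _ | J
    · rw [pow_zero, Module.End.one_apply] at hN
      simp [hN]
    · rw [Finset.sum_range_succ', Finset.sum_eq_zero]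
      · simp [coeff_zero_powLogSeries]
      · intro j _
        simp [coeff_zero_powLogSeries]
  | succ i ih =>
    have h' : (i : ℂ) + 1 ≠ 0 := by exact_mod_cast i.succ_ne_zero
    apply smul_right_injective _ h'
    change ((i : ℂ) + 1) • _ = ((i : ℂ) + 1) • _
    rw [binomOp_succ_apply, ih, map_sum, Finset.smul_sum, Finset.smul_sum]
    simp only [map_smul, hT, smul_smul, coeff_succ_powLogSeries, smul_add, add_smul,
      Finset.sum_add_distrib]
    have e : ∑ j ∈ Finset.range J, (if j = 0 then 0 else
        PowerSeries.coeff i (powLogSeries l (j - 1))) • (N ^ j) u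
        = ∑ j ∈ Finset.range J, PowerSeries.coeff i (powLogSeries l j) • (N ^ (j + 1)) u := by
      have h1 := Finset.sum_range_succ (fun j => (if j = 0 then 0 else
        PowerSeries.coeff i (powLogSeries l (j - 1))) • (N ^ j) u) J
      rw [hN, smul_zero, add_zero] at h1
      rw [← h1, Finset.sum_range_succ']
      simp
    rw [e, add_sub_right_comm, ← Finset.sum_sub_distrib]
    congr 1
    refine Finset.sum_congr rfl fun j _ => ?_
    rw [← sub_smul]
    congr 1
    ring

/-- The residue calculus behind the commutation relations. The function
`(1 + y) ^ l ∑_j (log (1 + y)) ^ j / j! E_j(log (1 + y)) y ^ (-t)` is expanded at infinity, at `y = -1`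
and at `y = 0`. It is a Laurent polynomial in `y`. -/
theorem exists_laurent_coeffs {J t Q : ℕ} {l : ℂ} {E : ℕ → ℂ → ℂ} {α β : ℕ → ℂ} {γ : ℕ → ℕ → ℂ}
    (hE : ∀ j < J, Differentiable ℂ (E j))
    (hA : ∀ x : ℝ, 0 < x → x < 1 → HasSum (fun s => α s * (x : ℂ) ^ s)
      (Complex.exp (l * -Real.log x) * ∑ j ∈ Finset.range J,
        (-Real.log x : ℂ) ^ j / j.factorial * (E j (-Real.log x) / ((x : ℂ)⁻¹ - 1) ^ t)))
    (hB : ∀ x : ℝ, 0 < x → x < 1 → HasSum (fun s => β s * (x : ℂ) ^ s)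
      (Complex.exp (l * Real.log x) * ∑ j ∈ Finset.range J,
        (Real.log x : ℂ) ^ j / j.factorial * (E j (Real.log x) / ((x : ℂ) - 1) ^ t)))
    (hC : ∀ j < J, ∀ y : ℝ, 0 < y → y < 1 → HasSum (fun i => γ j i * (y : ℂ) ^ i)
      ((y : ℂ) ^ Q * (E j (Real.log (1 + y)) / (y : ℂ) ^ t))) :
    ∃ c : ℕ → ℂ, (∀ k, t < k → c k = 0) ∧ c t = α 0 ∧
      (∑ k ∈ Finset.range (t + 1), c k * (-1) ^ k = (-1) ^ t * β 0) ∧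
      ∀ n : ℕ, (if Q ≤ n + t then c (n + t - Q) else 0) = ∑ j ∈ Finset.range J,
        ∑ p ∈ antidiagonal n, PowerSeries.coeff p.1 (powLogSeries l j) * γ j p.2 := by
  set Φ : ℂ → ℂ := fun ζ => Complex.exp (l * ζ) *
    ∑ j ∈ Finset.range J, ζ ^ j / j.factorial * E j ζ with hΦ
  have hΦd : Differentiable ℂ Φ := by
    refine Differentiable.mul (by fun_prop) (Differentiable.fun_sum fun j hj => ?_)
    exact ((differentiable_id.pow j).div_const _).mul (hE j (Finset.mem_range.mp hj))
  have hΦ' : ∀ ζ d : ℂ, Complex.exp (l * ζ) *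
      ∑ j ∈ Finset.range J, ζ ^ j / j.factorial * (E j ζ / d) = Φ ζ / d := fun ζ d => by
    rw [hΦ]
    dsimp only
    rw [mul_div_assoc, Finset.sum_div]
    simp only [mul_div_assoc]
  obtain ⟨a, had, ha, ha0, -⟩ := exists_analytic_of_hasSum hA
  obtain ⟨b, hbd, hb, hb0, -⟩ := exists_analytic_of_hasSum hB
  obtain ⟨c, hct, hc0, hc⟩ := exists_polynomial_in_exp (t := t) hΦd had hbd (fun x hx => by
    have h1 := ha (Real.exp (-x)) (Real.exp_pos _) (Real.exp_lt_one_iff.mpr (by linarith))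
    rw [hΦ', Real.log_exp] at h1
    push_cast at h1
    rw [h1, neg_neg, Complex.exp_neg, inv_inv, mul_div_cancel₀]
    exact pow_ne_zero _ (by
      rw [← Complex.ofReal_exp]
      have := Real.one_lt_exp_iff.mpr hx
      exact_mod_cast (sub_pos.mpr this).ne')) (fun x hx => by
    have h1 := hb (Real.exp x) (Real.exp_pos _) (Real.exp_lt_one_iff.mpr hx)
    rw [hΦ', Real.log_exp] at h1
    push_cast at h1
    rw [h1, mul_div_cancel₀]
    exact pow_ne_zero _ (by
      rw [← Complex.ofReal_exp]
      have := Real.exp_lt_one_iff.mpr hx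
      exact_mod_cast (sub_neg.mpr this).ne))
  set c' : ℕ → ℂ := fun k => if k ≤ t then c k else 0 with hc'
  have hc'e : ∀ k ∈ Finset.range (t + 1), c k = c' k := fun k hk => by
    rw [hc']
    exact (if_pos (Nat.lt_succ_iff.mp (Finset.mem_range.mp hk))).symm
  refine ⟨c', fun k hk => if_neg (not_le.mpr hk), ?_, ?_, fun n => ?_⟩
  · rw [← hc'e t (Finset.self_mem_range_succ t), hct, ha0]
  · rw [← hb0, ← hc0]
    exact Finset.sum_congr rfl fun k hk => by rw [hc'e k hk]
  · choose! G hGd hG hG0 hGt using fun j (hj : j < J) => exists_analytic_of_hasSum (hC j hj)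
    have h1 : HasTaylor (fun y => y ^ t * ∑ j ∈ Finset.range J, powLog l j y * G j y)
        (PowerSeries.X ^ t * ∑ j ∈ Finset.range J, powLogSeries l j * PowerSeries.mk (γ j)) :=
      (HasTaylor.id.pow t).mul (HasTaylor.sum fun j hj =>
        (hasTaylor_powLog l j).mul (hGt j (Finset.mem_range.mp hj)))
    have h2 : HasTaylor (fun y => y ^ Q * ∑ k ∈ Finset.range (t + 1), c k * y ^ k)
        (PowerSeries.X ^ Q * ∑ k ∈ Finset.range (t + 1), PowerSeries.C (c k) * PowerSeries.X ^ k) :=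
      (HasTaylor.id.pow Q).mul (HasTaylor.sum fun k _ =>
        (HasTaylor.const (c k)).mul (HasTaylor.id.pow k))
    have h3 := h1.unique h2 (by
      rw [← Complex.ofReal_zero]
      refine frequently_of_real (a := 0) (b := 1) (by norm_num) fun y hy => ?_
      have hy0 : (y : ℂ) ≠ 0 := by exact_mod_cast hy.1.ne'
      have h4 := hc (Real.log (1 + y))
      have hlog : Complex.log (1 + y) = (Real.log (1 + y) : ℝ) := by
        rw [Complex.ofReal_log (by linarith [hy.1])]
        push_cast
        rfl
      rw [← Complex.ofReal_exp, Real.exp_log (by linarith [hy.1])] at h4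
      push_cast at h4
      rw [add_sub_cancel_left] at h4
      rw [← h4, hΦ]
      dsimp only
      rw [Finset.mul_sum, Finset.mul_sum, Finset.mul_sum]
      refine Finset.sum_congr rfl fun j hj => ?_
      rw [hG j (Finset.mem_range.mp hj) y hy.1 hy.2, powLog, hlog]
      field_simp)
    have h4 := congrArg (PowerSeries.coeff (n + t)) h3
    rw [PowerSeries.coeff_X_pow_mul, PowerSeries.coeff_X_pow_mul'] at h4
    have h5 : ∀ i, PowerSeries.coeff i
        (∑ k ∈ Finset.range (t + 1), PowerSeries.C (c k) * PowerSeries.X ^ k) = c' i := by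
      intro i
      rw [map_sum]
      simp only [PowerSeries.coeff_C_mul, PowerSeries.coeff_X_pow]
      by_cases hi : i ≤ t
      · rw [Finset.sum_eq_single i]
        · simp [hc', hi]
        · intro k _ hk
          rw [if_neg (Ne.symm hk), mul_zero]
        · intro h
          exact absurd (Finset.mem_range.mpr (by omega)) h
      · rw [hc']
        dsimp only
        rw [if_neg hi]
        refine Finset.sum_eq_zero fun k hk => ?_
        rw [Finset.mem_range] at hk
        rw [if_neg (by omega), mul_zero]
    rw [h5] at h4
    rw [← h4, map_sum]
    refine Finset.sum_congr rfl fun j _ => ?_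
    rw [PowerSeries.coeff_mul]
    simp only [PowerSeries.coeff_mk]

end

end TwistedZhu

namespace TwistedZhu

noncomputable section

open Finset.HasAntidiagonal (antidiagonal mem_antidiagonal)

/-! ### Degrees in a twisted module -/

/-- A vector is zero if all its homogeneous components are zero. -/
theorem eq_zero_of_byGrading_eq_zero {ι W : Type*} [DecidableEq ι] [AddCommGroup W] [Module ℂ W]
    {ℳ : ι → Submodule ℂ W} (h : DirectSum.IsInternal ℳ) {x : W}
    (hx : ∀ i, byGrading ℳ h (fun j => if j = i then LinearMap.id else 0) x = 0) : x = 0 := by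
  obtain ⟨f, rfl⟩ := h.2 x
  have h1 : ∀ i, byGrading ℳ h (fun j => if j = i then LinearMap.id else 0)
      ∘ₗ DirectSum.coeLinearMap ℳ = (ℳ i).subtype ∘ₗ DirectSum.component ℂ ι (fun i => ℳ i) i := by
    intro i
    refine DirectSum.linearMap_ext _ fun j => LinearMap.ext fun y => ?_
    simp only [LinearMap.comp_apply, DirectSum.coeLinearMap_lof]
    rw [byGrading_apply _ _ _ y.2]
    split_ifs with hj
    · subst hj
      simp [DirectSum.component.lof_self]
    · rw [DirectSum.component.of, dif_neg hj]
      simp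
  have h2 : f = 0 := by
    refine DFinsupp.ext fun i => ?_
    have h3 := LinearMap.congr_fun (h1 i) f
    rw [LinearMap.comp_apply] at h3
    erw [hx i] at h3
    exact Subtype.ext h3.symm
  rw [h2]
  exact map_zero _

namespace TwistedData

variable {V W : Type*} [AddCommGroup V] [Module ℂ V] [AddCommGroup W] [Module ℂ W]
  (D : TwistedData V W)

theorem gr_le_deg (n : ℂ) (a : Strip) : D.gr (n, a) ≤ D.deg n :=
  le_iSup (fun a => D.gr (n, a)) a

theorem gr_le_gen (n : ℂ) (a : Strip) : D.gr (n, a) ≤ D.gen a :=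
  le_iSup (fun n => D.gr (n, a)) n

theorem deg_induction {n : ℂ} {P : W → Prop} (h0 : P 0) (hadd : ∀ x y, P x → P y → P (x + y))
    (hh : ∀ a, ∀ w ∈ D.gr (n, a), P w) {w : W} (hw : w ∈ D.deg n) : P w := by
  induction hw using Submodule.iSup_induction' with
  | mem i x hx => exact hh i x hx
  | zero => exact h0
  | add x y _ _ hx hy => exact hadd x y hx hy

theorem proj_of_mem {n r : ℂ} {w : W} (hw : w ∈ D.deg r) :
    D.proj n w = if r = n then w else 0 := by
  refine D.deg_induction (P := fun w => D.proj n w = if r = n then w else 0) (by simp)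
    (fun x y hx hy => ?_) (fun a x hx => ?_) hw
  · rw [map_add, hx, hy]
    split_ifs <;> simp
  · rw [proj, byGrading_apply _ _ _ hx]
    split_ifs <;> rfl

theorem top_induction {P : W → Prop} (h0 : P 0) (hadd : ∀ x y, P x → P y → P (x + y))
    (hh : ∀ n, ∀ w ∈ D.deg n, P w) (w : W) : P w := by
  have hw : w ∈ ⨆ i, D.gr i := D.gr_isInternal.submodule_iSup_eq_top ▸ Submodule.mem_top
  induction hw using Submodule.iSup_induction' with
  | mem i x hx => exact hh i.1 x (D.gr_le_deg _ i.2 hx)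
  | zero => exact h0
  | add x y _ _ hx hy => exact hadd x y hx hy

theorem deg_eq_bot {n : ℂ} (hn : n.re < 0) : D.deg n = ⊥ :=
  iSup_eq_bot.mpr fun a => D.gr_eq_bot n a hn

end TwistedData

/-! ### Consequences of equivariance -/

theorem logBranch_one (p : ℤ) : logBranch p 1 = twoPiI * p := by
  simp only [logBranch, arg0, twoPiI, norm_one, Real.log_one, Complex.arg_one, le_refl, if_true,
    Complex.ofReal_zero, zero_mul, zero_add]
  ring

/-- A polynomial with `p(x + τ) = μ p(x)` and `μ ≠ 1` is zero: compare leading coefficients. -/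
theorem polynomial_eq_zero_of_shift {p : Polynomial ℂ} {τ μ : ℂ} (hτ : τ ≠ 0) (hμ : μ ≠ 1)
    (h : ∀ k : ℕ, p.eval (τ * (k + 1)) = μ * p.eval (τ * k)) : p = 0 := by
  have h1 : p.comp (Polynomial.X + Polynomial.C τ) = Polynomial.C μ * p := by
    refine Polynomial.eq_of_infinite_eval_eq _ _
      ((Set.infinite_range_of_injective (f := fun k : ℕ => τ * (k : ℂ))
        fun i j hij => by simpa [hτ] using hij).mono ?_)
    rintro _ ⟨k, rfl⟩
    simp only [Set.mem_ofPred_eq, Polynomial.eval_comp, Polynomial.eval_add, Polynomial.eval_X,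
      Polynomial.eval_C, Polynomial.eval_mul]
    rw [← h k, mul_add, mul_one]
  have h2 := congrArg Polynomial.leadingCoeff h1
  rw [Polynomial.leadingCoeff_comp (by simp), Polynomial.leadingCoeff_mul,
    Polynomial.leadingCoeff_C, Polynomial.leadingCoeff_X_add_C, one_pow, mul_one] at h2
  have h3 : (μ - 1) * p.leadingCoeff = 0 := by
    rw [sub_mul, ← h2, one_mul, sub_self]
  exact Polynomial.leadingCoeff_eq_zero.mp
    ((mul_eq_zero.mp h3).resolve_left (sub_ne_zero.mpr hμ))

namespace WeakTwistedModule

variable {V W : Type*} [AddCommGroup V] [Module ℂ V] [AddCommGroup W] [Module ℂ W]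
  {𝒱 : VertexOperatorAlgebra V} {g : Automorphism 𝒱} (M : WeakTwistedModule 𝒱 g W)

theorem branch_eq_sum {m : ℤ} {v : V} (hv : v ∈ 𝒱.wt m) {r : ℂ} {w : W} (hw : w ∈ M.deg r)
    {K : ℕ} (hK : ∀ n k, K ≤ k → M.Yg n k v w = 0) (p : ℤ) (z n : ℂ) :
    M.branch p v z w n = ∑ k ∈ Finset.range K,
      TwistedData.monomial p z (m - 1 + r - n) k • M.Yg (m - 1 + r - n) k v w := by
  classical
  have h1 : ∀ q : ℂ × ℕ, M.proj n (M.Yg q.1 q.2 v w)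
      = if q.1 = m - 1 + r - n then M.Yg q.1 q.2 v w else 0 := fun q => by
    rw [M.proj_of_mem (M.degree m v hv r w hw q.1 q.2)]
    refine if_congr ⟨fun h => ?_, fun h => ?_⟩ rfl rfl
    · rw [← h]
      ring
    · rw [h]
      ring
  rw [TwistedData.branch, finsum_eq_sum_of_support_subset (s := (Finset.range K).map
    ⟨fun k => ((m - 1 + r - n : ℂ), k), fun i j hij => (Prod.mk.inj hij).2⟩)]
  · rw [Finset.sum_map]
    refine Finset.sum_congr rfl fun k _ => ?_
    rw [h1]
    exact congrArg _ (if_pos rfl)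
  · intro q hq
    rw [Function.mem_support, h1] at hq
    have hq1 : q.1 = m - 1 + r - n := by
      by_contra hne
      rw [if_neg hne, smul_zero] at hq
      exact hq rfl
    have hq2 : q.2 < K := by
      by_contra hlt
      rw [hK _ _ (not_lt.mp hlt), ite_self, smul_zero] at hq
      exact hq rfl
    simp only [Finset.coe_map, Set.mem_image, Finset.coe_range, Set.mem_Iio]
    exact ⟨q.2, hq2, by rw [← hq1]; rfl⟩

theorem exists_log_bound (v v' : V) (w : W) : ∃ K : ℕ, ∀ n k, K ≤ k →
    M.Yg n k v w = 0 ∧ M.Yg n k v' w = 0 := by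
  obtain ⟨K, hK⟩ := M.log_finite v w
  obtain ⟨K', hK'⟩ := M.log_finite v' w
  exact ⟨K + K' + 1, fun n k hk => ⟨hK n k (by omega), hK' n k (by omega)⟩⟩

/-- Equivariance at `z = 1`, coefficient by coefficient. -/
theorem sum_Yg_op {m : ℤ} {v : V} (hv : v ∈ 𝒱.wt m) {r : ℂ} {w : W} (hw : w ∈ M.deg r) (n : ℂ)
    {K : ℕ} (hK : ∀ n k, K ≤ k → M.Yg n k v w = 0)
    (hK' : ∀ n k, K ≤ k → M.Yg n k (g.op v) w = 0) (p : ℤ) :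
    ∑ k ∈ Finset.range K, (twoPiI * (p + 1)) ^ k • M.Yg n k (g.op v) w
      = Complex.exp (twoPiI * n) • ∑ k ∈ Finset.range K, (twoPiI * p) ^ k • M.Yg n k v w := by
  have h := congrFun (M.equivariance p 1 one_ne_zero v w) (m - 1 + r - n)
  rw [M.branch_eq_sum hv hw hK, M.branch_eq_sum (g.op_mem_wt hv) hw hK', sub_sub_cancel] at h
  simp only [TwistedData.monomial, logBranch_one, ← smul_smul, ← Finset.smul_sum] at h
  have h1 := congrArg (fun x => Complex.exp ((n + 1) * (twoPiI * (p + 1))) • x) h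
  simp only [smul_smul, ← Complex.exp_add] at h1
  have e1 : (n + 1) * (twoPiI * ((p : ℂ) + 1)) + (-n - 1) * (twoPiI * ((p + 1 : ℤ) : ℂ)) = 0 := by
    push_cast
    ring
  have e2 : (n + 1) * (twoPiI * ((p : ℂ) + 1)) + (-n - 1) * (twoPiI * p)
      = twoPiI * n + twoPiI := by ring
  have e3 : Complex.exp twoPiI = 1 := Complex.exp_two_pi_mul_I
  rw [e1, e2, Complex.exp_zero, one_smul, Complex.exp_add, e3, mul_one] at h1
  push_cast at h1
  exact h1

theorem exists_int_of_exp_eq {n a : ℂ} (h : Complex.exp (twoPiI * n) = Complex.exp (twoPiI * a)) :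
    ∃ z : ℤ, n = a + z := by
  obtain ⟨z, hz⟩ := Complex.exp_eq_exp_iff_exists_int.mp h
  refine ⟨z, mul_left_cancel₀ twoPiI_ne_zero ?_⟩
  rw [hz, twoPiI]
  ring

/-- If `v ∈ V^[a + ℤ]`, then only powers `x ^ (-n-1)` with `n ∈ a + ℤ` occur in `Y^g(v, x)`. -/
theorem Yg_eq_zero {a : Strip} {v : V} (hv : v ∈ g.gen a) {n : ℂ} (hn : ∀ z : ℤ, n ≠ a + z)
    (k : ℕ) (w : W) : M.Yg n k v w = 0 := by
  refine M.top_induction (P := fun w => M.Yg n k v w = 0) (map_zero _)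
    (fun x y hx hy => by rw [map_add, hx, hy, add_zero]) (fun r w hw => ?_) w
  revert hv
  refine g.gen_induction (P := fun v => M.Yg n k v w = 0) (by simp)
    (fun x y hx hy => by rw [map_add, LinearMap.add_apply, hx, hy, add_zero]) fun m v hm hv => ?_
  obtain ⟨d, hd⟩ := (Module.End.mem_maxGenEigenspace _ _ _).mp hv
  clear hv
  induction d generalizing v k with
  | zero =>
    rw [pow_zero, Module.End.one_apply] at hd
    simp [hd]
  | succ d ih =>
    have h1 : ∀ k, M.Yg n k (g.op v) w = a.eig • M.Yg n k v w := by
      intro k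
      have h2 := ih k ((g.op - a.eig • (1 : Module.End ℂ V)) v)
        (Submodule.sub_mem _ (g.op_mem_wt hm) (Submodule.smul_mem _ _ hm))
        (by rw [← Module.End.mul_apply, ← pow_succ, hd])
      rw [LinearMap.sub_apply, LinearMap.smul_apply, Module.End.one_apply, map_sub, map_smul,
        LinearMap.sub_apply, LinearMap.smul_apply, sub_eq_zero] at h2
      exact h2
    obtain ⟨K, hK⟩ := M.exists_log_bound v (g.op v) w
    rw [← Module.forall_dual_apply_eq_zero_iff ℂ]
    intro φ
    set P : Polynomial ℂ := ∑ k ∈ Finset.range K, Polynomial.monomial k (φ (M.Yg n k v w)) with hP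
    have hev : ∀ s : ℂ, P.eval s = φ (∑ k ∈ Finset.range K, s ^ k • M.Yg n k v w) := fun s => by
      rw [hP, Polynomial.eval_finsetSum, map_sum]
      refine Finset.sum_congr rfl fun k _ => ?_
      rw [Polynomial.eval_monomial, map_smul, smul_eq_mul, mul_comm]
    have hP0 : P = 0 := by
      refine polynomial_eq_zero_of_shift twoPiI_ne_zero
        (μ := Complex.exp (twoPiI * n) / a.eig) (fun h => ?_) fun p => ?_
      · obtain ⟨z, hz⟩ := exists_int_of_exp_eq ((div_eq_one_iff_eq a.eig_ne_zero).mp h)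
        exact hn z hz
      · have h2 := congrArg φ (M.sum_Yg_op hm hw n (fun n k h => (hK n k h).1)
          (fun n k h => (hK n k h).2) p)
        simp only [h1, smul_comm _ a.eig, ← Finset.smul_sum] at h2
        rw [map_smul, map_smul, smul_eq_mul, smul_eq_mul, Int.cast_natCast, ← hev, ← hev] at h2
        rw [div_mul_eq_mul_div, eq_div_iff a.eig_ne_zero, ← h2, mul_comm]
    by_cases hk : k < K
    · have h3 := congrArg (Polynomial.coeff · k) hP0
      simp only [hP, Polynomial.finsetSum_coeff, Polynomial.coeff_monomial, Polynomial.coeff_zero,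
        Finset.sum_ite_eq', Finset.mem_range, if_pos hk] at h3
      exact h3
    · rw [(hK n k (not_lt.mp hk)).1, map_zero]

/-- The logarithms in `Y^g(v, x)` come from `x ^ (-𝒩)`: the coefficient of `(log x) ^ k` is that of
`(log x) ^ 0` for the vector `(-𝒩) ^ k v / k!`. -/
theorem Yg_log (n : ℂ) (k : ℕ) (v : V) (w : W) :
    M.Yg n k v w = ((-1 : ℂ) ^ k / k.factorial) • M.Yg n 0 ((g.N ^ k) v) w := by
  refine M.top_induction (P := fun w => M.Yg n k v w
    = ((-1 : ℂ) ^ k / k.factorial) • M.Yg n 0 ((g.N ^ k) v) w) (by simp)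
    (fun x y hx hy => by rw [map_add, hx, hy, map_add, smul_add]) (fun r w hw => ?_) w
  refine g.hom_induction (P := fun v => M.Yg n k v w
    = ((-1 : ℂ) ^ k / k.factorial) • M.Yg n 0 ((g.N ^ k) v) w) (by simp)
    (fun x y hx hy => by simp only [map_add, LinearMap.add_apply, hx, hy, smul_add])
    (fun m a v hm hv => ?_) v
  by_cases hn : ∀ z : ℤ, n ≠ a + z
  · rw [M.Yg_eq_zero hv hn, M.Yg_eq_zero (g.N_pow_mem (fun _ h => g.N_mem_gen h) k v hv) hn,
      smul_zero]
  push Not at hn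
  obtain ⟨z, hz⟩ := hn
  have hexp : Complex.exp (twoPiI * n) = a.eig := by
    rw [Strip.eig]
    refine Complex.exp_eq_exp_iff_exists_int.mpr ⟨z, ?_⟩
    rw [hz, twoPiI]
    ring
  obtain ⟨K₀, hK₀⟩ := M.log_finite v w
  obtain ⟨K₁, hN, hU⟩ := g.unipotent_pow_apply v
  -- equivariance, iterated `j` times; on `V^[a + ℤ]` the factors `e ^ (2 π i n)` and `a.eig` cancel
  have hiter : ∀ (j : ℕ) (p : ℤ), ∃ K' : ℕ, ∀ K, K' ≤ K →
      ∑ k ∈ Finset.range K, (twoPiI * (p + j)) ^ k • M.Yg n k ((g.unipotent ^ j) v) w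
        = ∑ k ∈ Finset.range K, (twoPiI * p) ^ k • M.Yg n k v w := by
    intro j
    induction j with
    | zero =>
      intro p
      exact ⟨0, fun K _ => by simp⟩
    | succ j ih =>
      intro p
      obtain ⟨K', hK'⟩ := ih p
      have hm' : (g.unipotent ^ j) v ∈ 𝒱.wt m := by
        rw [hU j]
        exact Submodule.sum_mem _ fun i _ => Submodule.smul_mem _ _
          (g.N_pow_mem (fun _ h => g.N_mem_wt h) i v hm)
      have hv' : (g.unipotent ^ j) v ∈ g.gen a := by
        rw [hU j]
        exact Submodule.sum_mem _ fun i _ => Submodule.smul_mem _ _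
          (g.N_pow_mem (fun _ h => g.N_mem_gen h) i v hv)
      obtain ⟨L, hL⟩ := M.exists_log_bound ((g.unipotent ^ j) v) (g.op ((g.unipotent ^ j) v)) w
      refine ⟨K' + L, fun K hK => ?_⟩
      rw [← hK' K (by omega)]
      have h1 := M.sum_Yg_op hm' hw n (K := K) (fun n k h => (hL n k (by omega)).1)
        (fun n k h => (hL n k (by omega)).2) (p + j)
      have h2 : g.op ((g.unipotent ^ j) v) = a.eig • (g.unipotent ^ (j + 1)) v := by
        rw [pow_succ', Module.End.mul_apply, g.unipotent_apply hv', smul_smul,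
          mul_inv_cancel₀ a.eig_ne_zero, one_smul]
      rw [h2, hexp] at h1
      simp only [map_smul, LinearMap.smul_apply, smul_comm _ a.eig, ← Finset.smul_sum] at h1
      have h3 := smul_right_injective W a.eig_ne_zero h1
      push_cast at h3 ⊢
      rw [← add_assoc]
      exact h3
  set K := K₀ + K₁ + k + 1 with hKdef
  -- for `p = -j` the left-hand side of `hiter` reduces to `k = 0`, so that `hiter` becomes an
  -- identity of polynomials in `j`
  have key := eq_zero_of_sum_pow_smul_eq_zero (K := K)
    (a := fun i => ((i.factorial : ℂ)⁻¹) • M.Yg n 0 ((g.N ^ i) v) w - (-1 : ℂ) ^ i • M.Yg n i v w)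
    (Set.infinite_range_of_injective (f := fun j : ℕ => twoPiI * (j : ℂ))
      fun i j hij => by simpa [twoPiI_ne_zero] using hij) (by
    rintro _ ⟨j, rfl⟩
    obtain ⟨K', hK'⟩ := hiter j (-j)
    obtain ⟨L, hL⟩ := M.log_finite ((g.unipotent ^ j) v) w
    have h1 := hK' (K' + L + K + 1) (by omega)
    have h2 : ∑ k ∈ Finset.range (K' + L + K + 1),
        (twoPiI * (((-j : ℤ) : ℂ) + j)) ^ k • M.Yg n k ((g.unipotent ^ j) v) w
        = M.Yg n 0 ((g.unipotent ^ j) v) w := by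
      rw [Finset.sum_eq_single 0]
      · simp
      · intro i _ hi
        simp [hi]
      · intro h
        exact absurd (Finset.mem_range.mpr (by omega)) h
    have h3 : ∑ k ∈ Finset.range (K' + L + K + 1), (twoPiI * ((-j : ℤ) : ℂ)) ^ k • M.Yg n k v w
        = ∑ k ∈ Finset.range K, (twoPiI * ((-j : ℤ) : ℂ)) ^ k • M.Yg n k v w := by
      symm
      refine Finset.sum_subset (fun x hx => ?_) fun x _ hx => ?_
      · rw [Finset.mem_range] at *
        omega
      · rw [Finset.mem_range] at hx
        rw [hK₀ n x (by omega), smul_zero]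
    have h4 : (g.unipotent ^ j) v
        = ∑ i ∈ Finset.range K, ((twoPiI * j) ^ i / i.factorial : ℂ) • (g.N ^ i) v := by
      rw [hU j]
      refine Finset.sum_subset (fun x hx => ?_) fun x _ hx => ?_
      · rw [Finset.mem_range] at *
        omega
      · rw [Finset.mem_range] at hx
        rw [hN x (by omega), smul_zero]
    rw [h2, h3, h4] at h1
    simp only [smul_sub, Finset.sum_sub_distrib]
    rw [sub_eq_zero]
    simp only [map_sum, LinearMap.sum_apply, map_smul, LinearMap.smul_apply] at h1
    convert h1 using 2
    · rw [smul_smul, div_eq_mul_inv]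
    · rw [smul_smul, ← mul_pow]
      push_cast
      ring_nf) k (by omega)
  have h5 := congrArg (fun x => (-1 : ℂ) ^ k • x) (sub_eq_zero.mp key)
  simp only [smul_smul, ← mul_pow] at h5
  rw [neg_one_mul, neg_neg, one_pow, one_smul] at h5
  rw [← h5, div_eq_mul_inv]

/-- The condition in `Omega` on the modes without logarithm implies that for all modes, so that
`Ω_g(W)` is the sum of the spaces `W_n` with `Re n = 0`. -/
theorem mem_Omega_iff {w : W} : w ∈ M.Omega ↔ w ∈ ⨆ n : {n : ℂ // n.re = 0}, M.deg n := by
  rw [M.lowest]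
  refine ⟨fun h m v hv n k hn => ?_, fun h m v hv n hn => h m v hv n 0 hn⟩
  rw [M.Yg_log, h m _ (g.N_pow_mem (fun _ h => g.N_mem_wt h) k v hv) n hn, smul_zero]

theorem Omega_induction {P : W → Prop} (h0 : P 0) (hadd : ∀ x y, P x → P y → P (x + y))
    (hh : ∀ n : ℂ, n.re = 0 → ∀ w ∈ M.deg n, P w) {w : W} (hw : w ∈ M.Omega) : P w := by
  rw [mem_Omega_iff] at hw
  induction hw using Submodule.iSup_induction' with
  | mem i x hx => exact hh i i.2 x hx
  | zero => exact h0
  | add x y _ _ hx hy => exact hadd x y hx hy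

theorem deg_le_Omega {n : ℂ} (hn : n.re = 0) : M.deg n ≤ M.Omega := fun _ hw =>
  M.mem_Omega_iff.mpr (Submodule.mem_iSup_of_mem (⟨n, hn⟩ : {n : ℂ // n.re = 0}) hw)

/-! ### Zero modes -/

theorem zeroMode_apply {m : ℤ} {a : Strip} {v : V} (hm : v ∈ 𝒱.wt m) (hv : v ∈ g.gen a)
    (ha : (a : ℂ).re = 0) : M.zeroMode v = M.Yg (m + a - 1) 0 v := by
  rw [zeroMode, byGrading_apply _ _ _ hm, byGrading_apply _ _ _ hv, if_pos ha]

theorem zeroMode_eq_zero {a : Strip} {v : V} (hv : v ∈ g.gen a)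
    (ha : (a : ℂ).re ≠ 0) : M.zeroMode v = 0 := by
  refine g.gen_induction (P := fun v => M.zeroMode v = 0) (map_zero _)
    (fun x y hx hy => by rw [map_add, hx, hy, add_zero]) (fun m x hm hx => ?_) hv
  rw [zeroMode, byGrading_apply _ _ _ hm, byGrading_apply _ _ _ hx, if_neg ha, LinearMap.zero_apply]

theorem zeroMode_mem_deg {a : Strip} {v : V} (hv : v ∈ g.gen a) {n : ℂ} {w : W}
    (hw : w ∈ M.deg n) : M.zeroMode v w ∈ M.deg (n - a) := by
  by_cases ha : (a : ℂ).re = 0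
  · refine g.gen_induction (P := fun v => M.zeroMode v w ∈ M.deg (n - a)) (by simp)
      (fun x y hx hy => by rw [map_add]; exact Submodule.add_mem _ hx hy)
      (fun m x hm hx => ?_) hv
    rw [M.zeroMode_apply hm hx ha]
    have h := M.degree m x hm n w hw (m + a - 1) 0
    rwa [show (m : ℂ) - (m + a - 1) - 1 + n = n - a by ring] at h
  · rw [M.zeroMode_eq_zero hv ha]
    exact Submodule.zero_mem _

/-- Between lowest spaces, the operator of the right degree is the zero mode. -/
theorem apply_zeroMode {φ : W →ₗ[ℂ] ℂ} {n₀ n : ℂ} (h₀ : n₀.re = 0) (hn : n.re = 0)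
    (hφ : ∀ r ≠ n₀, ∀ w ∈ M.deg r, φ w = 0) {m : ℤ} {v : V} (hv : v ∈ 𝒱.wt m) {w : W}
    (hw : w ∈ M.deg n) : φ (M.Yg (m - 1 + n - n₀) 0 v w) = φ (M.zeroMode v w) := by
  let F : V →ₗ[ℂ] Module.End ℂ W :=
    byGrading 𝒱.wt 𝒱.wt_isInternal fun m => M.Yg (m - 1 + n - n₀) 0
  have h1 : F v = M.Yg (m - 1 + n - n₀) 0 v := byGrading_apply _ _ _ hv
  rw [← h1]
  clear h1 hv
  refine g.hom_induction (P := fun v => φ (F v w) = φ (M.zeroMode v w)) (by simp)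
    (fun x y hx hy => by simp only [map_add, LinearMap.add_apply, hx, hy])
    (fun m a x hm hx => ?_) v
  have h1 : F x = M.Yg (m - 1 + n - n₀) 0 x := byGrading_apply _ _ _ hm
  rw [h1]
  by_cases hna : n - n₀ = a
  · have ha : (a : ℂ).re = 0 := by
      rw [← hna, Complex.sub_re, h₀, hn, sub_zero]
    rw [M.zeroMode_apply hm hx ha, ← hna, show (m : ℂ) + (n - n₀) - 1 = m - 1 + n - n₀ by ring]
  · rw [hφ (n - a) (fun h => hna (by rw [← h]; ring)) _ (M.zeroMode_mem_deg hx hw),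
      M.Yg_eq_zero hx (fun z hz => hna ?_), map_zero]
    have h2 : n - n₀ = a + (z - m + 1 : ℤ) := by
      push_cast
      linear_combination hz
    have h3 := congrArg Complex.re h2
    rw [Complex.sub_re, h₀, hn, Complex.add_re, Complex.intCast_re] at h3
    have ha := a.2
    have h4 : (z - m + 1 : ℤ) = 0 := by
      have u : ((z - m + 1 : ℤ) : ℝ) < 1 := by linarith
      have l : (-1 : ℝ) < ((z - m + 1 : ℤ) : ℝ) := by linarith
      have u' : (z - m + 1 : ℤ) < 1 := by exact_mod_cast u
      have l' : -1 < (z - m + 1 : ℤ) := by exact_mod_cast l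
      omega
    rw [h2, h4]
    simp

end WeakTwistedModule

end

end TwistedZhu

namespace TwistedZhu

noncomputable section

open Finset.HasAntidiagonal (antidiagonal mem_antidiagonal)

/-! ### Duality on the positive real axis -/

theorem arg0_ofReal {x : ℝ} (hx : 0 < x) : arg0 x = 0 := by
  simp [arg0, Complex.arg_ofReal_of_nonneg hx.le]

theorem logBranch_ofReal {x : ℝ} (hx : 0 < x) : logBranch 0 x = Real.log x := by
  simp [logBranch, arg0_ofReal hx, abs_of_pos hx]

/-- For `z₂ = 1` and real `z₁ = e ^ ζ`, a two point function is `(e ^ ζ - 1) ^ (-t)` times an entire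
function of `ζ`. -/
theorem TwoPointFunction.exists_entire (f : TwoPointFunction) {t : ℕ} (ht : f.t ≤ t) :
    ∃ E : ℂ → ℂ, Differentiable ℂ E ∧ ∀ x : ℝ, 0 < x → x ≠ 1 →
      f.branch 0 x 1 = E (Real.log x) / ((x : ℂ) - 1) ^ t := by
  refine ⟨fun ζ => (Complex.exp ζ - 1) ^ (t - f.t) * ∑ i, ∑ j, ∑ k, ∑ l, f.a i j k l *
    Complex.exp (f.m i * ζ) * Complex.exp (f.n j * 0) * ζ ^ (k : ℕ) * 0 ^ (l : ℕ), by fun_prop,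
    fun x hx hx1 => ?_⟩
  have h1 : (x : ℂ) - 1 ≠ 0 := sub_ne_zero.mpr (by exact_mod_cast hx1)
  have h2 : logBranch 0 1 = 0 := by simp [logBranch_one]
  have h3 : Complex.exp (Real.log x) = x := by
    rw [← Complex.ofReal_exp, Real.exp_log hx]
  simp only [TwoPointFunction.branch, logBranch_ofReal hx, h2, h3, ← Finset.sum_mul]
  have h4 : ((x : ℂ) - 1) ^ t = (x - 1) ^ (t - f.t) * (x - 1) ^ f.t := by
    rw [← pow_add, Nat.sub_add_cancel ht]
  rw [h4, mul_div_mul_left _ _ (pow_ne_zero _ h1), div_eq_mul_inv]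

theorem sum_antidiagonal_pow_div_factorial (x y : ℂ) (t : ℕ) :
    ∑ p ∈ antidiagonal t, x ^ p.1 / p.1.factorial * (y ^ p.2 / p.2.factorial)
      = (x + y) ^ t / t.factorial := by
  have ht : (t.factorial : ℂ) ≠ 0 := by exact_mod_cast t.factorial_ne_zero
  rw [eq_div_iff ht, (Commute.all x y).add_pow', Finset.sum_mul]
  refine Finset.sum_congr rfl fun p hp => ?_
  rw [mem_antidiagonal] at hp
  have h1 : (p.1.factorial : ℂ) ≠ 0 := by exact_mod_cast p.1.factorial_ne_zero
  have h2 : (p.2.factorial : ℂ) ≠ 0 := by exact_mod_cast p.2.factorial_ne_zero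
  have h3 : (t.factorial : ℂ) = t.choose p.1 * p.1.factorial * p.2.factorial := by
    rw [← hp]
    rw [Nat.choose_symm_add]
    exact_mod_cast (Nat.add_choose_mul_factorial_mul_factorial p.1 p.2).symm
  rw [h3, nsmul_eq_mul]
  field_simp

/-- `e ^ x e ^ (-x) = 1` for truncated exponential series. -/
theorem sum_pow_div_factorial_cancel {X : Type*} [AddCommGroup X] [Module ℂ X] {J : ℕ} {F : ℕ → X}
    (hF : ∀ i, J ≤ i → F i = 0) (x : ℂ) :
    ∑ j ∈ Finset.range J, (x ^ j / j.factorial : ℂ) •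
      ∑ k ∈ Finset.range J, ((-x) ^ k / k.factorial : ℂ) • F (j + k) = F 0 := by
  simp only [Finset.smul_sum, smul_smul]
  rw [sum_range_sum_range_eq_antidiagonal (f := fun j k =>
    (x ^ j / j.factorial * ((-x) ^ k / k.factorial) : ℂ) • F (j + k))
    (fun i j h => by rw [hF _ h, smul_zero])]
  have h1 : ∀ t, ∑ p ∈ antidiagonal t, (x ^ p.1 / p.1.factorial *
      ((-x) ^ p.2 / p.2.factorial) : ℂ) • F (p.1 + p.2) = (0 ^ t / t.factorial : ℂ) • F t := by
    intro t
    rw [← add_neg_cancel x, ← sum_antidiagonal_pow_div_factorial, Finset.sum_smul]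
    refine Finset.sum_congr rfl fun p hp => ?_
    rw [mem_antidiagonal.mp hp]
  simp only [h1]
  rcases J with _ | J
  · simp [hF 0 le_rfl]
  · rw [Finset.sum_range_succ']
    simp

namespace VertexOperatorAlgebra

variable {V : Type*} [AddCommGroup V] [Module ℂ V] (𝒱 : VertexOperatorAlgebra V)

/-- For homogeneous vectors, each weight component of `Y(u, z) v` consists of one mode. -/
theorem eval_eq {m m' : ℤ} {u v : V} (hu : u ∈ 𝒱.wt m) (hv : v ∈ 𝒱.wt m') (z : ℂ) (n : ℤ) :
    𝒱.eval u z v n = z ^ (n - m - m') • 𝒱.mode u (m + m' - 1 - n) v := by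
  have h1 : ∀ k : ℤ, byGrading 𝒱.wt 𝒱.wt_isInternal (fun i => if i = n then LinearMap.id else 0)
      (𝒱.mode u k v) = if k = m + m' - 1 - n then 𝒱.mode u k v else 0 := fun k => by
    rw [byGrading_apply _ _ _ (𝒱.mode_mem_wt hu hv k)]
    by_cases hk : k = m + m' - 1 - n
    · rw [if_pos hk, if_pos (by omega)]
      rfl
    · rw [if_neg hk, if_neg (by omega)]
      rfl
  rw [eval, finsum_eq_single _ (m + m' - 1 - n)]
  · rw [h1, if_pos rfl]
    congr 2
    ring
  · intro k hk
    rw [h1, if_neg hk, smul_zero]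

end VertexOperatorAlgebra

namespace WeakTwistedModule

variable {V W : Type*} [AddCommGroup V] [Module ℂ V] [AddCommGroup W] [Module ℂ W]
  {𝒱 : VertexOperatorAlgebra V} {g : Automorphism 𝒱} (M : WeakTwistedModule 𝒱 g W)

theorem Yg_eq_zero_of_le {v : V} {J : ℕ} (hJ : ∀ i, J ≤ i → (g.N ^ i) v = 0) (n : ℂ) (k : ℕ)
    (hk : J ≤ k) (w : W) : M.Yg n k v w = 0 := by
  rw [M.Yg_log, hJ k hk]
  simp

theorem monomial_ofReal {x : ℝ} (hx : 0 < x) (n : ℂ) (k : ℕ) :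
    TwistedData.monomial 0 x n k = Complex.exp ((-n - 1) * Real.log x) * (Real.log x : ℂ) ^ k := by
  rw [TwistedData.monomial, logBranch_ofReal hx]

theorem branch_ofReal {m : ℤ} {v : V} (hv : v ∈ 𝒱.wt m) {J : ℕ}
    (hJ : ∀ i, J ≤ i → (g.N ^ i) v = 0) {r : ℂ} {w : W} (hw : w ∈ M.deg r) {x : ℝ} (hx : 0 < x)
    (n : ℂ) : M.branch 0 v x w n = Complex.exp ((-(m - 1 + r - n) - 1) * Real.log x) •
      ∑ k ∈ Finset.range J, ((-(Real.log x : ℂ)) ^ k / k.factorial) •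
        M.Yg (m - 1 + r - n) 0 ((g.N ^ k) v) w := by
  rw [M.branch_eq_sum hv hw (fun n k h => M.Yg_eq_zero_of_le hJ n k h w), Finset.smul_sum]
  refine Finset.sum_congr rfl fun k _ => ?_
  rw [monomial_ofReal hx, M.Yg_log, smul_smul, smul_smul, neg_pow (Real.log x : ℂ)]
  congr 1
  ring

theorem branch_one {m : ℤ} {v : V} (hv : v ∈ 𝒱.wt m) {r : ℂ} {w : W} (hw : w ∈ M.deg r) (n : ℂ) :
    M.branch 0 v 1 w n = M.Yg (m - 1 + r - n) 0 v w := by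
  obtain ⟨J, hJ⟩ := g.N_locally_nilpotent v
  have h := M.branch_ofReal hv (J := J + 1) (fun i hi => hJ i (by omega)) hw one_pos n
  rw [Complex.ofReal_one] at h
  rw [h, Finset.sum_range_succ', Finset.sum_eq_zero]
  · simp
  · intro k _
    simp

theorem pairing_ofReal {φ : W →ₗ[ℂ] ℂ} {n₀ : ℂ} (hφ : ∀ r ≠ n₀, ∀ w ∈ M.deg r, φ w = 0) {m : ℤ}
    {v : V} (hv : v ∈ 𝒱.wt m) {J : ℕ} (hJ : ∀ i, J ≤ i → (g.N ^ i) v = 0) {r : ℂ} {w : W}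
    (hw : w ∈ M.deg r) {x : ℝ} (hx : 0 < x) : M.pairing φ 0 v x w
      = Complex.exp ((-(m - 1 + r - n₀) - 1) * Real.log x) *
        ∑ k ∈ Finset.range J, ((-(Real.log x : ℂ)) ^ k / k.factorial) *
          φ (M.Yg (m - 1 + r - n₀) 0 ((g.N ^ k) v) w) := by
  have h1 : M.pairing φ 0 v x w = φ (M.branch 0 v x w n₀) := by
    rw [TwistedData.pairing, TwistedData.branch, map_finsum_linear]
    · refine finsum_congr fun q => ?_
      rw [map_smul, smul_eq_mul, M.proj_of_mem (M.degree m v hv r w hw q.1 q.2)]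
      split_ifs with h
      · rfl
      · rw [hφ _ h _ (M.degree m v hv r w hw q.1 q.2), map_zero]
    · refine (((Finset.range J).map (⟨fun k => ((m - 1 + r - n₀ : ℂ), k),
        fun i j hij => (Prod.mk.inj hij).2⟩ : ℕ ↪ ℂ × ℕ)).finite_toSet).subset fun q hq => ?_
      rw [Function.mem_support, M.proj_of_mem (M.degree m v hv r w hw q.1 q.2)] at hq
      have hq1 : q.1 = m - 1 + r - n₀ := by
        by_contra hne
        rw [if_neg (fun h => hne (by rw [← h]; ring)), smul_zero] at hq
        exact hq rfl
      have hq2 : q.2 < J := by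
        by_contra hlt
        rw [M.Yg_eq_zero_of_le hJ _ _ (not_lt.mp hlt), ite_self, smul_zero] at hq
        exact hq rfl
      simp only [Finset.coe_map, Set.mem_image, Finset.coe_range, Set.mem_Iio]
      exact ⟨q.2, hq2, by rw [← hq1]; rfl⟩
  rw [h1, M.branch_ofReal hv hJ hw hx, map_smul, smul_eq_mul, map_sum]
  simp only [map_smul, smul_eq_mul]

theorem pairing_one {φ : W →ₗ[ℂ] ℂ} {n₀ : ℂ} (hφ : ∀ r ≠ n₀, ∀ w ∈ M.deg r, φ w = 0) {m : ℤ}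
    {v : V} (hv : v ∈ 𝒱.wt m) {r : ℂ} {w : W} (hw : w ∈ M.deg r) :
    M.pairing φ 0 v 1 w = φ (M.Yg (m - 1 + r - n₀) 0 v w) := by
  obtain ⟨J, hJ⟩ := g.N_locally_nilpotent v
  have h := M.pairing_ofReal hφ hv (J := J + 1) (fun i hi => hJ i (by omega)) hw one_pos
  rw [Complex.ofReal_one] at h
  rw [h, Finset.sum_range_succ', Finset.sum_eq_zero]
  · simp
  · intro k _
    simp

end WeakTwistedModule

end

end TwistedZhu

namespace TwistedZhu

noncomputable section

open Finset.HasAntidiagonal (antidiagonal mem_antidiagonal)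

/-! ### The residue formula for zero modes -/

theorem Strip.nonneg_of_add {a : Strip} {z : ℤ} (h : 0 ≤ (a : ℂ).re + z) : 0 ≤ z := by
  have ha := a.2
  have h1 : (-1 : ℝ) < z := by linarith
  have h2 : -1 < z := by exact_mod_cast h1
  omega

theorem Strip.eps_le_of_sub {a : Strip} {z : ℤ} (h : 0 ≤ z - (a : ℂ).re) :
    Automorphism.eps a ≤ z := by
  have ha := a.2
  rw [Automorphism.eps]
  split_ifs with h0
  · rw [h0, sub_zero] at h
    exact_mod_cast h
  · have h1 : (0 : ℝ) < z := by
      have := lt_of_le_of_ne ha.1 (Ne.symm h0)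
      linarith
    have h2 : 0 < z := by exact_mod_cast h1
    omega

theorem exp_nat_mul_log {x : ℝ} (hx : 0 < x) (s : ℕ) :
    Complex.exp (s * Real.log x) = (x : ℂ) ^ s := by
  rw [Complex.exp_nat_mul, ← Complex.ofReal_exp, Real.exp_log hx]

namespace WeakTwistedModule

variable {V W : Type*} [AddCommGroup V] [Module ℂ V] [AddCommGroup W] [Module ℂ W]
  {𝒱 : VertexOperatorAlgebra V} {g : Automorphism 𝒱} (M : WeakTwistedModule 𝒱 g W)

open Automorphism

section

variable {φ : W →ₗ[ℂ] ℂ} {n₀ p : ℂ} (hφ : ∀ r ≠ n₀, ∀ w ∈ M.deg r, φ w = 0) (h₀ : n₀.re = 0)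
  (hp : p.re = 0) {m m' : ℤ} {a : Strip} {u v : V} {w : W} (hu : u ∈ 𝒱.wt m) (hua : u ∈ g.gen a)
  (hv : v ∈ 𝒱.wt m') (hw : w ∈ M.deg p) {J : ℕ} (hJ : ∀ i, J ≤ i → (g.N ^ i) u = 0)

theorem N_pow_N_pow_eq_zero (hJ : ∀ i, J ≤ i → (g.N ^ i) u = 0) (j : ℕ) :
    ∀ i, J ≤ i → (g.N ^ i) ((g.N ^ j) u) = 0 := fun i hi => by
  rw [← Module.End.mul_apply, ← pow_add, hJ _ (by omega)]

include hφ h₀ hu hua hv hw hJ in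
/-- The expansion in the region `|z₁| > |z₂|`, for `z₂ = 1` and `z₁ = x⁻¹`. The sum over `j` combines
`e ^ (ζ 𝒩) u` with the `x ^ (-𝒩)` in `Y^g`, so that all logarithms cancel. The intermediate
degrees are `n₀ + a - ε(a) + s` with `s ∈ ℕ`. -/
theorem hasSum_outer {B : ℕ → ℝ → ℂ} (hB : ∀ j < J, ∀ x : ℝ, 1 < x → HasSum (fun n : ℂ =>
      M.pairing φ 0 ((g.N ^ j) u) x (M.branch 0 v 1 w n)) (B j x)) {x : ℝ} (hx : 0 < x)
    (hx1 : x < 1) :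
    HasSum (fun s : ℕ => φ (M.Yg (m + a - eps a - 1 + s) 0 u
        (M.Yg (m' - 1 + p - (n₀ + a - eps a + s)) 0 v w)) * (x : ℂ) ^ s)
      (Complex.exp (l m a * -Real.log x) * ∑ j ∈ Finset.range J,
        (-Real.log x : ℂ) ^ j / j.factorial * B j x⁻¹) := by
  have h1 := (hasSum_sum (s := Finset.range J) fun j hj => (hB j (Finset.mem_range.mp hj) x⁻¹
    ((one_lt_inv₀ hx).mpr hx1)).mul_left ((-Real.log x : ℂ) ^ j / j.factorial)).mul_left
      (Complex.exp (l m a * -Real.log x))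
  have hL : ((Real.log x⁻¹ : ℝ) : ℂ) = -Real.log x := by
    rw [Real.log_inv]
    push_cast
    rfl
  have hX : ∀ n, M.Yg (m' - 1 + p - n) 0 v w ∈ M.deg n := fun n => by
    have h := M.degree m' v hv p w hw (m' - 1 + p - n) 0
    rwa [show (m' : ℂ) - (m' - 1 + p - n) - 1 + p = n by ring] at h
  have h2 : ∀ n : ℂ, Complex.exp (l m a * -Real.log x) * ∑ j ∈ Finset.range J,
      (-Real.log x : ℂ) ^ j / j.factorial *
        M.pairing φ 0 ((g.N ^ j) u) (x⁻¹ : ℝ) (M.branch 0 v 1 w n)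
      = Complex.exp ((l m a + (-(m - 1 + n - n₀) - 1)) * -Real.log x) *
        φ (M.Yg (m - 1 + n - n₀) 0 u (M.Yg (m' - 1 + p - n) 0 v w)) := by
    intro n
    have h3 := sum_pow_div_factorial_cancel (J := J)
      (F := fun i => φ (M.Yg (m - 1 + n - n₀) 0 ((g.N ^ i) u) (M.Yg (m' - 1 + p - n) 0 v w)))
      (fun i hi => by simp [hJ i hi]) (-Real.log x : ℂ)
    rw [pow_zero, Module.End.one_apply] at h3
    rw [add_mul, Complex.exp_add, mul_assoc, ← h3, Finset.mul_sum (a := Complex.exp (_ * _)),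
      Finset.mul_sum, Finset.mul_sum]
    refine Finset.sum_congr rfl fun j _ => ?_
    rw [M.branch_one hv hw, M.pairing_ofReal hφ (g.N_pow_mem (fun _ h => g.N_mem_wt h) j u hu)
      (N_pow_N_pow_eq_zero hJ j) (hX n) (inv_pos.mpr hx), hL]
    simp only [← Module.End.mul_apply, ← pow_add, smul_eq_mul, add_comm j]
    ring
  simp only [h2] at h1
  rw [← (Function.Injective.hasSum_iff (g := fun s : ℕ => (n₀ + a - eps a + s : ℂ))
    (fun i j hij => by simpa using hij) ?_)] at h1
  · refine h1.congr_fun fun s => ?_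
    dsimp only [Function.comp_apply]
    rw [l_eq, show ((m : ℂ) + (a - eps a) + (-(m - 1 + (n₀ + a - eps a + s) - n₀) - 1)) *
      -Real.log x = s * Real.log x by ring, exp_nat_mul_log hx, mul_comm]
    congr 5
    ring
  · intro n hn
    by_contra hne
    have hdeg : 0 ≤ n.re := by
      by_contra hlt
      have h3 := hX n
      rw [M.deg_eq_bot (not_le.mp hlt), Submodule.mem_bot] at h3
      rw [h3, map_zero, map_zero, mul_zero] at hne
      exact hne rfl
    obtain ⟨z, hz⟩ : ∃ z : ℤ, (m - 1 + n - n₀ : ℂ) = a + z := by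
      by_contra! h3
      rw [M.Yg_eq_zero hua h3, map_zero, mul_zero] at hne
      exact hne rfl
    have hn' : n = n₀ + a + (z - m + 1 : ℤ) := by
      push_cast
      linear_combination hz
    rw [hn', Complex.add_re, Complex.add_re, h₀, zero_add, Complex.intCast_re] at hdeg
    have h3 := Strip.nonneg_of_add hdeg
    have h4 : 0 ≤ eps a := by
      rw [eps]
      split_ifs <;> norm_num
    refine hn ⟨(z - m + 1 + eps a).toNat, ?_⟩
    dsimp only
    rw [hn', ← Int.cast_natCast (R := ℂ), Int.toNat_of_nonneg (by omega)]
    push_cast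
    ring

include hφ hp hu hua hv hw hJ in
/-- The expansion in the region `|z₂| > |z₁|`, for `z₂ = 1` and `z₁ = x`, with the same cancellation
of logarithms. The intermediate degrees are `p - a + ε(a) + s` with `s ∈ ℕ`. -/
theorem hasSum_inner {B : ℕ → ℝ → ℂ} (hB : ∀ j < J, ∀ x : ℝ, 0 < x → x < 1 → HasSum (fun n : ℂ =>
      M.pairing φ 0 v 1 (M.branch 0 ((g.N ^ j) u) x w n)) (B j x)) {x : ℝ} (hx : 0 < x)
    (hx1 : x < 1) :
    HasSum (fun s : ℕ => φ (M.Yg (m' - 1 + (p - a + eps a + s) - n₀) 0 v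
        (M.Yg (m + a - eps a - 1 - s) 0 u w)) * (x : ℂ) ^ s)
      (Complex.exp (l m a * Real.log x) * ∑ j ∈ Finset.range J,
        (Real.log x : ℂ) ^ j / j.factorial * B j x) := by
  have h1 := (hasSum_sum (s := Finset.range J) fun j hj => (hB j (Finset.mem_range.mp hj) x
    hx hx1).mul_left ((Real.log x : ℂ) ^ j / j.factorial)).mul_left
      (Complex.exp (l m a * Real.log x))
  have hX : ∀ n, ∀ y ∈ 𝒱.wt m, M.Yg (m - 1 + p - n) 0 y w ∈ M.deg n := fun n y hy => by
    have h := M.degree m y hy p w hw (m - 1 + p - n) 0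
    rwa [show (m : ℂ) - (m - 1 + p - n) - 1 + p = n by ring] at h
  have hN : ∀ i, (g.N ^ i) u ∈ 𝒱.wt m := fun i => g.N_pow_mem (fun _ h => g.N_mem_wt h) i u hu
  have h2 : ∀ n : ℂ, Complex.exp (l m a * Real.log x) * ∑ j ∈ Finset.range J,
      (Real.log x : ℂ) ^ j / j.factorial *
        M.pairing φ 0 v 1 (M.branch 0 ((g.N ^ j) u) x w n)
      = Complex.exp ((l m a + (-(m - 1 + p - n) - 1)) * Real.log x) *
        φ (M.Yg (m' - 1 + n - n₀) 0 v (M.Yg (m - 1 + p - n) 0 u w)) := by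
    intro n
    have h3 := sum_pow_div_factorial_cancel (J := J)
      (F := fun i => φ (M.Yg (m' - 1 + n - n₀) 0 v (M.Yg (m - 1 + p - n) 0 ((g.N ^ i) u) w)))
      (fun i hi => by simp [hJ i hi]) (Real.log x : ℂ)
    rw [pow_zero, Module.End.one_apply] at h3
    rw [add_mul, Complex.exp_add, mul_assoc, ← h3, Finset.mul_sum (a := Complex.exp (_ * _)),
      Finset.mul_sum, Finset.mul_sum]
    refine Finset.sum_congr rfl fun j _ => ?_
    rw [M.branch_ofReal (hN j) (N_pow_N_pow_eq_zero hJ j) hw hx,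
      M.pairing_one hφ hv (Submodule.smul_mem _ _ (Submodule.sum_mem _ fun k _ =>
        Submodule.smul_mem _ _ (hX n _ (g.N_pow_mem (fun _ h => g.N_mem_wt h) k _ (hN j)))))]
    simp only [← Module.End.mul_apply, ← pow_add, smul_eq_mul, add_comm j, map_smul, map_sum]
    ring
  simp only [h2] at h1
  rw [← (Function.Injective.hasSum_iff (g := fun s : ℕ => (p - a + eps a + s : ℂ))
    (fun i j hij => by simpa using hij) ?_)] at h1
  · refine h1.congr_fun fun s => ?_
    dsimp only [Function.comp_apply]
    rw [l_eq, show ((m : ℂ) + (a - eps a) + (-(m - 1 + p - (p - a + eps a + s)) - 1)) *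
      Real.log x = s * Real.log x by ring, exp_nat_mul_log hx, mul_comm,
      show (m : ℂ) - 1 + p - (p - a + eps a + s) = m + a - eps a - 1 - s by ring]
  · intro n hn
    by_contra hne
    have hdeg : 0 ≤ n.re := by
      by_contra hlt
      have h3 := hX n u hu
      rw [M.deg_eq_bot (not_le.mp hlt), Submodule.mem_bot] at h3
      rw [h3, map_zero, map_zero, mul_zero] at hne
      exact hne rfl
    obtain ⟨z, hz⟩ : ∃ z : ℤ, (m - 1 + p - n : ℂ) = a + z := by
      by_contra! h3
      rw [M.Yg_eq_zero hua h3, map_zero, map_zero, mul_zero] at hne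
      exact hne rfl
    have hn' : n = p + (m - 1 - z : ℤ) - a := by
      push_cast
      linear_combination -hz
    rw [hn', Complex.sub_re, Complex.add_re, hp, zero_add, Complex.intCast_re] at hdeg
    have h3 := Strip.eps_le_of_sub hdeg
    refine hn ⟨(m - 1 - z - eps a).toNat, ?_⟩
    dsimp only
    rw [hn', ← Int.cast_natCast (R := ℂ), Int.toNat_of_nonneg (by omega)]
    push_cast
    ring

include hφ h₀ hp hv hw in
/-- The expansion in the region `|z₂| > |z₁ - z₂|`, for `z₂ = 1` and `z₁ = 1 + x`. -/
theorem hasSum_iterate {y : V} (hy : y ∈ 𝒱.wt m) {Q : ℕ}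
    (hQ : ∀ k : ℤ, (Q : ℤ) ≤ k → 𝒱.mode y k v = 0) {x : ℝ} (hx : 0 < x) {b : ℂ}
    (hb : HasSum (fun n : ℤ => M.pairing φ 0 (𝒱.eval y x v n) 1 w) b) :
    HasSum (fun i : ℕ => φ (M.zeroMode (𝒱.mode y (Q - 1 - i) v) w) * (x : ℂ) ^ i)
      ((x : ℂ) ^ Q * b) := by
  have hx0 : (x : ℂ) ≠ 0 := by exact_mod_cast hx.ne'
  have h1 := hb.mul_left ((x : ℂ) ^ Q)
  have h2 : ∀ n : ℤ, M.pairing φ 0 (𝒱.eval y x v n) 1 w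
      = (x : ℂ) ^ (n - m - m') * φ (M.zeroMode (𝒱.mode y (m + m' - 1 - n) v) w) := by
    intro n
    have h3 : 𝒱.mode y (m + m' - 1 - n) v ∈ 𝒱.wt n := by
      have := 𝒱.mode_mem_wt hy hv (m + m' - 1 - n)
      rwa [show m + m' - (m + m' - 1 - n) - 1 = n by ring] at this
    rw [𝒱.eval_eq hy hv, M.pairing_one hφ (Submodule.smul_mem _ _ h3) hw,
      M.apply_zeroMode h₀ hp hφ (Submodule.smul_mem _ _ h3) hw, map_smul, LinearMap.smul_apply,
      map_smul, smul_eq_mul]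
  simp only [h2] at h1
  rw [← (Function.Injective.hasSum_iff (g := fun i : ℕ => (m + m' - Q + i : ℤ))
    (fun i j hij => by simpa using hij) ?_)] at h1
  · refine h1.congr_fun fun i => ?_
    dsimp only [Function.comp_apply]
    rw [← mul_assoc, ← zpow_natCast, ← zpow_natCast, ← zpow_add₀ hx0, mul_comm,
      show (m + m' - 1 - (m + m' - Q + i) : ℤ) = Q - 1 - i by ring,
      show (Q + (m + m' - Q + i - m - m') : ℤ) = i by ring]
  · intro n hn
    rw [hQ, map_zero, LinearMap.zero_apply, map_zero, mul_zero, mul_zero]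
    by_contra hlt
    refine hn ⟨(n - m - m' + Q).toNat, ?_⟩
    dsimp only
    rw [Int.toNat_of_nonneg (by omega)]
    ring

end

end WeakTwistedModule

end

end TwistedZhu

namespace TwistedZhu

noncomputable section

open Finset.HasAntidiagonal (antidiagonal mem_antidiagonal)

theorem sum_alternating (x : ℤ → ℂ) (t : ℕ) :
    ∑ k ∈ Finset.range (t + 1), (-1) ^ k * (x (k - 1) + 2 * x (k - 1 + 1) + x (k - 1 + 2))
      = x (-1) + x 0 + (-1) ^ t * (x t + x (t + 1)) := by
  induction t with
  | zero =>
    simp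
    ring
  | succ t ih =>
    rw [Finset.sum_range_succ, ih]
    push_cast
    rw [show (t + 1 - 1 : ℤ) = t by ring, show (t + 2 : ℤ) = t + 1 + 1 by ring]
    ring

namespace Automorphism

variable {V : Type*} [AddCommGroup V] [Module ℂ V] {𝒱 : VertexOperatorAlgebra V}
  (g : Automorphism 𝒱)

theorem conf_mem_gen : 𝒱.conf ∈ g.gen zeroStrip := g.mem_gen_zeroStrip g.map_conf

/-- The case `u = ω` of the products `res`, where `(1 + x) ^ (ℒ + 𝒩) ω = (1 + x) ^ 2 ω`. -/
theorem res_conf (q : ℤ) (v : V) : g.res q 𝒱.conf v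
    = 𝒱.mode 𝒱.conf q v + (2 : ℂ) • 𝒱.mode 𝒱.conf (q + 1) v + 𝒱.mode 𝒱.conf (q + 2) v := by
  have hT : g.T 𝒱.conf = (2 : ℂ) • 𝒱.conf := by
    rw [g.T_apply g.conf_mem_gen, 𝒱.mem_wt.mp 𝒱.conf_mem_wt, g.N_eq_zero g.map_conf,
      eps_eq_zero (a := zeroStrip) (by simp [zeroStrip])]
    simp [zeroStrip]
  have h1 : binomOp g.T 1 𝒱.conf = (2 : ℂ) • 𝒱.conf := by
    have h := binomOp_succ_apply g.T 0 𝒱.conf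
    simpa [hT] using h
  have h2 : binomOp g.T 2 𝒱.conf = 𝒱.conf := by
    have h := binomOp_succ_apply g.T 1 𝒱.conf
    rw [h1, map_smul, hT] at h
    have h' : (2 : ℂ) • binomOp g.T 2 𝒱.conf = (2 : ℂ) • 𝒱.conf := by
      rw [show (2 : ℂ) = ((1 : ℕ) : ℂ) + 1 by norm_num, h]
      module
    exact smul_right_injective V (two_ne_zero (α := ℂ)) h'
  have h3 : ∀ i, binomOp g.T (3 + i) 𝒱.conf = 0 := by
    intro i
    induction i with
    | zero =>
      have h := binomOp_succ_apply g.T 2 𝒱.conf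
      rw [h2, hT, Nat.cast_ofNat, sub_self, smul_eq_zero] at h
      exact h.resolve_left (by norm_num)
    | succ i ih =>
      have h := binomOp_succ_apply g.T (3 + i) 𝒱.conf
      rw [ih, map_zero, smul_zero, sub_zero, smul_eq_zero] at h
      exact h.resolve_left (Nat.cast_add_one_ne_zero _)
  rw [res, finsum_nat_eq_sum_range (K := 3)]
  · simp only [Finset.sum_range_succ, Finset.sum_range_zero, zero_add, h1, h2, binomOp_zero,
      Module.End.one_apply, 𝒱.mode_smul, LinearMap.smul_apply, Nat.cast_zero, Nat.cast_one,
      Nat.cast_ofNat, add_comm _ q, add_zero]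
  · intro j hj
    obtain ⟨i, rfl⟩ := Nat.exists_eq_add_of_le hj
    rw [h3, 𝒱.mode_zero, LinearMap.zero_apply]

end Automorphism

namespace WeakTwistedModule

variable {V W : Type*} [AddCommGroup V] [Module ℂ V] [AddCommGroup W] [Module ℂ W]
  {𝒱 : VertexOperatorAlgebra V} {g : Automorphism 𝒱} (M : WeakTwistedModule 𝒱 g W)

open Automorphism

/-- The products `res` in terms of the series of `(1 + y) ^ l (log (1 + y)) ^ j / j!`. -/
theorem apply_res_eq_sum (F : V →ₗ[ℂ] ℂ) {m m' : ℤ} {a : Strip} {u v : V} (hu : u ∈ 𝒱.wt m)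
    (hua : u ∈ g.gen a) (hv : v ∈ 𝒱.wt m') {J Q : ℕ} (hJ : (g.N ^ J) u = 0)
    (hQ : ∀ x ∈ 𝒱.fil m, ∀ y ∈ 𝒱.fil m', ∀ k : ℤ, (Q : ℤ) ≤ k → 𝒱.mode x k y = 0) (n : ℕ) :
    F (g.res (Q - 1 - n) u v) = ∑ j ∈ Finset.range J, ∑ p ∈ antidiagonal n,
      PowerSeries.coeff p.1 (powLogSeries (l m a) j) *
        F (𝒱.mode ((g.N ^ j) u) (Q - 1 - p.2) v) := by
  rw [g.res_eq, g.preservesFil_T.resOp_eq_sum hQ (𝒱.wt_le_fil le_rfl hu) (𝒱.wt_le_fil le_rfl hv)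
    (N := n + 1) (by push_cast; omega), map_sum, Finset.sum_comm,
    Finset.Nat.sum_antidiagonal_eq_sum_range_succ_mk]
  refine Finset.sum_congr rfl fun i hi => ?_
  have hi' : i ≤ n := Nat.lt_succ_iff.mp (Finset.mem_range.mp hi)
  rw [binomOp_eq_sum_powLogSeries (l := l m a) hJ, 𝒱.mode_sum, LinearMap.sum_apply, map_sum]
  · refine Finset.sum_congr rfl fun j _ => ?_
    rw [𝒱.mode_smul, LinearMap.smul_apply, map_smul, smul_eq_mul, Nat.cast_sub hi',
      show (i + (Q - 1 - n) : ℤ) = Q - 1 - (n - i) by ring]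
  · intro j
    have h1 := 𝒱.mem_wt.mp (g.N_pow_mem (fun _ h => g.N_mem_wt h) j u hu)
    rw [g.T_apply (g.N_pow_mem (fun _ h => g.N_mem_gen h) j u hua), h1, l_eq, add_smul, pow_succ',
      Module.End.mul_apply]

section

variable {φ : W →ₗ[ℂ] ℂ} {n₀ p : ℂ} (hd : M.IsGradedDual φ)
  (hφ : ∀ r ≠ n₀, ∀ w ∈ M.deg r, φ w = 0) (h₀ : n₀.re = 0)
  (hp : p.re = 0) {m m' : ℤ} {a : Strip} {u v : V} {w : W} (hu : u ∈ 𝒱.wt m) (hua : u ∈ g.gen a)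
  (hv : v ∈ 𝒱.wt m') (hw : w ∈ M.deg p)

include hd hφ h₀ hp hu hua hv hw

/-- The numbers `φ(o(res q u v) w)` are the coefficients of a Laurent polynomial in `y` whose
leading coefficient and whose value at `y = -1` are given by products of modes: it is
`(1 + y) ^ l ∑_j (log (1 + y)) ^ j / j! ⟨φ, Y^g(𝒩 ^ j u, 1 + y) Y^g(v, 1) w⟩`, expanded at `y = 0`, at
infinity and at `y = -1` by the three parts of duality. -/
theorem exists_coeffs_zeroMode_res : ∃ t₀ : ℕ, ∀ t, t₀ ≤ t → ∃ c : ℕ → ℂ,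
    (∀ k, t < k → c k = 0) ∧
    c t = φ (M.Yg (m + a - eps a - 1) 0 u (M.Yg (m' - 1 + p - (n₀ + a - eps a)) 0 v w)) ∧
    (∑ k ∈ Finset.range (t + 1), c k * (-1) ^ k = (-1) ^ t *
      φ (M.Yg (m' - 1 + (p - a + eps a) - n₀) 0 v (M.Yg (m + a - eps a - 1) 0 u w))) ∧
    ∀ q : ℤ, q < t → φ (M.zeroMode (g.res q u v) w) = c (t - 1 - q).toNat := by
  obtain ⟨J, hJ⟩ := g.N_locally_nilpotent u
  choose f hf using fun j => M.duality ((g.N ^ j) u) v w φ hd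
  refine ⟨∑ j ∈ Finset.range J, (f j).t, fun t ht => ?_⟩
  have htj : ∀ j < J, (f j).t ≤ t := fun j hj =>
    (Finset.single_le_sum (f := fun j => (f j).t) (fun _ _ => Nat.zero_le _)
      (Finset.mem_range.mpr hj)).trans ht
  choose! E hE hEf using fun j (hj : j < J) => (f j).exists_entire (htj j hj)
  obtain ⟨K, hK⟩ := 𝒱.exists_mode_fil_eq_zero m m'
  -- `Q` bounds the order of the poles of `Y(𝒩 ^ j u, y) v`; the summand `t` ensures that every
  -- coefficient `c k` is among those that the comparison at `y = 0` determines
  set Q : ℕ := K.toNat + t with hQ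
  have hKQ : ∀ x ∈ 𝒱.fil m, ∀ y ∈ 𝒱.fil m', ∀ k : ℤ, (Q : ℤ) ≤ k → 𝒱.mode x k y = 0 := by
    intro x hx y hy k hk
    refine hK x hx y hy k ?_
    have := Int.self_le_toNat K
    push_cast [hQ] at hk
    omega
  have hN : ∀ j, (g.N ^ j) u ∈ 𝒱.wt m := fun j => g.N_pow_mem (fun _ h => g.N_mem_wt h) j u hu
  have harg : ∀ x : ℝ, 0 < x → |arg0 x - arg0 1| < Real.pi / 2 := fun x hx => by
    have h1 : arg0 1 = 0 := by simpa using arg0_ofReal one_pos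
    rw [arg0_ofReal hx, h1, sub_zero, abs_zero]
    exact Real.pi_div_two_pos
  have hA := fun (x : ℝ) (hx : 0 < x) (hx1 : x < 1) =>
    M.hasSum_outer hφ h₀ hu hua hv hw hJ (B := fun j x => (f j).branch 0 x 1)
      (fun j _ x hx => ((hf j 0 x 1).1 (by simpa using lt_of_lt_of_le hx (le_abs_self x))
        (by simp)).2 (harg x (by linarith))) hx hx1
  have hB := fun (x : ℝ) (hx : 0 < x) (hx1 : x < 1) =>
    M.hasSum_inner hφ hp hu hua hv hw hJ (B := fun j x => (f j).branch 0 x 1)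
      (fun j _ x hx hx1 => ((hf j 0 x 1).2.1 (by simpa [abs_of_pos hx] using hx1)
        (by simpa using hx.ne')).2 (harg x hx)) hx hx1
  have hC : ∀ j < J, ∀ y : ℝ, 0 < y → y < 1 → HasSum (fun i : ℕ =>
      φ (M.zeroMode (𝒱.mode ((g.N ^ j) u) (Q - 1 - i) v) w) * (y : ℂ) ^ i)
      ((y : ℂ) ^ Q * (E j (Real.log (1 + y)) / (y : ℂ) ^ t)) := by
    intro j hj y hy hy1
    refine M.hasSum_iterate hφ h₀ hp hv hw (hN j)
      (fun k hk => hKQ _ (𝒱.wt_le_fil le_rfl (hN j)) _ (𝒱.wt_le_fil le_rfl hv) k hk) hy ?_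
    have h1 := ((hf j 0 (1 + y : ℝ) 1).2.2 (by simpa [abs_of_pos hy] using hy1)
      (by simpa using hy.ne')).2 (harg _ (by linarith))
    rw [hEf j hj _ (by linarith) (by linarith)] at h1
    simpa using h1
  obtain ⟨c, hc1, hc2, hc3, hc4⟩ := exists_laurent_coeffs hE
    (α := fun s : ℕ => φ (M.Yg (m + a - eps a - 1 + s) 0 u
      (M.Yg (m' - 1 + p - (n₀ + a - eps a + s)) 0 v w)))
    (β := fun s : ℕ => φ (M.Yg (m' - 1 + (p - a + eps a + s) - n₀) 0 v
      (M.Yg (m + a - eps a - 1 - s) 0 u w)))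
    (fun x hx hx1 => by
      have e : ∀ j ∈ Finset.range J, (-Real.log x : ℂ) ^ j / j.factorial *
          (f j).branch 0 ((x⁻¹ : ℝ) : ℂ) 1 = (-Real.log x : ℂ) ^ j / j.factorial *
            (E j (-Real.log x) / ((x : ℂ)⁻¹ - 1) ^ t) := fun j hj => by
        rw [hEf j (Finset.mem_range.mp hj) _ (inv_pos.mpr hx) (by simpa using hx1.ne), Real.log_inv]
        push_cast
        rfl
      rw [← Finset.sum_congr rfl e]
      exact hA x hx hx1)
    (fun x hx hx1 => by
      have e : ∀ j ∈ Finset.range J, (Real.log x : ℂ) ^ j / j.factorial *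
          (f j).branch 0 x 1 = (Real.log x : ℂ) ^ j / j.factorial *
            (E j (Real.log x) / ((x : ℂ) - 1) ^ t) := fun j hj => by
        rw [hEf j (Finset.mem_range.mp hj) _ hx hx1.ne]
      rw [← Finset.sum_congr rfl e]
      exact hB x hx hx1) hC
  refine ⟨c, hc1, ?_, ?_, fun q hq => ?_⟩
  · simpa using hc2
  · simpa using hc3
  · have h1 := hc4 (Q - 1 - q).toNat
    have h2 := apply_res_eq_sum (φ ∘ₗ LinearMap.applyₗ w ∘ₗ M.zeroMode) hu hua hv (hJ J le_rfl) hKQ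
      (Q - 1 - q).toNat
    have h3 : (((Q - 1 - q : ℤ).toNat : ℕ) : ℤ) = Q - 1 - q := Int.toNat_of_nonneg (by
      push_cast [hQ]
      omega)
    have h4 : (t - 1 - q : ℤ).toNat = (Q - 1 - q : ℤ).toNat + t - Q := by omega
    rw [h3, sub_sub_cancel] at h2
    rw [h4, ← if_pos (c := Q ≤ (Q - 1 - q : ℤ).toNat + t) (t := c _) (e := (0 : ℂ)) (by omega), h1]
    exact h2

theorem apply_zeroMode_res_eq_zero {q : ℤ} (hq : q < -1) :
    φ (M.zeroMode (g.res q u v) w) = 0 := by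
  obtain ⟨t, ht⟩ := M.exists_coeffs_zeroMode_res hd hφ h₀ hp hu hua hv hw
  obtain ⟨c, hc, -, -, h⟩ := ht t le_rfl
  rw [h q (by omega), hc _ (by omega)]

theorem apply_zeroMode_star :
    φ (M.zeroMode (g.res (-1) u v) w) = φ (M.zeroMode u (M.zeroMode v w)) := by
  obtain ⟨t, ht⟩ := M.exists_coeffs_zeroMode_res hd hφ h₀ hp hu hua hv hw
  obtain ⟨c, -, hc, -, h⟩ := ht t le_rfl
  rw [h (-1) (by omega), show (t - 1 - -1 : ℤ).toNat = t by omega, hc]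
  by_cases ha : (a : ℂ).re = 0
  · rw [eps_eq_zero ha, Int.cast_zero, sub_zero, sub_zero, M.zeroMode_apply hu hua ha]
    have h1 := M.apply_zeroMode (φ := φ ∘ₗ M.zeroMode u) (n₀ := n₀ + a) (n := p)
      (by rw [Complex.add_re, h₀, ha, add_zero]) hp (fun r hr y hy => ?_) hv hw
    · rw [LinearMap.comp_apply, LinearMap.comp_apply, M.zeroMode_apply hu hua ha] at h1
      exact h1
    · exact hφ (r - a) (fun h => hr (by rw [← h]; ring)) _ (M.zeroMode_mem_deg hua hy)
  · -- for `Re a > 0` the intermediate degree `n₀ + a - 1` has negative real part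
    have h1 : M.Yg (m' - 1 + p - (n₀ + a - eps a)) 0 v w = 0 := by
      have h2 := M.degree m' v hv p w hw (m' - 1 + p - (n₀ + a - eps a)) 0
      rwa [M.deg_eq_bot, Submodule.mem_bot] at h2
      rw [eps_eq_one ha, show (m' : ℂ) - (m' - 1 + p - (n₀ + a - (1 : ℤ))) - 1 + p = n₀ + a - 1 by
        push_cast; ring, Complex.sub_re, Complex.add_re, h₀, Complex.one_re]
      linarith [a.2.2]
    rw [h1, map_zero, map_zero, M.zeroMode_eq_zero hua ha, LinearMap.zero_apply, map_zero]

/-- The products `v * u` in the opposite order, from the value of the Laurent polynomial at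
`y = -1`. -/
theorem apply_zeroMode_star_comm (ha : (a : ℂ).re = 0) : ∃ t₀ : ℕ, ∀ t, t₀ ≤ t →
    ∑ k ∈ Finset.range (t + 1), (-1) ^ k * φ (M.zeroMode (g.res (k - 1) u v) w)
      = φ (M.zeroMode v (M.zeroMode u w)) := by
  obtain ⟨t₀, ht⟩ := M.exists_coeffs_zeroMode_res hd hφ h₀ hp hu hua hv hw
  refine ⟨t₀, fun t ht₀ => ?_⟩
  obtain ⟨c, -, -, hc, h⟩ := ht t ht₀
  rw [eps_eq_zero ha, Int.cast_zero, sub_zero, add_zero,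
    show (m : ℂ) + a - 1 = m + a - 1 from rfl, ← M.zeroMode_apply hu hua ha,
    M.apply_zeroMode h₀ (by rw [Complex.sub_re, hp, ha, sub_zero]) hφ hv
      (M.zeroMode_mem_deg hua hw)] at hc
  have h1 : ((-1 : ℂ) ^ t) * (-1) ^ t = 1 := by
    rw [← mul_pow]
    simp
  have h2 := congrArg (fun x => (-1 : ℂ) ^ t * x) hc
  simp only [← mul_assoc, h1, one_mul] at h2
  rw [← h2, Finset.mul_sum, ← Finset.sum_range_reflect]
  refine Finset.sum_congr rfl fun k hk => ?_
  have hk' : k ≤ t := Nat.lt_succ_iff.mp (Finset.mem_range.mp hk)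
  rw [h _ (by omega), show (t - 1 - (((t + 1 - 1 - k : ℕ) : ℤ) - 1)).toNat = k by omega,
    Nat.add_sub_cancel]
  have h3 : (-1 : ℂ) ^ t = (-1) ^ (t - k) * (-1) ^ k := by
    rw [← pow_add, Nat.sub_add_cancel hk']
  have h4 : ((-1 : ℂ) ^ k) * (-1) ^ k = 1 := by
    rw [← mul_pow]
    simp
  rw [h3]
  linear_combination (-(-1 : ℂ) ^ (t - k) * c k) * h4

end

/-- Functionals of the graded dual that are supported in one lowest degree separate the vectors of
the lowest space. -/
theorem eq_zero_of_forall_apply {x : W} (hx : x ∈ M.Omega) (h : ∀ (n₀ : ℂ) (φ : W →ₗ[ℂ] ℂ),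
    n₀.re = 0 → M.IsGradedDual φ → (∀ r ≠ n₀, ∀ w ∈ M.deg r, φ w = 0) → φ x = 0) : x = 0 := by
  classical
  refine eq_zero_of_byGrading_eq_zero M.gr_isInternal fun i => ?_
  set P := byGrading M.gr M.gr_isInternal (fun j => if j = i then LinearMap.id else 0) with hP
  have hgr : ∀ j, ∀ w ∈ M.gr j, j ≠ i → P w = 0 := fun j w hw hj => by
    rw [hP, byGrading_apply _ _ _ hw, if_neg hj]
    rfl
  have hdeg : ∀ r ≠ i.1, ∀ w ∈ M.deg r, P w = 0 := fun r hr w hw =>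
    M.deg_induction (P := fun w => P w = 0) (map_zero _)
      (fun x y hx hy => by rw [map_add, hx, hy, add_zero])
      (fun a w hw => hgr _ w hw fun h => hr (by rw [← h])) hw
  rw [← Module.forall_dual_apply_eq_zero_iff ℂ]
  intro ψ
  by_cases hi : i.1.re = 0
  · refine h i.1 (ψ ∘ₗ P) hi ((Set.finite_singleton i).subset ?_) fun r hr w hw => ?_
    · rintro j ⟨w, hw, hne⟩
      by_contra hj
      rw [LinearMap.comp_apply, hgr j w hw hj, map_zero] at hne
      exact hne rfl
    · rw [LinearMap.comp_apply, hdeg r hr w hw, map_zero]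
  · have h1 : P x = 0 := M.Omega_induction (P := fun x => P x = 0) (map_zero _)
      (fun x y hx hy => by rw [map_add, hx, hy, add_zero])
      (fun n hn w hw => hdeg n (fun h => hi (by rw [← h, hn])) w hw) hx
    rw [h1, map_zero]

theorem zeroMode_mem_Omega (v : V) {w : W} (hw : w ∈ M.Omega) : M.zeroMode v w ∈ M.Omega := by
  refine g.gen_top_induction (P := fun v => M.zeroMode v w ∈ M.Omega) (by simp)
    (fun x y hx hy => by rw [map_add]; exact Submodule.add_mem _ hx hy) (fun a v hv => ?_) v
  by_cases ha : (a : ℂ).re = 0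
  · refine M.Omega_induction (P := fun w => M.zeroMode v w ∈ M.Omega) (by simp)
      (fun x y hx hy => by rw [map_add]; exact Submodule.add_mem _ hx hy) (fun n hn w hw => ?_) hw
    exact M.deg_le_Omega (by rw [Complex.sub_re, hn, ha, sub_zero]) (M.zeroMode_mem_deg hv hw)
  · rw [M.zeroMode_eq_zero hv ha]
    exact Submodule.zero_mem _

/-! ### The representation on the lowest space -/

theorem zeroMode_res_eq_zero {a : Strip} {u : V} (hu : u ∈ g.gen a) (v : V) {q : ℤ} (hq : q < -1)
    {w : W} (hw : w ∈ M.Omega) : M.zeroMode (g.res q u v) w = 0 := by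
  refine M.Omega_induction (P := fun w => M.zeroMode (g.resₗ q u v) w = 0) (map_zero _)
    (fun x y hx hy => by rw [map_add, hx, hy, add_zero]) (fun p hp w hw => ?_) hw
  refine g.gen_induction (P := fun u => M.zeroMode (g.resₗ q u v) w = 0) (by simp)
    (fun x y hx hy => by
      rw [map_add, LinearMap.add_apply, map_add, LinearMap.add_apply, hx, hy, add_zero])
    (fun m u hm hua => ?_) hu
  refine 𝒱.wt_induction (P := fun v => M.zeroMode (g.resₗ q u v) w = 0) (by simp)
    (fun x y hx hy => by rw [map_add, map_add, LinearMap.add_apply, hx, hy, add_zero])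
    (fun m' v hv => ?_) v
  refine M.eq_zero_of_forall_apply (M.zeroMode_mem_Omega _ (M.deg_le_Omega hp hw))
    fun n₀ φ h₀ hd hφ => ?_
  exact M.apply_zeroMode_res_eq_zero hd hφ h₀ hp hm hua hv hw hq

/-- The zero modes represent the product of `A_g(V)` on the lowest space. -/
theorem zeroMode_star (u v : V) {w : W} (hw : w ∈ M.Omega) :
    M.zeroMode (g.res (-1) u v) w = M.zeroMode u (M.zeroMode v w) := by
  refine M.Omega_induction (P := fun w => M.zeroMode (g.resₗ (-1) u v) w
    = M.zeroMode u (M.zeroMode v w)) (by simp)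
    (fun x y hx hy => by simp only [map_add, hx, hy]) (fun p hp w hw => ?_) hw
  refine g.hom_induction (P := fun u => M.zeroMode (g.resₗ (-1) u v) w
    = M.zeroMode u (M.zeroMode v w)) (by simp)
    (fun x y hx hy => by simp only [map_add, LinearMap.add_apply, hx, hy])
    (fun m a u hm hua => ?_) u
  refine 𝒱.wt_induction (P := fun v => M.zeroMode (g.resₗ (-1) u v) w
    = M.zeroMode u (M.zeroMode v w)) (by simp)
    (fun x y hx hy => by simp only [map_add, LinearMap.add_apply, hx, hy])
    (fun m' v hv => ?_) v
  have hΩ := M.deg_le_Omega hp hw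
  rw [← sub_eq_zero]
  refine M.eq_zero_of_forall_apply (Submodule.sub_mem _ (M.zeroMode_mem_Omega _ hΩ)
    (M.zeroMode_mem_Omega _ (M.zeroMode_mem_Omega _ hΩ))) fun n₀ φ h₀ hd hφ => ?_
  rw [map_sub, sub_eq_zero]
  exact M.apply_zeroMode_star hd hφ h₀ hp hm hua hv hw

/-- `O_g(V)` acts by zero on the lowest space. For `ε(a) = 1` the generators with `n = 2` are products
`u *_g v` with `o(u) = 0`. -/
theorem zeroMode_O {x : V} (hx : x ∈ g.O) {w : W} (hw : w ∈ M.Omega) : M.zeroMode x w = 0 := by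
  have h1 : g.O ≤ LinearMap.ker (LinearMap.applyₗ w ∘ₗ M.zeroMode) := by
    refine g.O_le fun a b u hu v _ n hn => ?_
    change M.zeroMode (g.res (eps a - n) u v) w = 0
    by_cases ha : (a : ℂ).re = 0
    · exact M.zeroMode_res_eq_zero hu v (by rw [eps_eq_zero ha]; omega) hw
    · rcases (show 2 ≤ n by omega).lt_or_eq with h | rfl
      · exact M.zeroMode_res_eq_zero hu v (by rw [eps_eq_one ha]; omega) hw
      · rw [eps_eq_one ha, show (1 - 2 : ℤ) = -1 by norm_num, M.zeroMode_star u v hw,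
          M.zeroMode_eq_zero hu ha, LinearMap.zero_apply]
  exact h1 hx

theorem zeroMode_conf : M.zeroMode 𝒱.conf = M.L0 := by
  rw [M.zeroMode_apply 𝒱.conf_mem_wt (g.conf_mem_gen) (by simp [zeroStrip]), L0]
  congr 1
  simp [zeroStrip]
  norm_num

/-- The commutator with `L^g(0)`. It comes from the case `u = ω` of the residue formula, as
`∑_k (-1) ^ k x ^ (k-1) (1 + x) ^ 2` telescopes to `x ^ (-1) + 1`. -/
theorem L0_zeroMode_sub (v : V) {w : W} (hw : w ∈ M.Omega) :
    M.L0 (M.zeroMode v w) - M.zeroMode v (M.L0 w) = M.zeroMode (𝒱.L (-1) v + 𝒱.L 0 v) w := by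
  rw [← zeroMode_conf, ← sub_eq_zero]
  refine M.Omega_induction (P := fun w => M.zeroMode 𝒱.conf (M.zeroMode v w)
    - M.zeroMode v (M.zeroMode 𝒱.conf w) - M.zeroMode (𝒱.L (-1) v + 𝒱.L 0 v) w = 0) (by simp)
    (fun x y hx hy => by
      simp only [map_add]
      rw [← add_zero (0 : W)]
      nth_rewrite 1 [← hx]
      rw [← hy]
      simp only [map_add, LinearMap.add_apply]
      abel) (fun p hp w hw => ?_) hw
  refine 𝒱.wt_induction (P := fun v => M.zeroMode 𝒱.conf (M.zeroMode v w)
    - M.zeroMode v (M.zeroMode 𝒱.conf w) - M.zeroMode (𝒱.L (-1) v + 𝒱.L 0 v) w = 0) (by simp)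
    (fun x y hx hy => by
      rw [← add_zero (0 : W)]
      nth_rewrite 1 [← hx]
      rw [← hy]
      simp only [map_add, LinearMap.add_apply]
      abel) (fun m' v hv => ?_) v
  have hΩ := M.deg_le_Omega hp hw
  refine M.eq_zero_of_forall_apply (Submodule.sub_mem _ (Submodule.sub_mem _
    (M.zeroMode_mem_Omega _ (M.zeroMode_mem_Omega _ hΩ))
    (M.zeroMode_mem_Omega _ (M.zeroMode_mem_Omega _ hΩ))) (M.zeroMode_mem_Omega _ hΩ))
    fun n₀ φ h₀ hd hφ => ?_
  have h1 := M.apply_zeroMode_star hd hφ h₀ hp 𝒱.conf_mem_wt g.conf_mem_gen hv hw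
  obtain ⟨t₀, ht⟩ := M.apply_zeroMode_star_comm hd hφ h₀ hp 𝒱.conf_mem_wt g.conf_mem_gen hv hw
    (by simp [zeroStrip])
  obtain ⟨K, hK⟩ := 𝒱.mode_eq_zero 𝒱.conf v
  have h2 := ht (t₀ + K) (by omega)
  have h3 : ∀ q : ℤ, φ (M.zeroMode (g.res q 𝒱.conf v) w) = φ (M.zeroMode (𝒱.mode 𝒱.conf q v) w)
      + 2 * φ (M.zeroMode (𝒱.mode 𝒱.conf (q + 1) v) w)
      + φ (M.zeroMode (𝒱.mode 𝒱.conf (q + 2) v) w) := fun q => by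
    rw [g.res_conf]
    simp only [map_add, map_smul, LinearMap.add_apply, LinearMap.smul_apply, smul_eq_mul]
  simp only [h3] at h1 h2
  rw [sum_alternating (fun q => φ (M.zeroMode (𝒱.mode 𝒱.conf q v) w))] at h2
  rw [hK ((t₀ + K : ℕ) : ℤ) (by push_cast; omega),
    hK (((t₀ + K : ℕ) : ℤ) + 1) (by push_cast; omega), map_zero, LinearMap.zero_apply, map_zero,
    add_zero, mul_zero, add_zero] at h2
  rw [show (-1 + 1 : ℤ) = 0 by norm_num, show (-1 + 2 : ℤ) = 1 by norm_num] at h1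
  have e1 : 𝒱.L (-1) v = 𝒱.mode 𝒱.conf 0 v := rfl
  have e2 : 𝒱.L 0 v = 𝒱.mode 𝒱.conf 1 v := rfl
  rw [map_sub, map_sub, ← h1, ← h2, map_add, LinearMap.add_apply, map_add, e1, e2]
  ring

end WeakTwistedModule

end

end TwistedZhu

namespace TwistedZhu

noncomputable section

/-! ### Generalized eigenspaces -/

section

variable {X : Type*} [AddCommGroup X] [Module ℂ X]

theorem mem_maxGenEigenspace_of_sub_mem {f : Module.End ℂ X} {μ : ℂ} {x : X}
    (h : f x - μ • x ∈ f.maxGenEigenspace μ) : x ∈ f.maxGenEigenspace μ := by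
  obtain ⟨k, hk⟩ := (Module.End.mem_maxGenEigenspace _ _ _).mp h
  refine (Module.End.mem_maxGenEigenspace _ _ _).mpr ⟨k + 1, ?_⟩
  rw [pow_succ, Module.End.mul_apply]
  exact hk

/-- Independent subspaces cannot be larger than subspaces of them that already span. -/
theorem eq_of_le_of_iSupIndep {ι : Type*} {G E : ι → Submodule ℂ X} (hE : iSupIndep E)
    (hle : ∀ i, G i ≤ E i) (hG : ⨆ i, G i = ⊤) (i : ι) : E i = G i := by
  refine le_antisymm ?_ (hle i)
  have h1 : (G i ⊔ ⨆ (j) (_ : j ≠ i), G j) ⊓ E i = G i ⊔ (⨆ (j) (_ : j ≠ i), G j) ⊓ E i :=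
    (sup_inf_assoc_of_le _ (hle i))
  rw [← iSup_split_single, hG, top_inf_eq] at h1
  rw [h1]
  refine sup_le le_rfl ?_
  have h2 : (⨆ (j) (_ : j ≠ i), G j) ⊓ E i ≤ ⊥ := by
    rw [inf_comm]
    exact (inf_le_inf_left _ (iSup₂_mono fun j _ => hle j)).trans (hE i).le_bot
  exact h2.trans bot_le

theorem mem_maxGenEigenspace_restrict {f : Module.End ℂ X} {p : Submodule ℂ X}
    (h : ∀ x ∈ p, f x ∈ p) {μ : ℂ} {x : p} :
    x ∈ Module.End.maxGenEigenspace (f.restrict h) μ ↔ (x : X) ∈ f.maxGenEigenspace μ := by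
  rw [Module.End.maxGenEigenspace, Module.End.genEigenspace_restrict]
  rfl

/-- The restriction of an operator to a stable subspace inherits the decomposition into
generalized eigenspaces. -/
theorem iSup_maxGenEigenspace_restrict {f : Module.End ℂ X} {p : Submodule ℂ X}
    (h : ∀ x ∈ p, f x ∈ p) (htop : ⨆ μ, f.maxGenEigenspace μ = ⊤) :
    ⨆ μ, Module.End.maxGenEigenspace (f.restrict h) μ = ⊤ := by
  refine eq_top_iff.mpr fun x _ => ?_
  have h1 : (x : X) ∈ ⨆ μ, p ⊓ f.maxGenEigenspace μ :=
    inf_iSup_genEigenspace_le f h ⊤ ⟨x.2, htop.symm ▸ Submodule.mem_top⟩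
  have h2 : ⨆ μ, p ⊓ f.maxGenEigenspace μ
      ≤ (⨆ μ, Module.End.maxGenEigenspace (f.restrict h) μ).map p.subtype := by
    refine iSup_le fun μ y hy => ⟨⟨y, hy.1⟩, ?_, rfl⟩
    exact Submodule.mem_iSup_of_mem μ ((mem_maxGenEigenspace_restrict h).mpr hy.2)
  obtain ⟨y, hy, hyx⟩ := h2 h1
  rwa [← Subtype.ext hyx]

/-- Simultaneous generalized eigenspaces of two commuting operators. -/
theorem isInternal_inf_maxGenEigenspace {f k : Module.End ℂ X} (hfk : Commute f k)
    (hf : ⨆ μ, f.maxGenEigenspace μ = ⊤) {ι : Type*} [DecidableEq ι] {e : ι → ℂ}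
    (he : Function.Injective e) (hk : ⨆ a, k.maxGenEigenspace (e a) = ⊤) :
    DirectSum.IsInternal fun i : ℂ × ι => f.maxGenEigenspace i.1 ⊓ k.maxGenEigenspace (e i.2) := by
  apply DirectSum.isInternal_submodule_of_iSupIndep_of_iSup_eq_top
  · have h1 := Module.End.independent_iInf_maxGenEigenspace_of_forall_mapsTo
      (fun b : Bool => bif b then f else k) fun i j μ => by
        refine Module.End.mapsTo_maxGenEigenspace_of_comm ?_ μ
        cases i <;> cases j
        exacts [Commute.refl _, hfk, hfk.symm, Commute.refl _]
    have h2 := h1.comp (f := fun (i : ℂ × ι) (b : Bool) => bif b then i.1 else e i.2) (by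
      intro i j hij
      exact Prod.ext (congrFun hij true) (he (congrFun hij false)))
    convert h2 using 2 with i
    simp [iInf_bool_eq]
  · rw [eq_top_iff, ← hk]
    refine iSup_le fun a => ?_
    have h1 := inf_iSup_genEigenspace_le f (p := k.maxGenEigenspace (e a))
      (fun x hx => Module.End.mapsTo_maxGenEigenspace_of_comm hfk.symm _ hx) ⊤
    change k.maxGenEigenspace (e a) ⊓ ⨆ μ, f.maxGenEigenspace μ ≤ _ at h1
    rw [hf, inf_top_eq] at h1
    refine h1.trans (iSup_le fun μ => ?_)
    rw [inf_comm]
    exact le_iSup (fun i : ℂ × ι => f.maxGenEigenspace i.1 ⊓ k.maxGenEigenspace (e i.2)) (μ, a)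

end

/-! ### The lowest space as a module -/

namespace WeakTwistedModule

variable {V W : Type*} [AddCommGroup V] [Module ℂ V] [AddCommGroup W] [Module ℂ W]
  {𝒱 : VertexOperatorAlgebra V} {g : Automorphism 𝒱} (M : WeakTwistedModule 𝒱 g W)

open Automorphism

theorem act_zeroMode (v : V) (w : W) :
    M.act (M.zeroMode v w) = M.zeroMode (g.op v) (M.act w) := by
  refine g.hom_induction (P := fun v => M.act (M.zeroMode v w) = M.zeroMode (g.op v) (M.act w))
    (by simp) (fun x y hx hy => by simp only [map_add, LinearMap.add_apply, hx, hy])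
    (fun m a v hm hv => ?_) v
  by_cases ha : (a : ℂ).re = 0
  · rw [M.zeroMode_apply hm hv ha, M.zeroMode_apply (g.op_mem_wt hm) (g.op_mem_gen a hv) ha,
      M.act_Yg]
  · rw [M.zeroMode_eq_zero hv ha, M.zeroMode_eq_zero (g.op_mem_gen a hv) ha]
    simp

theorem act_mem_Omega {w : W} (hw : w ∈ M.Omega) : M.act w ∈ M.Omega := by
  intro m u hu k hk
  obtain ⟨u', rfl⟩ := g.equiv.surjective u
  have hu' : u' ∈ 𝒱.wt m := by
    rw [𝒱.mem_wt] at *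
    apply g.equiv.injective
    rw [map_smul, ← hu]
    exact g.op_L 0 u'
  have h := M.act_Yg k 0 u' w
  rw [hw m u' hu' k hk, map_zero] at h
  exact h.symm

theorem act_symm_mem_Omega {w : W} (hw : w ∈ M.Omega) : M.act.symm w ∈ M.Omega := by
  intro m u hu k hk
  apply M.act.injective
  rw [M.act_Yg, LinearEquiv.apply_symm_apply, map_zero]
  exact hw m _ (g.op_mem_wt hu) k hk

/-- The zero modes as operators on the lowest space. -/
def zeroModeOmega : V →ₗ[ℂ] Module.End ℂ M.Omega where
  toFun v := (M.zeroMode v).restrict fun _ hw => M.zeroMode_mem_Omega v hw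
  map_add' u v := LinearMap.ext fun w => Subtype.ext (by simp)
  map_smul' r v := LinearMap.ext fun w => Subtype.ext (by simp)

@[simp]
theorem coe_zeroModeOmega (v : V) (w : M.Omega) :
    (M.zeroModeOmega v w : W) = M.zeroMode v w := rfl

/-- The action of `g` on the lowest space. -/
def actOmega : M.Omega ≃ₗ[ℂ] M.Omega :=
  LinearEquiv.ofLinearMap (M.act.toLinearMap.restrict fun _ hw => M.act_mem_Omega hw)
    (M.act.symm.toLinearMap.restrict fun _ hw => M.act_symm_mem_Omega hw)
    (LinearMap.ext fun w => Subtype.ext (by simp))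
    (LinearMap.ext fun w => Subtype.ext (by simp))

theorem actOmega_eq_restrict : M.actOmega.toLinearMap
    = M.act.toLinearMap.restrict fun _ hw => M.act_mem_Omega hw := rfl

theorem gen_le (a : Strip) : M.gen a ≤ Module.End.maxGenEigenspace M.act.toLinearMap a.eig :=
  fun w hw => (Module.End.mem_maxGenEigenspace _ _ _).mpr
    ((M.generalized a w hw).imp fun _ h => h.2)

theorem iSup_gen : ⨆ a, M.gen a = ⊤ := by
  rw [eq_top_iff, ← M.gr_isInternal.submodule_iSup_eq_top]
  exact iSup_le fun i => (M.gr_le_gen i.1 i.2).trans (le_iSup _ i.2)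

/-- The grading of `W` by `ℂ / ℤ` is the one by generalized eigenspaces of `g`. -/
theorem maxGenEigenspace_act (a : Strip) :
    Module.End.maxGenEigenspace M.act.toLinearMap a.eig = M.gen a :=
  eq_of_le_of_iSupIndep
    ((Module.End.independent_maxGenEigenspace M.act.toLinearMap).comp Strip.eig_injective)
    M.gen_le M.iSup_gen a

theorem iSup_maxGenEigenspace_actOmega :
    ⨆ a : Strip, Module.End.maxGenEigenspace M.actOmega.toLinearMap a.eig = ⊤ := by
  refine eq_top_iff.mpr fun x _ => ?_
  suffices h : (x : W) ∈ (⨆ a : Strip,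
      Module.End.maxGenEigenspace M.actOmega.toLinearMap a.eig).map M.Omega.subtype by
    obtain ⟨y, hy, hyx⟩ := h
    rwa [← Subtype.ext hyx]
  refine M.Omega_induction (P := fun x => x ∈ (⨆ a : Strip, Module.End.maxGenEigenspace
    M.actOmega.toLinearMap a.eig).map M.Omega.subtype) (Submodule.zero_mem _)
    (fun _ _ => Submodule.add_mem _) (fun n hn w hw => ?_) x.2
  refine M.deg_induction (P := fun x => x ∈ (⨆ a : Strip, Module.End.maxGenEigenspace
    M.actOmega.toLinearMap a.eig).map M.Omega.subtype) (Submodule.zero_mem _)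
    (fun _ _ => Submodule.add_mem _) (fun a w hw => ?_) hw
  refine ⟨⟨w, M.deg_le_Omega hn (M.gr_le_deg n a hw)⟩, Submodule.mem_iSup_of_mem a ?_, rfl⟩
  rw [actOmega_eq_restrict, mem_maxGenEigenspace_restrict]
  exact M.gen_le a (M.gr_le_gen n a hw)

theorem zeroMode_vac (w : W) : M.zeroMode 𝒱.vac w = w := by
  rw [M.zeroMode_apply 𝒱.vac_mem_wt (g.mem_gen_zeroStrip g.op_vac) (by simp [zeroStrip]),
    M.identity, if_pos ⟨by simp [zeroStrip], rfl⟩]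

theorem zeroModeOmega_O {x : V} (hx : x ∈ g.O) : M.zeroModeOmega x = 0 :=
  LinearMap.ext fun w => Subtype.ext (M.zeroMode_O hx w.2)

theorem zeroModeOmega_star (u v : V) (w : M.Omega) :
    M.zeroModeOmega (g.star u v) w = M.zeroModeOmega u (M.zeroModeOmega v w) :=
  Subtype.ext (M.zeroMode_star u v w.2)

theorem zeroModeOmega_vac (w : M.Omega) : M.zeroModeOmega 𝒱.vac w = w :=
  Subtype.ext (M.zeroMode_vac w)

theorem actOmega_zeroModeOmega (v : V) (w : M.Omega) :
    M.actOmega (M.zeroModeOmega v w) = M.zeroModeOmega (g.op v) (M.actOmega w) :=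
  Subtype.ext (M.act_zeroMode v w)

variable {prod : V → V → V} {O : Submodule ℂ V}

/-- The lowest space as a graded module for an algebra `V / O` which maps to `A_g(V)` by an
operator `U` on `V` (which is the identity for `A_g(V)` and `𝒰(1)` for `Ã_g(V)`). -/
def gradedModule (𝔸 : InducedAlgebra g prod O) (U : Module.End ℂ V) (hO : ∀ x ∈ O, U x ∈ g.O)
    (hprod : ∀ u v, U (prod u v) = g.star (U u) (U v)) (hvac : U 𝒱.vac = 𝒱.vac)
    (hop : ∀ v, g.op (U v) = U (g.op v)) : 𝔸.GradedModule M.Omega where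
  smul := O.liftQ (M.zeroModeOmega ∘ₗ U) fun x hx => M.zeroModeOmega_O (hO x hx)
  mul_smul x y w := by
    obtain ⟨u, rfl⟩ := O.mkQ_surjective x
    obtain ⟨v, rfl⟩ := O.mkQ_surjective y
    rw [𝔸.mul_mk]
    change M.zeroModeOmega (U (prod u v)) w = M.zeroModeOmega (U u) (M.zeroModeOmega (U v) w)
    rw [hprod, zeroModeOmega_star]
  one_smul w := by
    change M.zeroModeOmega (U 𝒱.vac) w = w
    rw [hvac, zeroModeOmega_vac]
  act := M.actOmega
  act_smul x w := by
    obtain ⟨u, rfl⟩ := O.mkQ_surjective x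
    rw [𝔸.gact_mk]
    change M.actOmega (M.zeroModeOmega (U u) w) = M.zeroModeOmega (U (g.op u)) (M.actOmega w)
    rw [actOmega_zeroModeOmega, hop]
  isInternal := DirectSum.isInternal_submodule_of_iSupIndep_of_iSup_eq_top
    ((Module.End.independent_maxGenEigenspace M.actOmega.toLinearMap).comp Strip.eig_injective)
    M.iSup_maxGenEigenspace_actOmega

/-! ### Weights -/

theorem mem_OmegaWt {n : ℂ} {w : M.Omega} :
    w ∈ M.OmegaWt n ↔ (w : W) ∈ M.L0.maxGenEigenspace n := Iff.rfl

theorem L0_mem_Omega {w : W} (hw : w ∈ M.Omega) : M.L0 w ∈ M.Omega := by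
  rw [← zeroMode_conf]
  exact M.zeroMode_mem_Omega _ hw

/-- Modulo `O_g(V)` one has `L(-1) v + L(0) v = - (a + 𝒩) v` for `v ∈ V^[a + ℤ]`. Hence the zero mode
of `v` shifts weights by `-a`, up to the nilpotent term from `𝒩`. -/
theorem L0_zeroMode {a : Strip} (ha : (a : ℂ).re = 0) {v : V} (hv : v ∈ g.gen a) {w : W}
    (hw : w ∈ M.Omega) : M.L0 (M.zeroMode v w)
      = M.zeroMode v (M.L0 w) - (a : ℂ) • M.zeroMode v w - M.zeroMode (g.N v) w := by
  have h1 := M.L0_zeroMode_sub v hw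
  have h2 := M.zeroMode_O (g.L_neg_one_add_T_mem_O ha hv) hw
  rw [g.T_apply hv, eps_eq_zero ha, Int.cast_zero, sub_zero] at h2
  simp only [map_add, map_smul, LinearMap.add_apply, LinearMap.smul_apply] at h1 h2
  rw [sub_eq_iff_eq_add.mp h1, eq_comm, ← sub_eq_zero, ← neg_eq_zero, ← h2]
  abel

/-- Induction on the sum of the nilpotency degrees of `𝒩` at `v` and of `L^g(0) - n` at `w`. -/
theorem zeroMode_mem_maxGenEigenspace {a : Strip} (ha : (a : ℂ).re = 0) {n : ℂ} (d : ℕ) :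
    ∀ (J K : ℕ), J + K = d → ∀ v ∈ g.gen a, (g.N ^ J) v = 0 → ∀ w ∈ M.Omega,
      ((M.L0 - n • (1 : Module.End ℂ W)) ^ K) w = 0 →
        M.zeroMode v w ∈ M.L0.maxGenEigenspace (n - a) := by
  induction d with
  | zero =>
    intro J K hd v _ hv w _ _
    obtain rfl : J = 0 := by omega
    rw [pow_zero, Module.End.one_apply] at hv
    simp [hv]
  | succ d ih =>
    intro J K hd v hv hvJ w hw hwK
    rcases J with _ | J
    · rw [pow_zero, Module.End.one_apply] at hvJ
      simp [hvJ]
    rcases K with _ | K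
    · rw [pow_zero, Module.End.one_apply] at hwK
      simp [hwK]
    apply mem_maxGenEigenspace_of_sub_mem
    have h1 : M.L0 (M.zeroMode v w) - (n - a : ℂ) • M.zeroMode v w
        = M.zeroMode v ((M.L0 - n • (1 : Module.End ℂ W)) w) - M.zeroMode (g.N v) w := by
      rw [M.L0_zeroMode ha hv hw, LinearMap.sub_apply, LinearMap.smul_apply, Module.End.one_apply,
        map_sub, map_smul]
      module
    rw [h1]
    refine Submodule.sub_mem _ (ih (J + 1) K (by omega) v hv hvJ _ ?_ ?_)
      (ih J (K + 1) (by omega) _ (g.N_mem_gen hv) ?_ w hw hwK)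
    · exact Submodule.sub_mem _ (M.L0_mem_Omega hw) (Submodule.smul_mem _ _ hw)
    · rw [← Module.End.mul_apply, ← pow_succ, hwK]
    · rw [← Module.End.mul_apply, ← pow_succ, hvJ]

/-- The sums of the weight spaces over the lines `r + iℝ` are stable under the zero modes. -/
theorem zeroModeOmega_mem_iSup (v : V) {r : ℝ} {w : M.Omega}
    (hw : w ∈ ⨆ n : {n : ℂ // n.re = r}, M.OmegaWt n) :
    M.zeroModeOmega v w ∈ ⨆ n : {n : ℂ // n.re = r}, M.OmegaWt n := by
  refine g.gen_top_induction (P := fun v => M.zeroModeOmega v w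
    ∈ ⨆ n : {n : ℂ // n.re = r}, M.OmegaWt n) (by simp)
    (fun x y hx hy => by rw [map_add]; exact Submodule.add_mem _ hx hy) (fun a v hv => ?_) v
  by_cases ha : (a : ℂ).re = 0
  · induction hw using Submodule.iSup_induction' with
    | mem i x hx =>
      obtain ⟨K, hK⟩ := (Module.End.mem_maxGenEigenspace _ _ _).mp (M.mem_OmegaWt.mp hx)
      obtain ⟨J, hJ⟩ := g.N_locally_nilpotent v
      exact Submodule.mem_iSup_of_mem (⟨i - a, by rw [Complex.sub_re, i.2, ha, sub_zero]⟩ :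
        {n : ℂ // n.re = r}) (M.zeroMode_mem_maxGenEigenspace ha (J + K) J K rfl v hv (hJ J le_rfl)
          x x.2 hK)
    | zero => simp
    | add x y _ _ hx hy =>
      rw [map_add]
      exact Submodule.add_mem _ hx hy
  · have h1 : M.zeroModeOmega v w = 0 := Subtype.ext (by
      rw [coe_zeroModeOmega, M.zeroMode_eq_zero hv ha]
      rfl)
    rw [h1]
    exact Submodule.zero_mem _

section

variable {𝔸 : InducedAlgebra g prod O} {R : 𝔸.GradedModule M.Omega} {U : Module.End ℂ V}
  (hR : ∀ v, R.smul (O.mkQ v) = M.zeroModeOmega (U v)) (hact : R.act = M.actOmega) {y : V}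
  (hy : U y = 𝒱.conf)

include hR

theorem isSubmodule_iSup_OmegaWt (r : ℝ) :
    R.IsSubmodule (⨆ n : {n : ℂ // n.re = r}, M.OmegaWt n) := by
  intro x w hw
  obtain ⟨v, rfl⟩ := O.mkQ_surjective x
  rw [hR]
  exact M.zeroModeOmega_mem_iSup _ hw

include hy

theorem smul_conf : R.smul (O.mkQ y) = M.L0.restrict fun _ hw => M.L0_mem_Omega hw := by
  rw [hR, hy]
  refine LinearMap.ext fun w => Subtype.ext ?_
  rw [coe_zeroModeOmega, zeroMode_conf]
  rfl

theorem weightSpace_eq (n : ℂ) : R.weightSpace y n = M.OmegaWt n := by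
  ext w
  rw [InducedAlgebra.GradedModule.weightSpace, M.smul_conf hR hy, mem_maxGenEigenspace_restrict,
    mem_OmegaWt]

include hact

theorem isLowerBounded_gradedModule (hM : M.IsLowerBounded) : R.IsLowerBounded y where
  isInternal := by
    have h1 := isInternal_inf_maxGenEigenspace
      (f := M.L0.restrict fun _ hw => M.L0_mem_Omega hw) (k := M.actOmega.toLinearMap)
      (LinearMap.ext fun w => Subtype.ext ?_)
      (iSup_maxGenEigenspace_restrict _ hM.isInternal.submodule_iSup_eq_top)
      Strip.eig_injective M.iSup_maxGenEigenspace_actOmega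
    · convert h1 using 2 with i
      rw [InducedAlgebra.GradedModule.doubleSpace, InducedAlgebra.GradedModule.weightSpace,
        M.smul_conf hR hy, hact]
    · have h2 := M.act_Yg 1 0 𝒱.conf w
      rw [show g.op 𝒱.conf = 𝒱.conf from g.map_conf] at h2
      exact h2.symm
  bounded n a := by
    obtain ⟨B, hB⟩ := hM.bounded n a
    refine ⟨B, fun l hl => eq_bot_iff.mpr fun w hw => ?_⟩
    have h1 : (w : W) ∈ M.L0.maxGenEigenspace (n + l) ⊓ M.gen a := by
      refine ⟨?_, ?_⟩
      · have := hw.1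
        rwa [M.weightSpace_eq hR hy] at this
      · have := hw.2
        rwa [hact, actOmega_eq_restrict, SetLike.mem_coe, mem_maxGenEigenspace_restrict,
          maxGenEigenspace_act] at this
    rw [hB l hl, Submodule.mem_bot] at h1
    exact (Submodule.mem_bot ℂ).mpr (Subtype.ext h1)

end

end WeakTwistedModule

end

end TwistedZhu

theorem theorem5p5 {V : Type*} [AddCommGroup V] [Module ℂ V]
    (𝒱 : TwistedZhu.VertexOperatorAlgebra V) (g : TwistedZhu.Automorphism 𝒱)
    {W : Type*} [AddCommGroup W] [Module ℂ W] (M : TwistedZhu.WeakTwistedModule 𝒱 g W) :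
    g.O ≤ LinearMap.ker M.o ∧ g.OT ≤ LinearMap.ker M.rho ∧
    (∃ (𝔸 : TwistedZhu.ZhuAlgebra g) (R : 𝔸.GradedModule M.Omega),
      (∀ (u : V) (w : M.Omega), (R.smul (g.O.mkQ u) w : W) = M.o u w) ∧
      (∀ w : M.Omega, (R.act w : W) = M.act w) ∧
      (M.IsLowerBounded → R.IsLowerBounded 𝒱.conf ∧
        (∀ n : ℂ, R.weightSpace 𝒱.conf n = M.OmegaWt n) ∧
        ∀ r : ℝ, R.IsSubmodule (⨆ n : {n : ℂ // n.re = r}, M.OmegaWt n))) ∧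
    (∃ (𝔸 : TwistedZhu.ZhuAlgebraT g) (R : 𝔸.GradedModule M.Omega),
      (∀ (u : V) (w : M.Omega), (R.smul (g.OT.mkQ u) w : W) = M.rho u w) ∧
      (∀ w : M.Omega, (R.act w : W) = M.act w) ∧
      (M.IsLowerBounded → R.IsLowerBounded 𝒱.confT ∧
        (∀ n : ℂ, R.weightSpace 𝒱.confT n = M.OmegaWt n) ∧
        ∀ r : ℝ, R.IsSubmodule (⨆ n : {n : ℂ // n.re = r}, M.OmegaWt n))) := by
  have hO : g.O ≤ LinearMap.ker M.o := fun x hx =>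
    LinearMap.ext fun w => M.zeroMode_O hx w.2
  have hOT : g.OT ≤ LinearMap.ker M.rho := fun x hx =>
    LinearMap.ext fun w => M.zeroMode_O ((g.mem_OT_iff x).mp hx) w.2
  refine ⟨hO, hOT, ⟨TwistedZhu.zhuAlgebra g,
    M.gradedModule _ LinearMap.id (fun _ hx => hx) (fun _ _ => rfl) rfl (fun _ => rfl),
    fun _ _ => rfl, fun _ => rfl, fun hM => ⟨?_, ?_, ?_⟩⟩,
    ⟨TwistedZhu.zhuAlgebraT g,
    M.gradedModule _ 𝒱.U1 (fun x hx => (g.mem_OT_iff x).mp hx) (g.U1_resT (-1)) 𝒱.U1_vac g.op_U1,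
    fun _ _ => rfl, fun _ => rfl, fun hM => ⟨?_, ?_, ?_⟩⟩⟩
  · exact M.isLowerBounded_gradedModule (U := LinearMap.id) (fun _ => rfl) rfl rfl hM
  · exact M.weightSpace_eq (U := LinearMap.id) (fun _ => rfl) rfl
  · exact M.isSubmodule_iSup_OmegaWt (U := LinearMap.id) fun _ => rfl
  · exact M.isLowerBounded_gradedModule (U := 𝒱.U1) (fun _ => rfl) rfl 𝒱.U1_confT hM
  · exact M.weightSpace_eq (U := 𝒱.U1) (fun _ => rfl) 𝒱.U1_confT
  · exact M.isSubmodule_iSup_OmegaWt (U := 𝒱.U1) fun _ => rfl
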